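/- Let $K$ be a real quadratic field whose discriminant $D$ is a prime, with ring of integers $\mathcal O_K$, different $\mathfrak d$, conjugation $\lambda\mapsto\lambda'$, norm $N$, and fundamental unit $\varepsilon_0>1$; regard $K\subset\mathbb R$. Let $\chi_D$ be the quadratic character modulo $D$, and let $m$ be a positive integer. Let $\mathbb H$ be the upper half plane and write $z_j=x_j+iy_j$. For $\operatorname{Re}(s)>1$ put $$\Phi_m(z_1,z_2,s)=\sum_{\substack{a,b\in\mathbb Z,\ \lambda\in\mathfrak d^{-1}\\ ab-N(\lambda)=m/D}}Q_{s-1}\!\left(1+\frac{|az_1z_2+\lambda z_1+\lambda' z_2+b|^2}{2y_1y_2m/D}\right),\qquad Q_{s-1}(t)=\int_0^\infty\bigl(t+\sqrt{t^2-1}\cosh u\bigr)^{-s}\,du .$$ This function is invariant under $(z_1,z_2)\mapsto(z_1+\mu,z_2+\mu')$ for $\mu\in\mathcal O_K$. For $y_1y_2>m/D$ let $u_0(y_1,y_2,s)$ be the constant term of its Fourier expansion in $(x_1,x_2)$, i.e. its mean over a period parallelogram of the lattice $\{(\mu,\mu'):\mu\in\mathcal O_K\}\subset\mathbb R^2$.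 The Weyl chambers of discriminant $m$ are the connected components of the complement in $\mathbb H^2$ of $\bigcup_{\lambda\in\mathfrak d^{-1},\,N(\lambda)=-m/D}\{(z_1,z_2):\lambda y_1+\lambda'y_2=0\}$. Let $W$ be one of them, and let $R(W,m)$ be the set of $\lambda\in\mathfrak d^{-1}$ with $\lambda>0$, $N(\lambda)=-m/D$, and $\lambda y_1+\lambda'y_2<0<\varepsilon_0^2\lambda y_1+\varepsilon_0'^2\lambda'y_2$ for all $(z_1,z_2)\in W$. Then $R(W,m)$ is finite. For $(z_1,z_2)\in W$ with $y_1y_2>m/D$ and $\operatorname{Re}(s)>1$ the series $\Phi_m(z_1,z_2,s)$ converges absolutely, it is integrable over the period parallelogram through $(z_1,z_2)$, and $$u_0(y_1,y_2,s)=2\zeta(2s-1)\varphi_m(s)\left(\frac{\pi^2y_1y_2}{D}\right)^{1-s}+\frac{4\pi}{2s-1}\cdot\frac1{1-\varepsilon_0^{2-4s}}\sum_{\lambda\in R(W,m)}\Bigl(\varepsilon_0^{2-4s}(\lambda y_1)^{1-s}(-\lambda'y_2)^s+(-\lambda'y_2)^{1-s}(\lambda y_1)^s\Bigr),$$ where $$\varphi_m(s)=-\frac{\Gamma(s-1/2)}{\Gamma(3/2-s)}\,\frac{1}{L(1-2s,\chi_D)}\,\sigma_m(2s-1),\qquad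 \sigma_m(s)=m^{(1-s)/2}\sum_{d\mid m}d^s\bigl(\chi_D(d)+\chi_D(m/d)\bigr).$$ At $s=\tfrac32,\tfrac52,\dots$, where $1/\Gamma(3/2-s)$ and $L(1-2s,\chi_D)$ both vanish, the right-hand side is to be read as its limit. The right-hand side is meromorphic in $s\in\mathbb C$. If $\Psi(z_1,z_2,s)$ is a continuation of $\Phi_m$ to $\{\operatorname{Re}(s)>3/4,\ s\ne1\}$ (for the given $y_1,y_2$: jointly continuous in $(x_1,x_2,s)$, holomorphic in $s$, equal to $\Phi_m$ for $\operatorname{Re}(s)>1$), then the same formula gives its constant term for all $s\neq \tfrac32,\tfrac52,\dots$ in this domain. -/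

import Mathlib

open scoped NumberField UpperHalfPlane Topology nonZeroDivisors

noncomputable section

namespace HilbertGreen

/-- The Legendre function of the second kind, in its integral representation
`Q_ν(t) = ∫_0^∞ (t + √(t² - 1) cosh u)^(-ν-1) du` for `t > 1`, `Re ν > -1`. -/
def legendreQ (ν : ℂ) (t : ℝ) : ℂ :=
  ∫ u in Set.Ioi (0 : ℝ), ((t + Real.sqrt (t ^ 2 - 1) * Real.cosh u : ℝ) : ℂ) ^ (-ν - 1)

/-- The quadratic character `χ_D` modulo the prime `D`, with values in `ℂ`. For the prime
discriminant `D` of a real quadratic field (so `D ≡ 1 mod 4`) we have `(D/x) = (x/D)`. -/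
def chiD (D : ℕ) [Fact D.Prime] : DirichletCharacter ℂ D :=
  (quadraticChar (ZMod D)).ringHomComp (Int.castRingHom ℂ)

/-- `σ_m(s) = m^((1-s)/2) ∑_{d ∣ m} d^s (χ_D(d) + χ_D(m/d))`. -/
def sigmaM (D : ℕ) [Fact D.Prime] (m : ℕ) (s : ℂ) : ℂ :=
  (m : ℂ) ^ ((1 - s) / 2) *
    ∑ d ∈ m.divisors, (d : ℂ) ^ s * (chiD D (d : ZMod D) + chiD D ((m / d : ℕ) : ZMod D))

/-- `φ_m(s) = - Γ(s-1/2)/Γ(3/2-s) · 1/L(1-2s, χ_D) · σ_m(2s-1)`. -/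
def phiM (D : ℕ) [Fact D.Prime] (m : ℕ) (s : ℂ) : ℂ :=
  -(Complex.Gamma (s - 1 / 2) / Complex.Gamma (3 / 2 - s)) *
    (1 / DirichletCharacter.LFunction (chiD D) (1 - 2 * s)) * sigmaM D m (2 * s - 1)

section Field

variable {K : Type*} [Field K] [NumberField K]

/-- The inverse different `𝔡⁻¹`, a fractional ideal of `K`. -/
def inverseDifferent (K : Type*) [Field K] [NumberField K] : FractionalIdeal (𝓞 K)⁰ K :=
  ((differentIdeal ℤ (𝓞 K) : Ideal (𝓞 K)) : FractionalIdeal (𝓞 K)⁰ K)⁻¹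

/-- With respect to the real embedding `ι` of the real quadratic field `K`, the unit `ε` is the
fundamental unit `> 1`. -/
def IsFundamentalUnit (ι : K →+* ℝ) (ε : (𝓞 K)ˣ) : Prop :=
  1 < ι ((ε : 𝓞 K) : K) ∧ ∀ u : (𝓞 K)ˣ, ∃ n : ℤ, u = ε ^ n ∨ u = -ε ^ n

/-- The linear form `(λ, z) = λ y₁ + λ' y₂`, where `λ = ι l`, `λ' = ι' l` are the two real
conjugates and `y_j` is the imaginary part of `z_j`. -/
def pairing (ι ι' : K →+* ℝ) (l : K) (z : ℍ × ℍ) : ℝ :=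
  ι l * z.1.im + ι' l * z.2.im

/-- The triples `(a, b, λ)` with `a, b ∈ ℤ`, `λ ∈ 𝔡⁻¹` and `ab - N(λ) = m/D`. -/
def greenIndex (K : Type*) [Field K] [NumberField K] (D m : ℕ) : Set (ℤ × ℤ × K) :=
  {p | p.2.2 ∈ inverseDifferent K ∧
    (p.1 : ℚ) * (p.2.1 : ℚ) - Algebra.norm ℚ p.2.2 = (m : ℚ) / (D : ℚ)}

/-- The summand of the Green function attached to `(a, b, λ)`:
`Q_{s-1}(1 + |a z₁ z₂ + λ z₁ + λ' z₂ + b|² / (2 y₁ y₂ m / D))`. -/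
def greenTerm (ι ι' : K →+* ℝ) (D m : ℕ) (s : ℂ) (z : ℍ × ℍ) (p : ℤ × ℤ × K) : ℂ :=
  legendreQ (s - 1)
    (1 + ‖(p.1 : ℂ) * (z.1 : ℂ) * (z.2 : ℂ) + ((ι p.2.2 : ℝ) : ℂ) * (z.1 : ℂ)
          + ((ι' p.2.2 : ℝ) : ℂ) * (z.2 : ℂ) + (p.2.1 : ℂ)‖ ^ 2
        / (2 * z.1.im * z.2.im * ((m : ℝ) / (D : ℝ))))

/-- The Green function `Φ_m(z₁, z₂, s)`, for `Re s > 1`. -/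
def greenFunction (ι ι' : K →+* ℝ) (D m : ℕ) (s : ℂ) (z : ℍ × ℍ) : ℂ :=
  ∑' p : greenIndex K D m, greenTerm ι ι' D m s z p

/-- The translate of `z` by the real vector `t₀ ω₀ + t₁ ω₁`, where `(ω₀, ω₁)` is the `ℤ`-basis `b`
of `𝓞 K`, embedded into `ℝ²` by `(ι, ι')`. -/
def translate (ι ι' : K →+* ℝ) (b : Module.Basis (Fin 2) ℤ (𝓞 K)) (t : ℝ × ℝ) (z : ℍ × ℍ) :
    ℍ × ℍ :=
  ((t.1 * ι (b 0 : K) + t.2 * ι (b 1 : K)) +ᵥ z.1,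
    (t.1 * ι' (b 0 : K) + t.2 * ι' (b 1 : K)) +ᵥ z.2)

/-- The constant term, at the height `(Im z₁, Im z₂)`, of the Fourier expansion
`∑_{ν ∈ 𝔡⁻¹} u_ν(y₁, y₂) e(ν x₁ + ν' x₂)` of a function `f` that is invariant under the translations
`(z₁, z₂) ↦ (z₁ + μ, z₂ + μ')`, `μ ∈ 𝓞 K`: the mean of `f` over a period parallelogram. -/
def constantTerm (ι ι' : K →+* ℝ) (b : Module.Basis (Fin 2) ℤ (𝓞 K)) (f : ℍ × ℍ → ℂ)
    (z : ℍ × ℍ) : ℂ :=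
  ∫ t in Set.Icc (0 : ℝ) 1 ×ˢ Set.Icc (0 : ℝ) 1, f (translate ι ι' b t z)

/-- The union `S(m)` of the hyperplanes `λ y₁ + λ' y₂ = 0`, for `λ ∈ 𝔡⁻¹` with `N(λ) = -m/D`. -/
def wallSet (ι ι' : K →+* ℝ) (D m : ℕ) : Set (ℍ × ℍ) :=
  {z | ∃ l : K, l ∈ inverseDifferent K ∧ Algebra.norm ℚ l = -((m : ℚ) / (D : ℚ)) ∧
    pairing ι ι' l z = 0}

/-- The Weyl chambers of discriminant `m`: the connected components of `ℍ² - S(m)`. -/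
def IsWeylChamber (ι ι' : K →+* ℝ) (D m : ℕ) (W : Set (ℍ × ℍ)) : Prop :=
  ∃ z ∈ (wallSet ι ι' D m)ᶜ, W = connectedComponentIn (wallSet ι ι' D m)ᶜ z

/-- `R(W, m)`: the `λ ∈ 𝔡⁻¹` with `λ > 0`, `N(λ) = -m/D`, `(λ, W) < 0` and `(ε₀² λ, W) > 0`. -/
def weylSet (ι ι' : K →+* ℝ) (ε : (𝓞 K)ˣ) (D m : ℕ) (W : Set (ℍ × ℍ)) : Set K :=
  {l | l ∈ inverseDifferent K ∧ 0 < ι l ∧ Algebra.norm ℚ l = -((m : ℚ) / (D : ℚ)) ∧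
    (∀ z ∈ W, pairing ι ι' l z < 0) ∧
    (∀ z ∈ W, 0 < pairing ι ι' (((ε : 𝓞 K) : K) ^ 2 * l) z)}

/-- The explicit expression
`2 ζ(2s-1) φ_m(s) (π² y₁ y₂ / D)^(1-s) + 4π/(2s-1) · 1/(1 - ε₀^(2-4s)) ·`
`∑_{λ ∈ R(W,m)} (ε₀^(2-4s) (λ y₁)^(1-s) (-λ' y₂)^s + (-λ' y₂)^(1-s) (λ y₁)^s)`. -/
def explicitTerm (ι ι' : K →+* ℝ) (ε : (𝓞 K)ˣ) (D : ℕ) [Fact D.Prime] (m : ℕ)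
    (W : Set (ℍ × ℍ)) (y₁ y₂ : ℝ) (s : ℂ) : ℂ :=
  2 * riemannZeta (2 * s - 1) * phiM D m s *
      ((Real.pi ^ 2 * y₁ * y₂ / (D : ℝ) : ℝ) : ℂ) ^ (1 - s)
    + 4 * (Real.pi : ℂ) / (2 * s - 1) *
        (1 / (1 - ((ι ((ε : 𝓞 K) : K) : ℝ) : ℂ) ^ (2 - 4 * s))) *
      ∑ᶠ l ∈ weylSet ι ι' ε D m W,
        (((ι ((ε : 𝓞 K) : K) : ℝ) : ℂ) ^ (2 - 4 * s) *
            ((ι l * y₁ : ℝ) : ℂ) ^ (1 - s) * ((-ι' l * y₂ : ℝ) : ℂ) ^ s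
          + ((-ι' l * y₂ : ℝ) : ℂ) ^ (1 - s) * ((ι l * y₁ : ℝ) : ℂ) ^ s)

end Field

end HilbertGreen

end

/-! The sum is split according to whether `a` vanishes.

For a ≠ 0 the relation ab − N(λ) = m/D gives az₁z₂ + λz₁ + λ'z₂ + b = a(z₁ + λ'/a)(z₂ + λ/a) +
(m/D)/a (`arg_of_ne_zero`). Hence all summands with the same a are translates of one function on ℝ²,
and b is determined by λ, subject to −D·N(λ) ≡ m mod aD. Replacing λ by λ + aκ' with κ integral is a
translation by a lattice vector, so the mean unfolds into (number of admissible classes) · D^(-1/2)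
· (integral over ℝ²) (`hasSum_unfold`). For fixed z₂ the argument of Q is the cosine hyperbolic of a
hyperbolic distance. Its integral along a horizontal line is elementary
(`integral_legendreQ_horo_of_lt`), and a Gamma integral in x₂ remains. The condition y₁y₂ > m/D
keeps the line above the singularity for every a, so the result is a constant times |a|^(-2s)
(`integral_planeTerm`).

The class numbers are solution counts of the norm form modulo aD, divided by D (`classCount_mul`).
They are computed by Hensel lifting, quadratic reciprocity and multiplicativity. Convolved with χ_D
they become a divisor sum (`sum_chi_mul_repCount`), so their Dirichlet series at 2s is ζ(2s−1)/L(2s,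
χ_D) times a finite sum (`LSeriesHasSum_density`). The functional equation of L(s, χ_D), whose root
number 1 amounts to the evaluation √D of the Gauss sum, turns this into the term with φ_m
(`prefactor_eq`).

For a = 0 the sum over b ∈ ℤ unfolds the mean into an integral over a line, giving 2π/(2s−1) · min^s
max^(1−s) of the numbers |λ|y₁, |λ'|y₂. The λ of norm −m/D are exactly ±ε₀^(2k)r with r ∈ R(W, m)
and k ∈ ℤ (`orbitMap_bijective`), and each orbit contributes two geometric series of ratio
ε₀^(2−4s).

Convergence comes from the same formulas: for real s the summands are positive, so the exact means
prove summability of the means of the norms. A Harnack inequality (`norm_legendreQ_le_mul`) upgrades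
this to a uniform bound on the period parallelogram. Before the functional equation is applied, the
value (`greenMean`) is holomorphic for Re s > 1/2, s ≠ 1. This yields the limits at 3/2, 5/2, … by
continuity, and the statement about continuations by the identity theorem. -/

noncomputable section

namespace HilbertGreen

/-! ### Counting solutions of congruences; Hensel lifting -/

section Counting

open Finset

/-- The number of `(x, y)` with `0 ≤ x, y < N` that satisfy `P`. -/
def boxCount (N : ℕ) (P : ℤ → ℤ → Prop) : ℕ := by
  classical exact ∑ x ∈ range N, ∑ y ∈ range N, if P x y then 1 else 0

lemma sum_range_mul_eq {M : Type*} [AddCommMonoid M] (a b : ℕ) (f : ℕ → M) :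
    ∑ x ∈ range (a * b), f x = ∑ i ∈ range a, ∑ j ∈ range b, f (i + a * j) := by
  rcases Nat.eq_zero_or_pos a with rfl | ha
  · simp
  rw [← Finset.sum_product']
  refine Finset.sum_nbij' (fun x => (x % a, x / a)) (fun p => p.1 + a * p.2) ?_ ?_ ?_ ?_ ?_
  · intro x hx
    simp only [mem_range, mem_product] at hx ⊢
    exact ⟨Nat.mod_lt _ ha, Nat.div_lt_of_lt_mul hx⟩
  · rintro ⟨i, j⟩ hx
    simp only [mem_range, mem_product] at hx ⊢
    calc i + a * j < a + a * j := by omega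
      _ = a * (j + 1) := by ring
      _ ≤ a * b := Nat.mul_le_mul_left _ hx.2
  · intro x _
    exact Nat.mod_add_div x a
  · rintro ⟨i, j⟩ hx
    simp only [mem_range, mem_product] at hx
    simp [Nat.add_mul_div_left, ha, Nat.mod_eq_of_lt hx.1, Nat.div_eq_of_lt hx.1]
  · intro x _
    simp [Nat.mod_add_div x a]

lemma boxCount_congr {N : ℕ} {P P' : ℤ → ℤ → Prop} (h : ∀ x y, P x y ↔ P' x y) :
    boxCount N P = boxCount N P' := by
  have : P = P' := by ext x y; exact h x y
  rw [this]

/-- Residues modulo ab are x + as with x modulo a and s modulo b, so the count is organised by the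
fibres over the residues modulo a, as lifting requires. -/
lemma boxCount_mul (a b : ℕ) (P : ℤ → ℤ → Prop) :
    boxCount (a * b) P =
      ∑ x ∈ range a, ∑ y ∈ range a, boxCount b (fun s t => P (x + a * s) (y + a * t)) := by
  classical
  unfold boxCount
  rw [sum_range_mul_eq]
  refine Finset.sum_congr rfl fun x _ => ?_
  simp only [sum_range_mul_eq a b]
  rw [Finset.sum_comm]
  refine Finset.sum_congr rfl fun y _ => Finset.sum_congr rfl fun s _ =>
    Finset.sum_congr rfl fun t _ => ?_
  push_cast
  rfl

lemma boxCount_false (N : ℕ) {P : ℤ → ℤ → Prop} (h : ∀ x y, ¬ P x y) : boxCount N P = 0 := by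
  classical
  simp [boxCount, h]

lemma boxCount_true (N : ℕ) {P : ℤ → ℤ → Prop} (h : ∀ x y, P x y) : boxCount N P = N ^ 2 := by
  classical
  simp [boxCount, h, sq]

lemma boxCount_mul_of_periodic (a b : ℕ) {P : ℤ → ℤ → Prop}
    (h : ∀ x y s t : ℤ, P (x + a * s) (y + a * t) ↔ P x y) :
    boxCount (a * b) P = b ^ 2 * boxCount a P := by
  classical
  rw [boxCount_mul]
  simp only [h]
  rw [boxCount, Finset.mul_sum]
  refine Finset.sum_congr rfl fun x _ => ?_
  rw [Finset.mul_sum]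
  refine Finset.sum_congr rfl fun y _ => ?_
  by_cases hp : P x y
  · rw [boxCount_true _ (fun _ _ => hp)]; simp [hp]
  · rw [boxCount_false _ (fun _ _ => hp)]; simp [hp]

lemma boxCount_eq_card (N : ℕ) [NeZero N] (P : ZMod N → ZMod N → Prop) :
    boxCount N (fun x y => P x y) = Nat.card {v : ZMod N × ZMod N // P v.1 v.2} := by
  classical
  rw [Nat.card_eq_fintype_card, Fintype.card_subtype, Finset.card_filter, ← Finset.univ_product_univ,
    Finset.sum_product]
  have key : ∀ f : ZMod N → ℕ, ∑ x ∈ range N, f ((x : ℤ) : ZMod N) = ∑ x, f x := by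
    intro f
    refine Finset.sum_nbij' (fun x => ((x : ℤ) : ZMod N)) (fun x => x.val) ?_ ?_ ?_ ?_ ?_
    · simp
    · intro x _; simpa using ZMod.val_lt x
    · intro x hx; simpa using ZMod.val_cast_of_lt (by simpa using hx)
    · intro x _; simp
    · simp
  unfold boxCount
  rw [← key (fun x => ∑ y, if P x y then 1 else 0)]
  refine Finset.sum_congr rfl fun x _ => ?_
  rw [← key (fun y => if P _ y then 1 else 0)]

lemma card_linear_zmod {p : ℕ} [Fact p.Prime] {a b : ZMod p} (h : ¬ (a = 0 ∧ b = 0)) (c : ZMod p) :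
    Nat.card {v : ZMod p × ZMod p // c + (a * v.1 + b * v.2) = 0} = p := by
  by_cases ha : a = 0
  · have hb : b ≠ 0 := fun hb => h ⟨ha, hb⟩
    have e : {v : ZMod p × ZMod p // c + (a * v.1 + b * v.2) = 0} ≃ ZMod p :=
      { toFun := fun v => v.1.1
        invFun := fun x => ⟨(x, -(c + a * x) / b), by field_simp; ring⟩
        left_inv := by
          rintro ⟨⟨x, y⟩, hv⟩
          simp only at hv
          ext <;> simp only
          rw [div_eq_iff hb]; linear_combination -hv
        right_inv := fun x => rfl }
    rw [Nat.card_congr e, Nat.card_zmod]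
  · have e : {v : ZMod p × ZMod p // c + (a * v.1 + b * v.2) = 0} ≃ ZMod p :=
      { toFun := fun v => v.1.2
        invFun := fun y => ⟨(-(c + b * y) / a, y), by field_simp; ring⟩
        left_inv := by
          rintro ⟨⟨x, y⟩, hv⟩
          simp only at hv
          ext <;> simp only
          rw [div_eq_iff ha]; linear_combination -hv
        right_inv := fun x => rfl }
    rw [Nat.card_congr e, Nat.card_zmod]

lemma boxCount_linear {p : ℕ} [Fact p.Prime] {a b : ℤ} (h : ¬ ((p : ℤ) ∣ a ∧ (p : ℤ) ∣ b)) (c : ℤ) :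
    boxCount p (fun s t => (p : ℤ) ∣ c + (a * s + b * t)) = p := by
  have h' : ¬ ((a : ZMod p) = 0 ∧ (b : ZMod p) = 0) := by
    simpa only [ZMod.intCast_zmod_eq_zero_iff_dvd] using h
  have := boxCount_eq_card p (fun s t : ZMod p => (c : ZMod p) + ((a : ZMod p) * s + (b : ZMod p) * t) = 0)
  rw [card_linear_zmod h'] at this
  refine Eq.trans ?_ this
  refine boxCount_congr fun s t => ?_
  rw [← ZMod.intCast_zmod_eq_zero_iff_dvd]
  push_cast
  rfl

/-- The binary quadratic form `α x² + β x y + γ y²`. -/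
def binForm (α β γ x y : ℤ) : ℤ := α * x ^ 2 + β * x * y + γ * y ^ 2

/-- `(x, y)` is not a zero modulo `p` of the gradient of the form. -/
def IsSmoothPt (α β γ : ℤ) (p : ℕ) (x y : ℤ) : Prop :=
  ¬ ((p : ℤ) ∣ 2 * α * x + β * y ∧ (p : ℤ) ∣ β * x + 2 * γ * y)

lemma isSmoothPt_add_mul (α β γ : ℤ) (p : ℕ) {d : ℤ} (hd : (p : ℤ) ∣ d) (x y s t : ℤ) :
    IsSmoothPt α β γ p (x + d * s) (y + d * t) ↔ IsSmoothPt α β γ p x y := by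
  unfold IsSmoothPt
  have h1 : 2 * α * (x + d * s) + β * (y + d * t) = (2 * α * x + β * y) + d * (2 * α * s + β * t) := by
    ring
  have h2 : β * (x + d * s) + 2 * γ * (y + d * t) = (β * x + 2 * γ * y) + d * (β * s + 2 * γ * t) := by
    ring
  rw [h1, h2, Int.dvd_add_left (hd.mul_right _), Int.dvd_add_left (hd.mul_right _)]

/-- The smooth solutions of `α x² + β x y + γ y² = m` modulo `p ^ k`. -/
def smoothCount (α β γ m : ℤ) (p k : ℕ) : ℕ :=
  boxCount (p ^ k) (fun x y => (p : ℤ) ^ k ∣ binForm α β γ x y - m ∧ IsSmoothPt α β γ p x y)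

/-- Hensel's lemma with multiplicity: a lift of a smooth solution modulo p^k solves the next
congruence exactly when one inhomogeneous linear equation in (s, t) holds modulo p. Its coefficients
are the gradient, not both divisible by p, so there are p lifts. -/
lemma smoothCount_succ (α β γ m : ℤ) (p : ℕ) [hp : Fact p.Prime] {k : ℕ} (hk : 1 ≤ k) :
    smoothCount α β γ m p (k + 1) = p * smoothCount α β γ m p k := by
  classical
  have hpk : (p : ℤ) ∣ (p : ℤ) ^ k := dvd_pow_self _ (by omega)
  have hp0 : (p : ℤ) ^ k ≠ 0 := pow_ne_zero _ (by exact_mod_cast hp.out.ne_zero)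
  unfold smoothCount
  rw [pow_succ p k, boxCount_mul, boxCount, Finset.mul_sum]
  refine Finset.sum_congr rfl fun x _ => ?_
  rw [Finset.mul_sum]
  refine Finset.sum_congr rfl fun y _ => ?_
  -- Taylor expansion at (x, y). The quadratic term carries p^k inside the bracket, hence vanishes
  -- modulo p because k ≥ 1.
  have expand : ∀ s t : ℤ, binForm α β γ (x + (p : ℤ) ^ k * s) (y + (p : ℤ) ^ k * t) - m =
      (binForm α β γ x y - m) + (p : ℤ) ^ k *
        ((2 * α * x + β * y) * s + (β * x + 2 * γ * y) * t + (p : ℤ) ^ k * binForm α β γ s t) := by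
    intro s t; unfold binForm; ring
  push_cast
  simp only [isSmoothPt_add_mul α β γ p hpk, expand]
  by_cases hs : IsSmoothPt α β γ p x y
  · by_cases hd : (p : ℤ) ^ k ∣ binForm α β γ x y - m
    · simp only [hs, hd, and_true, if_true, mul_one]
      obtain ⟨c, hc⟩ := hd
      refine Eq.trans ?_
        (boxCount_linear (p := p) (a := 2 * α * x + β * y) (b := β * x + 2 * γ * y) hs c)
      refine boxCount_congr fun s t => ?_
      rw [hc, ← mul_add, pow_succ, mul_dvd_mul_iff_left hp0, ← add_assoc,
        Int.dvd_add_left (hpk.mul_right _)]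
    · simp only [hd, false_and, if_false, mul_zero]
      refine boxCount_false _ fun s t hst => hd ?_
      have := (pow_dvd_pow (p : ℤ) (Nat.le_succ k)).trans hst.1
      rwa [Int.dvd_add_left (dvd_mul_right _ _)] at this
  · simp only [hs, and_false, if_false, mul_zero]
    exact boxCount_false _ fun s t hst => by simp at hst

lemma smoothCount_eq (α β γ m : ℤ) (p : ℕ) [hp : Fact p.Prime] (k : ℕ) :
    smoothCount α β γ m p (k + 1) = p ^ k * smoothCount α β γ m p 1 := by
  induction k with
  | zero => simp
  | succ k ih => rw [smoothCount_succ _ _ _ _ _ (by omega), ih]; ring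

/-- The number of solutions of `α x² + β x y + γ y² = m` in `ℤ/c`. -/
def repCount (α β γ m : ℤ) (c : ℕ) : ℕ :=
  Nat.card {v : ZMod c × ZMod c // (α : ZMod c) * v.1 ^ 2 + β * v.1 * v.2 + γ * v.2 ^ 2 = m}

lemma repCount_eq_boxCount (α β γ m : ℤ) (c : ℕ) [NeZero c] :
    repCount α β γ m c = boxCount c (fun x y => (c : ℤ) ∣ binForm α β γ x y - m) := by
  rw [repCount, ← boxCount_eq_card c (fun x y : ZMod c => (α : ZMod c) * x ^ 2 + β * x * y + γ * y ^ 2 = m)]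
  refine boxCount_congr fun s t => ?_
  rw [← ZMod.intCast_zmod_eq_zero_iff_dvd, binForm]
  push_cast
  rw [sub_eq_zero]

end Counting

end HilbertGreen

/-! ### The norm form modulo a prime p ≠ D -/

namespace HilbertGreen

lemma card_roots_two_zero : Nat.card {t : ZMod 2 // t ^ 2 + t = 0} = 2 := by
  rw [Nat.card_eq_fintype_card]; decide

lemma card_roots_two_one : Nat.card {t : ZMod 2 // t ^ 2 + t = 1} = 0 := by
  rw [Nat.card_eq_fintype_card]; decide

section ModPrime

open Finset

variable {p : ℕ} [Fact p.Prime]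

/-- The quadratic character of `ℤ/D`, with values in `ℤ`. -/
def chiInt (D : ℕ) [Fact D.Prime] (n : ℤ) : ℤ := quadraticChar (ZMod D) (n : ZMod D)

lemma chiInt_mul (D : ℕ) [Fact D.Prime] (a b : ℤ) : chiInt D (a * b) = chiInt D a * chiInt D b := by
  rw [chiInt, Int.cast_mul, map_mul]; rfl

lemma chiInt_sq {D : ℕ} [Fact D.Prime] {a : ℤ} (h : ¬ (D : ℤ) ∣ a) : chiInt D a ^ 2 = 1 :=
  quadraticChar_sq_one (by rwa [ne_eq, ZMod.intCast_zmod_eq_zero_iff_dvd])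

lemma chiInt_eq_zero {D : ℕ} [Fact D.Prime] {a : ℤ} (h : (D : ℤ) ∣ a) : chiInt D a = 0 := by
  rw [chiInt, (ZMod.intCast_zmod_eq_zero_iff_dvd a D).2 h]
  simp

lemma chiInt_neg {D : ℕ} [Fact D.Prime] (hD : D % 4 = 1) (a : ℤ) : chiInt D (-a) = chiInt D a := by
  have h2 : ringChar (ZMod D) ≠ 2 := by
    rw [ZMod.ringChar_zmod_n]; omega
  have h1 : quadraticChar (ZMod D) (-1) = 1 := by
    rw [quadraticChar_neg_one h2, ZMod.card, ZMod.χ₄_nat_one_mod_four hD]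
  rw [chiInt, Int.cast_neg, ← neg_one_mul, map_mul, h1, one_mul, chiInt]

/-- The norm form of the quadratic order of discriminant `1 + 4 e`. -/
lemma norm_form_comp {R : Type*} [CommRing R] (e a b x y : R) :
    (a * x + e * b * y) ^ 2 + (a * x + e * b * y) * (a * y + b * x + b * y)
        - e * (a * y + b * x + b * y) ^ 2 =
      (a ^ 2 + a * b - e * b ^ 2) * (x ^ 2 + x * y - e * y ^ 2) := by
  ring

/-- With ω² = ω + e the form is the norm of x + yω. Multiplication by an element a + bω of norm m
carries norm 1 to norm m, with inverse multiplication by the conjugate (a + b) − bω divided by m. -/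
lemma card_normForm_eq_one {F : Type*} [Field F] [Finite F] {e m : F} (hm : m ≠ 0)
    (h : ∃ a b : F, a ^ 2 + a * b - e * b ^ 2 = m) :
    Nat.card {v : F × F // v.1 ^ 2 + v.1 * v.2 - e * v.2 ^ 2 = m} =
      Nat.card {v : F × F // v.1 ^ 2 + v.1 * v.2 - e * v.2 ^ 2 = 1} := by
  obtain ⟨a, b, hab⟩ := h
  refine Nat.card_congr (Equiv.symm
    { toFun := fun v => ⟨(a * v.1.1 + e * b * v.1.2, a * v.1.2 + b * v.1.1 + b * v.1.2), ?_⟩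
      invFun := fun v => ⟨(((a + b) * v.1.1 - e * b * v.1.2) / m,
        ((a + b) * v.1.2 - b * v.1.1 - b * v.1.2) / m), ?_⟩
      left_inv := ?_
      right_inv := ?_ })
  · rw [norm_form_comp, hab, v.2, mul_one]
  · have := norm_form_comp e (a + b) (-b) v.1.1 v.1.2
    rw [v.2] at this
    have h1 : (a + b) ^ 2 + (a + b) * (-b) - e * (-b) ^ 2 = m := by rw [← hab]; ring
    rw [h1] at this
    simp only
    field_simp
    linear_combination this
  · rintro ⟨⟨x, y⟩, hv⟩
    ext <;> simp only <;> rw [div_eq_iff hm, ← hab] <;> ring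
  · rintro ⟨⟨x, y⟩, hv⟩
    ext <;> simp only <;> field_simp <;> rw [← hab] <;> ring

/-- For odd p, completing the square turns the equation into u² = (1 + 4e)y² + 4m, and two quadratic
polynomials over a finite field always have a pair of values with sum zero. For p = 2 every element
is a square. -/
lemma exists_normForm_eq {e : ZMod p} (he : 1 + 4 * e ≠ 0) (m : ZMod p) :
    ∃ a b : ZMod p, a ^ 2 + a * b - e * b ^ 2 = m := by
  rcases (Fact.out : p.Prime).eq_two_or_odd with rfl | hp
  · exact ⟨m, 0, by simp⟩
  · have h2 : (2 : ZMod p) ≠ 0 := by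
      intro h
      have := (ZMod.natCast_eq_zero_iff 2 p).1 (by exact_mod_cast h)
      have := Nat.le_of_dvd (by norm_num) this
      have := (Fact.out : p.Prime).two_le
      omega
    obtain ⟨u, y, h⟩ := FiniteField.exists_root_sum_quadratic (R := ZMod p)
      (f := Polynomial.X ^ 2) (g := Polynomial.C (-(1 + 4 * e)) * Polynomial.X ^ 2 +
        Polynomial.C (-(4 * m))) (Polynomial.degree_X_pow 2)
      (by
        rw [Polynomial.degree_add_C (by rw [Polynomial.degree_C_mul_X_pow 2 (neg_ne_zero.2 he)]; norm_num)]
        exact Polynomial.degree_C_mul_X_pow 2 (neg_ne_zero.2 he))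
      (by rw [ZMod.card]; exact hp)
    simp only [Polynomial.eval_pow, Polynomial.eval_X, Polynomial.eval_add, Polynomial.eval_mul,
      Polynomial.eval_C] at h
    refine ⟨(u - y) / 2, y, ?_⟩
    field_simp
    linear_combination h

/-- A zero with y = 0 is trivial. Any other is (ty, y) with y a unit and t a root of t² + t = e. -/
lemma card_normForm_zero (e : ZMod p) :
    Nat.card {v : ZMod p × ZMod p // v.1 ^ 2 + v.1 * v.2 - e * v.2 ^ 2 = 0} =
      1 + (p - 1) * Nat.card {t : ZMod p // t ^ 2 + t = e} := by
  classical
  have hE : {v : ZMod p × ZMod p // v.1 ^ 2 + v.1 * v.2 - e * v.2 ^ 2 = 0} ≃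
      Unit ⊕ ((ZMod p)ˣ × {t : ZMod p // t ^ 2 + t = e}) :=
    { toFun := fun v => if h : v.1.2 = 0 then Sum.inl () else
        Sum.inr (Units.mk0 v.1.2 h, ⟨v.1.1 / v.1.2, by
          have := v.2
          field_simp
          linear_combination this⟩)
      invFun := Sum.elim (fun _ => ⟨(0, 0), by simp⟩)
        (fun w => ⟨(w.2.1 * (w.1 : ZMod p), (w.1 : ZMod p)), by
          have := w.2.2
          simp only
          linear_combination (w.1 : ZMod p) ^ 2 * this⟩)
      left_inv := by
        rintro ⟨⟨x, y⟩, hv⟩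
        by_cases h : y = 0
        · subst h
          have hx : x = 0 := by simpa using hv
          simp [hx]
        · simp [h]
      right_inv := by
        rintro (⟨⟩ | ⟨u, t, ht⟩)
        · simp
        · simp }
  rw [Nat.card_congr hE, Nat.card_sum, Nat.card_prod, Nat.card_unique,
    Nat.card_eq_fintype_card (α := (ZMod p)ˣ), ZMod.card_units]

/-- Partition of the plane into the fibres of the form: all fibres over nonzero values have the size
of the fibre over 1. -/
lemma card_normForm_total {e : ZMod p} (he : 1 + 4 * e ≠ 0) :
    Nat.card {v : ZMod p × ZMod p // v.1 ^ 2 + v.1 * v.2 - e * v.2 ^ 2 = 0} +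
      (p - 1) * Nat.card {v : ZMod p × ZMod p // v.1 ^ 2 + v.1 * v.2 - e * v.2 ^ 2 = 1} = p ^ 2 := by
  classical
  have h := Nat.card_congr (Equiv.sigmaFiberEquiv
    (fun v : ZMod p × ZMod p => v.1 ^ 2 + v.1 * v.2 - e * v.2 ^ 2))
  rw [Nat.card_sigma, Nat.card_prod, Nat.card_zmod] at h
  rw [sq, ← h, ← Finset.add_sum_erase _ _ (Finset.mem_univ (0 : ZMod p))]
  congr 1
  rw [Finset.sum_congr rfl (fun x hx => card_normForm_eq_one (Finset.ne_of_mem_erase hx)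
    (exists_normForm_eq he x)), Finset.sum_const, Finset.card_erase_of_mem (Finset.mem_univ _),
    Finset.card_univ, ZMod.card, smul_eq_mul]

/-- Reciprocity: the number of roots of `t² + t = E` modulo `p` is `1 + χ_D(p)`. -/
lemma card_roots_eq (D : ℕ) [hD : Fact D.Prime] {E : ℕ} (hDE : D = 1 + 4 * E) (hpD : p ≠ D) :
    (Nat.card {t : ZMod p // t ^ 2 + t = (E : ZMod p)} : ℤ) = 1 + chiInt D p := by
  classical
  have hD2 : D ≠ 2 := by omega
  rcases (Fact.out : p.Prime).eq_two_or_odd with rfl | hp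
  -- On ℤ/2 the polynomial t² + t vanishes identically, so there are 2 or 0 roots according to the
  -- parity of E. This is D modulo 8, which is what the supplementary law for 2 measures.
  · have h1 : chiInt D (2 : ℕ) = ZMod.χ₈ D := legendreSym.at_two hD2
    rw [h1, ZMod.χ₈_nat_eq_if_mod_eight]
    have hE : (E : ZMod 2) = ((E % 2 : ℕ) : ZMod 2) := by simp
    rw [hE]
    rcases Nat.mod_two_eq_zero_or_one E with h | h
    · have : D % 8 = 1 := by omega
      have h2 : D % 2 ≠ 0 := by omega
      rw [h, if_neg h2, if_pos (Or.inl this), Nat.cast_zero, card_roots_two_zero]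
      norm_num
    · have : ¬ (D % 8 = 1 ∨ D % 8 = 7) := by omega
      have h2 : D % 2 ≠ 0 := by omega
      rw [h, if_neg h2, if_neg this, Nat.cast_one, card_roots_two_one]
      norm_num
  · have hp2 : p ≠ 2 := by rintro rfl; simp at hp
    have h2 : (2 : ZMod p) ≠ 0 := by
      intro h
      have := (ZMod.natCast_eq_zero_iff 2 p).1 (by exact_mod_cast h)
      exact hp2 ((Nat.prime_dvd_prime_iff_eq (Fact.out) Nat.prime_two).1 this)
    have h1 : chiInt D p = quadraticChar (ZMod p) (D : ZMod p) := by
      have := legendreSym.quadratic_reciprocity_one_mod_four (p := D) (q := p) (by omega) hp2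
      rw [legendreSym, legendreSym] at this
      rw [chiInt, ← this]
      simp
    have h3 := quadraticChar_card_sqrts (F := ZMod p) (by rw [ZMod.ringChar_zmod_n]; exact hp2)
      (D : ZMod p)
    rw [h1, add_comm, ← h3, ← Set.ncard_eq_toFinset_card', ← Nat.card_coe_set_eq]
    congr 1
    -- Completing the square: (2t + 1)² = 1 + 4E = D.
    refine Nat.card_congr
      { toFun := fun t => ⟨2 * t.1 + 1, ?_⟩
        invFun := fun u => ⟨(u.1 - 1) / 2, ?_⟩
        left_inv := ?_
        right_inv := ?_ }
    · have := t.2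
      simp only [Set.mem_ofPred_eq, hDE]
      push_cast
      linear_combination 4 * this
    · have := u.2
      simp only [Set.mem_ofPred_eq, hDE] at this
      push_cast at this
      field_simp
      linear_combination this
    · intro t; ext; simp [h2]
    · intro u; ext; simp only; field_simp; ring

/-- The roots of t² + t = E determine the fibre over 0; the remaining points are shared equally by
the p − 1 nonzero values. -/
lemma repCount_prime (D : ℕ) [hD : Fact D.Prime] {E : ℕ} (hDE : D = 1 + 4 * E) (hpD : p ≠ D) (m : ℤ) :
    (repCount 1 1 (-E) m p : ℤ) =
      if (p : ℤ) ∣ m then 1 + ((p : ℤ) - 1) * (1 + chiInt D p) else p - chiInt D p := by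
  have hp1 := (Fact.out : p.Prime).two_le
  have he : 1 + 4 * (E : ZMod p) ≠ 0 := by
    intro h
    have := (ZMod.natCast_eq_zero_iff D p).1 (by rw [hDE]; push_cast; exact h)
    exact hpD ((Nat.prime_dvd_prime_iff_eq Fact.out hD.out).1 this)
  have h0 := card_normForm_zero (p := p) (E : ZMod p)
  have ht := card_normForm_total he
  have hr := card_roots_eq D hDE hpD
  have hrep : repCount 1 1 (-E) m p =
      Nat.card {v : ZMod p × ZMod p // v.1 ^ 2 + v.1 * v.2 - (E : ZMod p) * v.2 ^ 2 = m} := by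
    rw [repCount]
    congr! 3
    push_cast
    rw [one_mul, one_mul, neg_mul, ← sub_eq_add_neg]
  have h0' : (Nat.card {v : ZMod p × ZMod p // v.1 ^ 2 + v.1 * v.2 - (E : ZMod p) * v.2 ^ 2 = 0} : ℤ)
      = 1 + ((p : ℤ) - 1) * (1 + chiInt D p) := by
    rw [h0]; push_cast [Nat.cast_sub (show 1 ≤ p by omega)]; rw [hr]
  rw [hrep]
  split_ifs with hm
  · rw [(ZMod.intCast_zmod_eq_zero_iff_dvd m p).2 hm, h0']
  · have hm' : (m : ZMod p) ≠ 0 := by rwa [ne_eq, ZMod.intCast_zmod_eq_zero_iff_dvd]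
    rw [card_normForm_eq_one hm' (exists_normForm_eq he _)]
    have ht' : (1 + ((p : ℤ) - 1) * (1 + chiInt D p)) + ((p : ℤ) - 1) *
        (Nat.card {v : ZMod p × ZMod p // v.1 ^ 2 + v.1 * v.2 - (E : ZMod p) * v.2 ^ 2 = 1} : ℤ)
          = (p : ℤ) ^ 2 := by
      rw [← h0']
      have := congrArg (Nat.cast : ℕ → ℤ) ht
      push_cast [Nat.cast_sub (show 1 ≤ p by omega)] at this
      exact this
    have hpne : (p : ℤ) - 1 ≠ 0 := by omega
    apply mul_left_cancel₀ hpne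
    linear_combination ht'

end ModPrime

end HilbertGreen

/-! ### The norm form modulo prime powers -/

namespace HilbertGreen

section PrimePower

open Finset

lemma boxCount_add_compl (N : ℕ) (P S : ℤ → ℤ → Prop) :
    boxCount N P = boxCount N (fun x y => P x y ∧ S x y) + boxCount N (fun x y => P x y ∧ ¬ S x y) := by
  classical
  unfold boxCount
  simp only [← Finset.sum_add_distrib]
  refine Finset.sum_congr rfl fun x _ => Finset.sum_congr rfl fun y _ => ?_
  by_cases h1 : P x y <;> by_cases h2 : S x y <;> simp [h1, h2]

lemma boxCount_of_dvd (p N : ℕ) (hp : 0 < p) (P : ℤ → ℤ → Prop) :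
    boxCount (p * N) (fun x y => P x y ∧ ((p : ℤ) ∣ x ∧ (p : ℤ) ∣ y)) =
      boxCount N (fun s t => P (p * s) (p * t)) := by
  classical
  rw [boxCount_mul]
  have h0 : ∀ x ∈ range p, ∀ s : ℤ, ((p : ℤ) ∣ x + p * s ↔ x = 0) := by
    intro x hx s
    rw [Int.dvd_add_left (dvd_mul_right _ _), Int.natCast_dvd_natCast]
    constructor
    · intro h
      exact Nat.eq_zero_of_dvd_of_lt h (mem_range.1 hx)
    · rintro rfl; simp
  rw [Finset.sum_eq_single_of_mem 0 (mem_range.2 hp), Finset.sum_eq_single_of_mem 0 (mem_range.2 hp)]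
  · simp
  · intro y hy hy0
    refine boxCount_false _ fun s t h => hy0 ((h0 y hy t).1 h.2.2)
  · intro x hx hx0
    refine Finset.sum_eq_zero fun y hy => boxCount_false _ fun s t h => hx0 ((h0 x hx s).1 h.2.1)

lemma repCount_one (α β γ m : ℤ) : repCount α β γ m 1 = 1 := by
  rw [repCount_eq_boxCount, boxCount_true]
  · rfl
  · simp

section Unramified

variable {p : ℕ} [Fact p.Prime] (D : ℕ) [hD : Fact D.Prime] {E : ℕ}

/-- The gradient is a linear map of determinant −D, invertible modulo p ≠ D, so only the origin is
singular. -/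
lemma not_isSmoothPt_iff (hDE : D = 1 + 4 * E) (hpD : p ≠ D) (x y : ℤ) :
    ¬ IsSmoothPt 1 1 (-E) p x y ↔ ((p : ℤ) ∣ x ∧ (p : ℤ) ∣ y) := by
  unfold IsSmoothPt
  rw [not_not]
  constructor
  · rintro ⟨h1, h2⟩
    have h3 : (p : ℤ) ∣ D * y := by
      have e : (D : ℤ) * y = (2 * 1 * x + 1 * y) - 2 * (1 * x + 2 * (-E) * y) := by
        rw [hDE]; push_cast; ring
      rw [e]
      exact h1.sub (h2.mul_left 2)
    have hpy : (p : ℤ) ∣ y := by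
      rcases (Nat.prime_iff_prime_int.1 (Fact.out : p.Prime)).dvd_or_dvd h3 with h | h
      · exact absurd ((Nat.prime_dvd_prime_iff_eq Fact.out hD.out).1 (Int.natCast_dvd_natCast.1 h)) hpD
      · exact h
    refine ⟨?_, hpy⟩
    have e : x = (1 * x + 2 * (-E) * y) - (2 * -(E : ℤ)) * y := by ring
    rw [e]
    exact h2.sub (hpy.mul_left (2 * -(E : ℤ)))
  · rintro ⟨h1, h2⟩
    exact ⟨(h1.mul_left _).add (h2.mul_left _), (h1.mul_left _).add (h2.mul_left _)⟩

/-- Smooth solutions are lifted from level one. At a non-smooth point both coordinates are divisible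
by p, and the form becomes p² times itself. -/
lemma repCount_pow_succ (hDE : D = 1 + 4 * E) (hpD : p ≠ D) (m : ℤ) (k : ℕ) :
    repCount 1 1 (-E) m (p ^ (k + 1)) = p ^ k * smoothCount 1 1 (-E) m p 1 +
      boxCount (p ^ k) (fun s t => (p : ℤ) ^ (k + 1) ∣ p ^ 2 * binForm 1 1 (-E) s t - m) := by
  have hp := (Fact.out : p.Prime)
  have : NeZero (p ^ (k + 1)) := ⟨pow_ne_zero _ hp.ne_zero⟩
  rw [repCount_eq_boxCount, boxCount_add_compl _ _ (IsSmoothPt 1 1 (-E) p), ← smoothCount_eq,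
    smoothCount]
  push_cast
  congr 1
  · simp only [not_isSmoothPt_iff D hDE hpD]
    rw [pow_succ' p k, boxCount_of_dvd _ _ hp.pos]
    refine boxCount_congr fun s t => ?_
    have : binForm 1 1 (-E) (p * s) (p * t) = (p : ℤ) ^ 2 * binForm 1 1 (-E) s t := by
      unfold binForm; ring
    rw [this]

lemma smoothCount_one_eq (hDE : D = 1 + 4 * E) (hpD : p ≠ D) (m : ℤ) :
    (smoothCount 1 1 (-E) m p 1 : ℤ) =
      if (p : ℤ) ∣ m then ((p : ℤ) - 1) * (1 + chiInt D p) else p - chiInt D p := by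
  classical
  have h1 := repCount_pow_succ D hDE hpD m 0
  have h2 := repCount_prime (p := p) D hDE hpD m
  rw [zero_add, pow_one, pow_zero, one_mul] at h1
  rw [h1] at h2
  by_cases hm : (p : ℤ) ∣ m
  · rw [if_pos hm] at h2 ⊢
    rw [boxCount_true] at h2
    · push_cast at h2; linarith
    · intro x y
      rw [pow_one]
      exact dvd_sub (dvd_mul_of_dvd_left (dvd_pow_self _ two_ne_zero) _) hm
  · rw [if_neg hm] at h2 ⊢
    rw [boxCount_false] at h2
    · push_cast at h2; linarith
    · intro x y h
      rw [pow_one] at h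
      exact hm ((dvd_sub_right (dvd_mul_of_dvd_left (dvd_pow_self _ two_ne_zero) _)).1 h)

/-- The descent from p²m modulo p^(k+2) to m modulo p^k. The coordinates divided by p live modulo
p^(k+1) but matter only modulo p^k, whence the factor p². -/
lemma repCount_pow_succ_succ (hDE : D = 1 + 4 * E) (hpD : p ≠ D) (m : ℤ) (k : ℕ) :
    repCount 1 1 (-E) ((p : ℤ) ^ 2 * m) (p ^ (k + 2)) = p ^ (k + 1) * smoothCount 1 1 (-E) ((p : ℤ) ^ 2 * m) p 1 +
      p ^ 2 * repCount 1 1 (-E) m (p ^ k) := by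
  have hp := (Fact.out : p.Prime)
  have : NeZero (p ^ k) := ⟨pow_ne_zero _ hp.ne_zero⟩
  have hp0 : (p : ℤ) ^ 2 ≠ 0 := pow_ne_zero _ (by exact_mod_cast hp.ne_zero)
  rw [repCount_pow_succ D hDE hpD, repCount_eq_boxCount, pow_succ p k]
  congr 1
  rw [← boxCount_mul_of_periodic]
  · refine boxCount_congr fun s t => ?_
    rw [← mul_sub, show (p : ℤ) ^ (k + 1 + 1) = p ^ 2 * p ^ k by ring, mul_dvd_mul_iff_left hp0]
    push_cast
    rfl
  · intro x y s t
    have : binForm 1 1 (-E) (x + (p ^ k : ℕ) * s) (y + (p ^ k : ℕ) * t) - m = (binForm 1 1 (-E) x y - m)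
        + (p ^ k : ℕ) * (2 * x * s + (x * t + y * s) - 2 * E * y * t +
            (p ^ k : ℕ) * binForm 1 1 (-E) s t) := by
      unfold binForm; ring
    rw [this, Int.dvd_add_left (dvd_mul_right _ _)]

lemma repCount_pow_succ_of_not_dvd (hDE : D = 1 + 4 * E) (hpD : p ≠ D) {m : ℤ} {k : ℕ}
    (hm : ¬ (p : ℤ) ^ min (k + 1) 2 ∣ m) :
    repCount 1 1 (-E) m (p ^ (k + 1)) = p ^ k * smoothCount 1 1 (-E) m p 1 := by
  rw [repCount_pow_succ D hDE hpD, boxCount_false, add_zero]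
  intro x y h
  refine hm ((dvd_sub_right (dvd_mul_of_dvd_left (pow_dvd_pow _ (min_le_right (k + 1) 2)) _)).1
    ((pow_dvd_pow _ (min_le_left (k + 1) 2)).trans h))

/-- The truncated sum `∑_{j ≤ k, p ^ j ∣ m} χ ^ j`. -/
def truncSum (p : ℕ) (χ m : ℤ) (k : ℕ) : ℤ :=
  ∑ j ∈ range (k + 1), if (p : ℤ) ^ j ∣ m then χ ^ j else 0

lemma truncSum_zero (p : ℕ) (χ m : ℤ) : truncSum p χ m 0 = 1 := by simp [truncSum]

lemma truncSum_succ (p : ℕ) (χ m : ℤ) (k : ℕ) :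
    truncSum p χ m (k + 1) = truncSum p χ m k + if (p : ℤ) ^ (k + 1) ∣ m then χ ^ (k + 1) else 0 := by
  rw [truncSum, Finset.sum_range_succ]; rfl

lemma truncSum_of_not_dvd {p : ℕ} (χ : ℤ) {m : ℤ} (h : ¬ (p : ℤ) ∣ m) (k : ℕ) :
    truncSum p χ m k = 1 := by
  induction k with
  | zero => exact truncSum_zero _ _ _
  | succ k ih =>
    rw [truncSum_succ, ih, if_neg, add_zero]
    exact fun h' => h ((dvd_pow_self _ (by omega)).trans h')

lemma truncSum_of_dvd_of_not_dvd {p : ℕ} (χ : ℤ) {m : ℤ} (h : (p : ℤ) ∣ m) (h' : ¬ (p : ℤ) ^ 2 ∣ m)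
    (k : ℕ) : truncSum p χ m (k + 1) = 1 + χ := by
  induction k with
  | zero => rw [truncSum_succ, truncSum_zero, zero_add, pow_one, if_pos h, pow_one]
  | succ k ih =>
    rw [truncSum_succ, ih, if_neg, add_zero]
    exact fun h'' => h' ((pow_dvd_pow _ (by omega)).trans h'')

/-- The terms j = 0, 1 split off, and the rest is the sum for m shifted by two, which χ² = 1 makes
invisible. This matches the descent by p² in the counts. -/
lemma truncSum_sq_mul {p : ℕ} (hp : p ≠ 0) {χ : ℤ} (hχ : χ ^ 2 = 1) (m : ℤ) (k : ℕ) :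
    truncSum p χ ((p : ℤ) ^ 2 * m) (k + 2) = 1 + χ + truncSum p χ m k := by
  have hp0 : (p : ℤ) ^ 2 ≠ 0 := pow_ne_zero _ (by exact_mod_cast hp)
  induction k with
  | zero =>
    rw [truncSum_succ, truncSum_succ, truncSum_zero, truncSum_zero, if_pos, if_pos]
    · linear_combination hχ
    · simp
    · exact dvd_mul_of_dvd_left (pow_dvd_pow _ (by omega)) _
  | succ k ih =>
    have hdvd : (p : ℤ) ^ (k + 2 + 1) ∣ p ^ 2 * m ↔ (p : ℤ) ^ (k + 1) ∣ m := by
      rw [show (p : ℤ) ^ (k + 2 + 1) = p ^ 2 * p ^ (k + 1) by ring, mul_dvd_mul_iff_left hp0]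
    rw [truncSum_succ, ih, truncSum_succ p χ m k]
    simp only [hdvd]
    split_ifs
    · linear_combination χ ^ (k + 1) * hχ
    · ring

/-- Strong induction on the exponent: when p² divides m both sides descend by two, and otherwise
only smooth solutions remain and the truncated sums have at most two terms. -/
lemma repCount_pow_eq (hDE : D = 1 + 4 * E) (hpD : p ≠ D) (k : ℕ) : ∀ m : ℤ,
    (repCount 1 1 (-E) m (p ^ (k + 1)) : ℤ) = p ^ (k + 1) * truncSum p (chiInt D p) m (k + 1)
      - chiInt D p * p ^ k * truncSum p (chiInt D p) m k := by
  have hp := (Fact.out : p.Prime)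
  have hχ : chiInt D p ^ 2 = 1 := chiInt_sq (by
    rw [Int.natCast_dvd_natCast]
    exact fun h => hpD ((Nat.prime_dvd_prime_iff_eq hD.out hp).1 h).symm)
  induction k using Nat.strong_induction_on with
  | _ k ih =>
  intro m
  by_cases h1 : (p : ℤ) ∣ m
  · rcases k with _ | k
    · rw [zero_add, pow_one, repCount_prime D hDE hpD, if_pos h1, truncSum_succ, truncSum_zero, zero_add, pow_one, if_pos h1]
      ring
    · by_cases h2 : (p : ℤ) ^ 2 ∣ m
      · obtain ⟨m, rfl⟩ := h2
        rw [repCount_pow_succ_succ D hDE hpD]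
        push_cast
        rw [smoothCount_one_eq D hDE hpD, if_pos h1, truncSum_sq_mul hp.ne_zero hχ]
        rcases k with _ | k
        · rw [pow_zero, repCount_one, truncSum_succ, truncSum_zero, zero_add, pow_one, if_pos h1, truncSum_zero]
          push_cast
          linear_combination (p : ℤ) * hχ
        · rw [ih k (by omega), truncSum_sq_mul hp.ne_zero hχ]
          ring_nf
          linear_combination (p : ℤ) ^ (k + 2) * hχ
      · rw [repCount_pow_succ_of_not_dvd D hDE hpD (by simpa using h2)]
        push_cast
        rw [smoothCount_one_eq D hDE hpD, if_pos h1, truncSum_of_dvd_of_not_dvd _ h1 h2,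
          truncSum_of_dvd_of_not_dvd _ h1 h2]
        ring_nf
        linear_combination (p : ℤ) ^ (k + 1) * hχ
  · rw [repCount_pow_succ_of_not_dvd D hDE hpD
      (fun h => h1 ((dvd_pow_self _ (by omega)).trans h))]
    push_cast
    rw [smoothCount_one_eq D hDE hpD, if_neg h1, truncSum_of_not_dvd _ h1, truncSum_of_not_dvd _ h1]
    ring

/-- The local factor at a prime `p ≠ D`. -/
lemma sum_chi_mul_repCount_pow (hDE : D = 1 + 4 * E) (hpD : p ≠ D) (m : ℤ) (k : ℕ) :
    ∑ j ∈ range (k + 1), chiInt D p ^ (k - j) * (repCount 1 1 (-E) m (p ^ j) : ℤ) =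
      p ^ k * truncSum p (chiInt D p) m k := by
  induction k with
  | zero => simp [repCount_one, truncSum_zero]
  | succ k ih =>
    rw [Finset.sum_range_succ, repCount_pow_eq D hDE hpD, Nat.sub_self, pow_zero, one_mul]
    have : ∑ j ∈ range (k + 1), chiInt D p ^ (k + 1 - j) * (repCount 1 1 (-E) m (p ^ j) : ℤ) =
        chiInt D p * ∑ j ∈ range (k + 1), chiInt D p ^ (k - j) * (repCount 1 1 (-E) m (p ^ j) : ℤ) := by
      rw [Finset.mul_sum]
      refine Finset.sum_congr rfl fun j hj => ?_
      rw [Nat.sub_add_comm (by simpa [Nat.lt_succ_iff] using hj), pow_succ]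
      ring
    rw [this, ih]
    ring

end Unramified

section Ramified

variable (D : ℕ) [hD : Fact D.Prime]

/-- Modulo D the form x² − Dy² is x². As D does not divide m, every solution has x prime to D and is
smooth, so counting square roots modulo D and lifting suffices. -/
lemma repCount_ramified_of_not_dvd (hD4 : D % 4 = 1) {m : ℤ} (hm : ¬ (D : ℤ) ∣ m) (k : ℕ) :
    (repCount 1 0 (-D) m (D ^ (k + 1)) : ℤ) = D ^ (k + 1) * (1 + chiInt D m) := by
  classical
  have : NeZero (D ^ (k + 1)) := ⟨pow_ne_zero _ hD.out.ne_zero⟩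
  have hD2 : D ≠ 2 := by rintro rfl; simp at hD4
  have hsm : ∀ k, 1 ≤ k → repCount 1 0 (-D) m (D ^ k) = smoothCount 1 0 (-D) m D k := by
    intro k hk
    have : NeZero (D ^ k) := ⟨pow_ne_zero _ hD.out.ne_zero⟩
    rw [repCount_eq_boxCount, smoothCount]
    push_cast
    refine boxCount_congr fun x y => ⟨fun h => ⟨h, ?_⟩, fun h => h.1⟩
    rintro ⟨h1, -⟩
    have h1' : (D : ℤ) ∣ 2 * x := by simpa using h1
    have hx : (D : ℤ) ∣ x := by
      rcases (Nat.prime_iff_prime_int.1 hD.out).dvd_or_dvd h1' with h | h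
      · exact absurd ((Nat.prime_dvd_prime_iff_eq hD.out Nat.prime_two).1 (by exact_mod_cast h)) hD2
      · exact h
    refine hm ?_
    have h2 := (dvd_pow_self (D : ℤ) (by omega : k ≠ 0)).trans h
    have h3 : binForm 1 0 (-D) x y - m = (x * x - D * y ^ 2) - m := by unfold binForm; ring
    rw [h3] at h2
    exact (dvd_sub_right ((hx.mul_left x).sub (dvd_mul_right _ _))).1 h2
  have h1 : repCount 1 0 (-D) m D = D * Nat.card {x : ZMod D // x ^ 2 = m} := by
    have e : {v : ZMod D × ZMod D // ((1 : ℤ) : ZMod D) * v.1 ^ 2 + ((0 : ℤ) : ZMod D) * v.1 * v.2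
        + ((-D : ℤ) : ZMod D) * v.2 ^ 2 = m} ≃ ZMod D × {x : ZMod D // x ^ 2 = m} :=
      { toFun := fun v => (v.1.2, ⟨v.1.1, by simpa using v.2⟩)
        invFun := fun w => ⟨(w.2.1, w.1), by simpa using w.2.2⟩
        left_inv := fun v => rfl
        right_inv := fun w => rfl }
    rw [repCount, Nat.card_congr e, Nat.card_prod, Nat.card_zmod]
  have h2 := quadraticChar_card_sqrts (F := ZMod D) (by rw [ZMod.ringChar_zmod_n]; exact hD2) (m : ZMod D)
  rw [← Set.ncard_eq_toFinset_card', ← Nat.card_coe_set_eq] at h2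
  have h2' : (Nat.card {x : ZMod D // x ^ 2 = m} : ℤ) = 1 + chiInt D m := by
    rw [chiInt, add_comm, ← h2]; rfl
  rw [hsm _ (by omega), smoothCount_eq, ← hsm 1 le_rfl, pow_one, h1]
  push_cast
  rw [h2']
  ring

/-- Divisibility by D forces x = Ds, and dividing the congruence by −D gives y² − Ds² ≡ −m. The two
variables exchange roles; y is still counted modulo D^(k+1), which gives the factor D. -/
lemma repCount_ramified_of_dvd (m : ℤ) (k : ℕ) :
    repCount 1 0 (-D) (D * m) (D ^ (k + 1)) = D * repCount 1 0 (-D) (-m) (D ^ k) := by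
  classical
  have hpos := hD.out.pos
  have : NeZero (D ^ (k + 1)) := ⟨pow_ne_zero _ hD.out.ne_zero⟩
  have : NeZero (D ^ k) := ⟨pow_ne_zero _ hD.out.ne_zero⟩
  have hD0 : (D : ℤ) ≠ 0 := by exact_mod_cast hD.out.ne_zero
  rw [repCount_eq_boxCount, repCount_eq_boxCount]
  have hx : ∀ x ∈ range D, ∀ s : ℕ, ∀ y : ℤ,
      (((D ^ (k + 1) : ℕ) : ℤ) ∣ binForm 1 0 (-D) ((x + D * s : ℕ) : ℤ) y - D * m ↔
        x = 0 ∧ ((D ^ k : ℕ) : ℤ) ∣ binForm 1 0 (-D) y s - (-m)) := by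
    intro x hx s y
    have h2 : binForm 1 0 (-D) ((0 + D * s : ℕ) : ℤ) y - D * m =
        -(D * (binForm 1 0 (-D) y s - (-m))) := by
      unfold binForm; push_cast; ring
    constructor
    · intro h
      have hx0 : x = 0 := by
        have h3 : (D : ℤ) ∣ (x : ℤ) ^ 2 := by
          have h4 : (D : ℤ) ∣ binForm 1 0 (-D) ((x + D * s : ℕ) : ℤ) y - D * m :=
            (by push_cast; exact dvd_pow_self _ (by omega) : (D : ℤ) ∣ ((D ^ (k + 1) : ℕ) : ℤ)).trans h
          have h5 : binForm 1 0 (-D) ((x + D * s : ℕ) : ℤ) y - D * m =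
              (x : ℤ) ^ 2 + D * (2 * x * s + D * s ^ 2 - y ^ 2 - m) := by
            unfold binForm; push_cast; ring
          rw [h5] at h4
          exact (Int.dvd_add_left (dvd_mul_right _ _)).1 h4
        have := (Nat.prime_iff_prime_int.1 hD.out).dvd_of_dvd_pow h3
        exact Nat.eq_zero_of_dvd_of_lt (Int.natCast_dvd_natCast.1 this) (mem_range.1 hx)
      subst hx0
      refine ⟨rfl, ?_⟩
      rw [h2, dvd_neg, pow_succ', Nat.cast_mul, mul_dvd_mul_iff_left hD0] at h
      exact h
    · rintro ⟨rfl, h⟩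
      rw [h2, dvd_neg, pow_succ', Nat.cast_mul, mul_dvd_mul_iff_left hD0]
      exact h
  have hy : ∀ s y t : ℕ, ((D ^ k : ℕ) : ℤ) ∣ binForm 1 0 (-D) ((y + D ^ k * t : ℕ) : ℤ) s - (-m) ↔
      ((D ^ k : ℕ) : ℤ) ∣ binForm 1 0 (-D) y s - (-m) := by
    intro s y t
    have : binForm 1 0 (-D) ((y + D ^ k * t : ℕ) : ℤ) s - (-m) = (binForm 1 0 (-D) y s - (-m)) +
        ((D ^ k : ℕ) : ℤ) * (2 * y * t + D ^ k * t ^ 2) := by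
      unfold binForm; push_cast; ring
    rw [this, Int.dvd_add_left (dvd_mul_right _ _)]
  unfold boxCount
  rw [pow_succ' D k, sum_range_mul_eq D (D ^ k), Finset.sum_eq_single_of_mem 0 (mem_range.2 hpos)]
  · rw [Finset.sum_comm (s := range (D ^ k)) (t := range (D ^ k)), Finset.mul_sum]
    refine Finset.sum_congr rfl fun s _ => ?_
    rw [mul_comm D (D ^ k), sum_range_mul_eq (D ^ k) D, Finset.mul_sum]
    refine Finset.sum_congr rfl fun y _ => ?_
    rw [← pow_succ]
    simp only [hx 0 (mem_range.2 hpos), hy, true_and, Finset.sum_const, card_range, smul_eq_mul]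
    congr
  · intro x hx' hx0
    refine Finset.sum_eq_zero fun s _ => Finset.sum_eq_zero fun y _ => ?_
    rw [← pow_succ', if_neg]
    rw [Iff.not (hx x hx' s y)]
    exact fun h => hx0 h.1

/-- Each factor D of the value is removed by one exchange of variables; the accompanying change of
sign is harmless because χ_D is even. -/
lemma repCount_ramified (hD4 : D % 4 = 1) (l : ℕ) : ∀ (k : ℕ) {m : ℤ}, ¬ (D : ℤ) ∣ m →
    (repCount 1 0 (-D) (D ^ l * m) (D ^ k) : ℤ) = D ^ k * (1 + if l < k then chiInt D m else 0) := by
  induction l with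
  | zero =>
    intro k m hm
    rcases k with _ | k
    · simp [repCount_one]
    · rw [pow_zero, one_mul, repCount_ramified_of_not_dvd D hD4 hm, if_pos (by omega)]
  | succ l ih =>
    intro k m hm
    rcases k with _ | k
    · simp [repCount_one]
    · rw [pow_succ' (D : ℤ) l, mul_assoc, repCount_ramified_of_dvd, ← mul_neg]
      push_cast
      rw [ih k (by rwa [dvd_neg]), chiInt_neg hD4]
      simp only [add_lt_add_iff_right]
      ring

/-- Since 2 is invertible modulo D^k, one may use 4(x² + xy − Ey²) = (2x + y)² − Dy². -/
lemma repCount_disc_eq {D E : ℕ} (hDE : D = 1 + 4 * E) (m : ℤ) (k : ℕ) :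
    repCount 1 1 (-E) m (D ^ k) = repCount 1 0 (-D) (4 * m) (D ^ k) := by
  have hodd : Nat.Coprime 2 (D ^ k) := by
    refine Nat.Coprime.pow_right _ (Nat.coprime_two_left.2 ?_)
    exact ⟨2 * E, by omega⟩
  set h : ZMod (D ^ k) := ((2 : ℕ) : ZMod (D ^ k))⁻¹ with hdef
  have hh : (2 : ZMod (D ^ k)) * h = 1 := by
    have := ZMod.coe_mul_inv_eq_one 2 hodd
    simpa [hdef] using this
  have hDz : ((D : ℕ) : ZMod (D ^ k)) = 1 + 4 * (E : ZMod (D ^ k)) := by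
    have := congrArg (Nat.cast : ℕ → ZMod (D ^ k)) hDE
    push_cast at this
    exact this
  unfold repCount
  refine Nat.card_congr
    { toFun := fun v => ⟨(2 * v.1.1 + v.1.2, v.1.2), ?_⟩
      invFun := fun v => ⟨(h * (v.1.1 - v.1.2), v.1.2), ?_⟩
      left_inv := ?_
      right_inv := ?_ }
  · have := v.2
    push_cast at this ⊢
    rw [hDz]
    linear_combination 4 * this
  · have := v.2
    push_cast at this ⊢
    rw [hDz] at this
    linear_combination h ^ 2 * this + (2 * h + 1) * (E * v.1.2 ^ 2 + m) * hh
      + (h * v.1.2 ^ 2 - h * v.1.1 * v.1.2) * hh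
  · rintro ⟨⟨x, y⟩, hv⟩
    ext <;> simp only
    linear_combination x * hh
  · rintro ⟨⟨x, y⟩, hv⟩
    ext <;> simp only
    linear_combination (x - y) * hh

end Ramified

end PrimePower

end HilbertGreen

/-! ### Multiplicativity and the divisor sum for composite moduli -/

namespace HilbertGreen

section GlobalCount

open Finset

lemma repCount_mul (α β γ m : ℤ) {a b : ℕ} (hab : a.Coprime b) :
    repCount α β γ m (a * b) = repCount α β γ m a * repCount α β γ m b := by
  let e := ZMod.chineseRemainder hab
  have key : ∀ v : ZMod (a * b) × ZMod (a * b),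
      ((α : ZMod (a * b)) * v.1 ^ 2 + β * v.1 * v.2 + γ * v.2 ^ 2 = m ↔
        ((α : ZMod a) * (e v.1).1 ^ 2 + β * (e v.1).1 * (e v.2).1 + γ * (e v.2).1 ^ 2 = m ∧
         (α : ZMod b) * (e v.1).2 ^ 2 + β * (e v.1).2 * (e v.2).2 + γ * (e v.2).2 ^ 2 = m)) := by
    intro v
    rw [← e.injective.eq_iff, Prod.ext_iff]
    simp
  unfold repCount
  rw [← Nat.card_prod]
  refine Nat.card_congr
    { toFun := fun v => (⟨((e v.1.1).1, (e v.1.2).1), ((key v.1).1 v.2).1⟩,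
        ⟨((e v.1.1).2, (e v.1.2).2), ((key v.1).1 v.2).2⟩)
      invFun := fun w => ⟨(e.symm (w.1.1.1, w.2.1.1), e.symm (w.1.1.2, w.2.1.2)), ?_⟩
      left_inv := ?_
      right_inv := ?_ }
  · rw [key]
    simp only [RingEquiv.apply_symm_apply]
    exact ⟨w.1.2, w.2.2⟩
  · rintro ⟨⟨x, y⟩, hv⟩
    ext <;> simp
  · rintro ⟨⟨⟨x, y⟩, hv⟩, ⟨⟨x', y'⟩, hv'⟩⟩
    simp

open ArithmeticFunction

variable (D : ℕ) [hD : Fact D.Prime]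

/-- The quadratic character modulo `D` as an arithmetic function. -/
def chiArith : ArithmeticFunction ℤ := ⟨fun n => chiInt D n, by simp [chiInt]⟩

/-- The counting function of the solutions of `x² + xy - E y² = m` modulo `c`. -/
def repArith (E : ℕ) (m : ℤ) : ArithmeticFunction ℤ :=
  ⟨fun c => if c = 0 then 0 else repCount 1 1 (-E) m c, by simp⟩

/-- The function `d ↦ d χ(d) [d ∣ m]`. -/
def chiDivArith (m : ℤ) : ArithmeticFunction ℤ :=
  ⟨fun d => if (d : ℤ) ∣ m then d * chiInt D d else 0, by simp⟩

lemma chiInt_one : chiInt D 1 = 1 := by simp [chiInt]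

lemma chiArith_isMultiplicative : (chiArith D).IsMultiplicative := by
  refine ⟨by simpa [chiArith] using chiInt_one D, ?_⟩
  intro a b _
  simp [chiArith, chiInt_mul]

lemma repArith_isMultiplicative (E : ℕ) (m : ℤ) : (repArith E m).IsMultiplicative := by
  rw [IsMultiplicative.iff_ne_zero]
  refine ⟨by simp [repArith, repCount_one], ?_⟩
  intro a b ha hb hab
  simp [repArith, ha, hb, repCount_mul _ _ _ _ hab]

lemma chiDivArith_isMultiplicative (m : ℤ) : (chiDivArith D m).IsMultiplicative := by
  refine ⟨by simpa [chiDivArith] using chiInt_one D, ?_⟩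
  intro a b hab
  have : ((a * b : ℕ) : ℤ) ∣ m ↔ (a : ℤ) ∣ m ∧ (b : ℤ) ∣ m := by
    push_cast
    constructor
    · intro h; exact ⟨(dvd_mul_right _ _).trans h, (dvd_mul_left _ _).trans h⟩
    · rintro ⟨h1, h2⟩
      exact (Nat.isCoprime_iff_coprime.2 hab).mul_dvd h1 h2
  simp only [chiDivArith, coe_mk, this]
  push_cast
  rw [chiInt_mul]
  by_cases h1 : (a : ℤ) ∣ m <;> by_cases h2 : (b : ℤ) ∣ m <;> simp [h1, h2]
  ring

lemma chiInt_pow (a : ℤ) (k : ℕ) : chiInt D (a ^ k) = chiInt D a ^ k := by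
  induction k with
  | zero => simp [chiInt_one]
  | succ k ih => rw [pow_succ, chiInt_mul, ih, pow_succ]

lemma arith_mul_prime_pow (f g : ArithmeticFunction ℤ) {p : ℕ} (hp : p.Prime) (k : ℕ) :
    (f * g) (p ^ k) = ∑ j ∈ range (k + 1), f (p ^ (k - j)) * g (p ^ j) := by
  rw [mul_comm f g, mul_apply, Nat.sum_divisorsAntidiagonal (fun x y => g x * f y),
    Nat.divisors_prime_pow hp, Finset.sum_map]
  refine Finset.sum_congr rfl fun j hj => ?_
  simp only [Function.Embedding.coeFn_mk]
  rw [Nat.pow_div (by simpa [Nat.lt_succ_iff] using hj) hp.pos, mul_comm]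

variable {D}

/-- Both convolutions are multiplicative, so the identity reduces to the local factors at primes
different from D. -/
lemma chi_mul_rep_of_coprime {E : ℕ} (hDE : D = 1 + 4 * E) (m : ℤ) (a : ℕ) : a.Coprime D →
    (chiArith D * repArith E m) a = ((ArithmeticFunction.id : ArithmeticFunction ℕ) *
      chiDivArith D m : ArithmeticFunction ℤ) a := by
  have hm1 := (chiArith_isMultiplicative D).mul (repArith_isMultiplicative E m)
  have hm2 : (((ArithmeticFunction.id : ArithmeticFunction ℕ) : ArithmeticFunction ℤ) *
      chiDivArith D m).IsMultiplicative :=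
    (isMultiplicative_id.natCast).mul (chiDivArith_isMultiplicative D m)
  induction a using Nat.recOnPosPrimePosCoprime with
  | prime_pow p k hp hk =>
    intro hc
    have : Fact p.Prime := ⟨hp⟩
    have hpD : p ≠ D := by
      rintro rfl
      rw [Nat.coprime_pow_left_iff hk, Nat.coprime_self] at hc
      exact hp.one_lt.ne' hc
    rw [arith_mul_prime_pow _ _ hp, arith_mul_prime_pow _ _ hp]
    have h := sum_chi_mul_repCount_pow (p := p) D hDE hpD m k
    have h1 : ∀ j ∈ range (k + 1), chiArith D (p ^ (k - j)) * repArith E m (p ^ j) =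
        chiInt D p ^ (k - j) * (repCount 1 1 (-E) m (p ^ j) : ℤ) := by
      intro j _
      simp [chiArith, repArith, hp.ne_zero, chiInt_pow]
    rw [Finset.sum_congr rfl h1, h, truncSum, Finset.mul_sum]
    refine Finset.sum_congr rfl fun j hj => ?_
    have hj' : j ≤ k := by simpa [Nat.lt_succ_iff] using hj
    simp only [chiDivArith, coe_mk, natCoe_apply, id_apply]
    push_cast
    rw [chiInt_pow]
    split_ifs
    · rw [← mul_assoc, ← pow_add, Nat.sub_add_cancel hj']
    · simp
  | zero => intro _; simp
  | one => intro _; rw [hm1.1, hm2.1]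
  | coprime a b ha hb hab iha ihb =>
    intro hc
    rw [hm1.2 hab, hm2.2 hab, iha (Nat.Coprime.coprime_mul_right hc), ihb (Nat.Coprime.coprime_mul_left hc)]

/-- χ_D kills every positive power of D, so the convolution collapses to its term at the full power.
-/
lemma chi_mul_rep_ramified {E : ℕ} (hDE : D = 1 + 4 * E) {m : ℤ} (l k : ℕ) (hm : ¬ (D : ℤ) ∣ m) :
    (chiArith D * repArith E (D ^ l * m)) (D ^ k) =
      D ^ k * (1 + if l < k then chiInt D m else 0) := by
  have hp := hD.out
  have hD2 : ¬ (D : ℤ) ∣ 4 := by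
    intro h
    have h' : D ∣ 2 ^ 2 := by exact_mod_cast h
    have := (Nat.prime_dvd_prime_iff_eq hp Nat.prime_two).1 (hp.dvd_of_dvd_pow h')
    omega
  have h4 : chiInt D 4 = 1 := by
    have : ¬ (D : ℤ) ∣ 2 := fun h => hD2 (h.trans ⟨2, by norm_num⟩)
    rw [show (4 : ℤ) = 2 ^ 2 by norm_num, chiInt_pow, chiInt_sq this]
  rw [arith_mul_prime_pow _ _ hp, Finset.sum_range_succ, Finset.sum_eq_zero, zero_add]
  · have h1 : chiArith D (D ^ (k - k)) = 1 := by simp [chiArith, chiInt_one]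
    rw [h1, one_mul]
    simp only [repArith, coe_mk, pow_eq_zero_iff', hp.ne_zero, false_and, if_false]
    rw [repCount_disc_eq hDE, mul_left_comm, repCount_ramified D (by omega), chiInt_mul, h4, one_mul]
    intro h
    rcases (Nat.prime_iff_prime_int.1 hp).dvd_or_dvd h with h | h
    · exact hD2 h
    · exact hm h
  · intro j hj
    have : chiArith D (D ^ (k - j)) = 0 := by
      simp only [chiArith, coe_mk]
      refine chiInt_eq_zero ?_
      push_cast
      exact dvd_pow_self _ (by simp at hj; omega)
    rw [this, zero_mul]

/-- The convolution of `χ_D` with the counting function of the representations of `m` by the norm form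
modulo `aD`. -/
theorem sum_chi_mul_repCount {E : ℕ} (hDE : D = 1 + 4 * E) {m : ℕ} (hm : 0 < m) {a : ℕ} (ha : 0 < a) :
    ∑ d ∈ a.divisors, chiInt D ((a / d : ℕ) : ℤ) * (repCount 1 1 (-E) m (d * D) : ℤ) =
      a * D * ∑ d ∈ a.divisors with d ∣ m, (chiInt D d + chiInt D ((m / d : ℕ) : ℤ)) := by
  classical
  have hp := hD.out
  have hDpos := hp.pos
  have hDi := Nat.prime_iff_prime_int.1 hp
  -- the left-hand side is the convolution at `a * D`
  have hL : ∑ d ∈ a.divisors, chiInt D ((a / d : ℕ) : ℤ) * (repCount 1 1 (-E) m (d * D) : ℤ) =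
      (chiArith D * repArith E m) (a * D) := by
    rw [mul_comm (chiArith D), mul_apply, Nat.sum_divisorsAntidiagonal (fun x y => repArith E m x * chiArith D y)]
    symm
    rw [← Finset.sum_filter_of_ne (p := fun x => D ∣ x)]
    · symm
      refine Finset.sum_bij (fun d _ => d * D) ?_ ?_ ?_ ?_
      · intro d hd
        have hd' := Nat.dvd_of_mem_divisors hd
        simp only [mem_filter, Nat.mem_divisors]
        exact ⟨⟨Nat.mul_dvd_mul_right hd' D, by positivity⟩, dvd_mul_left _ _⟩
      · intro d _ d' _ h
        exact Nat.eq_of_mul_eq_mul_right hDpos h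
      · intro x hx
        simp only [mem_filter, Nat.mem_divisors] at hx
        obtain ⟨⟨hx1, hx2⟩, ⟨y, rfl⟩⟩ := hx
        refine ⟨y, ?_, mul_comm _ _⟩
        rw [Nat.mem_divisors]
        exact ⟨Nat.dvd_of_mul_dvd_mul_right hDpos (by rwa [mul_comm y D]), ha.ne'⟩
      · intro d hd
        have hd0 := Nat.pos_of_mem_divisors hd
        simp only [repArith, chiArith, coe_mk]
        rw [if_neg (by positivity), Nat.mul_div_mul_right _ _ hDpos, mul_comm]
    -- A divisor x of aD not divisible by D leaves a factor D in aD/x, where χ_D vanishes; only the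
    -- moduli dD survive.
    · intro x hx hne
      by_contra hDx
      apply hne
      have hx' := Nat.dvd_of_mem_divisors hx
      have : D ∣ a * D / x := by
        obtain ⟨y, hy⟩ := hx'
        have hx0 := Nat.pos_of_mem_divisors hx
        rw [hy, Nat.mul_div_cancel_left _ hx0]
        have h1 : D ∣ x * y := hy ▸ dvd_mul_left _ _
        exact (hp.dvd_mul.1 h1).resolve_left hDx
      simp only [chiArith, coe_mk]
      rw [chiInt_eq_zero (Int.natCast_dvd_natCast.2 this), mul_zero]
  rw [hL]
  -- split off the powers of `D`
  obtain ⟨k, a₀, ha₀, rfl⟩ := Nat.exists_eq_pow_mul_and_not_dvd ha.ne' D hp.ne_one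
  obtain ⟨l, m₀, hm₀, rfl⟩ := Nat.exists_eq_pow_mul_and_not_dvd hm.ne' D hp.ne_one
  have hcop : a₀.Coprime D := (Nat.Prime.coprime_iff_not_dvd hp).2 ha₀ |>.symm
  have hm1 := (chiArith_isMultiplicative D).mul (repArith_isMultiplicative E ((D ^ l * m₀ : ℕ) : ℤ))
  have ha0pos : 0 < a₀ := Nat.pos_of_ne_zero (by rintro rfl; exact ha₀ (dvd_zero _))
  have hm0pos : 0 < m₀ := Nat.pos_of_ne_zero (by rintro rfl; exact hm₀ (dvd_zero _))
  have hm0' : ¬ (D : ℤ) ∣ (m₀ : ℤ) := by rwa [Int.natCast_dvd_natCast]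
  rw [show D ^ k * a₀ * D = a₀ * D ^ (k + 1) by ring, hm1.2 (hcop.pow_right _),
    chi_mul_rep_of_coprime hDE _ _ hcop]
  rw [show ((D ^ l * m₀ : ℕ) : ℤ) = (D : ℤ) ^ l * (m₀ : ℤ) by push_cast; rfl,
    chi_mul_rep_ramified hDE l (k + 1) hm0']
  -- the sum over the divisors prime to `D`
  set T : ℤ := ∑ d ∈ a₀.divisors with d ∣ m₀, chiInt D d with hT
  have hcopd : ∀ d ∈ a₀.divisors, d.Coprime D := fun d hd =>
    Nat.Coprime.coprime_dvd_left (Nat.dvd_of_mem_divisors hd) hcop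
  have hdm : ∀ d : ℕ, d.Coprime D → (d ∣ D ^ l * m₀ ↔ d ∣ m₀) := by
    intro d hd
    exact ⟨fun h => (hd.pow_right l).dvd_of_dvd_mul_left h, fun h => h.mul_left _⟩
  have h1 : ((ArithmeticFunction.id : ArithmeticFunction ℕ) *
      chiDivArith D ((D : ℤ) ^ l * (m₀ : ℤ)) : ArithmeticFunction ℤ) a₀ = a₀ * T := by
    rw [mul_comm, mul_apply, Nat.sum_divisorsAntidiagonal (fun x y => chiDivArith D ((D : ℤ) ^ l * (m₀ : ℤ)) x *
      ((ArithmeticFunction.id : ArithmeticFunction ℕ) : ArithmeticFunction ℤ) y), hT, Finset.sum_filter,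
      Finset.mul_sum]
    refine Finset.sum_congr rfl fun d hd => ?_
    have hd' := hdm d (hcopd d hd)
    have : (d : ℤ) ∣ (D : ℤ) ^ l * m₀ ↔ d ∣ m₀ := by
      rw [← hd']; exact_mod_cast Int.natCast_dvd_natCast
    simp only [chiDivArith, coe_mk, this, natCoe_apply, id_apply]
    split_ifs
    · have h3 : (d : ℤ) * ((a₀ / d : ℕ) : ℤ) = a₀ := by
        exact_mod_cast Nat.mul_div_cancel' (Nat.dvd_of_mem_divisors hd)
      linear_combination chiInt D d * h3
    · simp
  rw [h1, Finset.sum_add_distrib]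
  -- the divisors with `χ(d) ≠ 0`
  have h2 : ∑ d ∈ (D ^ k * a₀).divisors with d ∣ D ^ l * m₀, chiInt D d = T := by
    symm
    refine Finset.sum_subset_zero_on_sdiff ?_ ?_ (fun _ _ => rfl)
    · intro d hd
      simp only [mem_filter, Nat.mem_divisors] at hd ⊢
      exact ⟨⟨hd.1.1.mul_left _, by positivity⟩, hd.2.mul_left _⟩
    · intro d hd
      simp only [mem_sdiff, mem_filter, Nat.mem_divisors, not_and] at hd
      by_cases hdD : D ∣ d
      · exact chiInt_eq_zero (Int.natCast_dvd_natCast.2 hdD)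
      · have hc : d.Coprime D := ((Nat.Prime.coprime_iff_not_dvd hp).2 hdD).symm
        exact absurd ((hdm d hc).1 hd.1.2)
          (hd.2 ⟨(hc.pow_right k).dvd_of_dvd_mul_left hd.1.1.1, ha0pos.ne'⟩)
  -- the divisors with `χ(m / d) ≠ 0`
  have h3 : ∑ d ∈ (D ^ k * a₀).divisors with d ∣ D ^ l * m₀, chiInt D ((D ^ l * m₀ / d : ℕ) : ℤ) =
      if l < k + 1 then chiInt D m₀ * T else 0 := by
    -- χ_D(m/d) is nonzero only if d absorbs the whole power D^l of m, which fits into D^k a₀ only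
    -- when l ≤ k.
    have hpk : ∀ d, d ∣ D ^ l * m₀ → ¬ D ^ l ∣ d → chiInt D ((D ^ l * m₀ / d : ℕ) : ℤ) = 0 := by
      intro d hd hl
      refine chiInt_eq_zero (Int.natCast_dvd_natCast.2 ?_)
      by_contra hnd
      obtain ⟨y, hy⟩ := hd
      have hd0 : 0 < d := Nat.pos_of_ne_zero (by rintro rfl; simp at hy; omega)
      rw [hy, Nat.mul_div_cancel_left _ hd0] at hnd
      have hc : (D ^ l).Coprime y := (((Nat.Prime.coprime_iff_not_dvd hp).2 hnd).pow_left l)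
      exact hl (hc.dvd_of_dvd_mul_right (hy ▸ dvd_mul_right _ _))
    split_ifs with hlk
    · rw [hT, Finset.mul_sum]
      have hinj : Set.InjOn (fun d => D ^ l * d) (a₀.divisors.filter (fun d => d ∣ m₀)) := by
        intro x _ y _ h
        exact Nat.eq_of_mul_eq_mul_left (by positivity) h
      refine Eq.trans (Eq.symm (Finset.sum_subset
        (s₁ := (a₀.divisors.filter (fun d => d ∣ m₀)).image (fun d => D ^ l * d)) ?_ ?_)) ?_
      rotate_left 2
      · rw [Finset.sum_image hinj]
        refine Finset.sum_congr rfl fun d hd => ?_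
        simp only [mem_filter, Nat.mem_divisors] at hd
        rw [Nat.mul_div_mul_left _ _ (by positivity : 0 < D ^ l)]
        obtain ⟨y, hy⟩ := hd.2
        have hd0 : 0 < d := Nat.pos_of_ne_zero (by rintro rfl; simp at hy; omega)
        rw [hy, Nat.mul_div_cancel_left _ hd0]
        have hcd : ¬ (D : ℤ) ∣ (d : ℤ) := by
          rw [Int.natCast_dvd_natCast]
          exact fun h => ha₀ (h.trans hd.1.1)
        push_cast
        rw [chiInt_mul]
        -- For m₀ = dy, multiplying χ_D(m₀) by χ_D(d) gives back χ_D(y), because χ_D(d)² = 1.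
        linear_combination -chiInt D y * chiInt_sq hcd
      · intro x hx
        simp only [mem_image, mem_filter, Nat.mem_divisors] at hx ⊢
        obtain ⟨d, ⟨⟨hd1, hd2⟩, hd3⟩, rfl⟩ := hx
        exact ⟨⟨Nat.mul_dvd_mul (pow_dvd_pow _ (by omega)) hd1, by positivity⟩, Nat.mul_dvd_mul_left _ hd3⟩
      · intro x hx hx'
        simp only [mem_image, mem_filter, Nat.mem_divisors] at hx hx'
        refine hpk x hx.2 fun hl => hx' ?_
        obtain ⟨d, rfl⟩ := hl
        have hdm' : d ∣ m₀ := Nat.dvd_of_mul_dvd_mul_left (by positivity) hx.2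
        have hdc : d.Coprime (D ^ k) :=
          (((Nat.Prime.coprime_iff_not_dvd hp).2 fun h => hm₀ (h.trans hdm')).symm).pow_right k
        exact ⟨d, ⟨⟨hdc.dvd_of_dvd_mul_left ((dvd_mul_left _ _).trans hx.1.1), ha0pos.ne'⟩, hdm'⟩, rfl⟩
    · refine Finset.sum_eq_zero fun d hd => ?_
      simp only [mem_filter, Nat.mem_divisors] at hd
      refine hpk d hd.2 fun hl => ?_
      have h5 : D ^ (k + 1) ∣ D ^ k * a₀ := (pow_dvd_pow D (by omega)).trans (hl.trans hd.1.1)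
      rw [pow_succ] at h5
      exact ha₀ (Nat.dvd_of_mul_dvd_mul_left (by positivity) h5)
  rw [h2, h3]
  push_cast
  split_ifs <;> ring

/-- A form of discriminant `D` that represents `1` has as many representations of `m` modulo `c` as the
norm form. -/
lemma repCount_eq_of_disc {α β γ x₀ y₀ : ℤ} {E : ℕ} (hdisc : β ^ 2 - 4 * α * γ = 1 + 4 * E)
    (h1 : binForm α β γ x₀ y₀ = 1) (m : ℤ) (c : ℕ) :
    repCount α β γ m c = repCount 1 1 (-E) m c := by
  have hcop : IsCoprime x₀ y₀ := ⟨α * x₀ + β * y₀, γ * y₀, by rw [← h1, binForm]; ring⟩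
  obtain ⟨v, u', huv⟩ := hcop
  -- `v x₀ + u' y₀ = 1`; the second basis vector is `(-u', v)`
  set B : ℤ := 2 * α * x₀ * (-u') + β * (x₀ * v + y₀ * (-u')) + 2 * γ * y₀ * v with hB
  set C : ℤ := binForm α β γ (-u') v with hC
  have hdisc' : B ^ 2 - 4 * C = 1 + 4 * E := by
    have : B ^ 2 - 4 * binForm α β γ x₀ y₀ * C = (β ^ 2 - 4 * α * γ) * (v * x₀ + u' * y₀) ^ 2 := by
      rw [hB, hC, binForm, binForm]; ring
    rw [h1, huv, hdisc] at this
    linarith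
  -- The discriminant is odd, hence so is B. Subtracting j times the first basis vector from the
  -- second then normalises the middle coefficient to 1, and the last coefficient becomes −E.
  have hodd : B % 2 = 1 := by
    have h2 : B ^ 2 % 2 = 1 := by omega
    rcases Int.emod_two_eq_zero_or_one B with h | h
    · rw [sq, Int.mul_emod, h] at h2; simp at h2
    · exact h
  obtain ⟨j, hj⟩ : ∃ j, B = 2 * j + 1 := ⟨B / 2, by omega⟩
  have hCj : C = j ^ 2 + j - E := by
    rw [hj] at hdisc'
    linarith
  -- new basis `(x₀, y₀)`, `(-u' - j x₀, v - j y₀)`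
  have huv' : (v : ZMod c) * x₀ + u' * y₀ = 1 := by exact_mod_cast congrArg (Int.cast : ℤ → ZMod c) huv
  have hval : ∀ X Y : ZMod c, (α : ZMod c) * (x₀ * X + (-u' - j * x₀) * Y) ^ 2 +
      β * (x₀ * X + (-u' - j * x₀) * Y) * (y₀ * X + (v - j * y₀) * Y) + γ * (y₀ * X + (v - j * y₀) * Y) ^ 2
        = X ^ 2 + X * Y - E * Y ^ 2 := by
    intro X Y
    have e1 : (α : ZMod c) * x₀ ^ 2 + β * x₀ * y₀ + γ * y₀ ^ 2 = 1 := by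
      exact_mod_cast congrArg (Int.cast : ℤ → ZMod c) h1
    have e2 : 2 * (α : ZMod c) * x₀ * (-u') + β * (x₀ * v + y₀ * (-u')) + 2 * γ * y₀ * v = 2 * j + 1 := by
      exact_mod_cast congrArg (Int.cast : ℤ → ZMod c) (hB.symm.trans hj)
    have e3 : (α : ZMod c) * (-u') ^ 2 + β * (-u') * v + γ * v ^ 2 = j ^ 2 + j - E := by
      exact_mod_cast congrArg (Int.cast : ℤ → ZMod c) (hC.symm.trans hCj)
    linear_combination (X - j * Y) ^ 2 * e1 + (X - j * Y) * Y * e2 + Y ^ 2 * e3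
  unfold repCount
  refine Nat.card_congr (Equiv.symm
    { toFun := fun w => ⟨(x₀ * w.1.1 + (-u' - j * x₀) * w.1.2, y₀ * w.1.1 + (v - j * y₀) * w.1.2), ?_⟩
      invFun := fun w => ⟨((v - j * y₀) * w.1.1 + (u' + j * x₀) * w.1.2, x₀ * w.1.2 - y₀ * w.1.1), ?_⟩
      left_inv := ?_
      right_inv := ?_ })
  · simp only
    rw [hval]
    have := w.2
    push_cast at this
    linear_combination this
  · have h2 := hval ((v - j * y₀) * w.1.1 + (u' + j * x₀) * w.1.2) (x₀ * w.1.2 - y₀ * w.1.1)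
    have hx : (x₀ : ZMod c) * ((v - j * y₀) * w.1.1 + (u' + j * x₀) * w.1.2) +
        (-u' - j * x₀) * (x₀ * w.1.2 - y₀ * w.1.1) = w.1.1 := by linear_combination w.1.1 * huv'
    have hy : (y₀ : ZMod c) * ((v - j * y₀) * w.1.1 + (u' + j * x₀) * w.1.2) +
        (v - j * y₀) * (x₀ * w.1.2 - y₀ * w.1.1) = w.1.2 := by linear_combination w.1.2 * huv'
    rw [hx, hy, w.2] at h2
    push_cast
    linear_combination -h2
  · rintro ⟨⟨X, Y⟩, hv⟩
    ext <;> simp only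
    · linear_combination X * huv'
    · linear_combination Y * huv'
  · rintro ⟨⟨X, Y⟩, hv⟩
    ext <;> simp only
    · linear_combination X * huv'
    · linear_combination Y * huv'

end GlobalCount

end HilbertGreen

/-! ### The Dirichlet series of the representation numbers -/

namespace HilbertGreen

section DirichletSeries

open Finset ArithmeticFunction

variable {D : ℕ} [hD : Fact D.Prime]

lemma chiD_natCast (n : ℕ) : chiD D (n : ZMod D) = (chiInt D n : ℂ) := by
  simp [chiD, chiInt]

/-- The Dirichlet character as an arithmetic function. -/
def dirichletArith (χ : DirichletCharacter ℂ D) : ArithmeticFunction ℂ :=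
  ⟨fun n => if n = 0 then 0 else χ n, by simp⟩

/-- The arithmetic function `n ↦ χ(n) μ(n)`. -/
def dirichletMoebius (χ : DirichletCharacter ℂ D) : ArithmeticFunction ℂ :=
  ⟨fun n => if n = 0 then 0 else χ n * (moebius n : ℂ), by simp⟩

lemma dirichletArith_mul_moebius (χ : DirichletCharacter ℂ D) :
    dirichletArith χ * dirichletMoebius χ = 1 := by
  have h := DirichletCharacter.convolution_mul_moebius χ
  apply DFunLike.coe_injective
  rw [← ArithmeticFunction.coe_mul]
  refine Eq.trans ?_ (h.trans one_eq_delta.symm)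
  exact LSeries.convolution_congr (fun hn => by simp [dirichletArith, hn])
    (fun hn => by simp [dirichletMoebius, hn])

/-- The normalized counting function `a ↦ #{q = m mod aD} / D`. -/
def densityArith (D E m : ℕ) : ArithmeticFunction ℂ :=
  ⟨fun a => if a = 0 then 0 else (repCount 1 1 (-E) m (a * D) : ℂ) / D, by simp⟩

/-- The function `d ↦ d (χ_D(d) + χ_D(m/d)) [d ∣ m]`. -/
def divisorCharArith (D : ℕ) [Fact D.Prime] (m : ℕ) : ArithmeticFunction ℂ :=
  ⟨fun d => if d ∈ m.divisors then d * (chiD D (d : ZMod D) + chiD D ((m / d : ℕ) : ZMod D)) else 0,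
    by simp⟩

/-- The identity `n ↦ n`, with values in `ℂ`. -/
def idArith : ArithmeticFunction ℂ := ⟨fun n => n, by simp⟩

/-- The divisor-sum identity, divided by D, as an equality of Dirichlet convolutions. Inverting χ_D
by χ_D·μ then expresses the densities through three series that can be summed. -/
lemma chi_mul_density {E : ℕ} (hDE : D = 1 + 4 * E) {m : ℕ} (hm : 0 < m) :
    dirichletArith (chiD D) * densityArith D E m = idArith * divisorCharArith D m := by
  have hD0 : (D : ℂ) ≠ 0 := by exact_mod_cast hD.out.ne_zero
  ext a
  rcases Nat.eq_zero_or_pos a with rfl | ha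
  · simp
  have h := congrArg (Int.cast : ℤ → ℂ) (sum_chi_mul_repCount (D := D) hDE hm ha)
  rw [mul_comm (dirichletArith _), mul_comm idArith, mul_apply, mul_apply,
    Nat.sum_divisorsAntidiagonal (fun x y => densityArith D E m x * dirichletArith (chiD D) y),
    Nat.sum_divisorsAntidiagonal (fun x y => divisorCharArith D m x * idArith y)]
  have h1 : ∑ d ∈ a.divisors, densityArith D E m d * dirichletArith (chiD D) (a / d) =
      (∑ d ∈ a.divisors, (chiInt D ((a / d : ℕ) : ℤ) : ℂ) * (repCount 1 1 (-E) m (d * D) : ℂ)) / D := by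
    rw [Finset.sum_div]
    refine Finset.sum_congr rfl fun d hd => ?_
    have hd0 := (Nat.pos_of_mem_divisors hd).ne'
    have had : a / d ≠ 0 := (Nat.div_pos (Nat.divisor_le hd) (Nat.pos_of_ne_zero hd0)).ne'
    simp only [densityArith, dirichletArith, coe_mk, if_neg hd0, if_neg had]
    rw [chiD_natCast]
    ring
  have h2 : ∑ d ∈ a.divisors, divisorCharArith D m d * idArith (a / d) =
      a * ∑ d ∈ a.divisors with d ∣ m, ((chiInt D d : ℂ) + (chiInt D ((m / d : ℕ) : ℤ) : ℂ)) := by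
    rw [Finset.sum_filter, Finset.mul_sum]
    refine Finset.sum_congr rfl fun d hd => ?_
    have h3 : (d : ℂ) * ((a / d : ℕ) : ℂ) = a := by
      exact_mod_cast Nat.mul_div_cancel' (Nat.dvd_of_mem_divisors hd)
    simp only [divisorCharArith, idArith, coe_mk, Nat.mem_divisors, hm.ne', ne_eq, not_false_eq_true, and_true]
    rw [chiD_natCast, chiD_natCast]
    split_ifs
    · rw [← h3]; ring
    · simp
  rw [h1, h2]
  simp only [Int.cast_sum, Int.cast_mul, Int.cast_add, Int.cast_natCast] at h
  rw [div_eq_iff hD0, h]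
  ring

/-- The density is a convolution of absolutely convergent series. -/
lemma density_eq {E : ℕ} (hDE : D = 1 + 4 * E) {m : ℕ} (hm : 0 < m) :
    densityArith D E m = dirichletMoebius (chiD D) * (idArith * divisorCharArith D m) := by
  rw [← chi_mul_density hDE hm, ← mul_assoc, mul_comm (dirichletMoebius _), dirichletArith_mul_moebius, one_mul]

lemma LSeriesHasSum_idArith {w : ℂ} (hw : 2 < w.re) :
    LSeriesHasSum idArith w (riemannZeta (w - 1)) := by
  have h := LSeriesHasSum_one (s := w - 1) (by simp; linarith)
  have h0 : w - 1 ≠ 0 := by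
    intro h0
    have := congrArg Complex.re h0
    simp at this
    linarith
  unfold LSeriesHasSum at h ⊢
  refine (?_ : LSeries.term 1 (w - 1) = LSeries.term idArith w) ▸ h
  ext n
  rcases eq_or_ne n 0 with rfl | hn
  · simp
  · have hn' : (n : ℂ) ≠ 0 := by exact_mod_cast hn
    rw [LSeries.term_of_ne_zero hn, LSeries.term_of_ne_zero hn, Complex.cpow_sub _ _ hn', Complex.cpow_one]
    simp [idArith]

lemma LSeriesHasSum_divisorCharArith (m : ℕ) (w : ℂ) :
    LSeriesHasSum (divisorCharArith D m) w
      (∑ d ∈ m.divisors, (d : ℂ) ^ (1 - w) * (chiD D (d : ZMod D) + chiD D ((m / d : ℕ) : ZMod D))) := by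
  unfold LSeriesHasSum
  have h : ∀ d ∉ m.divisors, LSeries.term (divisorCharArith D m) w d = 0 := by
    intro d hd
    rcases eq_or_ne d 0 with rfl | h0
    · simp
    · rw [LSeries.term_of_ne_zero h0]
      simp only [divisorCharArith, coe_mk, if_neg hd, zero_div]
  have hs := hasSum_sum_of_ne_finset_zero (L := SummationFilter.unconditional ℕ) h
  convert hs using 1
  refine Finset.sum_congr rfl fun d hd => ?_
  have hd0 := (Nat.pos_of_mem_divisors hd).ne'
  have hdc : (d : ℂ) ≠ 0 := by exact_mod_cast hd0
  rw [LSeries.term_of_ne_zero hd0]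
  simp only [divisorCharArith, coe_mk, if_pos hd]
  rw [Complex.cpow_sub _ _ hdc, Complex.cpow_one]
  ring

/-- The Dirichlet series of the representation numbers. -/
theorem LSeriesHasSum_density {E : ℕ} (hDE : D = 1 + 4 * E) {m : ℕ} (hm : 0 < m) {w : ℂ}
    (hw : 2 < w.re) :
    LSeriesHasSum (densityArith D E m) w
      (riemannZeta (w - 1) / DirichletCharacter.LFunction (chiD D) w *
        ∑ d ∈ m.divisors, (d : ℂ) ^ (1 - w) * (chiD D (d : ZMod D) + chiD D ((m / d : ℕ) : ZMod D))) := by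
  have hw1 : 1 < w.re := by linarith
  have h1 := LSeriesHasSum_mul (LSeriesHasSum_idArith hw) (LSeriesHasSum_divisorCharArith (D := D) m w)
  have h2 : LSeriesSummable (dirichletMoebius (chiD D)) w := by
    refine (LSeriesSummable_congr w ?_).1 (DirichletCharacter.LSeriesSummable_mul (chiD D)
      (LSeriesSummable_moebius_iff.2 hw1))
    intro n hn
    simp [dirichletMoebius, hn]
  have h3 : LSeries (dirichletMoebius (chiD D)) w =
      (DirichletCharacter.LFunction (chiD D) w)⁻¹ := by
    rw [DirichletCharacter.LFunction_eq_LSeries _ hw1]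
    have := DirichletCharacter.LSeries.mul_mu_eq_one (chiD D) hw1
    rw [eq_comm, inv_eq_of_mul_eq_one_right]
    rw [← this]
    congr 1
    refine LSeries_congr ?_ w
    intro n hn
    simp [dirichletMoebius, hn]
  have h4 := LSeriesHasSum_mul h2.LSeriesHasSum h1
  rw [h3, ← density_eq hDE hm] at h4
  convert h4 using 1
  ring

end DirichletSeries

end HilbertGreen

/-! ### The quadratic Gauss sum from the theta transformation -/

namespace HilbertGreen

section GaussSumSign

open Filter Complex

lemma summable_exp_neg_pi_sq {A : ℝ} (hA : 0 < A) :
    Summable fun n : ℤ => Real.exp (-Real.pi * A * (n : ℝ) ^ 2) := by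
  have h := (summable_jacobiTheta₂_term_iff 0 (I * A)).2 (by simpa using hA)
  refine h.norm.congr fun n => ?_
  rw [norm_jacobiTheta₂_term]
  congr 1
  simp
  ring

lemma norm_exp_neg_pi_sq (A : ℂ) (n : ℤ) :
    ‖cexp (-Real.pi * A * (n : ℂ) ^ 2)‖ = Real.exp (-Real.pi * A.re * (n : ℝ) ^ 2) := by
  rw [Complex.norm_exp]
  congr 1
  have : (-(Real.pi : ℂ) * A * (n : ℂ) ^ 2) = ((-Real.pi * (n : ℝ) ^ 2 : ℝ) : ℂ) * A := by
    push_cast; ring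
  rw [this, Complex.re_ofReal_mul]
  ring

lemma re_inv_pos {A : ℂ} (hA : 0 < A.re) : 0 < (A⁻¹).re := by
  rw [Complex.inv_re]
  refine div_pos hA (Complex.normSq_pos.2 ?_)
  rintro rfl
  simp at hA

/-- The Gaussian sum `∑_k exp(-π (k + r)² / A)`. -/
def gaussianShift (A : ℂ) (r : ℝ) : ℂ := ∑' k : ℤ, cexp (-Real.pi / A * ((k : ℂ) + r) ^ 2)

/-- Poisson summation; the factor A^(1/2) carries the principal branch that eventually fixes the
sign of the Gauss sum. -/
lemma gaussianShift_eq {A : ℂ} (hA : 0 < A.re) (r : ℝ) :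
    gaussianShift A r = A ^ (1 / 2 : ℂ) *
      ∑' n : ℤ, cexp (-Real.pi * A * (n : ℂ) ^ 2 + 2 * Real.pi * (-I * r) * n) := by
  have hA0 : A ≠ 0 := by rintro rfl; simp at hA
  have h := Complex.tsum_exp_neg_quadratic hA (-I * r)
  have hI : I * (-I * (r : ℂ)) = r := by linear_combination -(r : ℂ) * Complex.I_mul_I
  rw [hI] at h
  rw [h, gaussianShift, ← mul_assoc, mul_one_div_cancel, one_mul]
  simp [Complex.cpow_eq_zero_iff, hA0]

/-- After Poisson summation only the frequency n = 0 survives as Re A tends to infinity. -/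
lemma tendsto_gaussianShift {l : Filter ℝ} {A : ℝ → ℂ} (hA : Tendsto (fun T => (A T).re) l atTop) (r : ℝ) :
    Tendsto (fun T => gaussianShift (A T) r / (A T) ^ (1 / 2 : ℂ)) l (𝓝 1) := by
  have h1 : Tendsto (fun T => ∑' n : ℤ,
      cexp (-Real.pi * (A T) * (n : ℂ) ^ 2 + 2 * Real.pi * (-I * r) * n)) l
      (𝓝 (∑' n : ℤ, if n = 0 then 1 else 0)) := by
    have hnorm : ∀ (T : ℝ) (n : ℤ), ‖cexp (-Real.pi * (A T) * (n : ℂ) ^ 2 + 2 * Real.pi * (-I * r) * n)‖ =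
        Real.exp (-Real.pi * (A T).re * (n : ℝ) ^ 2) := by
      intro T n
      rw [Complex.exp_add, norm_mul, norm_exp_neg_pi_sq]
      have : 2 * (Real.pi : ℂ) * (-I * r) * n = ((-2 * Real.pi * r * n : ℝ) : ℂ) * I := by push_cast; ring
      rw [this, Complex.norm_exp_ofReal_mul_I, mul_one]
    refine tendsto_tsum_of_dominated_convergence (summable_exp_neg_pi_sq one_pos) ?_ ?_
    · intro n
      rcases eq_or_ne n 0 with rfl | hn
      · simpa using tendsto_const_nhds
      · rw [if_neg hn, tendsto_zero_iff_norm_tendsto_zero]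
        simp only [hnorm]
        refine Real.tendsto_exp_atBot.comp ?_
        have hn2 : (0 : ℝ) < (n : ℝ) ^ 2 := by positivity
        have : Tendsto (fun T => -(Real.pi * (n : ℝ) ^ 2 * (A T).re)) l atBot :=
          tendsto_neg_atTop_atBot.comp (hA.const_mul_atTop (by positivity))
        refine this.congr fun T => ?_
        ring
    · filter_upwards [hA.eventually_ge_atTop 1] with T hT n
      rw [hnorm]
      refine Real.exp_le_exp.2 ?_
      have : 0 ≤ Real.pi * (n : ℝ) ^ 2 := by positivity
      nlinarith
  rw [tsum_ite_eq] at h1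
  refine h1.congr' ?_
  filter_upwards [hA.eventually_gt_atTop 0] with T hT
  have hA0 : A T ≠ 0 := by intro h; rw [h] at hT; simp at hT
  rw [gaussianShift_eq hT, mul_div_cancel_left₀]
  simp [Complex.cpow_eq_zero_iff, hA0]

/-- Writing n = kN + r separates the periodic coefficient from a Gaussian sum shifted by r/N. -/
lemma tsum_periodic_gaussian (N : ℕ) [NeZero N] {A : ℂ} (hA : 0 < A.re) (c : ℤ → ℂ)
    (hc : ∀ k r : ℤ, c (k * N + r) = c r) (hc1 : ∀ n, ‖c n‖ ≤ 1) :
    ∑' n : ℤ, c n * cexp (-Real.pi / (N ^ 2 * A) * (n : ℂ) ^ 2) =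
      ∑ r : Fin N, c r * gaussianShift A ((r : ℕ) / N : ℝ) := by
  have hN : (N : ℂ) ≠ 0 := by exact_mod_cast NeZero.ne N
  have hA' : 0 < ((N ^ 2 * A)⁻¹).re := by
    refine re_inv_pos ?_
    rw [show ((N : ℂ) ^ 2 * A) = (((N : ℝ) ^ 2 : ℝ) : ℂ) * A by push_cast; ring, Complex.re_ofReal_mul]
    have : (0 : ℝ) < N := by exact_mod_cast Nat.pos_of_ne_zero (NeZero.ne N)
    positivity
  have hs : Summable fun n : ℤ => c n * cexp (-Real.pi / (N ^ 2 * A) * (n : ℂ) ^ 2) := by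
    refine Summable.of_norm_bounded (summable_exp_neg_pi_sq hA') fun n => ?_
    rw [norm_mul, div_eq_mul_inv, norm_exp_neg_pi_sq]
    exact mul_le_of_le_one_left (Real.exp_pos _).le (hc1 n)
  rw [← (Int.divModEquiv N).symm.tsum_eq]
  have hs' := (Int.divModEquiv N).symm.summable_iff.2 hs
  rw [← (Equiv.prodComm (Fin N) ℤ).tsum_eq]
  refine (Summable.tsum_prod ((Equiv.prodComm (Fin N) ℤ).summable_iff.2 hs')).trans ?_
  rw [tsum_fintype]
  refine Finset.sum_congr rfl fun r _ => ?_
  rw [gaussianShift, ← tsum_mul_left]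
  refine tsum_congr fun k => ?_
  change c (k * N + ((r : ℕ) : ℤ)) * cexp (-Real.pi / (N ^ 2 * A) * ((k * N + ((r : ℕ) : ℤ) : ℤ) : ℂ) ^ 2) = _
  rw [hc]
  congr 2
  push_cast
  field_simp

/-- The theta series at a = 1/(D²T) − 2i/D is evaluated twice. Directly, its terms are e(n²/D) times
a Gaussian, periodic modulo D. After Poisson summation 1/a = iD/2 + 1/(4A), and exp(−πiDn²/2)
depends only on the parity of n, being −i for odd n since D ≡ 1 mod 4. -/
lemma gauss_sum_transformation {D : ℕ} (hD : D % 4 = 1) {T : ℝ} (hT : 0 < T) {a A : ℂ}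
    (ha : a = ((1 / (D ^ 2 * T) : ℝ) : ℂ) - ((2 / D : ℝ) : ℂ) * I)
    (hA : A = T + ((1 / (2 * D) : ℝ) : ℂ) * I) :
    ∑ r : Fin D, cexp (2 * Real.pi * I * ((r : ℕ) : ℂ) ^ 2 / D) * gaussianShift T ((r : ℕ) / D : ℝ) =
      1 / a ^ (1 / 2 : ℂ) * (gaussianShift A 0 - I * gaussianShift A (1 / 2)) := by
  have hD0 : D ≠ 0 := by omega
  have : NeZero D := ⟨hD0⟩
  have hDc : (D : ℂ) ≠ 0 := by exact_mod_cast hD0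
  have hDr : (0 : ℝ) < D := by exact_mod_cast Nat.pos_of_ne_zero hD0
  have hTc : (T : ℂ) ≠ 0 := by exact_mod_cast hT.ne'
  have hare : a.re = 1 / (D ^ 2 * T) := by
    rw [ha, Complex.sub_re, Complex.ofReal_re, Complex.re_ofReal_mul, Complex.I_re, mul_zero, sub_zero]
  have hAre : A.re = T := by
    rw [hA, Complex.add_re, Complex.ofReal_re, Complex.re_ofReal_mul, Complex.I_re, mul_zero, add_zero]
  have haT : 0 < a.re := by rw [hare]; positivity
  have haT0 : a ≠ 0 := by intro h; rw [h] at haT; simp at haT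
  have hA0 : A ≠ 0 := by
    intro h
    rw [h] at hAre
    simp at hAre
    exact hT.ne hAre
  have h1 := tsum_periodic_gaussian D (A := (T : ℂ)) (by simpa using hT)
    (fun n => cexp (2 * Real.pi * I * (n : ℂ) ^ 2 / D)) (by
      intro k r
      rw [Complex.exp_eq_exp_iff_exists_int]
      refine ⟨k ^ 2 * D + 2 * k * r, ?_⟩
      push_cast
      field_simp
      ring) (by
      intro n
      rw [show 2 * (Real.pi : ℂ) * I * (n : ℂ) ^ 2 / D = ((2 * Real.pi * n ^ 2 / D : ℝ) : ℂ) * I by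
        push_cast; ring, Complex.norm_exp_ofReal_mul_I])
  have h2 := tsum_periodic_gaussian 2 (A := A) (by rw [hAre]; exact hT)
    (fun n => cexp (-(Real.pi * I * D / 2) * (n : ℂ) ^ 2)) (by
      intro k r
      rw [Complex.exp_eq_exp_iff_exists_int]
      refine ⟨-(D * (k ^ 2 + k * r)), ?_⟩
      push_cast
      ring) (by
      intro n
      rw [show -(Real.pi * I * D / 2) * (n : ℂ) ^ 2 = ((-(Real.pi * D / 2 * n ^ 2) : ℝ) : ℂ) * I by
        push_cast; ring, Complex.norm_exp_ofReal_mul_I])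
  have h3 := Complex.tsum_exp_neg_mul_int_sq haT
  have h4 : ∀ n : ℤ, cexp (-Real.pi * a * (n : ℂ) ^ 2) =
      cexp (2 * Real.pi * I * (n : ℂ) ^ 2 / D) * cexp (-Real.pi / ((D : ℂ) ^ 2 * T) * (n : ℂ) ^ 2) := by
    intro n
    rw [← Complex.exp_add, ha]
    congr 1
    push_cast
    field_simp
    ring
  have hinv : 1 / a = I * D / 2 + 1 / ((2 : ℕ) ^ 2 * A) := by
    have h4A : ((2 : ℕ) : ℂ) ^ 2 * A ≠ 0 := mul_ne_zero (by norm_num) hA0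
    have e1 : a * (4 * A) * (I * D / 2) + a = 4 * A := by
      rw [ha, hA]
      push_cast
      field_simp
      ring_nf
      simp only [Complex.I_sq, show I ^ 3 = -I by rw [pow_succ, Complex.I_sq]; ring]
      ring
    field_simp
    push_cast
    linear_combination -2 * e1
  have h5 : ∀ n : ℤ, cexp (-Real.pi / a * (n : ℂ) ^ 2) =
      cexp (-(Real.pi * I * D / 2) * (n : ℂ) ^ 2) *
        cexp (-Real.pi / ((2 : ℕ) ^ 2 * A) * (n : ℂ) ^ 2) := by
    intro n
    rw [← Complex.exp_add]
    congr 1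
    rw [div_eq_mul_one_div, hinv]
    ring
  have h6 : cexp (-(Real.pi * I * D / 2)) = -I := by
    obtain ⟨k, hk⟩ : ∃ k, D = 4 * k + 1 := ⟨D / 4, by omega⟩
    have : (-(Real.pi * I * D / 2) : ℂ) = -(Real.pi / 2) * I + ((-k : ℤ) : ℂ) * (2 * Real.pi * I) := by
      rw [hk]; push_cast; ring
    rw [this, Complex.exp_add, Complex.exp_int_mul_two_pi_mul_I, mul_one,
      show -((Real.pi : ℂ) / 2) * I = -(Real.pi / 2 * I) by ring, Complex.exp_neg, Complex.exp_pi_div_two_mul_I,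
      Complex.inv_I]
  simp only [h4, h5] at h3
  rw [h1, h2, Fin.sum_univ_two] at h3
  simp only [Fin.val_zero, Fin.val_one, Nat.cast_zero, Nat.cast_one, Int.cast_zero, Int.cast_one, one_pow,
    mul_one, ne_eq, OfNat.ofNat_ne_zero, not_false_eq_true, zero_pow, mul_zero, Complex.exp_zero, one_mul,
    zero_div, h6, Int.cast_natCast, Nat.cast_ofNat] at h3
  rw [h3]
  ring

lemma tendsto_ratio_cpow (c : ℝ) :
    Tendsto (fun T : ℝ => ((T : ℂ) + (c : ℂ) * I) ^ (1 / 2 : ℂ) / (T : ℂ) ^ (1 / 2 : ℂ)) atTop (𝓝 1) := by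
  have h1 : Tendsto (fun T : ℝ => (1 + c * I * ((T⁻¹ : ℝ) : ℂ)) ^ (1 / 2 : ℂ)) atTop
      (𝓝 ((1 + c * I * ((0 : ℝ) : ℂ)) ^ (1 / 2 : ℂ))) := by
    refine Tendsto.cpow ?_ tendsto_const_nhds (by simp)
    exact tendsto_const_nhds.add (((Complex.continuous_ofReal.tendsto _).comp tendsto_inv_atTop_zero).const_mul _)
  simp only [Complex.ofReal_zero, mul_zero, add_zero, Complex.one_cpow] at h1
  refine h1.congr' ?_
  filter_upwards [eventually_gt_atTop 0] with T hT
  have hTc : (T : ℂ) ≠ 0 := by exact_mod_cast hT.ne'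
  have hz : (1 + c * I * ((T⁻¹ : ℝ) : ℂ)) ≠ 0 := by
    intro h
    have := congrArg Complex.re h
    rw [show c * I * ((T⁻¹ : ℝ) : ℂ) = ((c * T⁻¹ : ℝ) : ℂ) * I by push_cast; ring] at this
    rw [Complex.add_re, Complex.re_ofReal_mul, Complex.I_re] at this
    simp at this
  have hAT : (T : ℂ) + c * I = T * (1 + c * I * ((T⁻¹ : ℝ) : ℂ)) := by
    push_cast; field_simp
  rw [hAT, Complex.cpow_def_of_ne_zero (mul_ne_zero hTc hz), Complex.log_ofReal_mul hT hz, Complex.ofReal_log hT.le,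
    add_mul, Complex.exp_add, ← Complex.cpow_def_of_ne_zero hTc, ← Complex.cpow_def_of_ne_zero hz,
    mul_div_cancel_left₀]
  simp [Complex.cpow_eq_zero_iff, hTc]

lemma one_sub_I_ne_zero : (1 : ℂ) - I ≠ 0 := by
  intro h
  have := congrArg Complex.re h
  simp at this

/-- The evaluation of the quadratic Gauss sum for a modulus `D ≡ 1 mod 4`. -/
theorem quadratic_gauss_sum {D : ℕ} (hD : D % 4 = 1) :
    ∑ r : Fin D, cexp (2 * Real.pi * I * ((r : ℕ) : ℂ) ^ 2 / D) = ((Real.sqrt D : ℝ) : ℂ) := by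
  have hD0 : D ≠ 0 := by omega
  have hDr : (0 : ℝ) < D := by exact_mod_cast Nat.pos_of_ne_zero hD0
  set S := ∑ r : Fin D, cexp (2 * Real.pi * I * ((r : ℕ) : ℂ) ^ 2 / D) with hS
  have hl1 : Tendsto (fun T : ℝ => (∑ r : Fin D, cexp (2 * Real.pi * I * ((r : ℕ) : ℂ) ^ 2 / D) *
      gaussianShift T ((r : ℕ) / D : ℝ)) / (T : ℂ) ^ (1 / 2 : ℂ)) atTop (𝓝 S) := by
    simp only [Finset.sum_div, mul_div_assoc]
    have : S = ∑ r : Fin D, cexp (2 * Real.pi * I * (((r : ℕ) : ℂ) ^ 2 / D)) * 1 := by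
      simp [hS, mul_div_assoc]
    rw [this]
    refine tendsto_finsetSum _ fun r _ => Tendsto.const_mul _ ?_
    exact tendsto_gaussianShift (A := fun T => (T : ℂ)) (tendsto_id.congr fun T => by simp) _
  have hsqrtne : ((Real.sqrt D : ℝ) : ℂ) ≠ 0 := by exact_mod_cast (Real.sqrt_pos.2 hDr).ne'
  have hne : (1 - I) / ((Real.sqrt D : ℝ) : ℂ) ≠ 0 := div_ne_zero one_sub_I_ne_zero hsqrtne
  -- The sign is decided here: of the two square roots of −2i/D the principal one, with positive
  -- real part, is (1 − i)/√D.
  have hsqrt : (-(((2 / D : ℝ) : ℂ) * I)) ^ (1 / 2 : ℂ) = (1 - I) / ((Real.sqrt D : ℝ) : ℂ) := by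
    have hsq : (((Real.sqrt D : ℝ) : ℂ)) ^ 2 = D := by
      rw [← Complex.ofReal_pow, Real.sq_sqrt hDr.le]; simp
    have h1 : -(((2 / D : ℝ) : ℂ) * I) = ((1 - I) / ((Real.sqrt D : ℝ) : ℂ)) ^ 2 := by
      rw [div_pow, hsq, sub_sq, Complex.I_sq]; push_cast; ring
    rw [h1, one_div, Complex.sq_cpow_two_inv]
    rw [Complex.div_ofReal_re]
    simp [hDr]
  have h1 : Tendsto (fun T : ℝ => (((1 / (D ^ 2 * T) : ℝ) : ℂ) - ((2 / D : ℝ) : ℂ) * I) ^ (1 / 2 : ℂ)) atTop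
      (𝓝 ((1 - I) / ((Real.sqrt D : ℝ) : ℂ))) := by
    rw [← hsqrt]
    refine Tendsto.cpow ?_ tendsto_const_nhds ?_
    · have h0 : Tendsto (fun T : ℝ => (1 / (D ^ 2 * T) : ℝ)) atTop (𝓝 0) := by
        simp only [one_div]
        exact tendsto_inv_atTop_zero.comp (tendsto_id.const_mul_atTop (by positivity))
      simpa using ((Complex.continuous_ofReal.tendsto _).comp h0).sub_const (((2 / D : ℝ) : ℂ) * I)
    · right
      rw [Complex.neg_im, Complex.im_ofReal_mul, Complex.I_im, mul_one]
      exact neg_ne_zero.2 (by positivity)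
  have hA : Tendsto (fun T : ℝ => ((T : ℂ) + ((1 / (2 * D) : ℝ) : ℂ) * I).re) atTop atTop := by
    refine tendsto_id.congr fun T => ?_
    rw [Complex.add_re, Complex.ofReal_re, Complex.re_ofReal_mul, Complex.I_re, mul_zero, add_zero, id]
  have h2 := ((tendsto_const_nhds (x := (1 : ℂ))).div h1 hne).mul
    (((tendsto_gaussianShift hA 0).sub ((tendsto_gaussianShift hA (1 / 2)).const_mul I)).mul
      (tendsto_ratio_cpow (1 / (2 * D))))
  have hlim := tendsto_nhds_unique (hl1.congr' (by
    filter_upwards [eventually_gt_atTop 0] with T hT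
    have hA0 : ((T : ℂ) + ((1 / (2 * D) : ℝ) : ℂ) * I) ^ (1 / 2 : ℂ) ≠ 0 := by
      rw [ne_eq, Complex.cpow_eq_zero_iff]
      rintro ⟨h, -⟩
      have := congrArg Complex.re h
      rw [Complex.add_re, Complex.ofReal_re, Complex.re_ofReal_mul, Complex.I_re, mul_zero, add_zero] at this
      exact hT.ne' this
    rw [gauss_sum_transformation hD hT rfl rfl, Pi.div_apply]
    rw [← mul_div_assoc I, ← sub_div, mul_div_assoc, div_mul_div_cancel₀ hA0])) h2
  rw [hlim]
  have := one_sub_I_ne_zero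
  field_simp

end GaussSumSign

end HilbertGreen

/-! ### The functional equation of L(s, χ_D) -/

namespace HilbertGreen

section FunctionalEquation

open Complex

variable {D : ℕ} [hD : Fact D.Prime]

lemma chiD_ne_one (hD4 : D % 4 = 1) : chiD D ≠ 1 := by
  have h2 : ringChar (ZMod D) ≠ 2 := by
    rw [ZMod.ringChar_zmod_n]; omega
  obtain ⟨a, ha⟩ := quadraticChar_exists_neg_one h2
  intro h
  have h1 := congrArg (fun χ : DirichletCharacter ℂ D => χ a) h
  have ha0 : IsUnit a := by
    rw [isUnit_iff_ne_zero]
    rintro rfl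
    simp at ha
  simp only [chiD, MulChar.ringHomComp_apply, ha, MulChar.one_apply ha0] at h1
  norm_num at h1

lemma chiD_even (hD4 : D % 4 = 1) : (chiD D).Even := by
  have h := chiInt_neg (D := D) hD4 1
  rw [chiInt_one, chiInt] at h
  rw [DirichletCharacter.Even, chiD, MulChar.ringHomComp_apply]
  push_cast at h
  simp [h]

lemma chiD_isPrimitive (hD4 : D % 4 = 1) : (chiD D).IsPrimitive := by
  have h := (chiD D).conductor_dvd_level
  rcases (Nat.dvd_prime hD.out).1 h with h | h
  · exact absurd (DirichletCharacter.eq_one_iff_conductor_eq_one.2 h) (chiD_ne_one hD4)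
  · exact h

lemma chiD_inv : (chiD D)⁻¹ = chiD D :=
  ((quadraticChar_isQuadratic (ZMod D)).comp (Int.castRingHom ℂ)).inv

/-- Each a has 1 + χ_D(a) square roots, so the sum of e(x²/D) over x equals the sum of (1 +
χ_D(a))e(a/D) over a, and the part without χ_D vanishes. -/
lemma gaussSum_chiD (hD4 : D % 4 = 1) : gaussSum (chiD D) ZMod.stdAddChar = ((Real.sqrt D : ℝ) : ℂ) := by
  classical
  have h2 : ringChar (ZMod D) ≠ 2 := by
    rw [ZMod.ringChar_zmod_n]; omega
  have hcard : ∀ a : ZMod D, ((Finset.univ.filter (fun x : ZMod D => x ^ 2 = a)).card : ℂ) = 1 + chiD D a := by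
    intro a
    have h := quadraticChar_card_sqrts h2 a
    have e : {x : ZMod D | x ^ 2 = a}.toFinset = Finset.univ.filter (fun x : ZMod D => x ^ 2 = a) := by
      ext x; simp
    rw [e] at h
    have h' := congrArg (Int.cast : ℤ → ℂ) h
    push_cast at h'
    rw [h', chiD, MulChar.ringHomComp_apply]
    simp [add_comm]
  have h1 : ∑ x : ZMod D, (ZMod.stdAddChar (x ^ 2) : ℂ) = gaussSum (chiD D) ZMod.stdAddChar := by
    rw [← Finset.sum_fiberwise (s := Finset.univ) (g := fun x : ZMod D => x ^ 2)]
    have h3 : ∀ a : ZMod D, ∑ x ∈ Finset.univ.filter (fun x : ZMod D => x ^ 2 = a),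
        (ZMod.stdAddChar (x ^ 2) : ℂ) = ZMod.stdAddChar a + chiD D a * ZMod.stdAddChar a := by
      intro a
      rw [Finset.sum_congr rfl (g := fun _ => (ZMod.stdAddChar a : ℂ)) (fun x hx => by
        rw [(Finset.mem_filter.1 hx).2]), Finset.sum_const, nsmul_eq_mul, hcard]
      ring
    rw [Finset.sum_congr rfl (fun a _ => h3 a), Finset.sum_add_distrib, gaussSum]
    rw [AddChar.sum_eq_zero_of_ne_one, zero_add]
    intro h
    have := (ZMod.isPrimitive_stdAddChar D) (a := 1) one_ne_zero
    apply this
    simp [h]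
  rw [← h1, ← quadratic_gauss_sum hD4]
  refine (Finset.sum_bij' (fun (r : Fin D) _ => ((r : ℕ) : ZMod D)) (fun x _ => ⟨x.val, ZMod.val_lt x⟩) ?_ ?_ ?_ ?_ ?_).symm
  · simp
  · simp
  · intro r _; ext; simp [ZMod.val_cast_of_lt r.2]
  · intro x _; simp
  · intro r _
    have := ZMod.stdAddChar_coe (N := D) ((r : ℕ) ^ 2 : ℤ)
    push_cast at this
    rw [this]

lemma rootNumber_chiD (hD4 : D % 4 = 1) : (chiD D).rootNumber = 1 := by
  have hD0 : (0 : ℝ) < D := by exact_mod_cast hD.out.pos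
  rw [DirichletCharacter.rootNumber, gaussSum_chiD hD4, if_pos (chiD_even hD4), pow_zero, div_one]
  have : (D : ℂ) ^ (1 / 2 : ℂ) = ((Real.sqrt D : ℝ) : ℂ) := by
    rw [Real.sqrt_eq_rpow, Complex.ofReal_cpow hD0.le]
    simp
  rw [this, div_self]
  exact_mod_cast (Real.sqrt_pos.2 hD0).ne'

/-- The functional equation with the Gamma factors cleared. Both hypotheses on s together say that
1/2 − s is not a pole of Γ; at a pole the value 0 assigned to `Gamma` would spoil the cancellation.
-/
lemma LFunction_chiD_one_sub (hD4 : D % 4 = 1) {s : ℂ} (hs : 1 / 2 < s.re) (hs' : ∀ k : ℕ, s ≠ 3 / 2 + k) :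
    DirichletCharacter.LFunction (chiD D) (1 - 2 * s) * (Real.pi : ℂ) ^ (2 * s - 1 / 2) * Gamma (1 / 2 - s) =
      (D : ℂ) ^ (2 * s - 1 / 2) * DirichletCharacter.LFunction (chiD D) (2 * s) * Gamma s := by
  have hπ : (Real.pi : ℂ) ≠ 0 := by exact_mod_cast Real.pi_ne_zero
  have hs0 : s ≠ 0 := by rintro rfl; norm_num at hs
  have hne : ∀ n : ℕ, 1 / 2 - s ≠ -n := by
    intro n h
    rcases n with _ | n
    · have : s = 1 / 2 := by push_cast at h; linear_combination -h
      rw [this] at hs; norm_num at hs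
    · refine hs' n ?_
      push_cast at h
      linear_combination -h
  have hΓ : Gamma (1 / 2 - s) ≠ 0 := Complex.Gamma_ne_zero hne
  have hΓs : Gamma s ≠ 0 := Complex.Gamma_ne_zero_of_re_pos (by linarith)
  have h1 := DirichletCharacter.LFunction_eq_completed_div_gammaFactor (chiD D) (2 * s)
    (Or.inr hD.out.ne_one)
  have h2 := DirichletCharacter.LFunction_eq_completed_div_gammaFactor (chiD D) (1 - 2 * s)
    (Or.inr hD.out.ne_one)
  have h3 := (chiD_isPrimitive (D := D) hD4).completedLFunction_one_sub (2 * s)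
  rw [rootNumber_chiD hD4, mul_one, chiD_inv] at h3
  rw [(chiD_even hD4).gammaFactor_def, Complex.Gammaℝ_def] at h1 h2
  rw [h3] at h2
  have e1 : (2 * s / 2 : ℂ) = s := by ring
  have e2 : ((1 - 2 * s) / 2 : ℂ) = 1 / 2 - s := by ring
  have e3 : (-(2 * s) / 2 : ℂ) = -s := by ring
  have e4 : (-(1 - 2 * s) / 2 : ℂ) = s - 1 / 2 := by ring
  rw [e1, e3] at h1
  rw [e2, e4] at h2
  have hp1 : (Real.pi : ℂ) ^ (-s) ≠ 0 := by simp [Complex.cpow_eq_zero_iff, hπ]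
  have hp2 : (Real.pi : ℂ) ^ (s - 1 / 2) ≠ 0 := by simp [Complex.cpow_eq_zero_iff, hπ]
  have hp3 : (Real.pi : ℂ) ^ (2 * s - 1 / 2) = (Real.pi : ℂ) ^ (s - 1 / 2) * (Real.pi : ℂ) ^ s := by
    rw [← Complex.cpow_add _ _ hπ]; congr 1; ring
  have hp4 : (Real.pi : ℂ) ^ s * (Real.pi : ℂ) ^ (-s) = 1 := by
    rw [← Complex.cpow_add _ _ hπ]; simp
  rw [eq_div_iff (mul_ne_zero hp1 hΓs)] at h1
  rw [eq_div_iff (mul_ne_zero hp2 hΓ)] at h2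
  rw [hp3]
  rw [← h1] at h2
  linear_combination (Real.pi : ℂ) ^ s * h2 + (D : ℂ) ^ (2 * s - 1 / 2) *
    DirichletCharacter.LFunction (chiD D) (2 * s) * Gamma s * hp4

/-- The constant factor in the constant term, converted by the functional equation. -/
lemma prefactor_eq (hD4 : D % 4 = 1) {s : ℂ} (hs : 1 / 2 < s.re) (hs' : ∀ k : ℕ, s ≠ 3 / 2 + k) :
    2 * Real.pi / (2 * s - 1) * (Real.sqrt Real.pi / Gamma s) * (D : ℂ) ^ (-s - 1 / 2) *
        (1 / DirichletCharacter.LFunction (chiD D) (2 * s)) =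
      -((Real.pi ^ 2 / D : ℝ) : ℂ) ^ (1 - s) * (1 / Gamma (3 / 2 - s)) *
        (1 / DirichletCharacter.LFunction (chiD D) (1 - 2 * s)) := by
  have hD0 : (0 : ℝ) < D := by exact_mod_cast hD.out.pos
  have hDc : (D : ℂ) ≠ 0 := by exact_mod_cast hD.out.ne_zero
  have hπ : (Real.pi : ℂ) ≠ 0 := by exact_mod_cast Real.pi_ne_zero
  have hne : ∀ n : ℕ, 1 / 2 - s ≠ -n := by
    intro n h
    rcases n with _ | n
    · have : s = 1 / 2 := by push_cast at h; linear_combination -h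
      rw [this] at hs; norm_num at hs
    · refine hs' n ?_
      push_cast at h
      linear_combination -h
  have h2s : 2 * s - 1 ≠ 0 := by
    intro h
    have : s = 1 / 2 := by linear_combination h / 2
    rw [this] at hs; norm_num at hs
  have hΓ : Gamma (1 / 2 - s) ≠ 0 := Complex.Gamma_ne_zero hne
  have hΓs : Gamma s ≠ 0 := Complex.Gamma_ne_zero_of_re_pos (by linarith)
  have h12 : 1 / 2 - s ≠ 0 := by simpa using hne 0
  have hΓ3 : Gamma (3 / 2 - s) = (1 / 2 - s) * Gamma (1 / 2 - s) := by
    rw [← Complex.Gamma_add_one _ h12]; congr 1; ring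
  have hL : DirichletCharacter.LFunction (chiD D) (2 * s) ≠ 0 := by
    refine DirichletCharacter.LFunction_ne_zero_of_one_le_re _ (Or.inl (chiD_ne_one hD4)) ?_
    simp; linarith
  have hfe := LFunction_chiD_one_sub hD4 hs hs'
  have hp : (Real.pi : ℂ) ^ (2 * s - 1 / 2) ≠ 0 := by simp [Complex.cpow_eq_zero_iff, hπ]
  have hdp : (D : ℂ) ^ (2 * s - 1 / 2) ≠ 0 := by simp [Complex.cpow_eq_zero_iff, hDc]
  have hL' : DirichletCharacter.LFunction (chiD D) (1 - 2 * s) ≠ 0 := by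
    intro h
    rw [h, zero_mul, zero_mul] at hfe
    exact mul_ne_zero (mul_ne_zero hdp hL) hΓs hfe.symm
  have hsqrt : ((Real.sqrt Real.pi : ℝ) : ℂ) = (Real.pi : ℂ) ^ (1 / 2 : ℂ) := by
    rw [Real.sqrt_eq_rpow, Complex.ofReal_cpow Real.pi_pos.le]; simp
  have hpd : ((Real.pi ^ 2 / D : ℝ) : ℂ) ^ (1 - s) = (Real.pi : ℂ) ^ (2 - 2 * s) * (D : ℂ) ^ (s - 1) := by
    have h1 : ((Real.pi ^ 2 / D : ℝ) : ℂ) = ((Real.pi ^ 2 : ℝ) : ℂ) * (((D : ℝ)⁻¹ : ℝ) : ℂ) := by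
      push_cast; ring
    rw [h1, Complex.mul_cpow_ofReal_nonneg (by positivity) (by positivity), sq, Complex.ofReal_mul,
      Complex.mul_cpow_ofReal_nonneg Real.pi_pos.le Real.pi_pos.le, ← Complex.cpow_add _ _ hπ]
    congr 1
    · congr 1; ring
    · rw [Complex.ofReal_inv, Complex.inv_cpow, ← Complex.cpow_neg]
      · congr 1
        ring
      · rw [Complex.arg_ofReal_of_nonneg hD0.le]; exact Real.pi_pos.ne
  -- rewrite all powers in terms of `π ^ (2 s - 1 / 2)` and `D ^ (2 s - 1 / 2)`
  have q1 : (Real.pi : ℂ) ^ (2 - 2 * s) * (Real.pi : ℂ) ^ (2 * s - 1 / 2) = Real.pi * (Real.pi : ℂ) ^ (1 / 2 : ℂ) := by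
    rw [← Complex.cpow_add _ _ hπ, show (2 - 2 * s + (2 * s - 1 / 2) : ℂ) = 1 + 1 / 2 by ring,
      Complex.cpow_add _ _ hπ, Complex.cpow_one]
  have q2 : (D : ℂ) ^ (-s - 1 / 2) * (D : ℂ) ^ (2 * s - 1 / 2) = (D : ℂ) ^ (s - 1) := by
    rw [← Complex.cpow_add _ _ hDc]; congr 1; ring
  rw [hΓ3, hsqrt, hpd]
  have e : (Real.pi : ℂ) * (Real.pi : ℂ) ^ (1 / 2 : ℂ) * (D : ℂ) ^ (-s - 1 / 2) *
      (Gamma (1 / 2 - s) * DirichletCharacter.LFunction (chiD D) (1 - 2 * s)) =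
      (Real.pi : ℂ) ^ (2 - 2 * s) * (D : ℂ) ^ (s - 1) * (Gamma s * DirichletCharacter.LFunction (chiD D) (2 * s)) := by
    rw [← q1, ← q2]
    linear_combination (Real.pi : ℂ) ^ (2 - 2 * s) * (D : ℂ) ^ (-s - 1 / 2) * hfe
  have h12' : 1 / 2 - s = -(2 * s - 1) / 2 := by ring
  rw [h12']
  generalize DirichletCharacter.LFunction (chiD D) (1 - 2 * s) = L1 at *
  generalize DirichletCharacter.LFunction (chiD D) (2 * s) = L2 at *
  generalize Gamma s = G at *
  rw [h12'] at e hΓ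
  generalize Gamma (-(2 * s - 1) / 2) = G1 at *
  generalize (Real.pi : ℂ) ^ (2 - 2 * s) = P1 at *
  generalize (Real.pi : ℂ) ^ (1 / 2 : ℂ) = P2 at *
  generalize (D : ℂ) ^ (-s - 1 / 2) = P3 at *
  generalize (D : ℂ) ^ (s - 1) = P4 at *
  generalize 2 * s - 1 = u at *
  field_simp
  linear_combination e

end FunctionalEquation

end HilbertGreen

/-! ### The Legendre function: bounds and an algebraic kernel -/

namespace HilbertGreen
section LegendreBound

open MeasureTheory Set

lemma legendreQ_sub_one (s : ℂ) (t : ℝ) :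
    legendreQ (s - 1) t =
      ∫ u in Ioi (0 : ℝ), ((t + √(t ^ 2 - 1) * Real.cosh u : ℝ) : ℂ) ^ (-s) := by
  unfold legendreQ
  congr 1 with u
  congr 1
  ring

lemma sqrt_sq_sub_one_pos {t : ℝ} (ht : 1 < t) : 0 < √(t ^ 2 - 1) :=
  Real.sqrt_pos.2 (by nlinarith)

lemma exp_half_le_cosh (u : ℝ) : Real.exp u / 2 ≤ Real.cosh u := by
  rw [Real.cosh_eq]; linarith [Real.exp_pos (-u)]

lemma legendre_base_pos {t : ℝ} (ht : 1 < t) (u : ℝ) : 0 < t + √(t ^ 2 - 1) * Real.cosh u := by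
  have := Real.sqrt_nonneg (t ^ 2 - 1)
  have := Real.cosh_pos u
  positivity

/-- From cosh u ≥ e^u/2 the base is at least (c/2)e^u. The constant c is kept free to give
dominating functions uniform in t. -/
lemma norm_legendre_integrand_le {s : ℂ} (hs : 0 < s.re) {c t : ℝ} (hc : 0 < c) (ht : 1 < t)
    (hct : c ≤ √(t ^ 2 - 1)) (u : ℝ) :
    ‖((t + √(t ^ 2 - 1) * Real.cosh u : ℝ) : ℂ) ^ (-s)‖
      ≤ (c / 2) ^ (-s.re) * Real.exp (-s.re * u) := by
  rw [Complex.norm_cpow_eq_rpow_re_of_pos (legendre_base_pos ht u), Complex.neg_re]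
  have h1 : c / 2 * Real.exp u ≤ t + √(t ^ 2 - 1) * Real.cosh u := by
    have h2 := exp_half_le_cosh u
    have h3 : c * (Real.exp u / 2) ≤ √(t ^ 2 - 1) * Real.cosh u :=
      mul_le_mul hct h2 (by positivity) (by positivity)
    linarith
  calc _ ≤ (c / 2 * Real.exp u) ^ (-s.re) :=
        Real.rpow_le_rpow_of_nonpos (by positivity) h1 (by linarith)
    _ = _ := by
        rw [Real.mul_rpow (by positivity) (by positivity), ← Real.exp_mul]
        ring_nf

lemma continuous_legendre_integrand (s : ℂ) {t : ℝ} (ht : 1 < t) :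
    Continuous fun u : ℝ => ((t + √(t ^ 2 - 1) * Real.cosh u : ℝ) : ℂ) ^ (-s) := by
  refine Continuous.cpow (by fun_prop) continuous_const fun u => ?_
  exact Complex.ofReal_mem_slitPlane.2 (legendre_base_pos ht u)

lemma integrableOn_legendre_bound {σ : ℝ} (hσ : 0 < σ) (c : ℝ) :
    IntegrableOn (fun u : ℝ => (c / 2) ^ (-σ) * Real.exp (-σ * u)) (Ioi 0) :=
  (integrableOn_exp_mul_Ioi (by linarith : -σ < 0) 0).const_mul _

lemma integrableOn_legendre_integrand {s : ℂ} (hs : 0 < s.re) {t : ℝ} (ht : 1 < t) :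
    IntegrableOn (fun u : ℝ => ((t + √(t ^ 2 - 1) * Real.cosh u : ℝ) : ℂ) ^ (-s)) (Ioi 0) :=
  (integrableOn_legendre_bound hs (√(t ^ 2 - 1))).mono'
    (continuous_legendre_integrand s ht).aestronglyMeasurable.restrict
    (ae_of_all _ fun u => norm_legendre_integrand_le hs (sqrt_sq_sub_one_pos ht) ht le_rfl u)

/-- Decay of the Legendre function: `‖Q_{s-1}(t)‖ ≤ 2^σ/σ (t² - 1)^(-σ/2)`. -/
lemma norm_legendreQ_le {s : ℂ} (hs : 0 < s.re) {c t : ℝ} (hc : 0 < c) (ht : 1 < t)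
    (hct : c ≤ √(t ^ 2 - 1)) :
    ‖legendreQ (s - 1) t‖ ≤ (c / 2) ^ (-s.re) / s.re := by
  rw [legendreQ_sub_one]
  refine (norm_integral_le_of_norm_le (integrableOn_legendre_bound hs c)
    (ae_of_all _ fun u => norm_legendre_integrand_le hs hc ht hct u)).trans_eq ?_
  rw [integral_const_mul, integral_exp_mul_Ioi (by linarith)]
  simp [div_eq_mul_inv]

lemma continuousAt_legendreQ {s : ℂ} (hs : 0 < s.re) {t : ℝ} (ht : 1 < t) :
    ContinuousAt (legendreQ (s - 1)) t := by
  have hfun : legendreQ (s - 1) = fun t : ℝ =>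
      ∫ u in Ioi (0 : ℝ), ((t + √(t ^ 2 - 1) * Real.cosh u : ℝ) : ℂ) ^ (-s) :=
    funext fun t => legendreQ_sub_one s t
  rw [hfun]
  have hc : 0 < √(t ^ 2 - 1) := sqrt_sq_sub_one_pos ht
  have hcont : Continuous fun t : ℝ => √(t ^ 2 - 1) := by fun_prop
  have hev : ∀ᶠ x : ℝ in 𝓝 t, 1 < x ∧ √(t ^ 2 - 1) / 2 ≤ √(x ^ 2 - 1) := by
    refine (eventually_gt_nhds ht).and ?_
    have := hcont.continuousAt.eventually (eventually_gt_nhds (half_lt_self hc))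
    exact this.mono fun x hx => hx.le
  refine continuousAt_of_dominated
    (bound := fun u => (√(t ^ 2 - 1) / 2 / 2) ^ (-s.re) * Real.exp (-s.re * u))
    (hev.mono fun x hx => (continuous_legendre_integrand s hx.1).aestronglyMeasurable.restrict)
    (hev.mono fun x hx => ae_of_all _ fun u =>
      norm_legendre_integrand_le hs (by positivity) hx.1 hx.2 u)
    (integrableOn_legendre_bound hs _) (ae_of_all _ fun u => ?_)
  refine ContinuousAt.cpow (by fun_prop) continuousAt_const ?_
  exact Complex.ofReal_mem_slitPlane.2 (legendre_base_pos ht u)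

lemma continuousOn_legendreQ {s : ℂ} (hs : 0 < s.re) : ContinuousOn (legendreQ (s - 1)) (Ioi 1) :=
  fun _ ht => (continuousAt_legendreQ hs ht).continuousWithinAt

lemma legendreQ_ofReal (σ : ℝ) {t : ℝ} (ht : 1 < t) :
    legendreQ ((σ : ℂ) - 1) t =
      ((∫ u in Ioi (0 : ℝ), (t + √(t ^ 2 - 1) * Real.cosh u) ^ (-σ) : ℝ) : ℂ) := by
  rw [legendreQ_sub_one, ← integral_complex_ofReal]
  congr 1 with u
  rw [Complex.ofReal_cpow (legendre_base_pos ht u).le]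
  push_cast
  rfl

/-- Positivity at real exponents: the exact formulas for integrals of Q then also compute integrals
of norms, and every integrability and summability claim rests on this. -/
lemma legendreQ_ofReal_eq_norm (σ : ℝ) {t : ℝ} (ht : 1 < t) :
    legendreQ ((σ : ℂ) - 1) t = (‖legendreQ ((σ : ℂ) - 1) t‖ : ℝ) := by
  rw [legendreQ_ofReal σ ht, Complex.norm_real, Real.norm_of_nonneg]
  exact integral_nonneg fun u => Real.rpow_nonneg (legendre_base_pos ht u).le _

lemma norm_legendreQ_le_norm_re (s : ℂ) {t : ℝ} (ht : 1 < t) :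
    ‖legendreQ (s - 1) t‖ ≤ ‖legendreQ ((s.re : ℂ) - 1) t‖ := by
  rw [legendreQ_ofReal _ ht, Complex.norm_real, Real.norm_of_nonneg
    (integral_nonneg fun u => Real.rpow_nonneg (legendre_base_pos ht u).le _), legendreQ_sub_one]
  refine (norm_integral_le_integral_norm _).trans_eq ?_
  congr 1 with u
  rw [Complex.norm_cpow_eq_rpow_re_of_pos (legendre_base_pos ht u), Complex.neg_re]

end LegendreBound

section LegendreKernel

open MeasureTheory Set

lemma image_legendre_base {t : ℝ} (ht : 1 < t) :
    (fun u : ℝ => t + √(t ^ 2 - 1) * Real.cosh u) '' Ioi 0 = Ioi (t + √(t ^ 2 - 1)) := by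
  have hc := sqrt_sq_sub_one_pos ht
  ext w
  constructor
  · rintro ⟨u, hu, rfl⟩
    have : 1 < Real.cosh u := Real.one_lt_cosh.2 (ne_of_gt hu)
    simp only [mem_Ioi]
    nlinarith
  · intro hw
    have h1 : 1 < (w - t) / √(t ^ 2 - 1) := by
      rw [lt_div_iff₀ hc]; simp only [mem_Ioi] at hw; linarith
    refine ⟨Real.arcosh ((w - t) / √(t ^ 2 - 1)), Real.arcosh_pos h1, ?_⟩
    simp only
    rw [Real.cosh_arcosh h1.le]
    field_simp
    ring

/-- The Legendre function as an integral over `w > 1`; the kernel vanishes where its radicand is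
negative. -/
lemma legendreQ_eq_integral_kernel (s : ℂ) {t : ℝ} (ht : 1 < t) :
    legendreQ (s - 1) t =
      ∫ w in Ioi (1 : ℝ), ((√(w ^ 2 - 2 * t * w + 1))⁻¹ : ℝ) * (w : ℂ) ^ (-s) := by
  have hc := sqrt_sq_sub_one_pos ht
  have hsq : √(t ^ 2 - 1) ^ 2 = t ^ 2 - 1 := Real.sq_sqrt (by nlinarith)
  have hsub : Ioi (t + √(t ^ 2 - 1)) ⊆ Ioi 1 := Ioi_subset_Ioi (by linarith)
  rw [setIntegral_eq_of_subset_of_forall_sdiff_eq_zero measurableSet_Ioi hsub,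
    ← image_legendre_base ht,
    integral_image_eq_integral_abs_deriv_smul (f' := fun u => √(t ^ 2 - 1) * Real.sinh u)
      measurableSet_Ioi, legendreQ_sub_one]
  · refine setIntegral_congr_fun measurableSet_Ioi fun u hu => ?_
    have hsinh : 0 < Real.sinh u := Real.sinh_pos_iff.2 hu
    -- Under w = t + √(t² − 1) cosh u the radicand is the square of dw/du, so the Jacobian cancels
    -- the kernel.
    have hrad : (t + √(t ^ 2 - 1) * Real.cosh u) ^ 2
        - 2 * t * (t + √(t ^ 2 - 1) * Real.cosh u) + 1 = (√(t ^ 2 - 1) * Real.sinh u) ^ 2 := by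
      linear_combination (1 : ℝ) * hsq + √(t ^ 2 - 1) ^ 2 * Real.cosh_sq u
    rw [hrad, Real.sqrt_sq (by positivity), abs_of_pos (by positivity), Complex.real_smul,
      ← mul_assoc, ← Complex.ofReal_mul, mul_inv_cancel₀ (by positivity)]
    simp
  · intro u _
    exact (((Real.hasDerivAt_cosh u).const_mul _).const_add t).hasDerivWithinAt
  · intro u hu v hv huv
    have : Real.cosh u = Real.cosh v := by
      simpa [hc.ne'] using huv
    exact Real.cosh_injOn (mem_Ici.2 (le_of_lt hu)) (mem_Ici.2 (le_of_lt hv)) this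
  -- The smaller root of the radicand is below 1, so between 1 and the larger root it is
  -- nonpositive. There `√` is 0 and its inverse is 0, which extends the kernel by zero.
  · intro w hw
    have h1 : 1 < w := hw.1
    have h2 : w ≤ t + √(t ^ 2 - 1) := not_lt.1 hw.2
    have h3 : t - √(t ^ 2 - 1) < 1 := by
      have : (t - 1) ^ 2 < √(t ^ 2 - 1) ^ 2 := by rw [hsq]; nlinarith
      have := lt_of_pow_lt_pow_left₀ 2 hc.le this
      linarith
    have : w ^ 2 - 2 * t * w + 1 ≤ 0 := by nlinarith
    rw [Real.sqrt_eq_zero_of_nonpos this]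
    simp

lemma sqrt_one_sub_sq_inv_support {x : ℝ} (hx : x ∉ Ioc (-1 : ℝ) 1) : (√(1 - x ^ 2))⁻¹ = 0 := by
  rw [Real.sqrt_eq_zero_of_nonpos, inv_zero]
  simp only [mem_Ioc, not_and_or, not_lt, not_le] at hx
  rcases hx with h | h <;> nlinarith

lemma integrable_sqrt_one_sub_sq_inv : Integrable fun x : ℝ => (√(1 - x ^ 2))⁻¹ := by
  have h := Polynomial.Chebyshev.intervalIntegrable_sqrt_one_sub_sq_inv
  rw [intervalIntegrable_iff_integrableOn_Ioc_of_le (by norm_num)] at h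
  simp_rw [Real.sqrt_inv] at h
  rw [← integrableOn_univ]
  exact h.of_forall_sdiff_eq_zero MeasurableSet.univ
    fun x hx => sqrt_one_sub_sq_inv_support hx.2

lemma integral_sqrt_one_sub_sq_inv : ∫ x : ℝ, (√(1 - x ^ 2))⁻¹ = Real.pi := by
  have h := Polynomial.Chebyshev.integral_eval_T_real_measureT_zero
  rw [Polynomial.Chebyshev.integral_measureT,
    intervalIntegral.integral_of_le (by norm_num)] at h
  rw [← h, ← setIntegral_univ, setIntegral_eq_of_subset_of_forall_sdiff_eq_zero
    MeasurableSet.univ (subset_univ (Ioc (-1 : ℝ) 1))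
    fun x hx => sqrt_one_sub_sq_inv_support hx.2]
  simp [Real.sqrt_inv]

lemma sqrt_sub_mul_sq_inv_eq {α β : ℝ} (hα : 0 < α) (hβ : 0 < β) (x : ℝ) :
    (√(α - β * x ^ 2))⁻¹ = (√α)⁻¹ * (√(1 - (√(β / α) * x) ^ 2))⁻¹ := by
  rw [← mul_inv, ← Real.sqrt_mul hα.le, mul_pow, Real.sq_sqrt (by positivity)]
  congr 2
  field_simp

lemma integrable_sqrt_sub_mul_sq_inv (α : ℝ) {β : ℝ} (hβ : 0 < β) :
    Integrable fun x : ℝ => (√(α - β * x ^ 2))⁻¹ := by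
  rcases le_or_gt α 0 with hα | hα
  · refine (integrable_zero ℝ ℝ volume).congr (ae_of_all _ fun x => ?_)
    simp only
    rw [Real.sqrt_eq_zero_of_nonpos (by nlinarith [sq_nonneg x]), inv_zero, Pi.zero_apply]
  · simp_rw [sqrt_sub_mul_sq_inv_eq hα hβ]
    exact (integrable_sqrt_one_sub_sq_inv.comp_mul_left' (by positivity)).const_mul _

lemma integral_sqrt_sub_mul_sq_inv (α : ℝ) {β : ℝ} (hβ : 0 < β) :
    ∫ x : ℝ, (√(α - β * x ^ 2))⁻¹ = if 0 < α then Real.pi / √β else 0 := by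
  split_ifs with hα
  · simp_rw [sqrt_sub_mul_sq_inv_eq hα hβ]
    rw [integral_const_mul, Measure.integral_comp_mul_left (fun y : ℝ => (√(1 - y ^ 2))⁻¹),
      integral_sqrt_one_sub_sq_inv, abs_of_pos (by positivity), smul_eq_mul,
      Real.sqrt_div hβ.le]
    have := Real.sqrt_pos.2 hα
    field_simp
  · rw [← integral_zero ℝ ℝ]
    congr 1 with x
    rw [Real.sqrt_eq_zero_of_nonpos (by nlinarith [sq_nonneg x]), inv_zero]

end LegendreKernel
end HilbertGreen

/-! ### Integrals along horizontal lines -/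

namespace HilbertGreen
section Horocycle

open MeasureTheory Set

/-- The integrand of the double integral for the mean of the Legendre function along a
horocycle. -/
def horoKernel (s : ℂ) (v y : ℝ) (x w : ℝ) : ℂ :=
  ((√((w - y / v) * (w - v / y) - w / (y * v) * x ^ 2))⁻¹ : ℝ) * (w : ℂ) ^ (-s)

lemma one_lt_horoArg {v y : ℝ} (hv : 0 < v) (hy : 0 < y) (hne : v ≠ y) (x : ℝ) :
    1 < 1 + (x ^ 2 + (y - v) ^ 2) / (2 * y * v) := by
  have : 0 < (y - v) ^ 2 := by
    have : y - v ≠ 0 := sub_ne_zero.2 hne.symm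
    positivity
  have : 0 < (x ^ 2 + (y - v) ^ 2) / (2 * y * v) := by positivity
  linarith

/-- The radicand becomes (w − y/v)(w − v/y) − w x²/(yv), quadratic in x, so after exchanging
integrals the x-integral is an arcsine integral. -/
lemma legendreQ_horoArg (s : ℂ) {v y : ℝ} (hv : 0 < v) (hy : 0 < y) (hne : v ≠ y) (x : ℝ) :
    legendreQ (s - 1) (1 + (x ^ 2 + (y - v) ^ 2) / (2 * y * v)) =
      ∫ w in Ioi (1 : ℝ), horoKernel s v y x w := by
  rw [legendreQ_eq_integral_kernel s (one_lt_horoArg hv hy hne x)]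
  have hrad : ∀ w : ℝ, w ^ 2 - 2 * (1 + (x ^ 2 + (y - v) ^ 2) / (2 * y * v)) * w + 1 =
      (w - y / v) * (w - v / y) - w / (y * v) * x ^ 2 := fun w => by
    field_simp
    ring
  simp_rw [hrad]
  rfl

lemma measurable_horoKernel (s : ℂ) (v y : ℝ) :
    Measurable (Function.uncurry (horoKernel s v y)) := by
  unfold horoKernel Function.uncurry
  refine Measurable.mul ?_ ?_
  · exact Complex.measurable_ofReal.comp (Measurable.inv (Real.continuous_sqrt.measurable.comp
      (by fun_prop)))
  · exact (Complex.measurable_ofReal.comp measurable_snd).pow_const _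

lemma horo_pos_iff {v y w : ℝ} (hv : 0 < v) (hvy : v < y) (hw : 1 < w) :
    0 < (w - y / v) * (w - v / y) ↔ y / v < w := by
  have : v / y < 1 := (div_lt_one (hv.trans hvy)).2 hvy
  have h : 0 < w - v / y := by linarith
  rw [mul_pos_iff_of_pos_right h, sub_pos]

lemma integrable_horoKernel_left (s : ℂ) {v y w : ℝ} (hv : 0 < v) (hvy : v < y) (hw : 1 < w) :
    Integrable fun x => horoKernel s v y x w := by
  have hy := hv.trans hvy
  exact (integrable_sqrt_sub_mul_sq_inv _ (by positivity)).ofReal.mul_const _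

lemma integral_horoKernel_left (s : ℂ) {v y w : ℝ} (hv : 0 < v) (hvy : v < y) (hw : 1 < w) :
    ∫ x, horoKernel s v y x w =
      (Ioi (y / v)).indicator
        (fun w : ℝ => ((Real.pi * √(y * v) : ℝ) : ℂ) * (w : ℂ) ^ (-s - 1 / 2)) w := by
  have hy := hv.trans hvy
  unfold horoKernel
  rw [integral_mul_const, integral_complex_ofReal,
    integral_sqrt_sub_mul_sq_inv _ (by positivity)]
  simp only [horo_pos_iff hv hvy hw, indicator, mem_Ioi]
  split_ifs with h
  · have hw0 : (w : ℂ) ≠ 0 := by exact_mod_cast (by linarith : w ≠ 0)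
    rw [sub_eq_add_neg (-s), Complex.cpow_add _ _ hw0, Real.sqrt_div (by linarith),
      Complex.cpow_neg _ (1 / 2), show (w : ℂ) ^ (1 / 2 : ℂ) = ((√w : ℝ) : ℂ) by
        rw [Real.sqrt_eq_rpow, Complex.ofReal_cpow (by linarith)]; norm_num]
    have h1 : (0 : ℝ) < √w := Real.sqrt_pos.2 (by linarith)
    have h1' : ((√w : ℝ) : ℂ) ≠ 0 := by exact_mod_cast h1.ne'
    push_cast
    field_simp
  · simp

lemma norm_horoKernel (s : ℂ) (v y x : ℝ) {w : ℝ} (hw : 0 < w) :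
    ‖horoKernel s v y x w‖ = (√((w - y / v) * (w - v / y) - w / (y * v) * x ^ 2))⁻¹
      * w ^ (-s.re) := by
  unfold horoKernel
  rw [norm_mul, Complex.norm_real, Real.norm_of_nonneg (by positivity),
    Complex.norm_cpow_eq_rpow_re_of_pos hw, Complex.neg_re]

/-- Tonelli: the norm of the kernel has the same form with Re s in place of s, and its x-integral is
a multiple of w^(-Re s − 1/2) on w > y/v, integrable exactly for Re s > 1/2. -/
lemma integrable_horoKernel {s : ℂ} (hs : 1 / 2 < s.re) {v y : ℝ} (hv : 0 < v) (hvy : v < y) :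
    Integrable (Function.uncurry (horoKernel s v y))
      (volume.prod (volume.restrict (Ioi (1 : ℝ)))) := by
  have hy := hv.trans hvy
  rw [integrable_prod_iff' (measurable_horoKernel s v y).aestronglyMeasurable]
  constructor
  · filter_upwards [ae_restrict_mem measurableSet_Ioi] with w hw
    exact integrable_horoKernel_left s hv hvy hw
  · have hint : IntegrableOn
        (fun w => (Ioi (y / v)).indicator
          (fun w : ℝ => (Real.pi * √(y * v)) * w ^ (-s.re - 1 / 2)) w) (Ioi 1) := by
      refine Integrable.integrableOn ?_
      rw [integrable_indicator_iff measurableSet_Ioi]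
      exact (integrableOn_Ioi_rpow_of_lt (by linarith) (by positivity)).const_mul _
    refine hint.congr_fun (fun w hw => ?_) measurableSet_Ioi
    have hw' : (0 : ℝ) < w := lt_trans one_pos hw
    simp only [Function.uncurry_apply_pair, norm_horoKernel s v y _ hw']
    rw [integral_mul_const, integral_sqrt_sub_mul_sq_inv _ (by positivity)]
    simp only [horo_pos_iff hv hvy hw, indicator, mem_Ioi]
    split_ifs with h
    · rw [sub_eq_add_neg (-s.re), Real.rpow_add hw', Real.rpow_neg hw'.le (1 / 2),
        ← Real.sqrt_eq_rpow, Real.sqrt_div hw'.le]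
      have h1 : (0 : ℝ) < √w := Real.sqrt_pos.2 (by linarith)
      field_simp
    · simp

lemma integrable_legendreQ_horo_of_lt {s : ℂ} (hs : 1 / 2 < s.re) {v y : ℝ} (hv : 0 < v)
    (hvy : v < y) :
    Integrable fun x : ℝ => legendreQ (s - 1) (1 + (x ^ 2 + (y - v) ^ 2) / (2 * y * v)) := by
  simp_rw [legendreQ_horoArg s hv (hv.trans hvy) hvy.ne]
  exact (integrable_horoKernel hs hv hvy).integral_prod_left

/-- Integrating x first leaves π√(yv) times the integral of w^(-s − 1/2) from y/v to infinity,
because the kernel is supported on w > y/v when v < y. -/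
lemma integral_legendreQ_horo_of_lt {s : ℂ} (hs : 1 / 2 < s.re) {v y : ℝ} (hv : 0 < v)
    (hvy : v < y) :
    ∫ x : ℝ, legendreQ (s - 1) (1 + (x ^ 2 + (y - v) ^ 2) / (2 * y * v)) =
      2 * Real.pi / (2 * s - 1) * (v : ℂ) ^ s * (y : ℂ) ^ (1 - s) := by
  have hy := hv.trans hvy
  simp_rw [legendreQ_horoArg s hv hy hvy.ne]
  rw [integral_integral_swap (integrable_horoKernel hs hv hvy),
    setIntegral_congr_fun measurableSet_Ioi
      fun w hw => integral_horoKernel_left s hv hvy hw,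
    setIntegral_indicator measurableSet_Ioi,
    inter_eq_right.2 (Ioi_subset_Ioi ((one_le_div hv).2 hvy.le)), integral_const_mul,
    integral_Ioi_cpow_of_lt (by simp; linarith) (by positivity)]
  have hs1 : 2 * s - 1 ≠ 0 := by
    intro h
    have := congrArg Complex.re h
    simp at this
    linarith
  have hv0 : (v : ℂ) ≠ 0 := by exact_mod_cast hv.ne'
  have hy0 : (y : ℂ) ≠ 0 := by exact_mod_cast hy.ne'
  have e1 : -s - 1 / 2 + 1 = 1 / 2 - s := by ring
  have e2 : (1 / 2 - s : ℂ) ≠ 0 := by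
    intro h
    apply hs1
    linear_combination (-2) * h
  have hsq : ((√(y * v) : ℝ) : ℂ) = (y : ℂ) ^ (1 / 2 : ℂ) * (v : ℂ) ^ (1 / 2 : ℂ) := by
    rw [Real.sqrt_eq_rpow, Complex.ofReal_cpow (by positivity)]
    push_cast
    rw [Complex.mul_cpow_ofReal_nonneg hy.le hv.le]
  have hdiv : ((y / v : ℝ) : ℂ) ^ (1 / 2 - s) = (y : ℂ) ^ (1 / 2 - s) * (v : ℂ) ^ (s - 1 / 2) := by
    rw [div_eq_mul_inv, Complex.ofReal_mul,
      Complex.mul_cpow_ofReal_nonneg hy.le (by positivity), Complex.ofReal_inv,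
      Complex.inv_cpow _ _ (by rw [Complex.arg_ofReal_of_nonneg hv.le]; exact Real.pi_pos.ne),
      ← Complex.cpow_neg, neg_sub]
  have hy1 : (y : ℂ) ^ (1 - s) = (y : ℂ) ^ (1 / 2 : ℂ) * (y : ℂ) ^ (1 / 2 - s) := by
    rw [← Complex.cpow_add _ _ hy0]; ring_nf
  have hv1 : (v : ℂ) ^ s = (v : ℂ) ^ (1 / 2 : ℂ) * (v : ℂ) ^ (s - 1 / 2) := by
    rw [← Complex.cpow_add _ _ hv0]; ring_nf
  rw [e1, hdiv, hy1, hv1]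
  push_cast
  rw [hsq, show 2 * s - 1 = -(2 * (1 / 2 - s)) by ring]
  field_simp

lemma horoArg_comm (v y x : ℝ) :
    1 + (x ^ 2 + (y - v) ^ 2) / (2 * y * v) = 1 + (x ^ 2 + (v - y) ^ 2) / (2 * v * y) := by
  rw [show (2 * y * v) = 2 * v * y by ring, show (y - v) ^ 2 = (v - y) ^ 2 by ring]

end Horocycle

section PowerIntegral

open MeasureTheory Set

lemma integrable_sq_add_sq_cpow {s : ℂ} (hs : 1 / 2 < s.re) {y : ℝ} (hy : 0 < y) :
    Integrable fun x : ℝ => ((x ^ 2 + y ^ 2 : ℝ) : ℂ) ^ (-s) := by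
  have hc : Continuous fun x : ℝ => ((x ^ 2 + y ^ 2 : ℝ) : ℂ) ^ (-s) :=
    Continuous.cpow (by fun_prop) continuous_const
      fun x => Complex.ofReal_mem_slitPlane.2 (by positivity)
  have h1 := integrable_rpow_neg_one_add_norm_sq (E := ℝ) (μ := volume) (r := 2 * s.re)
    (by simp; linarith)
  have h2 := (h1.comp_mul_left' (inv_ne_zero hy.ne')).const_mul (y ^ (-2 * s.re))
  refine h2.mono' hc.aestronglyMeasurable (ae_of_all _ fun x => ?_)
  rw [Complex.norm_cpow_eq_rpow_re_of_pos (by positivity), Complex.neg_re, neg_mul,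
    show -(2 * s.re) / 2 = -s.re by ring, show -(2 * s.re) = 2 * (-s.re) by ring,
    Real.rpow_mul hy.le, Real.rpow_two, ← Real.mul_rpow (by positivity) (by positivity)]
  apply le_of_eq
  congr 1
  rw [norm_mul, mul_pow, Real.norm_eq_abs, Real.norm_eq_abs, sq_abs, sq_abs]
  field_simp
  ring

/-- The integrand of `∫∫ t^(s-1) e^(-(x² + y²) t) dt dx`. -/
def gammaKernel (s : ℂ) (y x t : ℝ) : ℂ :=
  (Real.exp (-t * x ^ 2) : ℝ) * ((t : ℂ) ^ (s - 1) * Complex.exp (-((y ^ 2 : ℝ) : ℂ) * t))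

lemma integral_gammaKernel_right {s : ℂ} (hs : 0 < s.re) {y : ℝ} (hy : 0 < y) (x : ℝ) :
    ∫ t in Ioi (0 : ℝ), gammaKernel s y x t =
      Complex.Gamma s * ((x ^ 2 + y ^ 2 : ℝ) : ℂ) ^ (-s) := by
  have hp : 0 < x ^ 2 + y ^ 2 := by positivity
  have h := Complex.integral_cpow_mul_exp_neg_mul_Ioi (a := s) (r := x ^ 2 + y ^ 2) hs hp
  rw [one_div, Complex.inv_cpow _ _ (by
    rw [Complex.arg_ofReal_of_nonneg hp.le]; exact Real.pi_pos.ne), ← Complex.cpow_neg] at h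
  rw [mul_comm, ← h]
  congr 1 with t
  unfold gammaKernel
  rw [mul_left_comm, Complex.ofReal_exp, ← Complex.exp_add]
  congr 2
  push_cast
  ring

lemma integral_gammaKernel_left (s : ℂ) (y : ℝ) {t : ℝ} (ht : 0 < t) :
    ∫ x : ℝ, gammaKernel s y x t =
      (√Real.pi : ℝ) * ((t : ℂ) ^ (s - 1 / 2 - 1) * Complex.exp (-((y ^ 2 : ℝ) : ℂ) * t)) := by
  unfold gammaKernel
  have ht0 : (t : ℂ) ≠ 0 := by exact_mod_cast ht.ne'
  rw [integral_mul_const, integral_complex_ofReal, integral_gaussian, Real.sqrt_div Real.pi_pos.le,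
    show s - 1 = (s - 1 / 2 - 1) + 1 / 2 by ring, Complex.cpow_add _ _ ht0,
    show (t : ℂ) ^ (1 / 2 : ℂ) = ((√t : ℝ) : ℂ) by
        rw [Real.sqrt_eq_rpow, Complex.ofReal_cpow ht.le]; norm_num]
  have h1' : ((√t : ℝ) : ℂ) ≠ 0 := by exact_mod_cast (Real.sqrt_pos.2 ht).ne'
  push_cast
  field_simp

lemma norm_gammaKernel (s : ℂ) (y x : ℝ) {t : ℝ} (ht : 0 < t) :
    ‖gammaKernel s y x t‖ =
      Real.exp (-t * x ^ 2) * (t ^ (s.re - 1) * Real.exp (-(y ^ 2) * t)) := by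
  unfold gammaKernel
  rw [norm_mul, norm_mul, Complex.norm_real, Real.norm_of_nonneg (Real.exp_pos _).le,
    Complex.norm_cpow_eq_rpow_re_of_pos ht, Complex.norm_exp]
  congr 3
  rw [← Complex.ofReal_neg, ← Complex.ofReal_mul, Complex.ofReal_re]

lemma integrable_gammaKernel {s : ℂ} (hs : 1 / 2 < s.re) {y : ℝ} (hy : 0 < y) :
    Integrable (Function.uncurry (gammaKernel s y))
      (volume.prod (volume.restrict (Ioi (0 : ℝ)))) := by
  have hm : Measurable (Function.uncurry (gammaKernel s y)) := by
    unfold gammaKernel Function.uncurry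
    refine Measurable.mul (by fun_prop) (Measurable.mul ?_ (by fun_prop))
    exact (Complex.measurable_ofReal.comp measurable_snd).pow_const _
  rw [integrable_prod_iff' hm.aestronglyMeasurable]
  constructor
  · filter_upwards [ae_restrict_mem measurableSet_Ioi] with t ht
    exact (Integrable.ofReal (𝕜 := ℂ) (integrable_exp_neg_mul_sq (mem_Ioi.1 ht))).mul_const
      ((t : ℂ) ^ (s - 1) * Complex.exp (-((y ^ 2 : ℝ) : ℂ) * t))
  · have hint : IntegrableOn (fun t : ℝ => √Real.pi *
        (t ^ (s.re - 1 / 2 - 1) * Real.exp (-(y ^ 2) * t ^ (1 : ℝ)))) (Ioi 0) :=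
      (integrableOn_rpow_mul_exp_neg_mul_rpow (by linarith) one_pos (by positivity)).const_mul _
    refine hint.congr_fun (fun t ht => ?_) measurableSet_Ioi
    have ht' : (0 : ℝ) < t := ht
    simp only [Function.uncurry_apply_pair, norm_gammaKernel s y _ ht']
    rw [integral_mul_const, integral_gaussian, Real.sqrt_div Real.pi_pos.le,
      show s.re - 1 = (s.re - 1 / 2 - 1) + 1 / 2 by ring, Real.rpow_add ht',
      ← Real.sqrt_eq_rpow, Real.rpow_one]
    have := Real.sqrt_pos.2 ht'
    field_simp

/-- Writing the power as a Gamma integral and exchanging, the x-integral is Gaussian and lowers the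
exponent by 1/2. -/
lemma integral_sq_add_sq_cpow {s : ℂ} (hs : 1 / 2 < s.re) {y : ℝ} (hy : 0 < y) :
    ∫ x : ℝ, ((x ^ 2 + y ^ 2 : ℝ) : ℂ) ^ (-s) =
      (y : ℂ) ^ (1 - 2 * s) * ((√Real.pi : ℝ) * Complex.Gamma (s - 1 / 2) / Complex.Gamma s) := by
  have hG : Complex.Gamma s ≠ 0 := Complex.Gamma_ne_zero_of_re_pos (by linarith)
  have hy0 : (y : ℂ) ≠ 0 := by exact_mod_cast hy.ne'
  have h := integral_integral_swap (integrable_gammaKernel hs hy)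
  simp_rw [integral_gammaKernel_right (by linarith : 0 < s.re) hy] at h
  rw [integral_const_mul, setIntegral_congr_fun measurableSet_Ioi
    fun t ht => integral_gammaKernel_left s y ht, integral_const_mul] at h
  have h2 := Complex.integral_cpow_mul_exp_neg_mul_Ioi (a := s - 1 / 2)
    (r := y ^ 2) (by simp; linarith) (by positivity)
  simp_rw [neg_mul] at h
  rw [h2, one_div, Complex.inv_cpow _ _ (by
    rw [Complex.arg_ofReal_of_nonneg (by positivity)]; exact Real.pi_pos.ne),
    ← Complex.cpow_neg] at h
  have h3 : ((y ^ 2 : ℝ) : ℂ) ^ (-(s - 1 / 2)) = (y : ℂ) ^ (1 - 2 * s) := by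
    rw [pow_two, Complex.ofReal_mul, Complex.mul_cpow_ofReal_nonneg hy.le hy.le,
      ← Complex.cpow_add _ _ hy0]
    ring_nf
  rw [h3] at h
  rw [eq_div_of_mul_eq hG ((mul_comm _ _).trans h)]
  ring

end PowerIntegral
end HilbertGreen

/-! ### The integral over the plane of a summand with a ≠ 0 -/

namespace HilbertGreen
section PlaneIntegral

open MeasureTheory Set

/-- The summand of the Green function for `a ≠ 0`, translated so that `λ = 0`. -/
def planeTerm (s : ℂ) (a A y₁ y₂ : ℝ) (x : ℝ × ℝ) : ℂ :=
  legendreQ (s - 1) (1 + ‖(a : ℂ) * ((x.1 : ℂ) + y₁ * Complex.I) * ((x.2 : ℂ) + y₂ * Complex.I)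
    + ((A / a : ℝ) : ℂ)‖ ^ 2 / (2 * y₁ * y₂ * A))

/-- The height of the horocycle through which `planeTerm` passes for fixed `x₂`. -/
def planeHeight (a A y₂ x₂ : ℝ) : ℝ := A * y₂ / (a ^ 2 * (x₂ ^ 2 + y₂ ^ 2))

variable {a A y₁ y₂ : ℝ}

lemma planeHeight_pos (ha : a ≠ 0) (hA : 0 < A) (hy₂ : 0 < y₂) (x₂ : ℝ) :
    0 < planeHeight a A y₂ x₂ := by
  unfold planeHeight; positivity

/-- The role of y₁y₂ > m/D: since a² ≥ 1, the singularity in z₁ lies below the line of integration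
for every x₂, and one case of the horocycle integral serves for all a. -/
lemma planeHeight_lt (ha : 1 ≤ a ^ 2) (hy₁ : 0 < y₁) (hy₂ : 0 < y₂) (hA : A < y₁ * y₂) (x₂ : ℝ) :
    planeHeight a A y₂ x₂ < y₁ := by
  unfold planeHeight
  rw [div_lt_iff₀ (by positivity)]
  have h1 : y₁ * (x₂ ^ 2 + y₂ ^ 2) ≤ y₁ * (a ^ 2 * (x₂ ^ 2 + y₂ ^ 2)) := by
    apply mul_le_mul_of_nonneg_left _ hy₁.le
    exact le_mul_of_one_le_left (by positivity) ha
  nlinarith [mul_nonneg hy₁.le (sq_nonneg x₂)]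

/-- For fixed z₂ one has |az₁z₂ + A/a| = |az₂| · |z₁ + A/(a²z₂)|, and −A/(a²z₂) is a point of the
upper half plane of height `planeHeight`. The argument of Q is the cosine hyperbolic of its distance
from z₁. -/
lemma planeTerm_eq_horo (s : ℂ) (ha : a ≠ 0) (hA : 0 < A) (hy₁ : 0 < y₁) (hy₂ : 0 < y₂)
    (x₁ x₂ : ℝ) :
    planeTerm s a A y₁ y₂ (x₁, x₂) =
      legendreQ (s - 1) (1 + ((x₁ + A * x₂ / (a ^ 2 * (x₂ ^ 2 + y₂ ^ 2))) ^ 2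
        + (y₁ - planeHeight a A y₂ x₂) ^ 2) / (2 * y₁ * planeHeight a A y₂ x₂)) := by
  unfold planeTerm planeHeight
  have hn : ‖(a : ℂ) * ((x₁ : ℂ) + y₁ * Complex.I) * ((x₂ : ℂ) + y₂ * Complex.I)
      + ((A / a : ℝ) : ℂ)‖ ^ 2 = (a * (x₁ * x₂ - y₁ * y₂) + A / a) ^ 2
        + (a * (x₁ * y₂ + y₁ * x₂)) ^ 2 := by
    rw [Complex.sq_norm, Complex.normSq_apply]
    simp
    ring
  have hr : x₂ ^ 2 + y₂ ^ 2 ≠ 0 := by positivity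
  simp only [hn]
  congr 2
  field_simp
  ring

lemma integrable_planeTerm_left {s : ℂ} (hs : 1 / 2 < s.re) (ha : 1 ≤ a ^ 2) (hA : 0 < A)
    (hy₁ : 0 < y₁) (hy₂ : 0 < y₂) (hAy : A < y₁ * y₂) (x₂ : ℝ) :
    Integrable fun x₁ => planeTerm s a A y₁ y₂ (x₁, x₂) := by
  have ha0 : a ≠ 0 := by rintro rfl; norm_num at ha
  simp_rw [planeTerm_eq_horo s ha0 hA hy₁ hy₂]
  exact (integrable_legendreQ_horo_of_lt hs (planeHeight_pos ha0 hA hy₂ x₂)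
    (planeHeight_lt ha hy₁ hy₂ hAy x₂)).comp_add_right _

lemma integral_planeTerm_left {s : ℂ} (hs : 1 / 2 < s.re) (ha : 1 ≤ a ^ 2) (hA : 0 < A)
    (hy₁ : 0 < y₁) (hy₂ : 0 < y₂) (hAy : A < y₁ * y₂) (x₂ : ℝ) :
    ∫ x₁, planeTerm s a A y₁ y₂ (x₁, x₂) =
      2 * Real.pi / (2 * s - 1) * ((A * y₂ / a ^ 2 : ℝ) : ℂ) ^ s * (y₁ : ℂ) ^ (1 - s)
        * ((x₂ ^ 2 + y₂ ^ 2 : ℝ) : ℂ) ^ (-s) := by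
  have ha0 : a ≠ 0 := by rintro rfl; norm_num at ha
  simp_rw [planeTerm_eq_horo s ha0 hA hy₁ hy₂]
  rw [integral_add_right_eq_self (fun x : ℝ => legendreQ (s - 1) (1 + (x ^ 2
        + (y₁ - planeHeight a A y₂ x₂) ^ 2) / (2 * y₁ * planeHeight a A y₂ x₂))),
    integral_legendreQ_horo_of_lt hs (planeHeight_pos ha0 hA hy₂ x₂)
    (planeHeight_lt ha hy₁ hy₂ hAy x₂)]
  have hr : 0 < x₂ ^ 2 + y₂ ^ 2 := by positivity
  have : ((planeHeight a A y₂ x₂ : ℝ) : ℂ) ^ s =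
      ((A * y₂ / a ^ 2 : ℝ) : ℂ) ^ s * ((x₂ ^ 2 + y₂ ^ 2 : ℝ) : ℂ) ^ (-s) := by
    rw [Complex.cpow_neg, ← Complex.inv_cpow _ _ (by
      rw [Complex.arg_ofReal_of_nonneg hr.le]; exact Real.pi_pos.ne), ← Complex.ofReal_inv,
      ← Complex.mul_cpow_ofReal_nonneg (by positivity) (by positivity), ← Complex.ofReal_mul]
    congr 2
    unfold planeHeight
    field_simp
  rw [this]
  ring

/-- A zero of the divisor equation would have z₁ = −A/(a²z₂), whose height is at most A/(a²y₂) < y₁.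
-/
lemma planeArg_gt_one (ha : 1 ≤ a ^ 2) (hA : 0 < A)
    (hy₁ : 0 < y₁) (hy₂ : 0 < y₂) (hAy : A < y₁ * y₂) (x : ℝ × ℝ) :
    1 < 1 + ‖(a : ℂ) * ((x.1 : ℂ) + y₁ * Complex.I) * ((x.2 : ℂ) + y₂ * Complex.I)
    + ((A / a : ℝ) : ℂ)‖ ^ 2 / (2 * y₁ * y₂ * A) := by
  have ha0 : a ≠ 0 := by rintro rfl; norm_num at ha
  rw [lt_add_iff_pos_right]
  refine div_pos (pow_pos (norm_pos_iff.2 fun h => ?_) 2) (by positivity)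
  have hre := congrArg Complex.re h
  have him := congrArg Complex.im h
  simp at hre him
  have e1 : x.1 * y₂ = -(y₁ * x.2) := by
    have : a * (x.1 * y₂ + y₁ * x.2) = 0 := by linear_combination him
    linarith [(mul_eq_zero.1 this).resolve_left ha0]
  have e2 : a ^ 2 * (x.1 * x.2 - y₁ * y₂) + A = 0 := by
    field_simp at hre
    linear_combination hre
  have e3 : x.1 * x.2 ≤ 0 := by
    have : y₂ * (x.1 * x.2) = -(y₁ * x.2 ^ 2) := by linear_combination x.2 * e1
    by_contra hcon
    nlinarith [mul_nonneg hy₁.le (sq_nonneg x.2)]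
  nlinarith

lemma continuous_planeTerm {s : ℂ} (hs : 0 < s.re) (ha : 1 ≤ a ^ 2) (hA : 0 < A)
    (hy₁ : 0 < y₁) (hy₂ : 0 < y₂) (hAy : A < y₁ * y₂) :
    Continuous (planeTerm s a A y₁ y₂) := by
  unfold planeTerm
  exact (continuousOn_legendreQ hs).comp_continuous (by fun_prop)
    fun x => planeArg_gt_one ha hA hy₁ hy₂ hAy x

/-- Tonelli at a real exponent: the term is its own norm, so the inner integrals of norms are
already known and form an integrable power of x₂² + y₂². -/
lemma integrable_planeTerm_ofReal {σ : ℝ} (hs : 1 / 2 < σ) (ha : 1 ≤ a ^ 2) (hA : 0 < A)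
    (hy₁ : 0 < y₁) (hy₂ : 0 < y₂) (hAy : A < y₁ * y₂) :
    Integrable (planeTerm (σ : ℂ) a A y₁ y₂) := by
  rw [Measure.volume_eq_prod, integrable_prod_iff' (continuous_planeTerm
    (by rw [Complex.ofReal_re]; linarith) ha hA hy₁ hy₂ hAy).aestronglyMeasurable]
  have hs' : 1 / 2 < (σ : ℂ).re := hs
  refine ⟨ae_of_all _ fun x₂ => integrable_planeTerm_left hs' ha hA hy₁ hy₂ hAy x₂, ?_⟩
  have h : (fun x₂ => ∫ x₁, ‖planeTerm (σ : ℂ) a A y₁ y₂ (x₁, x₂)‖) = fun x₂ =>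
      ‖2 * Real.pi / (2 * (σ : ℂ) - 1) * ((A * y₂ / a ^ 2 : ℝ) : ℂ) ^ (σ : ℂ)
        * (y₁ : ℂ) ^ (1 - (σ : ℂ)) * ((x₂ ^ 2 + y₂ ^ 2 : ℝ) : ℂ) ^ (-(σ : ℂ))‖ := by
    funext x₂
    rw [← integral_planeTerm_left hs' ha hA hy₁ hy₂ hAy x₂]
    have : ∀ x₁, planeTerm (σ : ℂ) a A y₁ y₂ (x₁, x₂) =
        (‖planeTerm (σ : ℂ) a A y₁ y₂ (x₁, x₂)‖ : ℝ) := fun x₁ =>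
      legendreQ_ofReal_eq_norm σ (planeArg_gt_one ha hA hy₁ hy₂ hAy (x₁, x₂))
    conv_rhs => rw [integral_congr_ae (ae_of_all _ this), integral_complex_ofReal]
    rw [Complex.norm_real, Real.norm_of_nonneg (integral_nonneg fun x => norm_nonneg _)]
  rw [h]
  exact ((integrable_sq_add_sq_cpow hs' hy₂).const_mul _).norm

lemma integrable_planeTerm {s : ℂ} (hs : 1 / 2 < s.re) (ha : 1 ≤ a ^ 2) (hA : 0 < A)
    (hy₁ : 0 < y₁) (hy₂ : 0 < y₂) (hAy : A < y₁ * y₂) :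
    Integrable (planeTerm s a A y₁ y₂) :=
  (integrable_planeTerm_ofReal hs ha hA hy₁ hy₂ hAy).mono
    (continuous_planeTerm (by linarith) ha hA hy₁ hy₂ hAy).aestronglyMeasurable
    (ae_of_all _ fun x => norm_legendreQ_le_norm_re s (planeArg_gt_one ha hA hy₁ hy₂ hAy x))

lemma integral_planeTerm {s : ℂ} (hs : 1 / 2 < s.re) (ha : 1 ≤ a ^ 2) (hA : 0 < A)
    (hy₁ : 0 < y₁) (hy₂ : 0 < y₂) (hAy : A < y₁ * y₂) :
    ∫ x, planeTerm s a A y₁ y₂ x =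
      2 * Real.pi / (2 * s - 1) * (A : ℂ) ^ s * (((y₁ * y₂ : ℝ)) : ℂ) ^ (1 - s)
        * ((|a| : ℝ) : ℂ) ^ (-2 * s)
        * ((√Real.pi : ℝ) * Complex.Gamma (s - 1 / 2) / Complex.Gamma s) := by
  have ha0 : a ≠ 0 := by rintro rfl; norm_num at ha
  rw [Measure.volume_eq_prod, integral_prod_symm _ (integrable_planeTerm hs ha hA hy₁ hy₂ hAy)]
  simp_rw [integral_planeTerm_left hs ha hA hy₁ hy₂ hAy]
  rw [integral_const_mul, integral_sq_add_sq_cpow hs hy₂]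
  have hy0 : (y₂ : ℂ) ≠ 0 := by exact_mod_cast hy₂.ne'
  have ha1 : ((|a| : ℝ) : ℂ) ≠ 0 := by exact_mod_cast (abs_pos.2 ha0).ne'
  have h1 : ((A * y₂ / a ^ 2 : ℝ) : ℂ) ^ s =
      (A : ℂ) ^ s * (y₂ : ℂ) ^ s * ((|a| : ℝ) : ℂ) ^ (-2 * s) := by
    have hsp : A * y₂ / a ^ 2 = A * y₂ * (|a|⁻¹ * |a|⁻¹) := by
      rw [← mul_inv, ← pow_two, sq_abs, div_eq_mul_inv]
    rw [hsp, Complex.ofReal_mul, Complex.mul_cpow_ofReal_nonneg (by positivity) (by positivity),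
      Complex.ofReal_mul, Complex.mul_cpow_ofReal_nonneg hA.le hy₂.le,
      Complex.ofReal_mul, Complex.mul_cpow_ofReal_nonneg (by positivity) (by positivity),
      Complex.ofReal_inv, Complex.inv_cpow _ _ (by
      rw [Complex.arg_ofReal_of_nonneg (abs_nonneg a)]; exact Real.pi_pos.ne), ← Complex.cpow_neg,
      ← Complex.cpow_add _ _ ha1]
    ring_nf
  have h2 : (((y₁ * y₂ : ℝ)) : ℂ) ^ (1 - s) =
      (y₁ : ℂ) ^ (1 - s) * ((y₂ : ℂ) ^ s * (y₂ : ℂ) ^ (1 - 2 * s)) := by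
    rw [Complex.ofReal_mul, Complex.mul_cpow_ofReal_nonneg hy₁.le hy₂.le,
      ← Complex.cpow_add _ _ hy0]
    ring_nf
  rw [h1, h2]
  ring

end PlaneIntegral
end HilbertGreen

/-! ### Integral coordinates on the inverse different -/

namespace HilbertGreen
section Coordinates

/-- The two real embeddings `(w₀, w₁)`, `(v₀, v₁)` of a `ℤ`-basis of the ring of integers of a real
quadratic field of discriminant `D`, with the coefficients of its norm form. -/
structure LatticeData (D : ℕ) where
  w₀ : ℝ
  w₁ : ℝ
  v₀ : ℝ
  v₁ : ℝ
  N₀ : ℤ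
  N₁ : ℤ
  B : ℤ
  norm_zero : w₀ * v₀ = N₀
  norm_one : w₁ * v₁ = N₁
  mixed : w₀ * v₁ + w₁ * v₀ = B
  disc : (w₀ * v₁ - w₁ * v₀) ^ 2 = D
  unit : ∃ x y : ℤ, binForm N₁ (-B) N₀ x y = 1

namespace LatticeData

variable {D : ℕ} (L : LatticeData D)

/-- The covolume (up to sign) of the lattice. -/
def δ : ℝ := L.w₀ * L.v₁ - L.w₁ * L.v₀

/-- The first conjugate of the element of the dual lattice with coordinates `n`. -/
def lam (n : ℤ × ℤ) : ℝ := (n.1 * L.v₁ - n.2 * L.v₀) / L.δ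

/-- The second conjugate of the element of the dual lattice with coordinates `n`. -/
def lam' (n : ℤ × ℤ) : ℝ := (n.2 * L.w₀ - n.1 * L.w₁) / L.δ

/-- The quadratic form `-D N(λ)` on the dual lattice. -/
def q (n : ℤ × ℤ) : ℤ := binForm L.N₁ (-L.B) L.N₀ n.1 n.2

/-- The first coordinate of the translation vector. -/
def tr₁ (t : ℝ × ℝ) : ℝ := t.1 * L.w₀ + t.2 * L.w₁

/-- The second coordinate of the translation vector. -/
def tr₂ (t : ℝ × ℝ) : ℝ := t.1 * L.v₀ + t.2 * L.v₁

lemma disc_int : (D : ℤ) = L.B ^ 2 - 4 * L.N₀ * L.N₁ := by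
  have h := L.disc
  have : (D : ℝ) = (L.B : ℝ) ^ 2 - 4 * L.N₀ * L.N₁ := by
    rw [← h, ← L.norm_zero, ← L.norm_one, ← L.mixed]; ring
  exact_mod_cast this

lemma delta_sq : L.δ ^ 2 = D := L.disc

lemma delta_ne_zero [Fact D.Prime] : L.δ ≠ 0 := by
  intro h
  have := L.delta_sq
  rw [h] at this
  have h2 : (D : ℝ) ≠ 0 := by exact_mod_cast (Fact.out : D.Prime).ne_zero
  apply h2
  rw [← this]; norm_num

lemma abs_delta : |L.δ| = √D := by rw [← L.delta_sq, Real.sqrt_sq_eq_abs]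

lemma mod_four (L : LatticeData D) [Fact D.Prime] : D % 4 = 1 := by
  have hp := (Fact.out : D.Prime)
  have h := L.disc_int
  have h4 : ¬ 4 ∣ D := by
    intro h4
    have h2 : 2 ∣ D := dvd_trans (by norm_num) h4
    rw [Nat.prime_dvd_prime_iff_eq Nat.prime_two hp] at h2
    subst h2
    norm_num at h4
  have h5 : (D : ℤ) % 4 = (L.B ^ 2) % 4 := by
    rw [h, mul_assoc]
    omega
  rcases Int.even_or_odd' L.B with ⟨k, hk | hk⟩
  · rw [hk, show (2 * k) ^ 2 = 4 * k ^ 2 by ring] at h5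
    omega
  · rw [hk, show (2 * k + 1) ^ 2 = 4 * (k ^ 2 + k) + 1 by ring] at h5
    omega

lemma lam_mul_lam' [Fact D.Prime] (n : ℤ × ℤ) : L.lam n * L.lam' n = -(L.q n : ℝ) / D := by
  have h := L.delta_ne_zero
  unfold lam lam' q binForm
  rw [← L.delta_sq]
  push_cast
  rw [← L.norm_zero, ← L.norm_one, ← L.mixed]
  field_simp
  ring

/-- Duality: the coordinates of λ are the traces of λω₀ and λω₁, so real translation coordinates
pair with them as integers times reals. -/
lemma lam_tr [Fact D.Prime] (n : ℤ × ℤ) (t : ℝ × ℝ) :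
    L.lam n * L.tr₁ t + L.lam' n * L.tr₂ t = n.1 * t.1 + n.2 * t.2 := by
  have h := L.delta_ne_zero
  unfold lam lam' tr₁ tr₂
  field_simp
  unfold δ
  ring

lemma q_eq_iff [Fact D.Prime] (n : ℤ × ℤ) (a b : ℤ) (m : ℕ) :
    (a : ℝ) * b - L.lam n * L.lam' n = (m : ℝ) / D ↔ D * a * b + L.q n = m := by
  have hD : (D : ℝ) ≠ 0 := by exact_mod_cast (Fact.out : D.Prime).ne_zero
  rw [lam_mul_lam', ← @Int.cast_inj ℝ]
  push_cast
  constructor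
  · intro h
    field_simp at h
    linear_combination h
  · intro h
    field_simp
    linear_combination h

end LatticeData

end Coordinates

section FieldCoordinates

variable {K : Type*} [Field K] [NumberField K]

lemma mem_inverseDifferent_iff (l : K) :
    l ∈ inverseDifferent K ↔ ∀ a : 𝓞 K, ∃ k : ℤ, Algebra.trace ℚ K (l * a) = k := by
  have h : inverseDifferent K = FractionalIdeal.dual ℤ ℚ (1 : FractionalIdeal (𝓞 K)⁰ K) := by
    unfold inverseDifferent
    rw [coeIdeal_differentIdeal ℤ ℚ K (𝓞 K), inv_inv]
  rw [h, FractionalIdeal.mem_dual (one_ne_zero : (1 : FractionalIdeal (𝓞 K)⁰ K) ≠ 0)]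
  constructor
  · intro H a
    obtain ⟨k, hk⟩ := H (a : K) ((FractionalIdeal.mem_one_iff _).2 ⟨a, rfl⟩)
    exact ⟨k, by simpa [Algebra.traceForm_apply] using hk.symm⟩
  · intro H a ha
    obtain ⟨a, rfl⟩ := (FractionalIdeal.mem_one_iff _).1 ha
    obtain ⟨k, hk⟩ := H a
    exact ⟨k, by simpa [Algebra.traceForm_apply] using hk.symm⟩

/-- A real embedding, as a complex embedding over `ℚ`. -/
def complexEmbedding (ι : K →+* ℝ) : K →ₐ[ℚ] ℂ := (Complex.ofRealHom.comp ι).toRatAlgHom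

variable {ι ι' : K →+* ℝ}

lemma univ_embeddings (hK : Module.finrank ℚ K = 2) (hι : ι ≠ ι') [DecidableEq (K →ₐ[ℚ] ℂ)] :
    (Finset.univ : Finset (K →ₐ[ℚ] ℂ)) = {complexEmbedding ι, complexEmbedding ι'} := by
  symm
  apply Finset.eq_univ_of_card
  rw [AlgHom.card, hK, Finset.card_pair]
  intro h
  apply hι
  ext x
  have := DFunLike.congr_fun h x
  simpa [complexEmbedding] using this

lemma trace_eq_add (hK : Module.finrank ℚ K = 2) (hι : ι ≠ ι') (x : K) :
    ((Algebra.trace ℚ K x : ℚ) : ℝ) = ι x + ι' x := by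
  classical
  have h := trace_eq_sum_embeddings (K := ℚ) ℂ (x := x)
  have hne : complexEmbedding ι ≠ complexEmbedding ι' := by
    intro h
    apply hι
    ext x
    have := DFunLike.congr_fun h x
    simpa [complexEmbedding] using this
  rw [univ_embeddings hK hι, Finset.sum_pair hne] at h
  have : ((Algebra.trace ℚ K x : ℚ) : ℂ) = ((ι x + ι' x : ℝ) : ℂ) := by
    simpa [complexEmbedding] using h
  exact_mod_cast this

lemma norm_eq_mul (hK : Module.finrank ℚ K = 2) (hι : ι ≠ ι') (x : K) :
    ((Algebra.norm ℚ x : ℚ) : ℝ) = ι x * ι' x := by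
  classical
  have h := Algebra.norm_eq_prod_embeddings ℚ ℂ x
  have hne : complexEmbedding ι ≠ complexEmbedding ι' := by
    intro h
    apply hι
    ext x
    have := DFunLike.congr_fun h x
    simpa [complexEmbedding] using this
  rw [univ_embeddings hK hι, Finset.prod_pair hne] at h
  have : ((Algebra.norm ℚ x : ℚ) : ℂ) = ((ι x * ι' x : ℝ) : ℂ) := by
    simpa [complexEmbedding] using h
  exact_mod_cast this

lemma norm_int_eq_mul (hK : Module.finrank ℚ K = 2) (hι : ι ≠ ι') (x : 𝓞 K) :
    ((Algebra.norm ℤ x : ℤ) : ℝ) = ι x * ι' x := by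
  rw [← norm_eq_mul hK hι, ← Algebra.coe_norm_int]
  push_cast
  rfl

lemma trace_int_eq_add (hK : Module.finrank ℚ K = 2) (hι : ι ≠ ι') (x : 𝓞 K) :
    ((Algebra.trace ℤ (𝓞 K) x : ℤ) : ℝ) = ι x + ι' x := by
  rw [← trace_eq_add hK hι, ← Algebra.coe_trace_int]
  push_cast
  rfl

/-- The coordinates of the ring of integers of a real quadratic field. -/
def fieldLattice (hK : Module.finrank ℚ K = 2) {D : ℕ} (hD : NumberField.discr K = (D : ℤ))
    (hι : ι ≠ ι') (b : Module.Basis (Fin 2) ℤ (𝓞 K)) : LatticeData D where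
  w₀ := ι (b 0 : K)
  w₁ := ι (b 1 : K)
  v₀ := ι' (b 0 : K)
  v₁ := ι' (b 1 : K)
  N₀ := Algebra.norm ℤ (b 0)
  N₁ := Algebra.norm ℤ (b 1)
  B := Algebra.norm ℤ (b 0 + b 1) - Algebra.norm ℤ (b 0) - Algebra.norm ℤ (b 1)
  norm_zero := (norm_int_eq_mul hK hι _).symm
  norm_one := (norm_int_eq_mul hK hι _).symm
  mixed := by
    push_cast
    rw [norm_int_eq_mul hK hι, norm_int_eq_mul hK hι, norm_int_eq_mul hK hι]
    push_cast
    simp only [map_add]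
    ring
  disc := by
    have h := NumberField.discr_eq_discr K b
    rw [hD, Algebra.discr_def, Matrix.det_fin_two] at h
    have h2 := congrArg (Int.cast : ℤ → ℝ) h
    simp only [Algebra.traceMatrix_apply, Algebra.traceForm_apply] at h2
    push_cast at h2
    simp only [trace_int_eq_add hK hι, map_mul] at h2
    rw [← h2]
    ring
  -- The coordinates of 1 ∈ 𝓞 K. With coefficients N₁, −B, N₀, the value at (−y, x) is the norm of
  -- xω₀ + yω₁.
  unit := by
    have h1 : (1 : 𝓞 K) = b.repr 1 0 • b 0 + b.repr 1 1 • b 1 := by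
      conv_lhs => rw [← b.sum_repr 1, Fin.sum_univ_two]
    refine ⟨-b.repr 1 1, b.repr 1 0, ?_⟩
    have h2 : ((Algebra.norm ℤ (1 : 𝓞 K) : ℤ) : ℝ) = 1 := by simp
    rw [h1, norm_int_eq_mul hK hι] at h2
    have : ((binForm (Algebra.norm ℤ (b 1))
      (-(Algebra.norm ℤ (b 0 + b 1) - Algebra.norm ℤ (b 0) - Algebra.norm ℤ (b 1)))
      (Algebra.norm ℤ (b 0)) (-b.repr 1 1) (b.repr 1 0) : ℤ) : ℝ) = 1 := by
      rw [← h2]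
      unfold binForm
      push_cast
      rw [norm_int_eq_mul hK hι, norm_int_eq_mul hK hι, norm_int_eq_mul hK hι]
      simp only [map_add, zsmul_eq_mul, map_mul, map_intCast]
      ring
    exact_mod_cast this

section

variable (hK : Module.finrank ℚ K = 2) {D : ℕ} (hD : NumberField.discr K = (D : ℤ))
    (hι : ι ≠ ι') (b : Module.Basis (Fin 2) ℤ (𝓞 K))

lemma exists_coords (l : K) (hl : l ∈ inverseDifferent K) [Fact D.Prime] :
    ∃ n : ℤ × ℤ, ι l = (fieldLattice hK hD hι b).lam n ∧ ι' l = (fieldLattice hK hD hι b).lam' n := by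
  rw [mem_inverseDifferent_iff] at hl
  obtain ⟨n₀, h₀⟩ := hl (b 0)
  obtain ⟨n₁, h₁⟩ := hl (b 1)
  have e₀ := trace_eq_add hK hι (l * (b 0 : K))
  have e₁ := trace_eq_add hK hι (l * (b 1 : K))
  rw [h₀] at e₀
  rw [h₁] at e₁
  simp only [Rat.cast_intCast, map_mul] at e₀ e₁
  have hδ := (fieldLattice hK hD hι b).delta_ne_zero
  refine ⟨(n₀, n₁), ?_, ?_⟩
  · rw [LatticeData.lam, eq_div_iff hδ, e₀, e₁]
    simp only [LatticeData.δ, fieldLattice]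
    ring
  · rw [LatticeData.lam', eq_div_iff hδ, e₀, e₁]
    simp only [LatticeData.δ, fieldLattice]
    ring

lemma exists_of_coords (n : ℤ × ℤ) [Fact D.Prime] :
    ∃ l : K, l ∈ inverseDifferent K ∧
      ι l = (fieldLattice hK hD hι b).lam n ∧ ι' l = (fieldLattice hK hD hι b).lam' n := by
  set L := fieldLattice hK hD hι b with hL
  have hδ := L.delta_ne_zero
  have hδ2 := L.delta_sq
  set T₀₀ : ℤ := Algebra.trace ℤ (𝓞 K) (b 0 * b 0)
  set T₀₁ : ℤ := Algebra.trace ℤ (𝓞 K) (b 0 * b 1)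
  set T₁₁ : ℤ := Algebra.trace ℤ (𝓞 K) (b 1 * b 1)
  have h₀₀ : (T₀₀ : ℝ) = L.w₀ * L.w₀ + L.v₀ * L.v₀ := by
    rw [trace_int_eq_add hK hι]; simp [hL, fieldLattice]
  have h₀₁ : (T₀₁ : ℝ) = L.w₀ * L.w₁ + L.v₀ * L.v₁ := by
    rw [trace_int_eq_add hK hι]; simp [hL, fieldLattice]
  have h₁₁ : (T₁₁ : ℝ) = L.w₁ * L.w₁ + L.v₁ * L.v₁ := by
    rw [trace_int_eq_add hK hι]; simp [hL, fieldLattice]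
  -- The inverse of the trace matrix, of determinant D, applied to n; this element has trace n₁
  -- against ω₀ and n₂ against ω₁.
  let l : K := ((T₁₁ * n.1 - T₀₁ * n.2 : ℤ) * (b 0 : K) + (T₀₀ * n.2 - T₀₁ * n.1 : ℤ) * (b 1 : K)) / D
  have hl1 : ι l = L.lam n := by
    simp only [l, map_div₀, map_add, map_mul, map_intCast, map_natCast]
    push_cast
    rw [h₀₀, h₀₁, h₁₁, ← hδ2, LatticeData.lam, show ι (b 0 : K) = L.w₀ from rfl,
      show ι (b 1 : K) = L.w₁ from rfl]
    field_simp
    unfold LatticeData.δ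
    ring
  have hl2 : ι' l = L.lam' n := by
    simp only [l, map_div₀, map_add, map_mul, map_intCast, map_natCast]
    push_cast
    rw [h₀₀, h₀₁, h₁₁, ← hδ2, LatticeData.lam', show ι' (b 0 : K) = L.v₀ from rfl,
      show ι' (b 1 : K) = L.v₁ from rfl]
    field_simp
    unfold LatticeData.δ
    ring
  refine ⟨l, ?_, hl1, hl2⟩
  rw [mem_inverseDifferent_iff]
  intro a
  refine ⟨n.1 * b.repr a 0 + n.2 * b.repr a 1, ?_⟩
  have h := trace_eq_add hK hι (l * a)
  have ha : a = b.repr a 0 • b 0 + b.repr a 1 • b 1 := by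
    conv_lhs => rw [← b.sum_repr a, Fin.sum_univ_two]
  have h2 := L.lam_tr n (b.repr a 0, b.repr a 1)
  have hgoal : ((Algebra.trace ℚ K (l * a) : ℚ) : ℝ) =
      ((n.1 * b.repr a 0 + n.2 * b.repr a 1 : ℤ) : ℝ) := by
    rw [h]
    push_cast
    rw [← h2, map_mul, map_mul, hl1, hl2]
    conv_lhs => rw [ha]
    simp only [LatticeData.tr₁, LatticeData.tr₂, hL, fieldLattice]
    simp only [map_add, zsmul_eq_mul, map_mul, map_intCast]
  exact_mod_cast hgoal

/-- The inverse different in coordinates. -/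
def dualEquiv [Fact D.Prime] : ℤ × ℤ ≃ {l : K // l ∈ inverseDifferent K} :=
  Equiv.ofBijective (fun n => ⟨(exists_of_coords hK hD hι b n).choose,
    (exists_of_coords hK hD hι b n).choose_spec.1⟩) <| by
    have hs := fun n => (exists_of_coords hK hD hι b n).choose_spec.2
    constructor
    · intro n n' h
      have h0 : (exists_of_coords hK hD hι b n).choose =
        (exists_of_coords hK hD hι b n').choose := congrArg Subtype.val h
      have h1 := (hs n).1.symm.trans ((congrArg ι h0).trans (hs n').1)
      have h2 := (hs n).2.symm.trans ((congrArg ι' h0).trans (hs n').2)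
      have e := fun t => (LatticeData.lam_tr _ n t).symm.trans
        (((by rw [h1, h2]) : _ = _).trans (LatticeData.lam_tr _ n' t))
      have e1 := e (1, 0)
      have e2 := e (0, 1)
      simp at e1 e2
      exact Prod.ext e1 e2
    · rintro ⟨l, hl⟩
      obtain ⟨n, h1, _⟩ := exists_coords hK hD hι b l hl
      refine ⟨n, Subtype.ext (ι.injective ?_)⟩
      rw [h1]
      exact (hs n).1

lemma dualEquiv_embed [Fact D.Prime] (n : ℤ × ℤ) :
    ι (dualEquiv hK hD hι b n : K) = (fieldLattice hK hD hι b).lam n :=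
  (exists_of_coords hK hD hι b n).choose_spec.2.1

lemma dualEquiv_embed' [Fact D.Prime] (n : ℤ × ℤ) :
    ι' (dualEquiv hK hD hι b n : K) = (fieldLattice hK hD hι b).lam' n :=
  (exists_of_coords hK hD hι b n).choose_spec.2.2

end

end FieldCoordinates
end HilbertGreen

/-! ### Sums over a lattice modulo a sublattice -/

namespace HilbertGreen
section LatticeClasses

variable {M : Type*} [AddCommGroup M]

/-- The number of classes modulo the range of `φ` whose elements satisfy `V`. -/
def classCount (φ : M →ₗ[ℤ] M) (V : M → Prop) : ℕ :=
  Nat.card {c : M ⧸ LinearMap.range φ // V (Quotient.out c)}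

lemma invariant_of_mk_eq {φ : M →ₗ[ℤ] M} {V : M → Prop} (hV : ∀ n k, V (n + φ k) ↔ V n)
    {n n' : M} (h : Submodule.Quotient.mk (p := LinearMap.range φ) n = Submodule.Quotient.mk n') :
    V n ↔ V n' := by
  rw [Submodule.Quotient.eq] at h
  obtain ⟨k, hk⟩ := h
  rw [← hV n' k, hk, add_sub_cancel]

lemma mk_out {φ : M →ₗ[ℤ] M} (c : M ⧸ LinearMap.range φ) :
    Submodule.Quotient.mk (Quotient.out c) = c := Quotient.out_eq c

lemma mk_map (φ : M →ₗ[ℤ] M) (k : M) :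
    Submodule.Quotient.mk (p := LinearMap.range φ) (φ k) = 0 :=
  (Submodule.Quotient.mk_eq_zero _).2 ⟨k, rfl⟩

/-- Elements of `M` as pairs of a class modulo the range of `φ` and an element of `M`. -/
def classEquiv (φ : M →ₗ[ℤ] M) (hφ : Function.Injective φ) :
    (M ⧸ LinearMap.range φ) × M ≃ M :=
  Equiv.ofBijective (fun p => Quotient.out p.1 + φ p.2) <| by
    constructor
    · rintro ⟨c, k⟩ ⟨c', k'⟩ h
      have hc : c = c' := by
        have := congrArg (Submodule.Quotient.mk (p := LinearMap.range φ)) h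
        simp only [Submodule.Quotient.mk_add, mk_out] at this
        rwa [mk_map, mk_map, add_zero, add_zero] at this
      subst hc
      simp only [add_right_inj] at h
      rw [hφ h]
    · intro n
      have h := mk_out (φ := φ) (Submodule.Quotient.mk n)
      rw [eq_comm, Submodule.Quotient.eq] at h
      obtain ⟨k, hk⟩ := h
      exact ⟨(Submodule.Quotient.mk n, k), by simp only [hk]; abel⟩

lemma hasSum_prod_of_finite {α β : Type*} [Fintype α] {F : α × β → ℂ} {g : α → ℂ}
    (h : ∀ a, HasSum (fun b => F (a, b)) (g a)) : HasSum F (∑ a, g a) := by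
  classical
  have h1 : ∀ a, HasSum (fun p : α × β => if p.1 = a then F p else 0) (g a) := fun a => by
    have hinj : Function.Injective (fun b : β => (a, b)) := fun b b' h => (Prod.ext_iff.1 h).2
    rw [← hinj.hasSum_iff]
    · simpa [Function.comp_def] using h a
    · rintro ⟨a', b'⟩ hp
      rw [if_neg]
      rintro rfl
      exact hp ⟨b', rfl⟩
  have h2 := hasSum_sum (s := Finset.univ) fun a _ => h1 a
  convert h2 using 2 with p
  simp

/-- The lattice is a disjoint union of finitely many cosets of the image of φ; each coset satisfying
V contributes the same J, and the others contribute nothing. -/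
lemma hasSum_of_classes {φ : M →ₗ[ℤ] M} (hφ : Function.Injective φ)
    [Finite (M ⧸ LinearMap.range φ)] {V : M → Prop} (hV : ∀ n k, V (n + φ k) ↔ V n)
    {f : M → ℂ} {J : ℂ} (h : ∀ n, V n → HasSum (fun k => f (n + φ k)) J) :
    HasSum (fun n : {n // V n} => f n) (classCount φ V * J) := by
  classical
  have := Fintype.ofFinite (M ⧸ LinearMap.range φ)
  have h0 : HasSum ({n | V n}.indicator f) (classCount φ V * J) := by
    rw [← (classEquiv φ hφ).hasSum_iff]
    have h1 := hasSum_prod_of_finite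
      (F := ({n | V n}.indicator f) ∘ classEquiv φ hφ)
      (g := fun c => if V (Quotient.out c) then J else 0) (fun c => ?_)
    · convert h1
      rw [← Finset.sum_filter, Finset.sum_const, nsmul_eq_mul, classCount, Nat.card_eq_fintype_card,
        Fintype.card_subtype]
    · have he : ∀ k, classEquiv φ hφ (c, k) = Quotient.out c + φ k := fun k => rfl
      simp only [Function.comp, he, Set.indicator, Set.mem_ofPred_eq, hV]
      split_ifs with hc
      · exact h _ hc
      · exact hasSum_zero
  exact (hasSum_subtype_iff_indicator (f := f) (s := {n | V n})).2 h0

/-- The reduction `(ℤ/c)² → ℤ²/φ(ℤ²)`, for `c ℤ² ⊆ φ(ℤ²)`. -/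
def reductionHom (φ : (ℤ × ℤ) →ₗ[ℤ] (ℤ × ℤ)) (c : ℕ) (hc : ∀ n, (c : ℤ) • n ∈ LinearMap.range φ) :
    ZMod c × ZMod c →+ (ℤ × ℤ) ⧸ LinearMap.range φ :=
  AddMonoidHom.coprod
    (ZMod.lift c ⟨((LinearMap.range φ).mkQ.toAddMonoidHom).comp (AddMonoidHom.inl ℤ ℤ), by
      simpa using hc (1, 0)⟩)
    (ZMod.lift c ⟨((LinearMap.range φ).mkQ.toAddMonoidHom).comp (AddMonoidHom.inr ℤ ℤ), by
      simpa using hc (0, 1)⟩)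

lemma reductionHom_intCast {φ : (ℤ × ℤ) →ₗ[ℤ] (ℤ × ℤ)} {c : ℕ}
    (hc : ∀ n, (c : ℤ) • n ∈ LinearMap.range φ) (n : ℤ × ℤ) :
    reductionHom φ c hc (n.1, n.2) = Submodule.Quotient.mk n := by
  unfold reductionHom
  rw [AddMonoidHom.coprod_apply, ZMod.lift_coe, ZMod.lift_coe]
  simp [← Submodule.Quotient.mk_add]

/-- The reduction of (ℤ/c)² onto ℤ²/φ(ℤ²) is a surjective homomorphism, so its fibres have equal
size and invariant conditions can be counted on either side. -/
lemma card_mul_card_quotient {φ : (ℤ × ℤ) →ₗ[ℤ] (ℤ × ℤ)} {c : ℕ} [NeZero c]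
    (hc : ∀ n, (c : ℤ) • n ∈ LinearMap.range φ) [Finite ((ℤ × ℤ) ⧸ LinearMap.range φ)]
    {P : ZMod c × ZMod c → Prop} (hV : ∀ n k : ℤ × ℤ,
      P (((n + φ k).1 : ℤ), ((n + φ k).2 : ℤ)) ↔ P ((n.1 : ℤ), (n.2 : ℤ))) :
    Nat.card {v // P v} * Nat.card ((ℤ × ℤ) ⧸ LinearMap.range φ) =
      c ^ 2 * classCount φ (fun n : ℤ × ℤ => P ((n.1 : ℤ), (n.2 : ℤ))) := by
  classical
  have := Fintype.ofFinite ((ℤ × ℤ) ⧸ LinearMap.range φ)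
  set Φ := reductionHom φ c hc with hΦ
  have hcast : ∀ v : ZMod c × ZMod c, ∃ n : ℤ × ℤ, v = ((n.1 : ZMod c), (n.2 : ZMod c)) := fun v => by
    obtain ⟨x, hx⟩ := ZMod.intCast_surjective v.1
    obtain ⟨y, hy⟩ := ZMod.intCast_surjective v.2
    exact ⟨(x, y), Prod.ext hx.symm hy.symm⟩
  have hsurj : Function.Surjective Φ := fun x => by
    obtain ⟨n, rfl⟩ := Submodule.Quotient.mk_surjective _ x
    exact ⟨(n.1, n.2), reductionHom_intCast hc n⟩
  have hPiff : ∀ v, P v ↔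
      P (((Quotient.out (Φ v)).1 : ℤ), ((Quotient.out (Φ v)).2 : ℤ)) := fun v => by
    obtain ⟨n, rfl⟩ := hcast v
    refine invariant_of_mk_eq (V := fun n : ℤ × ℤ => P ((n.1 : ℤ), (n.2 : ℤ))) hV ?_
    rw [mk_out, hΦ, reductionHom_intCast hc n]
  set F := (Finset.univ.filter fun v => Φ v = 0).card with hF
  have hfib : ∀ x, (Finset.univ.filter fun v => Φ v = x).card = F := fun x =>
    AddMonoidHom.card_fiber_eq_of_mem_range Φ (hsurj x) (hsurj 0)
  have h1 : c ^ 2 = Nat.card ((ℤ × ℤ) ⧸ LinearMap.range φ) * F := by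
    have h := Finset.card_eq_sum_card_fiberwise (f := Φ) (s := Finset.univ) (t := Finset.univ)
      (fun _ _ => Finset.mem_coe.2 (Finset.mem_univ _))
    simp only [hfib, Finset.sum_const, smul_eq_mul, Finset.card_univ, Fintype.card_prod,
      ZMod.card] at h
    rw [pow_two, h, Nat.card_eq_fintype_card]
  have h2 : Nat.card {v // P v} = classCount φ (fun n : ℤ × ℤ => P ((n.1 : ℤ), (n.2 : ℤ))) * F := by
    rw [Nat.card_eq_fintype_card, Fintype.card_subtype,
      Finset.card_eq_sum_card_fiberwise (f := Φ) (t := Finset.univ.filter fun x :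
        (ℤ × ℤ) ⧸ LinearMap.range φ => P (((Quotient.out x).1 : ℤ), ((Quotient.out x).2 : ℤ)))]
    · rw [Finset.sum_congr rfl fun x hx => ?_, Finset.sum_const, smul_eq_mul, classCount,
        Nat.card_eq_fintype_card, Fintype.card_subtype]
      rw [← hfib x, Finset.filter_filter]
      congr 1
      ext v
      simp only [Finset.mem_filter, Finset.mem_univ, true_and, and_iff_right_iff_imp] at hx ⊢
      intro hv
      rw [hPiff, hv]
      exact hx
    · intro v hv
      simpa [← hPiff] using hv
  rw [h1, h2]
  ring

lemma card_quotient_range [Module.Free ℤ M] [Module.Finite ℤ M] {φ : M →ₗ[ℤ] M}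
    (hφ : Function.Injective φ) : Nat.card (M ⧸ LinearMap.range φ) = (LinearMap.det φ).natAbs := by
  rw [← Submodule.natAbs_det_equiv (LinearMap.range φ) (LinearEquiv.ofInjective φ hφ)]
  congr 2

end LatticeClasses

namespace LatticeData

variable {D : ℕ} (L : LatticeData D)

/-- The coordinates of `a κ'`, where `κ = k₀ ω₀ + k₁ ω₁`. -/
def shift (a : ℤ) : (ℤ × ℤ) →ₗ[ℤ] (ℤ × ℤ) :=
  Matrix.toLin (Module.Basis.finTwoProd ℤ) (Module.Basis.finTwoProd ℤ)
    !![a * (2 * L.N₀), a * L.B; a * L.B, a * (2 * L.N₁)]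

lemma shift_apply (a : ℤ) (k : ℤ × ℤ) :
    L.shift a k = (a * (2 * L.N₀) * k.1 + a * L.B * k.2, a * L.B * k.1 + a * (2 * L.N₁) * k.2) :=
  Matrix.toLin_finTwoProd_apply _ _ _ _ _

lemma det_shift (a : ℤ) : LinearMap.det (L.shift a) = -(a ^ 2 * D) := by
  rw [shift, LinearMap.det_toLin, Matrix.det_fin_two_of, L.disc_int]
  ring

lemma shift_injective [Fact D.Prime] {a : ℤ} (ha : a ≠ 0) : Function.Injective (L.shift a) := by
  have hD : (D : ℤ) ≠ 0 := by exact_mod_cast (Fact.out : D.Prime).ne_zero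
  rw [← LinearMap.ker_eq_bot]
  refine LinearMap.ker_eq_bot'.2 fun k hk => ?_
  rw [shift_apply, Prod.mk_eq_zero] at hk
  have e1 : a * D * k.1 = 0 := by
    rw [L.disc_int]; linear_combination L.B * hk.2 - 2 * L.N₁ * hk.1
  have e2 : a * D * k.2 = 0 := by
    rw [L.disc_int]; linear_combination L.B * hk.1 - 2 * L.N₀ * hk.2
  exact Prod.ext ((mul_eq_zero.1 e1).resolve_left (mul_ne_zero ha hD))
    ((mul_eq_zero.1 e2).resolve_left (mul_ne_zero ha hD))

lemma smul_mem_range_shift (a : ℤ) (n : ℤ × ℤ) :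
    (a * D) • n ∈ LinearMap.range (L.shift a) := by
  refine ⟨(L.B * n.2 - 2 * L.N₁ * n.1, L.B * n.1 - 2 * L.N₀ * n.2), ?_⟩
  rw [shift_apply, L.disc_int]
  ext <;> simp <;> ring

/-- N(λ + aκ') = N(λ) + a Tr(λκ) + a²N(κ) with integral trace and norm, and q = −D·N. -/
lemma q_add_shift (a : ℤ) (n k : ℤ × ℤ) :
    ∃ j : ℤ, L.q (n + L.shift a k) = L.q n + a * D * j := by
  refine ⟨n.1 * -k.1 + -n.2 * k.2 - a * (L.N₀ * k.1 ^ 2 + L.B * k.1 * k.2 + L.N₁ * k.2 ^ 2), ?_⟩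
  rw [shift_apply, L.disc_int]
  simp only [q, binForm, Prod.fst_add, Prod.snd_add]
  ring

end LatticeData
end HilbertGreen

/-! ### Counting classes and unfolding over the plane -/

namespace HilbertGreen
namespace LatticeData

variable {D : ℕ} (L : LatticeData D)

lemma shift_invariant (m : ℕ) (a : ℤ) (n k : ℤ × ℤ) :
    (a * D ∣ L.q (n + L.shift a k) - m) ↔ (a * D ∣ L.q n - m) := by
  obtain ⟨j, hj⟩ := L.q_add_shift a n k
  rw [hj, show L.q n + a * D * j - m = L.q n - m + a * D * j by ring]
  exact dvd_add_left ⟨j, rfl⟩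

lemma finite_quotient_shift [Fact D.Prime] {a : ℤ} (ha : a ≠ 0) :
    Finite ((ℤ × ℤ) ⧸ LinearMap.range (L.shift a)) := by
  apply Nat.finite_of_card_ne_zero
  rw [card_quotient_range (L.shift_injective ha), det_shift]
  have hD : (D : ℤ) ≠ 0 := by exact_mod_cast (Fact.out : D.Prime).ne_zero
  simp [ha, (Fact.out : D.Prime).ne_zero]

/-- The classes modulo `a 𝔡⁻¹`-translations of the solutions of `q(n) ≡ m mod aD` are counted by the
representation numbers of the principal form. -/
lemma classCount_mul [Fact D.Prime] {E : ℕ} (hDE : D = 1 + 4 * E) (m : ℕ) {a : ℤ} (ha : a ≠ 0) :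
    classCount (L.shift a) (fun n => a * D ∣ L.q n - m) * D =
      repCount 1 1 (-E) m (a.natAbs * D) := by
  have hD0 : D ≠ 0 := (Fact.out : D.Prime).ne_zero
  have hc0 : a.natAbs * D ≠ 0 := mul_ne_zero (Int.natAbs_ne_zero.2 ha) hD0
  have : NeZero (a.natAbs * D) := ⟨hc0⟩
  have := L.finite_quotient_shift ha
  obtain ⟨x, y, hxy⟩ := L.unit
  rw [← repCount_eq_of_disc (α := L.N₁) (β := -L.B) (γ := L.N₀) (x₀ := x) (y₀ := y) (E := E)
    (by rw [neg_sq, mul_assoc, mul_comm L.N₁, ← mul_assoc, ← L.disc_int, hDE]; push_cast; ring) hxy]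
  set P : ZMod (a.natAbs * D) × ZMod (a.natAbs * D) → Prop := fun v =>
    (L.N₁ : ZMod (a.natAbs * D)) * v.1 ^ 2 + ((-L.B : ℤ) : ZMod (a.natAbs * D)) * v.1 * v.2
      + (L.N₀ : ZMod (a.natAbs * D)) * v.2 ^ 2 = ((m : ℤ) : ZMod (a.natAbs * D)) with hP
  have hPV : ∀ n : ℤ × ℤ, P ((n.1 : ℤ), (n.2 : ℤ)) ↔ a * D ∣ L.q n - m := fun n => by
    have h1 : P ((n.1 : ℤ), (n.2 : ℤ)) ↔ ((L.q n - m : ℤ) : ZMod (a.natAbs * D)) = 0 := by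
      simp only [hP, q, binForm]
      push_cast
      rw [sub_eq_zero]
    rw [h1, ZMod.intCast_zmod_eq_zero_iff_dvd]
    push_cast
    rw [← abs_dvd (a * D), abs_mul, Nat.abs_cast]
  have hmem : ∀ n : ℤ × ℤ, ((a.natAbs * D : ℕ) : ℤ) • n ∈ LinearMap.range (L.shift a) := fun n => by
    have h := L.smul_mem_range_shift a n
    push_cast
    rcases abs_choice a with h1 | h1
    · rwa [h1]
    · rw [h1, neg_mul, neg_smul]
      exact Submodule.neg_mem _ h
  -- Here the modulus is |a|D and the quotient has |det| = a²D elements, so the solutions modulo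
  -- |a|D are D times as many as the classes.
  have h := card_mul_card_quotient (φ := L.shift a) hmem (P := P) (fun n k => by
    rw [hPV, hPV, shift_invariant])
  rw [card_quotient_range (L.shift_injective ha), det_shift] at h
  simp only [hPV] at h
  have h2 : (-(a ^ 2 * D) : ℤ).natAbs = a.natAbs ^ 2 * D := by
    simp [Int.natAbs_mul, Int.natAbs_pow]
  rw [h2] at h
  have h3 : Nat.card {v // P v} = repCount L.N₁ (-L.B) L.N₀ m (a.natAbs * D) := rfl
  rw [h3] at h
  have h4 : 0 < a.natAbs ^ 2 * D := Nat.pos_of_ne_zero (mul_ne_zero (pow_ne_zero 2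
    (Int.natAbs_ne_zero.2 ha)) hD0)
  refine Nat.eq_of_mul_eq_mul_left h4 ?_
  rw [mul_comm (a.natAbs ^ 2 * D) (repCount _ _ _ _ _), h]
  ring

end LatticeData

section Boxes

open MeasureTheory Set

lemma box_eq (k : ℤ × ℤ) : {x : ℝ × ℝ | (⌊x.1⌋, ⌊x.2⌋) = k} =
    (fun t : ℝ × ℝ => t + ((k.1 : ℝ), (k.2 : ℝ))) '' (Ico (0 : ℝ) 1 ×ˢ Ico (0 : ℝ) 1) := by
  ext x
  simp only [mem_ofPred_eq, Prod.ext_iff, Int.floor_eq_iff, mem_image, mem_prod, mem_Ico]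
  constructor
  · rintro ⟨⟨h1, h2⟩, h3, h4⟩
    exact ⟨(x.1 - k.1, x.2 - k.2), by constructor <;> constructor <;> simp <;> linarith, by simp, by simp⟩
  · rintro ⟨t, ⟨⟨h1, h2⟩, h3, h4⟩, h5, h6⟩
    simp only [Prod.fst_add, Prod.snd_add] at h5 h6
    constructor <;> constructor <;> linarith

lemma measurableSet_box (k : ℤ × ℤ) : MeasurableSet {x : ℝ × ℝ | (⌊x.1⌋, ⌊x.2⌋) = k} := by
  have : Measurable fun x : ℝ × ℝ => (⌊x.1⌋, ⌊x.2⌋) :=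
    (Int.measurable_floor.comp measurable_fst).prodMk (Int.measurable_floor.comp measurable_snd)
  exact this (measurableSet_singleton k)

/-- Tiling of the plane by translates of the unit square. -/
lemma hasSum_integral_boxes {H : ℝ × ℝ → ℂ} (hH : Integrable H) :
    HasSum (fun k : ℤ × ℤ => ∫ t in Icc (0 : ℝ) 1 ×ˢ Icc (0 : ℝ) 1, H (t + ((k.1 : ℝ), (k.2 : ℝ))))
      (∫ x, H x) := by
  have hU : (⋃ k : ℤ × ℤ, {x : ℝ × ℝ | (⌊x.1⌋, ⌊x.2⌋) = k}) = univ := by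
    ext x; simp
  have h := hasSum_integral_iUnion (f := H) (μ := volume) measurableSet_box
    (fun k k' hkk => Set.disjoint_left.2 fun x hx hx' => hkk (by
      simp only [mem_ofPred_eq] at hx hx'; rw [← hx, ← hx']))
    (by rw [hU]; exact hH.integrableOn)
  rw [hU, setIntegral_univ] at h
  refine h.congr_fun fun k => ?_
  rw [box_eq, (measurePreserving_add_right (volume : Measure (ℝ × ℝ))
    ((k.1 : ℝ), (k.2 : ℝ))).setIntegral_image_emb (measurableEmbedding_addRight _)]
  apply setIntegral_congr_set
  rw [Measure.volume_eq_prod]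
  exact Measure.set_prod_ae_eq Ico_ae_eq_Icc.symm Ico_ae_eq_Icc.symm

end Boxes

namespace LatticeData

open MeasureTheory Set

variable {D : ℕ} (L : LatticeData D)

/-- The linear map `t ↦ t₀ ω₀ + t₁ ω₁`. -/
def trMap : (ℝ × ℝ) →ₗ[ℝ] (ℝ × ℝ) :=
  Matrix.toLin (Module.Basis.finTwoProd ℝ) (Module.Basis.finTwoProd ℝ)
    !![L.w₀, L.w₁; L.v₀, L.v₁]

lemma trMap_apply (t : ℝ × ℝ) : L.trMap t = (L.tr₁ t, L.tr₂ t) := by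
  rw [trMap, Matrix.toLin_finTwoProd_apply, tr₁, tr₂]
  ext <;> simp <;> ring

lemma det_trMap : LinearMap.det L.trMap = L.δ := by
  rw [trMap, LinearMap.det_toLin, Matrix.det_fin_two_of, δ]

lemma map_trMap [Fact D.Prime] :
    Measure.map L.trMap volume = ENNReal.ofReal (√D)⁻¹ • (volume : Measure (ℝ × ℝ)) := by
  rw [Measure.map_linearMap_addHaar_eq_smul_addHaar _ (by rw [det_trMap]; exact L.delta_ne_zero),
    det_trMap, abs_inv, abs_delta]

lemma integrable_comp_trMap [Fact D.Prime] {P : ℝ × ℝ → ℂ} (hP : Integrable P) :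
    Integrable fun t => P (L.trMap t) := by
  have hm : AEMeasurable L.trMap volume :=
    (LinearMap.continuous_of_finiteDimensional L.trMap).measurable.aemeasurable
  have h : Integrable P (Measure.map L.trMap volume) := by
    rw [map_trMap]; exact hP.smul_measure ENNReal.ofReal_ne_top
  exact (integrable_map_measure h.aestronglyMeasurable hm).1 h

lemma integral_comp_trMap [Fact D.Prime] {P : ℝ × ℝ → ℂ} (hP : Integrable P) :
    ∫ t, P (L.trMap t) = ((√D)⁻¹ : ℝ) * ∫ x, P x := by
  have hm : AEMeasurable L.trMap volume :=
    (LinearMap.continuous_of_finiteDimensional L.trMap).measurable.aemeasurable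
  have h : Integrable P (Measure.map L.trMap volume) := by
    rw [map_trMap]; exact hP.smul_measure ENNReal.ofReal_ne_top
  rw [← integral_map hm h.aestronglyMeasurable, map_trMap, integral_smul_measure,
    ENNReal.toReal_ofReal (by positivity), Complex.real_smul]

lemma trMap_surjective [Fact D.Prime] : Function.Surjective L.trMap := fun p => by
  have h := L.delta_ne_zero
  refine ⟨((p.1 * L.v₁ - p.2 * L.w₁) / L.δ, (p.2 * L.w₀ - p.1 * L.v₀) / L.δ), ?_⟩
  rw [trMap_apply, tr₁, tr₂]
  ext
  · field_simp; unfold δ; ring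
  · field_simp; unfold δ; ring

/-- The point `(λ'/a, λ/a)`. -/
def center (a : ℤ) (n : ℤ × ℤ) : ℝ × ℝ := (L.lam' n / a, L.lam n / a)

/-- The reason for the form of `shift`: adding aκ' to λ moves (λ'/a, λ/a) by the lattice vector (κ,
κ'). -/
lemma center_add_shift [Fact D.Prime] {a : ℤ} (ha : a ≠ 0) (n k : ℤ × ℤ) :
    L.center a (n + L.shift a k) = L.center a n + L.trMap ((k.1 : ℝ), (k.2 : ℝ)) := by
  have h := L.delta_ne_zero
  have ha' : (a : ℝ) ≠ 0 := by exact_mod_cast ha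
  rw [trMap_apply, shift_apply, center, center, lam, lam', lam, lam', tr₁, tr₂]
  ext
  · simp only [Prod.fst_add, Prod.snd_add]
    push_cast
    rw [← L.norm_zero, ← L.norm_one, ← L.mixed]
    field_simp
    unfold δ
    ring
  · simp only [Prod.fst_add, Prod.snd_add]
    push_cast
    rw [← L.norm_zero, ← L.norm_one, ← L.mixed]
    field_simp
    unfold δ
    ring

/-- Unfolding: summing a function on the plane over the translates attached to a fixed `a ≠ 0`. -/
lemma hasSum_unfold [Fact D.Prime] (m : ℕ) {a : ℤ} (ha : a ≠ 0) {P : ℝ × ℝ → ℂ}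
    (hP : Integrable P) (x : ℝ × ℝ) :
    HasSum (fun n : {n : ℤ × ℤ // a * D ∣ L.q n - m} =>
        ∫ t in Icc (0 : ℝ) 1 ×ˢ Icc (0 : ℝ) 1, P (x + L.trMap t + L.center a n))
      (classCount (L.shift a) (fun n => a * D ∣ L.q n - m) * (((√D)⁻¹ : ℝ) * ∫ x, P x)) := by
  have := L.finite_quotient_shift ha
  refine hasSum_of_classes (L.shift_injective ha) (fun n k => L.shift_invariant m a n k)
    (f := fun n => ∫ t in Icc (0 : ℝ) 1 ×ˢ Icc (0 : ℝ) 1, P (x + L.trMap t + L.center a n))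
    fun n _ => ?_
  obtain ⟨ξ, hξ⟩ := L.trMap_surjective (x + L.center a n)
  have hH := L.integrable_comp_trMap hP
  have h := hasSum_integral_boxes (hH.comp_add_right ξ)
  rw [integral_add_right_eq_self (fun t => P (L.trMap t)), L.integral_comp_trMap hP] at h
  convert h using 5 with k t
  rw [center_add_shift L ha, map_add, map_add, hξ]
  abel

end LatticeData
end HilbertGreen

/-! ### A Harnack inequality and comparison of arguments -/

namespace HilbertGreen
section LowerBound

open MeasureTheory Set

/-- For u > 0 the base is at most 2t e^u. Together with the upper bound this makes Q comparable to
t^(-σ), which is what the Harnack inequality needs. -/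
lemma legendreQ_lower {σ : ℝ} (hσ : 0 < σ) {t : ℝ} (ht : 1 < t) :
    (2 * t) ^ (-σ) / σ ≤ ‖legendreQ ((σ : ℂ) - 1) t‖ := by
  have hpos : ∀ u, 0 < t + √(t ^ 2 - 1) * Real.cosh u := legendre_base_pos ht
  rw [legendreQ_ofReal _ ht, Complex.norm_real, Real.norm_of_nonneg
    (integral_nonneg fun u => Real.rpow_nonneg (hpos u).le _)]
  have hint : IntegrableOn (fun u : ℝ => (t + √(t ^ 2 - 1) * Real.cosh u) ^ (-σ)) (Ioi 0) := by
    have h := (integrableOn_legendre_integrand (s := (σ : ℂ)) hσ ht).norm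
    refine h.congr (ae_of_all _ fun u => ?_)
    simp only
    rw [Complex.norm_cpow_eq_rpow_re_of_pos (hpos u), Complex.neg_re, Complex.ofReal_re]
  have h1 : ∫ u in Ioi (0 : ℝ), (2 * t) ^ (-σ) * Real.exp (-σ * u) = (2 * t) ^ (-σ) / σ := by
    rw [integral_const_mul, integral_exp_mul_Ioi (by linarith)]
    simp [div_eq_mul_inv]
  rw [← h1]
  refine setIntegral_mono_on ((integrableOn_exp_mul_Ioi (by linarith) 0).const_mul _) hint
    measurableSet_Ioi fun u hu => ?_
  have hu0 : (0 : ℝ) < u := hu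
  have hs : √(t ^ 2 - 1) ≤ t := by
    rw [Real.sqrt_le_left (by linarith)]; linarith
  have hc : Real.cosh u ≤ Real.exp u := by
    rw [Real.cosh_eq]
    have : Real.exp (-u) ≤ Real.exp u := Real.exp_le_exp.2 (by linarith)
    linarith
  have he : 1 ≤ Real.exp u := Real.one_le_exp hu0.le
  have hb : t + √(t ^ 2 - 1) * Real.cosh u ≤ 2 * t * Real.exp u := by
    have : √(t ^ 2 - 1) * Real.cosh u ≤ t * Real.exp u :=
      mul_le_mul hs hc (Real.cosh_pos u).le (by linarith)
    nlinarith
  calc _ = (2 * t * Real.exp u) ^ (-σ) := by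
        rw [Real.mul_rpow (x := 2 * t) (by linarith) (by positivity), ← Real.exp_mul, mul_comm u]
    _ ≤ _ := Real.rpow_le_rpow_of_nonpos (hpos u) hb (by linarith)

lemma norm_legendreQ_le_rpow {s : ℂ} (hs : 0 < s.re) {t : ℝ} (ht : 2 ≤ t) :
    ‖legendreQ (s - 1) t‖ ≤ (t / 4) ^ (-s.re) / s.re := by
  have h : t / 2 ≤ √(t ^ 2 - 1) := Real.le_sqrt_of_sq_le (by nlinarith)
  refine (norm_legendreQ_le hs (by linarith) (by linarith) h).trans_eq ?_
  ring_nf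

/-- Harnack inequality for the Legendre functions. -/
lemma norm_legendreQ_le_mul {s : ℂ} (hs : 0 < s.re) {C t t' : ℝ} (hC : 0 < C) (ht : 2 ≤ t)
    (ht' : 1 < t') (h : t' ≤ C * t) :
    ‖legendreQ (s - 1) t‖ ≤ (1 / (8 * C)) ^ (-s.re) * ‖legendreQ ((s.re : ℂ) - 1) t'‖ := by
  have h1 := norm_legendreQ_le_rpow hs ht
  have h2 := legendreQ_lower hs ht'
  have h3 : (t / 4) ^ (-s.re) ≤ (1 / (8 * C)) ^ (-s.re) * (2 * t') ^ (-s.re) := by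
    rw [← Real.mul_rpow (by positivity) (by linarith)]
    refine Real.rpow_le_rpow_of_nonpos (by positivity) ?_ (by linarith)
    rw [div_mul_eq_mul_div, div_le_div_iff₀ (by positivity) (by norm_num)]
    nlinarith
  calc _ ≤ (t / 4) ^ (-s.re) / s.re := h1
    _ ≤ (1 / (8 * C)) ^ (-s.re) * (2 * t') ^ (-s.re) / s.re := by gcongr
    _ = (1 / (8 * C)) ^ (-s.re) * ((2 * t') ^ (-s.re) / s.re) := by ring
    _ ≤ _ := by gcongr

end LowerBound

section QuadraticComparison

variable {y₁ y₂ : ℝ}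

/-- The majorant of the quadratic form defining the divisors, at the point with real part `x`. -/
def majorant (y₁ y₂ a b l l' : ℝ) (x : ℝ × ℝ) : ℝ :=
  (a * (y₁ * y₂)) ^ 2 + (a * x.1 * x.2 + l * x.1 + l' * x.2 + b) ^ 2
    + ((a * x.2 + l) * y₁) ^ 2 + ((a * x.1 + l') * y₂) ^ 2

lemma sq_le_of_abs_le {x R : ℝ} (h : |x| ≤ R) : x ^ 2 ≤ R ^ 2 :=
  sq_le_sq' (by linarith [neg_abs_le x]) ((le_abs_self x).trans h)

/-- For bounded x the substitution is triangular: a is controlled by the first square, l and l' by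
the third and fourth given a, and finally b by the second. The constants collect the losses of these
steps. -/
lemma sum_sq_le_majorant (hy₁ : 0 < y₁) (hy₂ : 0 < y₂) (R : ℝ) :
    ∃ C > 0, ∀ a b l l' : ℝ, ∀ x : ℝ × ℝ, |x.1| ≤ R → |x.2| ≤ R →
      a ^ 2 + b ^ 2 + l ^ 2 + l' ^ 2 ≤ C * majorant y₁ y₂ a b l l' x := by
  set ca : ℝ := 1 / (y₁ * y₂) ^ 2
  set cl : ℝ := 2 / y₁ ^ 2 + 2 * R ^ 2 * ca
  set cl' : ℝ := 2 / y₂ ^ 2 + 2 * R ^ 2 * ca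
  set cb : ℝ := 4 * (1 + R ^ 4 * ca + R ^ 2 * cl + R ^ 2 * cl')
  refine ⟨ca + cb + cl + cl', by positivity, fun a b l l' x h1 h2 => ?_⟩
  have hx1 := sq_le_of_abs_le h1
  have hx2 := sq_le_of_abs_le h2
  set S := majorant y₁ y₂ a b l l' x with hS
  have p1 := sq_nonneg (a * (y₁ * y₂))
  have p2 := sq_nonneg (a * x.1 * x.2 + l * x.1 + l' * x.2 + b)
  have p3 := sq_nonneg ((a * x.2 + l) * y₁)
  have p4 := sq_nonneg ((a * x.1 + l') * y₂)
  have s1 : (a * (y₁ * y₂)) ^ 2 ≤ S := by rw [hS, majorant]; linarith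
  have s2 : (a * x.1 * x.2 + l * x.1 + l' * x.2 + b) ^ 2 ≤ S := by rw [hS, majorant]; linarith
  have s3 : ((a * x.2 + l) * y₁) ^ 2 ≤ S := by rw [hS, majorant]; linarith
  have s4 : ((a * x.1 + l') * y₂) ^ 2 ≤ S := by rw [hS, majorant]; linarith
  have ha : a ^ 2 ≤ ca * S := by
    simp only [ca]
    rw [div_mul_eq_mul_div, one_mul, le_div_iff₀ (by positivity), ← mul_pow]
    exact s1
  have hl : l ^ 2 ≤ cl * S := by
    have e1 : (a * x.2 + l) ^ 2 ≤ S / y₁ ^ 2 := by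
      rw [le_div_iff₀ (by positivity), ← mul_pow]; exact s3
    have e2 : l ^ 2 ≤ 2 * (a * x.2 + l) ^ 2 + 2 * (a ^ 2 * x.2 ^ 2) := by
      nlinarith [sq_nonneg (2 * a * x.2 + l)]
    have e3 : a ^ 2 * x.2 ^ 2 ≤ ca * S * R ^ 2 :=
      mul_le_mul ha hx2 (sq_nonneg _) ((sq_nonneg a).trans ha)
    calc l ^ 2 ≤ 2 * (S / y₁ ^ 2) + 2 * (ca * S * R ^ 2) := by linarith
      _ = cl * S := by simp only [cl]; ring
  have hl' : l' ^ 2 ≤ cl' * S := by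
    have e1 : (a * x.1 + l') ^ 2 ≤ S / y₂ ^ 2 := by
      rw [le_div_iff₀ (by positivity), ← mul_pow]; exact s4
    have e2 : l' ^ 2 ≤ 2 * (a * x.1 + l') ^ 2 + 2 * (a ^ 2 * x.1 ^ 2) := by
      nlinarith [sq_nonneg (2 * a * x.1 + l')]
    have e3 : a ^ 2 * x.1 ^ 2 ≤ ca * S * R ^ 2 :=
      mul_le_mul ha hx1 (sq_nonneg _) ((sq_nonneg a).trans ha)
    calc l' ^ 2 ≤ 2 * (S / y₂ ^ 2) + 2 * (ca * S * R ^ 2) := by linarith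
      _ = cl' * S := by simp only [cl']; ring
  have hb : b ^ 2 ≤ cb * S := by
    have e0 : ∀ p q r u : ℝ, (u - p - q - r) ^ 2 ≤ 4 * (u ^ 2 + p ^ 2 + q ^ 2 + r ^ 2) := by
      intro p q r u
      nlinarith [sq_nonneg (u + p), sq_nonneg (u + q), sq_nonneg (u + r), sq_nonneg (p - q),
        sq_nonneg (p - r), sq_nonneg (q - r)]
    have e1 := e0 (a * x.1 * x.2) (l * x.1) (l' * x.2) (a * x.1 * x.2 + l * x.1 + l' * x.2 + b)
    have e2 : (a * x.1 * x.2) ^ 2 ≤ ca * S * (R ^ 2 * R ^ 2) := by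
      rw [mul_assoc, mul_pow, mul_pow]
      exact mul_le_mul ha (mul_le_mul hx1 hx2 (sq_nonneg _) (sq_nonneg _)) (by positivity)
        ((sq_nonneg a).trans ha)
    have e3 : (l * x.1) ^ 2 ≤ cl * S * R ^ 2 := by
      rw [mul_pow]
      exact mul_le_mul hl hx1 (sq_nonneg _) ((sq_nonneg l).trans hl)
    have e4 : (l' * x.2) ^ 2 ≤ cl' * S * R ^ 2 := by
      rw [mul_pow]
      exact mul_le_mul hl' hx2 (sq_nonneg _) ((sq_nonneg l').trans hl')
    rw [show a * x.1 * x.2 + l * x.1 + l' * x.2 + b - a * x.1 * x.2 - l * x.1 - l' * x.2 = b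
      by ring] at e1
    calc b ^ 2 ≤ 4 * (S + ca * S * (R ^ 2 * R ^ 2) + cl * S * R ^ 2 + cl' * S * R ^ 2) := by linarith
      _ = cb * S := by simp only [cb]; ring
  linarith

lemma majorant_le_sum_sq (y₁ y₂ R : ℝ) :
    ∃ C > 0, ∀ a b l l' : ℝ, ∀ x : ℝ × ℝ, |x.1| ≤ R → |x.2| ≤ R →
      majorant y₁ y₂ a b l l' x ≤ C * (a ^ 2 + b ^ 2 + l ^ 2 + l' ^ 2) := by
  refine ⟨(y₁ * y₂) ^ 2 + 4 * (R ^ 4 + R ^ 2 + R ^ 2 + 1) + 2 * (R ^ 2 + 1) * y₁ ^ 2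
    + 2 * (R ^ 2 + 1) * y₂ ^ 2, by positivity, fun a b l l' x h1 h2 => ?_⟩
  have hx1 := sq_le_of_abs_le h1
  have hx2 := sq_le_of_abs_le h2
  set N := a ^ 2 + b ^ 2 + l ^ 2 + l' ^ 2 with hN
  have qa := sq_nonneg a
  have qb := sq_nonneg b
  have ql := sq_nonneg l
  have ql' := sq_nonneg l'
  have na : a ^ 2 ≤ N := by rw [hN]; linarith
  have nb : b ^ 2 ≤ N := by rw [hN]; linarith
  have nl : l ^ 2 ≤ N := by rw [hN]; linarith
  have nl' : l' ^ 2 ≤ N := by rw [hN]; linarith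
  have hN0 : 0 ≤ N := by positivity
  have e0 : ∀ p q r u : ℝ, (p + q + r + u) ^ 2 ≤ 4 * (p ^ 2 + q ^ 2 + r ^ 2 + u ^ 2) := by
    intro p q r u
    nlinarith [sq_nonneg (u - p), sq_nonneg (u - q), sq_nonneg (u - r), sq_nonneg (p - q),
      sq_nonneg (p - r), sq_nonneg (q - r)]
  have e1 := e0 (a * x.1 * x.2) (l * x.1) (l' * x.2) b
  have e2 : (a * x.1 * x.2) ^ 2 ≤ N * (R ^ 2 * R ^ 2) := by
    rw [mul_assoc, mul_pow, mul_pow]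
    exact mul_le_mul na (mul_le_mul hx1 hx2 (sq_nonneg _) (sq_nonneg _)) (by positivity) hN0
  have e3 : (l * x.1) ^ 2 ≤ N * R ^ 2 := by
    rw [mul_pow]; exact mul_le_mul nl hx1 (sq_nonneg _) hN0
  have e4 : (l' * x.2) ^ 2 ≤ N * R ^ 2 := by
    rw [mul_pow]; exact mul_le_mul nl' hx2 (sq_nonneg _) hN0
  have e5 : ((a * x.2 + l) * y₁) ^ 2 ≤ 2 * (N * R ^ 2 + N) * y₁ ^ 2 := by
    rw [mul_pow]
    refine mul_le_mul_of_nonneg_right ?_ (sq_nonneg _)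
    have : a ^ 2 * x.2 ^ 2 ≤ N * R ^ 2 := mul_le_mul na hx2 (sq_nonneg _) hN0
    nlinarith [sq_nonneg (a * x.2 - l)]
  have e6 : ((a * x.1 + l') * y₂) ^ 2 ≤ 2 * (N * R ^ 2 + N) * y₂ ^ 2 := by
    rw [mul_pow]
    refine mul_le_mul_of_nonneg_right ?_ (sq_nonneg _)
    have : a ^ 2 * x.1 ^ 2 ≤ N * R ^ 2 := mul_le_mul na hx1 (sq_nonneg _) hN0
    nlinarith [sq_nonneg (a * x.1 - l')]
  have e7 : (a * (y₁ * y₂)) ^ 2 ≤ N * (y₁ * y₂) ^ 2 := by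
    rw [mul_pow]; exact mul_le_mul_of_nonneg_right na (sq_nonneg _)
  unfold majorant
  calc _ ≤ N * (y₁ * y₂) ^ 2 + 4 * (N * (R ^ 2 * R ^ 2) + N * R ^ 2 + N * R ^ 2 + N)
        + 2 * (N * R ^ 2 + N) * y₁ ^ 2 + 2 * (N * R ^ 2 + N) * y₂ ^ 2 := by linarith
    _ = _ := by ring

end QuadraticComparison

namespace LatticeData

open MeasureTheory Set

variable {D : ℕ} (L : LatticeData D)

/-- The triples `(a, b, n)` with `D a b + q(n) = m`. -/
def index (m : ℕ) : Set (ℤ × ℤ × (ℤ × ℤ)) := {p | D * p.1 * p.2.1 + L.q p.2.2 = m}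

/-- The argument of the Legendre function in the summand attached to `(a, b, n)`. -/
def arg (m : ℕ) (y₁ y₂ : ℝ) (p : ℤ × ℤ × (ℤ × ℤ)) (x : ℝ × ℝ) : ℝ :=
  1 + ‖(p.1 : ℂ) * ((x.1 : ℂ) + y₁ * Complex.I) * ((x.2 : ℂ) + y₂ * Complex.I)
    + (L.lam p.2.2 : ℂ) * ((x.1 : ℂ) + y₁ * Complex.I)
    + (L.lam' p.2.2 : ℂ) * ((x.2 : ℂ) + y₂ * Complex.I) + (p.2.1 : ℂ)‖ ^ 2
    / (2 * y₁ * y₂ * ((m : ℝ) / D))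

/-- The summand of the Green function attached to `(a, b, n)`. -/
def term (m : ℕ) (y₁ y₂ : ℝ) (s : ℂ) (p : ℤ × ℤ × (ℤ × ℤ)) (x : ℝ × ℝ) : ℂ :=
  legendreQ (s - 1) (L.arg m y₁ y₂ p x)

variable {m : ℕ} {y₁ y₂ : ℝ}

lemma norm_sq_divisor (y₁ y₂ : ℝ) (p : ℤ × ℤ × (ℤ × ℤ)) (x : ℝ × ℝ) :
    ‖(p.1 : ℂ) * ((x.1 : ℂ) + y₁ * Complex.I) * ((x.2 : ℂ) + y₂ * Complex.I)
    + (L.lam p.2.2 : ℂ) * ((x.1 : ℂ) + y₁ * Complex.I)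
    + (L.lam' p.2.2 : ℂ) * ((x.2 : ℂ) + y₂ * Complex.I) + (p.2.1 : ℂ)‖ ^ 2 =
    (p.1 * (x.1 * x.2 - y₁ * y₂) + L.lam p.2.2 * x.1 + L.lam' p.2.2 * x.2 + p.2.1) ^ 2
    + (p.1 * (x.1 * y₂ + y₁ * x.2) + L.lam p.2.2 * y₁ + L.lam' p.2.2 * y₂) ^ 2 := by
  rw [Complex.sq_norm, Complex.normSq_apply]
  simp
  ring

/-- The relation ab − N(λ) = m/D absorbs the summand 1 into the indefinite part and turns the
argument into a positive definite quadratic form in (a, b, λ, λ'). -/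
lemma arg_eq [Fact D.Prime] (hm : 0 < m) (hy₁ : 0 < y₁) (hy₂ : 0 < y₂) {p : ℤ × ℤ × (ℤ × ℤ)}
    (hp : p ∈ L.index m) (x : ℝ × ℝ) :
    L.arg m y₁ y₂ p x =
      majorant y₁ y₂ p.1 p.2.1 (L.lam p.2.2) (L.lam' p.2.2) x / (2 * y₁ * y₂ * ((m : ℝ) / D)) := by
  have hD : (0 : ℝ) < D := by exact_mod_cast (Fact.out : D.Prime).pos
  have hm' : (0 : ℝ) < m := by exact_mod_cast hm
  have hA := (L.q_eq_iff p.2.2 p.1 p.2.1 m).2 hp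
  have hpos : 2 * y₁ * y₂ * ((m : ℝ) / D) ≠ 0 := by positivity
  rw [arg, norm_sq_divisor, eq_div_iff hpos, add_mul, one_mul, div_mul_cancel₀ _ hpos, ← hA,
    majorant]
  ring

lemma coords_sq_le [Fact D.Prime] : ∃ C > 0, ∀ n : ℤ × ℤ,
    (n.1 : ℝ) ^ 2 + (n.2 : ℝ) ^ 2 ≤ C * (L.lam n ^ 2 + L.lam' n ^ 2) := by
  refine ⟨2 * (L.w₀ ^ 2 + L.v₀ ^ 2 + L.w₁ ^ 2 + L.v₁ ^ 2) + 1, by positivity, fun n => ?_⟩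
  have h1 := L.lam_tr n (1, 0)
  have h2 := L.lam_tr n (0, 1)
  simp only [tr₁, tr₂] at h1 h2
  have e1 : (n.1 : ℝ) = L.lam n * L.w₀ + L.lam' n * L.v₀ := by linear_combination -h1
  have e2 : (n.2 : ℝ) = L.lam n * L.w₁ + L.lam' n * L.v₁ := by linear_combination -h2
  have e0 : ∀ l l' w v : ℝ, (l * w + l' * v) ^ 2 ≤ (w ^ 2 + v ^ 2) * (l ^ 2 + l' ^ 2) :=
    fun l l' w v => by nlinarith [sq_nonneg (l * v - l' * w)]
  rw [e1, e2]
  have e3 := e0 (L.lam n) (L.lam' n) L.w₀ L.v₀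
  have e4 := e0 (L.lam n) (L.lam' n) L.w₁ L.v₁
  have : 0 ≤ (L.w₀ ^ 2 + L.v₀ ^ 2 + L.w₁ ^ 2 + L.v₁ ^ 2 + 1) * (L.lam n ^ 2 + L.lam' n ^ 2) := by
    positivity
  linarith

lemma finite_of_sq_le (r : ℝ) : {p : ℤ × ℤ × (ℤ × ℤ) |
    (p.1 : ℝ) ^ 2 + (p.2.1 : ℝ) ^ 2 + (p.2.2.1 : ℝ) ^ 2 + (p.2.2.2 : ℝ) ^ 2 ≤ r}.Finite := by
  obtain ⟨M, hM⟩ := exists_nat_gt r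
  refine (Set.finite_Icc ((-M, -M, (-M, -M)) : ℤ × ℤ × (ℤ × ℤ)) (M, M, (M, M))).subset
    fun p hp => ?_
  have key : ∀ k : ℤ, (k : ℝ) ^ 2 ≤ r → -(M : ℤ) ≤ k ∧ k ≤ M := fun k hk => by
    have h1 : k ^ 2 ≤ (M : ℤ) := by
      have : (k : ℝ) ^ 2 ≤ M := hk.trans hM.le
      exact_mod_cast this
    have h2 : |k| ≤ k ^ 2 := by
      rw [← sq_abs, pow_two]
      rcases (abs_nonneg k).eq_or_lt with h | h
      · rw [← h]; norm_num
      · nlinarith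
    exact abs_le.1 (h2.trans h1)
  have hp' : (p.1 : ℝ) ^ 2 + (p.2.1 : ℝ) ^ 2 + (p.2.2.1 : ℝ) ^ 2 + (p.2.2.2 : ℝ) ^ 2 ≤ r := hp
  have q1 := sq_nonneg (p.1 : ℝ)
  have q2 := sq_nonneg (p.2.1 : ℝ)
  have q3 := sq_nonneg (p.2.2.1 : ℝ)
  have q4 := sq_nonneg (p.2.2.2 : ℝ)
  obtain ⟨a1, a2⟩ := key p.1 (by linarith)
  obtain ⟨b1, b2⟩ := key p.2.1 (by linarith)
  obtain ⟨c1, c2⟩ := key p.2.2.1 (by linarith)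
  obtain ⟨d1, d2⟩ := key p.2.2.2 (by linarith)
  exact ⟨⟨a1, b1, c1, d1⟩, ⟨a2, b2, c2, d2⟩⟩

/-- The arguments at two points of a bounded region are comparable. -/
lemma arg_harnack [Fact D.Prime] (hm : 0 < m) (hy₁ : 0 < y₁) (hy₂ : 0 < y₂) (R : ℝ) :
    ∃ C > 0, ∀ p ∈ L.index m, ∀ x x' : ℝ × ℝ, |x.1| ≤ R → |x.2| ≤ R → |x'.1| ≤ R → |x'.2| ≤ R →
      L.arg m y₁ y₂ p x' ≤ C * L.arg m y₁ y₂ p x := by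
  have hD : (0 : ℝ) < D := by exact_mod_cast (Fact.out : D.Prime).pos
  have hm' : (0 : ℝ) < m := by exact_mod_cast hm
  obtain ⟨C₁, h₁, H₁⟩ := sum_sq_le_majorant hy₁ hy₂ R
  obtain ⟨C₂, h₂, H₂⟩ := majorant_le_sum_sq y₁ y₂ R
  refine ⟨C₂ * C₁, by positivity, fun p hp x x' a1 a2 a3 a4 => ?_⟩
  rw [L.arg_eq hm hy₁ hy₂ hp, L.arg_eq hm hy₁ hy₂ hp, ← mul_div_assoc (C₂ * C₁)]
  have hpos : 0 < 2 * y₁ * y₂ * ((m : ℝ) / D) := by positivity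
  rw [div_le_div_iff_of_pos_right hpos]
  calc _ ≤ _ := H₂ _ _ _ _ x' a3 a4
    _ ≤ C₂ * (C₁ * _) := mul_le_mul_of_nonneg_left (H₁ _ _ _ _ x a1 a2) h₂.le
    _ = _ := (mul_assoc _ _ _).symm

/-- The majorant controls the sum of squares of the integral coordinates uniformly for bounded x, so
only finitely many triples have a small argument. -/
lemma eventually_two_le_arg [Fact D.Prime] (hm : 0 < m) (hy₁ : 0 < y₁) (hy₂ : 0 < y₂) (R : ℝ) :
    ∀ᶠ p : L.index m in Filter.cofinite, ∀ x : ℝ × ℝ, |x.1| ≤ R → |x.2| ≤ R →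
      2 ≤ L.arg m y₁ y₂ p x := by
  have hD : (0 : ℝ) < D := by exact_mod_cast (Fact.out : D.Prime).pos
  have hm' : (0 : ℝ) < m := by exact_mod_cast hm
  obtain ⟨C₁, h₁, H₁⟩ := sum_sq_le_majorant hy₁ hy₂ R
  obtain ⟨C₂, h₂, H₂⟩ := L.coords_sq_le
  have hfin := (finite_of_sq_le ((1 + C₂) * (C₁ * (2 * (2 * y₁ * y₂ * ((m : ℝ) / D)))))).preimage
    (f := ((↑) : L.index m → ℤ × ℤ × (ℤ × ℤ))) Subtype.val_injective.injOn
  rw [Filter.eventually_cofinite]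
  refine hfin.subset fun p hp => ?_
  rw [mem_ofPred_eq] at hp
  push Not at hp
  obtain ⟨x, hx1, hx2, hx⟩ := hp
  rw [L.arg_eq hm hy₁ hy₂ p.2, div_lt_iff₀ (by positivity)] at hx
  have e1 := H₁ (p.1.1 : ℝ) p.1.2.1 (L.lam p.1.2.2) (L.lam' p.1.2.2) x hx1 hx2
  have e2 := H₂ p.1.2.2
  have e3 : C₁ * majorant y₁ y₂ p.1.1 p.1.2.1 (L.lam p.1.2.2) (L.lam' p.1.2.2) x
      ≤ C₁ * (2 * (2 * y₁ * y₂ * ((m : ℝ) / D))) := mul_le_mul_of_nonneg_left hx.le h₁.le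
  have q1 := sq_nonneg (p.1.1 : ℝ)
  have q2 := sq_nonneg (p.1.2.1 : ℝ)
  have q3 := sq_nonneg (L.lam p.1.2.2)
  have q4 := sq_nonneg (L.lam' p.1.2.2)
  change (p.1.1 : ℝ) ^ 2 + (p.1.2.1 : ℝ) ^ 2 + (p.1.2.2.1 : ℝ) ^ 2 + (p.1.2.2.2 : ℝ) ^ 2 ≤ _
  have e4 : (p.1.1 : ℝ) ^ 2 + (p.1.2.1 : ℝ) ^ 2 + L.lam p.1.2.2 ^ 2 + L.lam' p.1.2.2 ^ 2
    ≤ C₁ * (2 * (2 * y₁ * y₂ * ((m : ℝ) / D))) := e1.trans e3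
  have e5 := mul_le_mul_of_nonneg_left e4 h₂.le
  nlinarith [mul_nonneg h₂.le q1, mul_nonneg h₂.le q2]

end LatticeData
end HilbertGreen

/-! ### From summable means to uniform convergence -/

namespace HilbertGreen
namespace LatticeData

open MeasureTheory Set

variable {D : ℕ} (L : LatticeData D) {m : ℕ} {y₁ y₂ : ℝ}

/-- The unit square. -/
def square : Set (ℝ × ℝ) := Icc (0 : ℝ) 1 ×ˢ Icc (0 : ℝ) 1

lemma isCompact_square : IsCompact square := isCompact_Icc.prod isCompact_Icc

lemma measurableSet_square : MeasurableSet square := measurableSet_Icc.prod measurableSet_Icc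

lemma volume_real_square : (volume : Measure (ℝ × ℝ)).real square = 1 := by
  rw [square, Measure.volume_eq_prod, measureReal_prod_prod]
  simp

lemma continuous_trMap : Continuous L.trMap :=
  LinearMap.continuous_of_finiteDimensional L.trMap

lemma exists_bound_translates (x : ℝ × ℝ) :
    ∃ R, ∀ t ∈ square, |(x + L.trMap t).1| ≤ R ∧ |(x + L.trMap t).2| ≤ R := by
  obtain ⟨R, hR⟩ := isCompact_square.exists_bound_of_continuousOn
    (f := fun t => x + L.trMap t) (by have := L.continuous_trMap; fun_prop)
  refine ⟨R, fun t ht => ?_⟩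
  have h := hR t ht
  rw [Prod.norm_def, max_le_iff] at h
  exact h

lemma continuous_arg (p : ℤ × ℤ × (ℤ × ℤ)) : Continuous (L.arg m y₁ y₂ p) := by
  unfold arg
  fun_prop

lemma continuous_term {s : ℂ} (hs : 0 < s.re) {p : ℤ × ℤ × (ℤ × ℤ)}
    (hp : ∀ x, 1 < L.arg m y₁ y₂ p x) : Continuous (L.term m y₁ y₂ s p) :=
  (continuousOn_legendreQ hs).comp_continuous (L.continuous_arg p) hp

lemma continuous_term_translate {s : ℂ} (hs : 0 < s.re) {p : ℤ × ℤ × (ℤ × ℤ)}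
    (hp : ∀ x, 1 < L.arg m y₁ y₂ p x) (x : ℝ × ℝ) :
    Continuous fun t => L.term m y₁ y₂ s p (x + L.trMap t) :=
  (L.continuous_term hs hp).comp (continuous_const.add L.continuous_trMap)

lemma integrableOn_term {s : ℂ} (hs : 0 < s.re) {p : ℤ × ℤ × (ℤ × ℤ)}
    (hp : ∀ x, 1 < L.arg m y₁ y₂ p x) (x : ℝ × ℝ) :
    IntegrableOn (fun t => L.term m y₁ y₂ s p (x + L.trMap t)) square :=
  (L.continuous_term_translate hs hp x).continuousOn.integrableOn_compact isCompact_square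

/-- Summability of the means of the majorant implies uniform summability. -/
lemma exists_summable_bound [Fact D.Prime] (hm : 0 < m) (hy₁ : 0 < y₁) (hy₂ : 0 < y₂) {s : ℂ}
    (hs : 0 < s.re) (hone : ∀ p ∈ L.index m, ∀ x, 1 < L.arg m y₁ y₂ p x) (x : ℝ × ℝ)
    (hsum : Summable fun p : L.index m =>
      ∫ t in square, ‖L.term m y₁ y₂ (s.re : ℂ) p (x + L.trMap t)‖) :
    ∃ u : L.index m → ℝ, Summable u ∧
      ∀ p : L.index m, ∀ t ∈ square, ‖L.term m y₁ y₂ s p (x + L.trMap t)‖ ≤ u p := by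
  classical
  obtain ⟨R, hR⟩ := L.exists_bound_translates x
  obtain ⟨C, hC, hH⟩ := L.arg_harnack (m := m) hm hy₁ hy₂ R
  have hev := L.eventually_two_le_arg (m := m) hm hy₁ hy₂ R
  have hM : ∀ p : L.index m, ∃ M, ∀ t ∈ square, ‖L.term m y₁ y₂ s p (x + L.trMap t)‖ ≤ M :=
    fun p => isCompact_square.exists_bound_of_continuousOn
      (L.continuous_term_translate hs (hone p p.2) x).continuousOn
  choose M hM using hM
  set v : L.index m → ℝ := fun p => (1 / (8 * C)) ^ (-s.re) *
    ∫ t in square, ‖L.term m y₁ y₂ (s.re : ℂ) p (x + L.trMap t)‖ with hv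
  have hvs : Summable v := hsum.mul_left _
  have hbound : ∀ᶠ p : L.index m in Filter.cofinite, ∀ t ∈ square,
      ‖L.term m y₁ y₂ s p (x + L.trMap t)‖ ≤ v p := by
    filter_upwards [hev] with p hp t ht
    have hint : IntegrableOn
        (fun t' => (1 / (8 * C)) ^ (-s.re) * ‖L.term m y₁ y₂ (s.re : ℂ) p (x + L.trMap t')‖) square :=
      (L.integrableOn_term (s := (s.re : ℂ)) hs (hone p p.2) x).norm.const_mul _
    -- The Harnack inequality between a fixed t and a variable t', averaged over t' in the square of
    -- measure 1, bounds the value at t by a constant times the mean.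
    have h1 : ∫ t' in square, ‖L.term m y₁ y₂ s p (x + L.trMap t)‖ ≤
        ∫ t' in square, (1 / (8 * C)) ^ (-s.re) * ‖L.term m y₁ y₂ (s.re : ℂ) p (x + L.trMap t')‖ := by
      refine setIntegral_mono_on (integrableOn_const
        (by exact isCompact_square.measure_lt_top.ne)) hint measurableSet_square fun t' ht' => ?_
      exact norm_legendreQ_le_mul hs hC (hp _ (hR t ht).1 (hR t ht).2) (hone p p.2 _)
        (hH p p.2 _ _ (hR t ht).1 (hR t ht).2 (hR t' ht').1 (hR t' ht').2)
    rw [setIntegral_const, volume_real_square, one_smul, integral_const_mul] at h1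
    exact h1
  set F : Set (L.index m) := {p | ¬ ∀ t ∈ square, ‖L.term m y₁ y₂ s p (x + L.trMap t)‖ ≤ v p}
  have hF : F.Finite := Filter.eventually_cofinite.1 hbound
  -- The finitely many triples whose argument may be close to 1 are bounded by their maxima on the
  -- compact square.
  refine ⟨fun p => if p ∈ F then M p else v p, ?_, fun p t ht => ?_⟩
  · refine (summable_congr_cofinite ?_).1 hvs
    filter_upwards [hbound] with p hp
    rw [if_neg]
    exact fun h => h hp
  · by_cases hp : p ∈ F
    · simp only [hp, if_true]
      exact hM p t ht
    · simp only [hp, if_false]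
      exact not_not.1 hp t ht

end LatticeData
end HilbertGreen

/-! ### The contribution of the summands with a ≠ 0 -/

namespace HilbertGreen
section SigmaSums

lemma summable_sigma_of_hasSum_nonneg {α : Type*} {β : α → Type*} {f : (Σ a, β a) → ℝ}
    {g : α → ℂ} (hf : ∀ p, 0 ≤ f p) (h : ∀ a, HasSum (fun c => (f ⟨a, c⟩ : ℂ)) (g a))
    (hg : Summable g) : Summable f := by
  rw [summable_sigma_of_nonneg hf]
  refine ⟨fun a => Complex.summable_ofReal.1 (h a).summable, ?_⟩
  rw [← Complex.summable_ofReal]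
  refine hg.congr fun a => ?_
  rw [Complex.ofReal_tsum, (h a).tsum_eq]

lemma hasSum_int_of_natAbs {f : ℕ → ℂ} {S : ℂ} (h0 : f 0 = 0) (h : HasSum f S) :
    HasSum (fun a : {a : ℤ // a ≠ 0} => f (a : ℤ).natAbs) (2 * S) := by
  have h1 : HasSum (fun n : ℕ => f (n + 1)) S := by
    simpa [h0] using (hasSum_nat_add_iff' 1).2 h
  have h2 : HasSum (fun a : ℤ => f a.natAbs) (S + S) := by
    refine HasSum.of_nat_of_neg_add_one (by simpa using h) ?_
    refine h1.congr_fun fun n => ?_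
    congr 1
  rw [two_mul]
  refine (hasSum_subtype_iff_of_support_subset (s := {a : ℤ | a ≠ 0})
    (f := fun a : ℤ => f a.natAbs) fun a ha => ?_).2 h2
  rintro rfl
  exact ha (by simpa using h0)

end SigmaSums

namespace LatticeData

open MeasureTheory Set

variable {D : ℕ} (L : LatticeData D) {m : ℕ} {y₁ y₂ : ℝ}

/-- The index set of the summands with `a ≠ 0`. -/
abbrev NonzeroIndex (m : ℕ) : Type :=
  Σ a : {a : ℤ // a ≠ 0}, {n : ℤ × ℤ // (a : ℤ) * D ∣ L.q n - m}

/-- The triple attached to a pair `(a, n)`. -/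
def ofNonzero [Fact D.Prime] (m : ℕ) (p : L.NonzeroIndex m) : L.index m :=
  ⟨((p.1 : ℤ), -((L.q p.2 - m) / ((p.1 : ℤ) * D)), (p.2 : ℤ × ℤ)), by
    have h := Int.mul_ediv_cancel' p.2.2
    change D * (p.1 : ℤ) * -((L.q p.2 - m) / ((p.1 : ℤ) * D)) + L.q p.2 = m
    linear_combination -h⟩

lemma ofNonzero_injective [Fact D.Prime] (m : ℕ) : Function.Injective (L.ofNonzero m) := by
  rintro ⟨a, n⟩ ⟨a', n'⟩ h
  have h' := congrArg Subtype.val h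
  simp only [ofNonzero, Prod.mk.injEq] at h'
  obtain ⟨h1, -, h2⟩ := h'
  have h3 := Subtype.ext h1
  subst h3
  have h4 := Subtype.ext h2
  subst h4
  rfl

lemma mem_range_ofNonzero [Fact D.Prime] {p : L.index m} (hp : p.1.1 ≠ 0) :
    p ∈ range (L.ofNonzero m) := by
  have hD : (D : ℤ) ≠ 0 := by exact_mod_cast (Fact.out : D.Prime).ne_zero
  have h : D * p.1.1 * p.1.2.1 + L.q p.1.2.2 = m := p.2
  have h1 : L.q p.1.2.2 - m = p.1.1 * D * -p.1.2.1 := by linear_combination h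
  refine ⟨⟨⟨p.1.1, hp⟩, ⟨p.1.2.2, ⟨-p.1.2.1, h1⟩⟩⟩, Subtype.ext ?_⟩
  simp only [ofNonzero]
  rw [h1, Int.mul_ediv_cancel_left _ (mul_ne_zero hp hD), neg_neg]

/-- az₁z₂ + λz₁ + λ'z₂ + b = a(z₁ + λ'/a)(z₂ + λ/a) + (ab − λλ')/a, with the last numerator equal to
m/D. -/
lemma arg_of_ne_zero [Fact D.Prime] {p : ℤ × ℤ × (ℤ × ℤ)} (hp : p ∈ L.index m) (hp0 : p.1 ≠ 0)
    (x : ℝ × ℝ) :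
    L.arg m y₁ y₂ p x = 1 + ‖((p.1 : ℝ) : ℂ) * (((x + L.center p.1 p.2.2).1 : ℂ) + y₁ * Complex.I)
      * (((x + L.center p.1 p.2.2).2 : ℂ) + y₂ * Complex.I)
      + ((((m : ℝ) / D) / (p.1 : ℝ) : ℝ) : ℂ)‖ ^ 2 / (2 * y₁ * y₂ * ((m : ℝ) / D)) := by
  have hA := (L.q_eq_iff p.2.2 p.1 p.2.1 m).2 hp
  have ha : (p.1 : ℂ) ≠ 0 := by exact_mod_cast hp0
  rw [arg, ← hA]
  congr 4
  simp only [center, Prod.fst_add, Prod.snd_add]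
  push_cast
  field_simp
  ring

lemma one_le_sq {a : ℤ} (ha : a ≠ 0) : (1 : ℝ) ≤ (a : ℝ) ^ 2 := by
  have : 1 ≤ a ^ 2 := by have := sq_pos_of_ne_zero ha; omega
  exact_mod_cast this

lemma one_lt_arg_of_ne_zero [Fact D.Prime] (hm : 0 < m) (hy₁ : 0 < y₁) (hy₂ : 0 < y₂)
    (hA : (m : ℝ) / D < y₁ * y₂) {p : ℤ × ℤ × (ℤ × ℤ)} (hp : p ∈ L.index m) (hp0 : p.1 ≠ 0)
    (x : ℝ × ℝ) : 1 < L.arg m y₁ y₂ p x := by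
  have hD : (0 : ℝ) < D := by exact_mod_cast (Fact.out : D.Prime).pos
  have hm' : (0 : ℝ) < m := by exact_mod_cast hm
  rw [L.arg_of_ne_zero hp hp0]
  exact planeArg_gt_one (one_le_sq hp0) (by positivity) hy₁ hy₂ hA _

/-- For a = 0 the imaginary part of the divisor equation is λy₁ + λ'y₂, nonzero off the walls. -/
lemma one_lt_arg_of_eq_zero [Fact D.Prime] (hm : 0 < m) (hy₁ : 0 < y₁) (hy₂ : 0 < y₂)
    (hwall : ∀ n, L.q n = m → L.lam n * y₁ + L.lam' n * y₂ ≠ 0)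
    {p : ℤ × ℤ × (ℤ × ℤ)} (hp : p ∈ L.index m) (hp0 : p.1 = 0)
    (x : ℝ × ℝ) : 1 < L.arg m y₁ y₂ p x := by
  have hD : (0 : ℝ) < D := by exact_mod_cast (Fact.out : D.Prime).pos
  have hm' : (0 : ℝ) < m := by exact_mod_cast hm
  have hq : L.q p.2.2 = m := by
    have h : D * p.1 * p.2.1 + L.q p.2.2 = m := hp
    rw [hp0] at h
    linarith
  have hne := hwall _ hq
  rw [arg, norm_sq_divisor, hp0, lt_add_iff_pos_right]
  refine div_pos ?_ (by positivity)
  have : 0 < (L.lam p.2.2 * y₁ + L.lam' p.2.2 * y₂) ^ 2 := by positivity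
  push_cast
  rw [zero_mul, zero_mul, zero_add, zero_add]
  positivity

lemma one_lt_arg [Fact D.Prime] (hm : 0 < m) (hy₁ : 0 < y₁) (hy₂ : 0 < y₂)
    (hA : (m : ℝ) / D < y₁ * y₂) (hwall : ∀ n, L.q n = m → L.lam n * y₁ + L.lam' n * y₂ ≠ 0)
    (p : ℤ × ℤ × (ℤ × ℤ)) (hp : p ∈ L.index m) (x : ℝ × ℝ) : 1 < L.arg m y₁ y₂ p x := by
  by_cases hp0 : p.1 = 0
  · exact L.one_lt_arg_of_eq_zero hm hy₁ hy₂ hwall hp hp0 x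
  · exact L.one_lt_arg_of_ne_zero hm hy₁ hy₂ hA hp hp0 x

lemma term_ofNonzero [Fact D.Prime] (s : ℂ) (p : L.NonzeroIndex m) (x : ℝ × ℝ) :
    L.term m y₁ y₂ s (L.ofNonzero m p) x =
      planeTerm s ((p.1 : ℤ) : ℝ) ((m : ℝ) / D) y₁ y₂ (x + L.center (p.1 : ℤ) p.2) := by
  rw [term, L.arg_of_ne_zero (L.ofNonzero m p).2 p.1.2]
  rfl

/-- The value of the contribution of the summands with `a ≠ 0` up to the Dirichlet series. -/
def planeConst (D m : ℕ) (y₁ y₂ : ℝ) (s : ℂ) : ℂ :=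
  ((√D)⁻¹ : ℝ) * (2 * Real.pi / (2 * s - 1) * (((m : ℝ) / D : ℝ) : ℂ) ^ s
    * (((y₁ * y₂ : ℝ)) : ℂ) ^ (1 - s)
    * ((√Real.pi : ℝ) * Complex.Gamma (s - 1 / 2) / Complex.Gamma s))

/-- The Dirichlet series of the contribution of the summands with `a ≠ 0`. -/
def densitySeries (D m : ℕ) [Fact D.Prime] (w : ℂ) : ℂ :=
  riemannZeta (w - 1) / DirichletCharacter.LFunction (chiD D) w *
    ∑ d ∈ m.divisors, (d : ℂ) ^ (1 - w) * (chiD D (d : ZMod D) + chiD D ((m / d : ℕ) : ZMod D))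

/-- Unfolding for one a: the class number is the density at |a|, and the plane integral supplies
|a|^(-2s), so together they form a term of the Dirichlet series. -/
lemma hasSum_nonzero_inner [Fact D.Prime] {E : ℕ} (hDE : D = 1 + 4 * E) (hm : 0 < m)
    (hy₁ : 0 < y₁) (hy₂ : 0 < y₂) (hA : (m : ℝ) / D < y₁ * y₂) {s : ℂ} (hs : 1 < s.re)
    (x : ℝ × ℝ) (a : {a : ℤ // a ≠ 0}) :
    HasSum (fun n : {n : ℤ × ℤ // (a : ℤ) * D ∣ L.q n - m} =>
        ∫ t in square, L.term m y₁ y₂ s (L.ofNonzero m ⟨a, n⟩) (x + L.trMap t))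
      (planeConst D m y₁ y₂ s * LSeries.term (densityArith D E m) (2 * s) (a : ℤ).natAbs) := by
  have hD0 : (D : ℂ) ≠ 0 := by exact_mod_cast (Fact.out : D.Prime).ne_zero
  have hD : (0 : ℝ) < D := by exact_mod_cast (Fact.out : D.Prime).pos
  have hm' : (0 : ℝ) < m := by exact_mod_cast hm
  have ha0 : (a : ℤ).natAbs ≠ 0 := Int.natAbs_ne_zero.2 a.2
  have hs' : 1 / 2 < s.re := by linarith
  have h := L.hasSum_unfold m a.2 (integrable_planeTerm hs' (one_le_sq a.2)
    (by positivity : 0 < (m : ℝ) / D) hy₁ hy₂ hA) x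
  rw [integral_planeTerm hs' (one_le_sq a.2) (by positivity) hy₁ hy₂ hA] at h
  have hG : (classCount (L.shift (a : ℤ)) (fun n => (a : ℤ) * D ∣ L.q n - m) : ℂ) =
      densityArith D E m (a : ℤ).natAbs := by
    have h1 := congrArg (Nat.cast : ℕ → ℂ) (L.classCount_mul hDE m a.2)
    push_cast at h1
    simp only [densityArith, ArithmeticFunction.coe_mk, if_neg ha0]
    rw [← h1]
    field_simp
  have hpow : ((|((a : ℤ) : ℝ)| : ℝ) : ℂ) ^ (-2 * s) = (((a : ℤ).natAbs : ℂ) ^ (2 * s))⁻¹ := by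
    rw [neg_mul, Complex.cpow_neg]
    congr 2
    rw [Nat.cast_natAbs, ← Int.cast_abs, Complex.ofReal_intCast]
  rw [hG, hpow] at h
  convert h using 1
  · funext n
    simp only [square, term_ofNonzero]
  · rw [LSeries.term_def, if_neg ha0, planeConst]
    ring

lemma hasSum_nonzero_outer [Fact D.Prime] {E : ℕ} (hDE : D = 1 + 4 * E) (hm : 0 < m) {s : ℂ}
    (hs : 1 < s.re) :
    HasSum (fun a : {a : ℤ // a ≠ 0} =>
        planeConst D m y₁ y₂ s * LSeries.term (densityArith D E m) (2 * s) (a : ℤ).natAbs)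
      (planeConst D m y₁ y₂ s * (2 * densitySeries D m (2 * s))) :=
  (hasSum_int_of_natAbs (by simp [LSeries.term_def])
    (LSeriesHasSum_density hDE hm (by simp; linarith))).mul_left _

lemma integral_norm_term_ofReal {σ : ℝ} {p : ℤ × ℤ × (ℤ × ℤ)} (hp : ∀ x, 1 < L.arg m y₁ y₂ p x)
    (x : ℝ × ℝ) :
    ((∫ t in square, ‖L.term m y₁ y₂ (σ : ℂ) p (x + L.trMap t)‖ : ℝ) : ℂ) =
      ∫ t in square, L.term m y₁ y₂ (σ : ℂ) p (x + L.trMap t) := by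
  rw [← integral_complex_ofReal]
  congr 1 with t
  exact (legendreQ_ofReal_eq_norm σ (hp _)).symm

lemma norm_term_le_re {s : ℂ} {p : ℤ × ℤ × (ℤ × ℤ)} (hp : ∀ x, 1 < L.arg m y₁ y₂ p x)
    (x : ℝ × ℝ) : ‖L.term m y₁ y₂ s p x‖ ≤ ‖L.term m y₁ y₂ (s.re : ℂ) p x‖ :=
  norm_legendreQ_le_norm_re s (hp x)

lemma norm_integral_term_le {s : ℂ} (hs : 0 < s.re) {p : ℤ × ℤ × (ℤ × ℤ)}
    (hp : ∀ x, 1 < L.arg m y₁ y₂ p x) (x : ℝ × ℝ) :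
    ‖∫ t in square, L.term m y₁ y₂ s p (x + L.trMap t)‖ ≤
      ∫ t in square, ‖L.term m y₁ y₂ (s.re : ℂ) p (x + L.trMap t)‖ :=
  norm_integral_le_of_norm_le (L.integrableOn_term (s := (s.re : ℂ)) hs hp x).norm
    (ae_of_all _ fun _ => L.norm_term_le_re hp _)

/-- At a real exponent the integrals of norms are the integrals themselves, so the exact sums over n
and then over a already give absolute summability. -/
lemma summable_nonzero [Fact D.Prime] (hm : 0 < m)
    (hy₁ : 0 < y₁) (hy₂ : 0 < y₂) (hA : (m : ℝ) / D < y₁ * y₂) {σ : ℝ} (hσ : 1 < σ)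
    (x : ℝ × ℝ) :
    Summable fun p : L.NonzeroIndex m =>
      ∫ t in square, ‖L.term m y₁ y₂ (σ : ℂ) (L.ofNonzero m p) (x + L.trMap t)‖ := by
  obtain ⟨E, hDE⟩ : ∃ E, D = 1 + 4 * E := ⟨D / 4, by have := L.mod_four; omega⟩
  refine summable_sigma_of_hasSum_nonneg (fun p => integral_nonneg fun t => norm_nonneg _)
    (fun a => ?_) (hasSum_nonzero_outer (y₁ := y₁) (y₂ := y₂) hDE hm (s := (σ : ℂ)) hσ).summable
  simp_rw [L.integral_norm_term_ofReal fun x => L.one_lt_arg_of_ne_zero hm hy₁ hy₂ hA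
    (L.ofNonzero m ⟨a, _⟩).2 a.2 x]
  exact L.hasSum_nonzero_inner hDE hm hy₁ hy₂ hA hσ x a

lemma hasSum_nonzero [Fact D.Prime] (hm : 0 < m)
    (hy₁ : 0 < y₁) (hy₂ : 0 < y₂) (hA : (m : ℝ) / D < y₁ * y₂) {s : ℂ} (hs : 1 < s.re)
    (x : ℝ × ℝ) :
    HasSum (fun p : L.NonzeroIndex m =>
        ∫ t in square, L.term m y₁ y₂ s (L.ofNonzero m p) (x + L.trMap t))
      (planeConst D m y₁ y₂ s * (2 * densitySeries D m (2 * s))) := by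
  obtain ⟨E, hDE⟩ : ∃ E, D = 1 + 4 * E := ⟨D / 4, by have := L.mod_four; omega⟩
  refine HasSum.sigma_of_hasSum (hasSum_nonzero_outer hDE hm hs)
    (L.hasSum_nonzero_inner hDE hm hy₁ hy₂ hA hs x) ?_
  refine Summable.of_norm_bounded (L.summable_nonzero hm hy₁ hy₂ hA hs x) fun p => ?_
  exact L.norm_integral_term_le (by linarith) (fun x => L.one_lt_arg_of_ne_zero hm hy₁ hy₂ hA
    (L.ofNonzero m p).2 p.1.2 x) x

end LatticeData
end HilbertGreen

/-! ### Averaging a periodized function of one variable -/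

namespace HilbertGreen
section Periodization

open MeasureTheory Set

lemma hasSum_integral_intervals {H : ℝ → ℂ} (hH : Integrable H) :
    HasSum (fun k : ℤ => ∫ t in Icc (0 : ℝ) 1, H (t + k)) (∫ x, H x) := by
  have hU : (⋃ k : ℤ, {x : ℝ | ⌊x⌋ = k}) = univ := by
    ext x; simp
  have h := hasSum_integral_iUnion (f := H) (μ := volume)
    (fun k : ℤ => Int.measurable_floor (measurableSet_singleton k))
    (fun k k' hkk => Set.disjoint_left.2 fun x hx hx' => hkk (by
      simp only [mem_preimage, mem_singleton_iff] at hx hx'; rw [← hx, ← hx']))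
    (by
      have : (⋃ k : ℤ, Int.floor ⁻¹' {k}) = (univ : Set ℝ) := hU
      rw [this]; exact hH.integrableOn)
  have : (⋃ k : ℤ, Int.floor ⁻¹' {k}) = (univ : Set ℝ) := hU
  rw [this, setIntegral_univ] at h
  refine h.congr_fun fun k => ?_
  have hbox : (Int.floor ⁻¹' {k} : Set ℝ) = (fun t : ℝ => t + k) '' Ico (0 : ℝ) 1 := by
    ext x
    simp only [mem_preimage, mem_singleton_iff, Int.floor_eq_iff, mem_image, mem_Ico]
    constructor
    · rintro ⟨h1, h2⟩
      exact ⟨x - k, ⟨by linarith, by linarith⟩, by simp⟩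
    · rintro ⟨t, ⟨h1, h2⟩, rfl⟩
      constructor <;> linarith
  rw [hbox, (measurePreserving_add_right (volume : Measure ℝ)
    (k : ℝ)).setIntegral_image_emb (measurableEmbedding_addRight _)]
  exact setIntegral_congr_set Ico_ae_eq_Icc.symm

/-- Averaging the periodization of a function along an integral multiple of the circle. -/
lemma hasSum_integral_mul {f : ℝ → ℂ} (hf : Integrable f) {k : ℤ} (hk : k ≠ 0) (c : ℝ) :
    HasSum (fun b : ℤ => ∫ t in Icc (0 : ℝ) 1, f (k * t + (c + b))) (∫ x, f x) := by
  have hk' : (k : ℝ) ≠ 0 := by exact_mod_cast hk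
  set φ : ℤ →ₗ[ℤ] ℤ := k • LinearMap.id with hφ
  have hφa : ∀ j, φ j = k * j := fun j => by simp [hφ]
  have hinj : Function.Injective φ := fun i j hij => by
    rw [hφa, hφa] at hij
    exact mul_left_cancel₀ hk hij
  have hcard : Nat.card (ℤ ⧸ LinearMap.range φ) = k.natAbs := by
    rw [card_quotient_range hinj, hφ, LinearMap.det_smul]
    simp
  have : Finite (ℤ ⧸ LinearMap.range φ) := by
    apply Nat.finite_of_card_ne_zero
    rw [hcard]
    exact Int.natAbs_ne_zero.2 hk
  -- Shifting b by kj is shifting t by j, so each of the |k| classes of b modulo k yields the full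
  -- integral of f(kt + c + b), which is |k|⁻¹ times the integral of f.
  have h := hasSum_of_classes hinj (V := fun _ => True) (fun _ _ => Iff.rfl)
    (f := fun b : ℤ => ∫ t in Icc (0 : ℝ) 1, f (k * t + (c + b)))
    (J := (|(k : ℝ)⁻¹| : ℝ) * ∫ x, f x) (fun n _ => by
      have hg : Integrable fun x => f (k * x + (c + n)) :=
        (hf.comp_add_right (c + n)).comp_mul_left' hk'
      have h1 := hasSum_integral_intervals hg
      rw [Measure.integral_comp_mul_left (fun y => f (y + (c + n))),
        integral_add_right_eq_self f, Complex.real_smul] at h1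
      refine h1.congr_fun fun j => ?_
      congr 1 with t
      congr 1
      rw [hφa]
      push_cast
      ring)
  have hc : classCount φ (fun _ => True) = k.natAbs := by
    rw [← hcard, classCount]
    exact Nat.card_congr (Equiv.subtypeUnivEquiv fun _ => trivial)
  rw [hc, ← mul_assoc, Nat.cast_natAbs, abs_inv] at h
  have h2 : (((|k| : ℤ) : ℂ)) * ((|(k : ℝ)|⁻¹ : ℝ) : ℂ) = 1 := by
    rw [← Int.cast_abs, Complex.ofReal_inv, Complex.ofReal_intCast]
    exact mul_inv_cancel₀ (by exact_mod_cast (abs_pos.2 hk).ne')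
  rw [h2, one_mul] at h
  have h3 := (hasSum_subtype_iff_indicator
    (f := fun b : ℤ => ∫ t in Icc (0 : ℝ) 1, f (k * t + (c + b))) (s := {_n : ℤ | True})).1 h
  refine h3.congr_fun fun b => ?_
  rw [indicator_of_mem (mem_ofPred_eq ▸ trivial)]

lemma integrableOn_Icc_of_continuous {E : Type*} [NormedAddCommGroup E] {f : ℝ → E}
    (hf : Continuous f) :
    IntegrableOn f (Icc (0 : ℝ) 1) := hf.continuousOn.integrableOn_compact isCompact_Icc

lemma continuous_inner_integral {f : ℝ × ℝ → ℂ} (hf : Continuous f) :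
    Continuous fun t₁ : ℝ => ∫ t₀ in Icc (0 : ℝ) 1, f (t₀, t₁) :=
  continuous_parametric_integral_of_continuous (f := fun t₁ t₀ => f (t₀, t₁))
    (by fun_prop) isCompact_Icc

/-- For each t₁ the t₀-averages sum to the integral of f, independently of t₁. The same statement
for ‖f‖, recorded by `G`, justifies integrating termwise in t₁. -/
lemma hasSum_square_of_fst_ne {f : ℝ → ℂ} (hf : Integrable f) (hc : Continuous f) {k : ℤ × ℤ}
    (hk : k.1 ≠ 0) (c : ℝ) :
    HasSum (fun b : ℤ => ∫ t in LatticeData.square, f (k.1 * t.1 + k.2 * t.2 + (c + b)))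
      (∫ x, f x) := by
  set g : ℤ → ℝ → ℂ := fun b t₁ => ∫ t₀ in Icc (0 : ℝ) 1, f (k.1 * t₀ + (k.2 * t₁ + c + b)) with hg
  set G : ℤ → ℝ → ℂ := fun b t₁ =>
    ∫ t₀ in Icc (0 : ℝ) 1, (‖f (k.1 * t₀ + (k.2 * t₁ + c + b))‖ : ℂ) with hG
  have hgc : ∀ b, Continuous (g b) := fun b =>
    continuous_inner_integral (f := fun t : ℝ × ℝ => f (k.1 * t.1 + (k.2 * t.2 + c + b)))
      (by fun_prop)
  have hGc : ∀ b, Continuous (G b) := fun b =>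
    continuous_inner_integral
      (f := fun t : ℝ × ℝ => ((‖f (k.1 * t.1 + (k.2 * t.2 + c + b))‖ : ℝ) : ℂ)) (by fun_prop)
  have hgs : ∀ t₁, HasSum (fun b => g b t₁) (∫ x, f x) := fun t₁ =>
    hasSum_integral_mul hf hk (k.2 * t₁ + c)
  have hGs : ∀ t₁, HasSum (fun b => G b t₁) ((∫ x, ‖f x‖ : ℝ) : ℂ) := fun t₁ => by
    rw [← integral_complex_ofReal]
    exact hasSum_integral_mul (hf.norm.ofReal (𝕜 := ℂ)) hk (k.2 * t₁ + c)
  have hGr : ∀ b t₁, G b t₁ = ((G b t₁).re : ℂ) ∧ ‖g b t₁‖ ≤ (G b t₁).re := fun b t₁ => by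
    simp only [hG, hg]
    rw [integral_complex_ofReal, Complex.ofReal_re]
    exact ⟨rfl, norm_integral_le_integral_norm _⟩
  have hGs' : ∀ t₁, HasSum (fun b => (G b t₁).re) (∫ x, ‖f x‖) := fun t₁ => by
    rw [← Complex.hasSum_ofReal]
    simp_rw [← (hGr _ _).1]
    exact hGs t₁
  have hGre : ∀ b, Continuous fun t₁ => (G b t₁).re := fun b => Complex.continuous_re.comp (hGc b)
  have hsum : Summable fun b => ∫ t₁ in Icc (0 : ℝ) 1, (G b t₁).re := by
    refine summable_of_sum_le (c := ∫ x, ‖f x‖) (fun b => integral_nonneg fun t₁ =>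
      (norm_nonneg _).trans (hGr b t₁).2) fun u => ?_
    rw [← integral_finsetSum _ fun b _ => integrableOn_Icc_of_continuous (hGre b)]
    calc _ ≤ ∫ _t in Icc (0 : ℝ) 1, ∫ x, ‖f x‖ := by
          refine setIntegral_mono_on (integrableOn_Icc_of_continuous
            (continuous_finsetSum _ fun b _ => hGre b))
            (integrableOn_Icc_of_continuous continuous_const) measurableSet_Icc fun t₁ _ => ?_
          exact sum_le_hasSum u (fun b _ => (norm_nonneg _).trans (hGr b t₁).2) (hGs' t₁)
      _ = _ := by simp
  have h := hasSum_integral_of_summable_integral_norm (μ := volume.restrict (Icc (0 : ℝ) 1))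
    (F := g) (fun b => integrableOn_Icc_of_continuous (hgc b))
    (Summable.of_nonneg_of_le (fun b => integral_nonneg fun t₁ => norm_nonneg _)
      (fun b => setIntegral_mono_on (integrableOn_Icc_of_continuous (hgc b)).norm
        (integrableOn_Icc_of_continuous (hGre b)) measurableSet_Icc fun t₁ _ => (hGr b t₁).2) hsum)
  have h2 : ∫ t₁ in Icc (0 : ℝ) 1, ∑' b, g b t₁ = ∫ x, f x := by
    simp_rw [fun t₁ => (hgs t₁).tsum_eq]
    simp
  rw [h2] at h
  refine h.congr_fun fun b => ?_
  have hcont : Continuous fun t : ℝ × ℝ => f (k.1 * t.1 + k.2 * t.2 + (c + b)) := by fun_prop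
  have hint := hcont.continuousOn.integrableOn_compact (μ := volume) LatticeData.isCompact_square
  rw [LatticeData.square, Measure.volume_eq_prod, IntegrableOn, ← Measure.prod_restrict] at hint
  rw [LatticeData.square, Measure.volume_eq_prod, ← Measure.prod_restrict,
    integral_prod_symm _ hint]
  simp only [hg]
  congr 1 with t₁
  congr 1 with t₀
  congr 1
  ring

lemma hasSum_square {f : ℝ → ℂ} (hf : Integrable f) (hc : Continuous f) {k : ℤ × ℤ}
    (hk : k ≠ 0) (c : ℝ) :
    HasSum (fun b : ℤ => ∫ t in LatticeData.square, f (k.1 * t.1 + k.2 * t.2 + (c + b)))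
      (∫ x, f x) := by
  by_cases h1 : k.1 = 0
  · have h2 : k.2 ≠ 0 := fun h2 => hk (Prod.ext h1 h2)
    refine (hasSum_square_of_fst_ne (k := (k.2, k.1)) hf hc h2 c).congr_fun fun b => ?_
    rw [LatticeData.square, Measure.volume_eq_prod, ← setIntegral_prod_swap]
    simp only [Prod.fst_swap, Prod.snd_swap]
    congr 1 with t
    congr 1
    ring
  · exact hasSum_square_of_fst_ne hf hc h1 c

end Periodization
end HilbertGreen

/-! ### The contribution of the summands with a = 0 -/

namespace HilbertGreen
section HorocycleMean

open MeasureTheory Set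

/-- The mean of the Legendre function along a horocycle of height `v`, seen from height `y`. -/
def horoMean (s : ℂ) (v y : ℝ) : ℂ :=
  2 * Real.pi / (2 * s - 1) *
    if v < y then (v : ℂ) ^ s * (y : ℂ) ^ (1 - s) else (y : ℂ) ^ s * (v : ℂ) ^ (1 - s)

lemma integral_legendreQ_horo {s : ℂ} (hs : 1 / 2 < s.re) {v y : ℝ} (hv : 0 < v) (hy : 0 < y)
    (hne : v ≠ y) :
    Integrable (fun x : ℝ => legendreQ (s - 1) (1 + (x ^ 2 + (y - v) ^ 2) / (2 * y * v))) ∧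
    ∫ x : ℝ, legendreQ (s - 1) (1 + (x ^ 2 + (y - v) ^ 2) / (2 * y * v)) = horoMean s v y := by
  rcases lt_or_gt_of_ne hne with h | h
  · refine ⟨integrable_legendreQ_horo_of_lt hs hv h, ?_⟩
    rw [integral_legendreQ_horo_of_lt hs hv h, horoMean, if_pos h, mul_assoc]
  · simp_rw [horoArg_comm]
    refine ⟨integrable_legendreQ_horo_of_lt hs hy h, ?_⟩
    rw [integral_legendreQ_horo_of_lt hs hy h, horoMean, if_neg h.not_gt, mul_assoc]

end HorocycleMean

namespace LatticeData

open MeasureTheory Set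

variable {D : ℕ} (L : LatticeData D) {m : ℕ} {y₁ y₂ : ℝ}

/-- The index set of the summands with `a = 0`. -/
abbrev ZeroIndex (m : ℕ) : Type := Σ _n : {n : ℤ × ℤ // L.q n = m}, ℤ

/-- The triple `(0, b, n)`. -/
def ofZero (m : ℕ) (p : L.ZeroIndex m) : L.index m :=
  ⟨(0, p.2, (p.1 : ℤ × ℤ)), by
    change D * 0 * p.2 + L.q p.1 = m
    rw [p.1.2]; ring⟩

lemma ofZero_injective (m : ℕ) : Function.Injective (L.ofZero m) := by
  rintro ⟨n, b⟩ ⟨n', b'⟩ h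
  have h' := congrArg Subtype.val h
  simp only [ofZero, Prod.mk.injEq, true_and] at h'
  obtain ⟨h1, h2⟩ := h'
  have h3 := Subtype.ext h2
  subst h3
  subst h1
  rfl

lemma mem_range_ofZero {p : L.index m} (hp : p.1.1 = 0) : p ∈ range (L.ofZero m) := by
  have h : D * p.1.1 * p.1.2.1 + L.q p.1.2.2 = m := p.2
  have h1 : L.q p.1.2.2 = m := by rw [hp] at h; linarith
  exact ⟨⟨⟨p.1.2.2, h1⟩, p.1.2.1⟩, Subtype.ext (Prod.ext hp.symm rfl)⟩

lemma lam_mul_lam'_of_q_eq [Fact D.Prime] {n : ℤ × ℤ} (hn : L.q n = m) :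
    L.lam n * L.lam' n = -((m : ℝ) / D) := by
  rw [lam_mul_lam', hn]
  push_cast
  ring

lemma abs_lam_pos [Fact D.Prime] (hm : 0 < m) {n : ℤ × ℤ} (hn : L.q n = m) :
    0 < |L.lam n| ∧ 0 < |L.lam' n| := by
  have hD : (0 : ℝ) < D := by exact_mod_cast (Fact.out : D.Prime).pos
  have hm' : (0 : ℝ) < m := by exact_mod_cast hm
  have h := L.lam_mul_lam'_of_q_eq hn
  have h1 : L.lam n * L.lam' n ≠ 0 := by
    rw [h]
    exact neg_ne_zero.2 (by positivity)
  exact ⟨abs_pos.2 (left_ne_zero_of_mul h1), abs_pos.2 (right_ne_zero_of_mul h1)⟩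

/-- λ and λ' have opposite signs and |λλ'| = m/D, so the argument is that of two points of heights
|λ|y₁ and |λ'|y₂, with a real part affine in t and integral coefficients. -/
lemma arg_ofZero [Fact D.Prime] {n : ℤ × ℤ}
    (hn : L.q n = m) (b : ℤ) (x t : ℝ × ℝ) :
    L.arg m y₁ y₂ (0, b, n) (x + L.trMap t) =
      1 + ((n.1 * t.1 + n.2 * t.2 + (L.lam n * x.1 + L.lam' n * x.2 + b)) ^ 2
        + (|L.lam n| * y₁ - |L.lam' n| * y₂) ^ 2) / (2 * (|L.lam n| * y₁) * (|L.lam' n| * y₂)) := by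
  have h := L.lam_mul_lam'_of_q_eq hn
  have hD : (0 : ℝ) ≤ (m : ℝ) / D := by positivity
  have habs : |L.lam n| * |L.lam' n| = (m : ℝ) / D := by
    rw [← abs_mul, h, abs_neg, abs_of_nonneg hD]
  rw [arg, norm_sq_divisor, ← L.lam_tr n t, trMap_apply]
  congr 2
  · simp only [Prod.fst_add, Prod.snd_add]
    push_cast
    have h1 : (|L.lam n| * y₁ - |L.lam' n| * y₂) ^ 2 = (L.lam n * y₁ + L.lam' n * y₂) ^ 2 := by
      have e1 := sq_abs (L.lam n)
      have e2 := sq_abs (L.lam' n)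
      linear_combination y₁ ^ 2 * e1 + y₂ ^ 2 * e2 - 2 * y₁ * y₂ * habs - 2 * y₁ * y₂ * h
    rw [h1]
    ring
  · rw [← habs]
    ring

lemma abs_ne_of_wall [Fact D.Prime] (hm : 0 < m) {n : ℤ × ℤ}
    (hn : L.q n = m) (hwall : L.lam n * y₁ + L.lam' n * y₂ ≠ 0) :
    |L.lam' n| * y₂ ≠ |L.lam n| * y₁ := by
  have hD : (0 : ℝ) < D := by exact_mod_cast (Fact.out : D.Prime).pos
  have hm' : (0 : ℝ) < m := by exact_mod_cast hm
  have h := L.lam_mul_lam'_of_q_eq hn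
  have hneg : L.lam n * L.lam' n < 0 := by
    rw [h]
    exact neg_neg_of_pos (by positivity)
  intro heq
  apply hwall
  rcases mul_neg_iff.1 hneg with ⟨h1, h2⟩ | ⟨h1, h2⟩
  · rw [abs_of_neg h2, abs_of_pos h1] at heq
    linarith
  · rw [abs_of_pos h2, abs_of_neg h1] at heq
    linarith

lemma hasSum_zero_inner [Fact D.Prime] (hm : 0 < m) (hy₁ : 0 < y₁) (hy₂ : 0 < y₂)
    (hwall : ∀ n, L.q n = m → L.lam n * y₁ + L.lam' n * y₂ ≠ 0) {s : ℂ} (hs : 1 / 2 < s.re)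
    (x : ℝ × ℝ) (n : {n : ℤ × ℤ // L.q n = m}) :
    HasSum (fun b : ℤ => ∫ t in square, L.term m y₁ y₂ s (L.ofZero m ⟨n, b⟩) (x + L.trMap t))
      (horoMean s (|L.lam' n| * y₂) (|L.lam n| * y₁)) := by
  have hpos := L.abs_lam_pos hm n.2
  have hv : 0 < |L.lam' n| * y₂ := mul_pos hpos.2 hy₂
  have hy : 0 < |L.lam n| * y₁ := mul_pos hpos.1 hy₁
  have hne := L.abs_ne_of_wall hm n.2 (hwall n n.2)
  obtain ⟨hint, hval⟩ := integral_legendreQ_horo hs hv hy hne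
  have hn0 : (n : ℤ × ℤ) ≠ 0 := by
    intro h0
    have := n.2
    rw [h0] at this
    simp [q, binForm] at this
    omega
  have hcont : Continuous fun x : ℝ => legendreQ (s - 1)
      (1 + (x ^ 2 + (|L.lam n| * y₁ - |L.lam' n| * y₂) ^ 2)
        / (2 * (|L.lam n| * y₁) * (|L.lam' n| * y₂))) :=
    (continuousOn_legendreQ (by linarith)).comp_continuous (by fun_prop)
      fun x => one_lt_horoArg hv hy hne x
  rw [← hval]
  refine (hasSum_square hint hcont hn0 (L.lam n * x.1 + L.lam' n * x.2)).congr_fun fun b => ?_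
  congr 1 with t
  rw [term, ← L.arg_ofZero n.2 b x t]
  rfl

lemma summable_zero [Fact D.Prime] (hm : 0 < m) (hy₁ : 0 < y₁) (hy₂ : 0 < y₂)
    (hwall : ∀ n, L.q n = m → L.lam n * y₁ + L.lam' n * y₂ ≠ 0) {σ : ℝ} (hσ : 1 / 2 < σ)
    (hJ : Summable fun n : {n : ℤ × ℤ // L.q n = m} =>
      horoMean σ (|L.lam' n| * y₂) (|L.lam n| * y₁)) (x : ℝ × ℝ) :
    Summable fun p : L.ZeroIndex m =>
      ∫ t in square, ‖L.term m y₁ y₂ (σ : ℂ) (L.ofZero m p) (x + L.trMap t)‖ := by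
  refine summable_sigma_of_hasSum_nonneg (fun p => integral_nonneg fun t => norm_nonneg _)
    (fun n => ?_) hJ
  simp_rw [L.integral_norm_term_ofReal fun x => L.one_lt_arg_of_eq_zero hm hy₁ hy₂ hwall
    (L.ofZero m ⟨n, _⟩).2 rfl x]
  exact L.hasSum_zero_inner hm hy₁ hy₂ hwall hσ x n

lemma hasSum_zero_part [Fact D.Prime] (hm : 0 < m) (hy₁ : 0 < y₁) (hy₂ : 0 < y₂)
    (hwall : ∀ n, L.q n = m → L.lam n * y₁ + L.lam' n * y₂ ≠ 0) {s J : ℂ} (hs : 1 / 2 < s.re)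
    (hJ : Summable fun n : {n : ℤ × ℤ // L.q n = m} =>
      horoMean (s.re : ℂ) (|L.lam' n| * y₂) (|L.lam n| * y₁))
    (hJs : HasSum (fun n : {n : ℤ × ℤ // L.q n = m} =>
      horoMean s (|L.lam' n| * y₂) (|L.lam n| * y₁)) J) (x : ℝ × ℝ) :
    HasSum (fun p : L.ZeroIndex m =>
      ∫ t in square, L.term m y₁ y₂ s (L.ofZero m p) (x + L.trMap t)) J := by
  refine HasSum.sigma_of_hasSum hJs (L.hasSum_zero_inner hm hy₁ hy₂ hwall hs x) ?_
  refine Summable.of_norm_bounded (L.summable_zero hm hy₁ hy₂ hwall hs hJ x) fun p => ?_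
  exact L.norm_integral_term_le (by linarith) (fun x => L.one_lt_arg_of_eq_zero hm hy₁ hy₂ hwall
    (L.ofZero m p).2 rfl x) x

/-- A sum over all triples from the sums over those with `a ≠ 0` and with `a = 0`. -/
lemma hasSum_index [Fact D.Prime] {E : Type*} [AddCommGroup E] [TopologicalSpace E]
    [ContinuousAdd E] {f : L.index m → E} {S T : E}
    (h1 : HasSum (fun p => f (L.ofNonzero m p)) S) (h2 : HasSum (fun p => f (L.ofZero m p)) T) :
    HasSum f (S + T) := by
  classical
  have g1 : HasSum (fun p : L.index m => if p.1.1 = 0 then 0 else f p) S := by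
    rw [← (L.ofNonzero_injective m).hasSum_iff]
    · refine h1.congr_fun fun p => ?_
      simp only [Function.comp]
      rw [if_neg]
      exact p.1.2
    · intro p hp
      by_contra h
      exact hp (L.mem_range_ofNonzero fun h0 => h (if_pos h0))
  have g2 : HasSum (fun p : L.index m => if p.1.1 = 0 then f p else 0) T := by
    rw [← (L.ofZero_injective m).hasSum_iff]
    · refine h2.congr_fun fun p => ?_
      simp only [Function.comp]
      rw [if_pos]
      rfl
    · intro p hp
      by_contra h
      refine hp (L.mem_range_ofZero ?_)
      by_contra h0
      exact h (if_neg h0)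
  refine (g1.add g2).congr_fun fun p => ?_
  split_ifs <;> simp

/-- The mean of the Green function, with absolute and uniform convergence. -/
theorem hasSum_mean [Fact D.Prime] (hm : 0 < m) (hy₁ : 0 < y₁) (hy₂ : 0 < y₂)
    (hA : (m : ℝ) / D < y₁ * y₂)
    (hwall : ∀ n, L.q n = m → L.lam n * y₁ + L.lam' n * y₂ ≠ 0) {s J : ℂ} (hs : 1 < s.re)
    (hJ : Summable fun n : {n : ℤ × ℤ // L.q n = m} =>
      horoMean (s.re : ℂ) (|L.lam' n| * y₂) (|L.lam n| * y₁))
    (hJs : HasSum (fun n : {n : ℤ × ℤ // L.q n = m} =>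
      horoMean s (|L.lam' n| * y₂) (|L.lam n| * y₁)) J) (x : ℝ × ℝ) :
    (∃ u : L.index m → ℝ, Summable u ∧
      ∀ p : L.index m, ∀ t ∈ square, ‖L.term m y₁ y₂ s p (x + L.trMap t)‖ ≤ u p) ∧
    ContinuousOn (fun t => ∑' p : L.index m, L.term m y₁ y₂ s p (x + L.trMap t)) square ∧
    ∫ t in square, ∑' p : L.index m, L.term m y₁ y₂ s p (x + L.trMap t) =
      planeConst D m y₁ y₂ s * (2 * densitySeries D m (2 * s)) + J := by
  have hone := L.one_lt_arg hm hy₁ hy₂ hA hwall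
  have hsum : Summable fun p : L.index m =>
      ∫ t in square, ‖L.term m y₁ y₂ (s.re : ℂ) p (x + L.trMap t)‖ :=
    (L.hasSum_index (L.summable_nonzero hm hy₁ hy₂ hA hs x).hasSum
      (L.summable_zero hm hy₁ hy₂ hwall (by linarith) hJ x).hasSum).summable
  obtain ⟨u, hu, hle⟩ := L.exists_summable_bound hm hy₁ hy₂ (by linarith) hone x hsum
  refine ⟨⟨u, hu, hle⟩, continuousOn_tsum (fun p => (L.continuous_term_translate (by linarith)
    (hone p p.2) x).continuousOn) hu hle, ?_⟩
  have hnorm : Summable fun p : L.index m =>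
      ∫ t in square, ‖L.term m y₁ y₂ s p (x + L.trMap t)‖ := by
    refine Summable.of_nonneg_of_le (fun p => integral_nonneg fun t => norm_nonneg _)
      (fun p => ?_) hsum
    exact setIntegral_mono_on (L.integrableOn_term (by linarith) (hone p p.2) x).norm
      (L.integrableOn_term (s := (s.re : ℂ)) (by simp; linarith) (hone p p.2) x).norm
      measurableSet_square fun t _ => L.norm_term_le_re (hone p p.2) _
  have h1 := hasSum_integral_of_summable_integral_norm (μ := volume.restrict square)
    (F := fun (p : L.index m) t => L.term m y₁ y₂ s p (x + L.trMap t))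
    (fun p => L.integrableOn_term (by linarith) (hone p p.2) x) hnorm
  exact h1.unique (L.hasSum_index (L.hasSum_nonzero hm hy₁ hy₂ hA hs x)
    (L.hasSum_zero_part hm hy₁ hy₂ hwall (by linarith) hJ hJs x))

end LatticeData
end HilbertGreen

/-! ### Unit orbits and Weyl chambers -/

namespace HilbertGreen
section Geometric

lemma ofReal_mul_cpow {x y : ℝ} (hx : 0 ≤ x) (hy : 0 ≤ y) (s : ℂ) :
    ((x * y : ℝ) : ℂ) ^ s = (x : ℂ) ^ s * (y : ℂ) ^ s := by
  rw [Complex.ofReal_mul, Complex.mul_cpow_ofReal_nonneg hx hy]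

lemma ofReal_pow_cpow {e : ℝ} (he : 0 < e) (k : ℕ) (s : ℂ) :
    ((e ^ k : ℝ) : ℂ) ^ s = (e : ℂ) ^ (k * s) := by
  rw [mul_comm, Complex.cpow_mul_nat, Complex.ofReal_pow]
  induction k with
  | zero => simp
  | succ k ih =>
    rw [pow_succ, pow_succ, ← ih, ← Complex.ofReal_pow, ← Complex.ofReal_mul,
      ofReal_mul_cpow (by positivity) he.le]

lemma ofReal_inv_cpow {x : ℝ} (hx : 0 < x) (s : ℂ) : ((x⁻¹ : ℝ) : ℂ) ^ s = (x : ℂ) ^ (-s) := by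
  rw [Complex.ofReal_inv, Complex.inv_cpow _ _ (by
    rw [Complex.arg_ofReal_of_nonneg hx.le]; exact Real.pi_pos.ne), ← Complex.cpow_neg]

lemma norm_unit_ratio_lt_one {e : ℝ} (he : 1 < e) {s : ℂ} (hs : 1 / 2 < s.re) :
    ‖(e : ℂ) ^ (2 - 4 * s)‖ < 1 := by
  rw [Complex.norm_cpow_eq_rpow_re_of_pos (by linarith)]
  exact Real.rpow_lt_one_of_one_lt_of_neg he (by simp; linarith)

lemma horo_ratio {e x y : ℝ} (he : 0 < e) (hx : 0 < x) (hy : 0 < y) (j : ℕ) (s : ℂ) :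
    ((((e ^ (2 * j))⁻¹ * x : ℝ) : ℂ)) ^ s * ((e ^ (2 * j) * y : ℝ) : ℂ) ^ (1 - s) =
      ((e : ℂ) ^ (2 - 4 * s)) ^ j * ((x : ℂ) ^ s * (y : ℂ) ^ (1 - s)) := by
  have he0 : (e : ℂ) ≠ 0 := by exact_mod_cast he.ne'
  rw [ofReal_mul_cpow (by positivity) hx.le, ofReal_mul_cpow (by positivity) hy.le,
    ofReal_inv_cpow (by positivity), ofReal_pow_cpow he, ofReal_pow_cpow he, ← Complex.cpow_mul_nat,
    show (2 - 4 * s) * (j : ℂ) = ((2 * j : ℕ) : ℂ) * -s + ((2 * j : ℕ) : ℂ) * (1 - s) by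
      push_cast; ring, Complex.cpow_add _ _ he0]
  ring

/-- The sum of the horocycle means over a unit orbit. -/
lemma hasSum_horoMean_units {e α β : ℝ} (he : 1 < e) (hα : 0 < α) (hαβ : α < β)
    (hβ : β < e ^ 4 * α) {s : ℂ} (hs : 1 / 2 < s.re) :
    HasSum (fun k : ℤ => horoMean s (e ^ (-(2 * k)) * β) (e ^ (2 * k) * α))
      (2 * Real.pi / (2 * s - 1) * (1 / (1 - (e : ℂ) ^ (2 - 4 * s))) *
        ((e : ℂ) ^ (2 - 4 * s) * (α : ℂ) ^ (1 - s) * (β : ℂ) ^ s + (β : ℂ) ^ (1 - s) * (α : ℂ) ^ s)) := by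
  have he0 : 0 < e := by linarith
  have hβ0 : 0 < β := hα.trans hαβ
  set q := (e : ℂ) ^ (2 - 4 * s) with hq
  have hq1 : ‖q‖ < 1 := norm_unit_ratio_lt_one he hs
  have hgeo := hasSum_geometric_of_norm_lt_one hq1
  -- The sum splits at k = 0. For k ≤ 0 the second height is the smaller one since α < β, and for k
  -- ≥ 1 the larger one since β < e⁴α; each half is geometric, the second starting with an extra
  -- factor q.
  rw [← (Equiv.neg ℤ).hasSum_iff]
  have h1 : HasSum (fun j : ℕ => horoMean s (e ^ (-(2 * (-(j : ℤ)))) * β) (e ^ (2 * (-(j : ℤ))) * α))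
      (2 * Real.pi / (2 * s - 1) * ((1 - q)⁻¹ * ((α : ℂ) ^ s * (β : ℂ) ^ (1 - s)))) := by
    refine ((hgeo.mul_right ((α : ℂ) ^ s * (β : ℂ) ^ (1 - s))).mul_left
      (2 * Real.pi / (2 * s - 1))).congr_fun fun j => ?_
    have e1 : e ^ (-(2 * (-(j : ℤ)))) = e ^ (2 * j) := by
      rw [← zpow_natCast]; congr 1; push_cast; omega
    have e2 : e ^ (2 * (-(j : ℤ))) = (e ^ (2 * j))⁻¹ := by
      rw [← zpow_natCast, ← zpow_neg]; congr 1; push_cast; omega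
    rw [e1, e2, horoMean, if_neg, horo_ratio he0 hα hβ0]
    rw [not_lt]
    have h3 : 1 ≤ e ^ (2 * j) := one_le_pow₀ he.le
    have h4 : (e ^ (2 * j))⁻¹ ≤ 1 := inv_le_one_of_one_le₀ h3
    nlinarith
  have h2 : HasSum (fun j : ℕ => horoMean s (e ^ (-(2 * (-(-((j : ℤ) + 1))))) * β)
      (e ^ (2 * (-(-((j : ℤ) + 1)))) * α))
      (2 * Real.pi / (2 * s - 1) * (q * ((1 - q)⁻¹ * ((β : ℂ) ^ s * (α : ℂ) ^ (1 - s))))) := by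
    refine (((hgeo.mul_right ((β : ℂ) ^ s * (α : ℂ) ^ (1 - s))).mul_left q).mul_left
      (2 * Real.pi / (2 * s - 1))).congr_fun fun j => ?_
    have e1 : e ^ (-(2 * (-(-((j : ℤ) + 1))))) = (e ^ (2 * (j + 1)))⁻¹ := by
      rw [← zpow_natCast, ← zpow_neg]; congr 1
    have e2 : e ^ (2 * (-(-((j : ℤ) + 1)))) = e ^ (2 * (j + 1)) := by
      rw [← zpow_natCast, neg_neg]; norm_cast
    rw [e1, e2, horoMean, if_pos, horo_ratio he0 hβ0 hα, pow_succ, ← hq]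
    · ring
    · have h3 : e ^ 4 ≤ e ^ (2 * (j + 1)) * e ^ (2 * (j + 1)) := by
        rw [← pow_add]
        exact pow_le_pow_right₀ he.le (by omega)
      rw [inv_mul_lt_iff₀ (by positivity), ← mul_assoc]
      calc β < e ^ 4 * α := hβ
        _ ≤ _ := mul_le_mul_of_nonneg_right h3 hα.le
  convert HasSum.of_nat_of_neg_add_one (f := (fun k : ℤ =>
    horoMean s (e ^ (-(2 * k)) * β) (e ^ (2 * k) * α)) ∘ Equiv.neg ℤ) h1 h2 using 1
  ring

end Geometric

section Embeddings

variable {K : Type*} [Field K] {ι ι' : K →+* ℝ}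

lemma zpow_unit_mem_integers (ε : (𝓞 K)ˣ) (k : ℤ) :
    (((ε ^ k : (𝓞 K)ˣ) : 𝓞 K) : K) = ((ε : 𝓞 K) : K) ^ k := by
  calc _ = ((Units.map (algebraMap (𝓞 K) K : 𝓞 K →* K) (ε ^ k) : Kˣ) : K) := rfl
    _ = ((Units.map (algebraMap (𝓞 K) K : 𝓞 K →* K) ε ^ k : Kˣ) : K) := by rw [map_zpow]
    _ = _ := Units.val_zpow_eq_zpow_val _ _

lemma embed_zpow_mul (ε : (𝓞 K)ˣ) (k : ℤ) (l : K) :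
    ι (((ε : 𝓞 K) : K) ^ (2 * k) * l) = ι ((ε : 𝓞 K) : K) ^ (2 * k) * ι l := by
  rw [map_mul, map_zpow₀]

lemma continuous_pairing (l : K) : Continuous (pairing ι ι' l) := by
  unfold pairing
  have h1 : Continuous fun z : ℍ × ℍ => z.1.im := UpperHalfPlane.continuous_im.comp continuous_fst
  have h2 : Continuous fun z : ℍ × ℍ => z.2.im := UpperHalfPlane.continuous_im.comp continuous_snd
  fun_prop

end Embeddings

section WeylChamber

variable {K : Type*} [Field K] [NumberField K] {ι ι' : K →+* ℝ} {D m : ℕ}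

/-- The elements of the inverse different of norm `-m/D`. -/
def wallElements (K : Type*) [Field K] [NumberField K] (D m : ℕ) : Set K :=
  {l | l ∈ inverseDifferent K ∧ Algebra.norm ℚ l = -((m : ℚ) / (D : ℚ))}

lemma mul_embed_of_mem (hK : Module.finrank ℚ K = 2) (hι : ι ≠ ι') {l : K}
    (hl : l ∈ wallElements K D m) : ι l * ι' l = -((m : ℝ) / D) := by
  rw [← norm_eq_mul hK hι, hl.2]
  push_cast
  rfl

/-- The norm of a unit is ±1, so its square is 1; this is why only even powers of ε act on the
elements of norm −m/D. -/
lemma unit_embed_mul (hK : Module.finrank ℚ K = 2) (hι : ι ≠ ι') (ε : (𝓞 K)ˣ) :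
    (ι ((ε : 𝓞 K) : K) * ι' ((ε : 𝓞 K) : K)) ^ 2 = 1 := by
  rw [← norm_int_eq_mul hK hι]
  have h : IsUnit (Algebra.norm ℤ (ε : 𝓞 K)) := ε.isUnit.map _
  rcases Int.isUnit_iff.1 h with h | h <;> simp [h]

lemma unit_zpow_mul_mem (hK : Module.finrank ℚ K = 2) (hι : ι ≠ ι') (ε : (𝓞 K)ˣ) (k : ℤ) {l : K}
    (hl : l ∈ wallElements K D m) : ((ε : 𝓞 K) : K) ^ (2 * k) * l ∈ wallElements K D m := by
  constructor
  · rw [← zpow_unit_mem_integers, ← Algebra.smul_def]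
    exact Submodule.smul_mem (inverseDifferent K : Submodule (𝓞 K) K) _ hl.1
  · have h : Algebra.norm ℚ (((ε : 𝓞 K) : K) ^ (2 * k)) = 1 := by
      have h1 : ((Algebra.norm ℚ (((ε : 𝓞 K) : K) ^ (2 * k)) : ℚ) : ℝ) = 1 := by
        rw [norm_eq_mul hK hι, map_zpow₀, map_zpow₀, ← mul_zpow, zpow_mul, zpow_ofNat,
          unit_embed_mul hK hι, one_zpow]
      exact_mod_cast h1
    rw [map_mul, h, one_mul, hl.2]

lemma neg_mem_wallElements (hK : Module.finrank ℚ K = 2) {l : K}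
    (hl : l ∈ wallElements K D m) : -l ∈ wallElements K D m := by
  refine ⟨Submodule.neg_mem (inverseDifferent K : Submodule (𝓞 K) K) hl.1, ?_⟩
  rw [← hl.2, ← neg_one_mul, map_mul]
  have : Algebra.norm ℚ (-1 : K) = 1 := by
    rw [show (-1 : K) = algebraMap ℚ K (-1) by simp, Algebra.norm_algebraMap, hK]
    norm_num
  rw [this, one_mul]

lemma embed'_zpow_mul (hK : Module.finrank ℚ K = 2) (hι : ι ≠ ι') (ε : (𝓞 K)ˣ) (k : ℤ) (l : K) :
    ι' (((ε : 𝓞 K) : K) ^ (2 * k) * l) = ι ((ε : 𝓞 K) : K) ^ (-(2 * k)) * ι' l := by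
  rw [map_mul, map_zpow₀]
  congr 1
  have h := unit_embed_mul hK hι ε
  rw [zpow_neg, ← inv_zpow, zpow_mul, zpow_mul, zpow_ofNat, zpow_ofNat]
  congr 1
  rw [inv_pow]
  rw [mul_pow] at h
  exact eq_inv_of_mul_eq_one_right h

variable {W : Set (ℍ × ℍ)}

lemma weylChamber_subset (hW : IsWeylChamber ι ι' D m W) : W ⊆ (wallSet ι ι' D m)ᶜ := by
  obtain ⟨z, -, rfl⟩ := hW
  exact connectedComponentIn_subset _ _

lemma pairing_ne_zero (hW : IsWeylChamber ι ι' D m W) {z : ℍ × ℍ} (hz : z ∈ W) {l : K}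
    (hl : l ∈ wallElements K D m) : pairing ι ι' l z ≠ 0 := fun h =>
  weylChamber_subset hW hz ⟨l, hl.1, hl.2, h⟩

/-- The sign of the linear form of an element of norm `-m/D` is constant on a Weyl chamber. -/
lemma pairing_neg_of_neg (hW : IsWeylChamber ι ι' D m W) {l : K} (hl : l ∈ wallElements K D m)
    {z z' : ℍ × ℍ} (hz : z ∈ W) (hz' : z' ∈ W) (h : pairing ι ι' l z < 0) :
    pairing ι ι' l z' < 0 := by
  by_contra hcon
  have hconn : IsPreconnected W := by
    obtain ⟨z₀, -, rfl⟩ := hW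
    exact isPreconnected_connectedComponentIn
  obtain ⟨w, hw, hw0⟩ := hconn.intermediate_value hz hz' (continuous_pairing l).continuousOn
    ⟨h.le, not_lt.1 hcon⟩
  exact pairing_ne_zero hW hw hl hw0

lemma pairing_pos_of_pos (hW : IsWeylChamber ι ι' D m W) {l : K} (hl : l ∈ wallElements K D m)
    {z z' : ℍ × ℍ} (hz : z ∈ W) (hz' : z' ∈ W) (h : 0 < pairing ι ι' l z) :
    0 < pairing ι ι' l z' := by
  rcases lt_or_gt_of_ne (pairing_ne_zero hW hz' hl) with h' | h'
  · exact absurd (pairing_neg_of_neg hW hl hz' hz h') h.le.not_gt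
  · exact h'

/-- Signs of the linear forms are constant on W, so one point z suffices. With α = λy₁ and β = −λ'y₂
the two conditions become α < β < ε⁴α, the second because ε²λ has conjugate ε⁻²λ'. -/
lemma mem_weylSet_iff (hK : Module.finrank ℚ K = 2) (hι : ι ≠ ι') (ε : (𝓞 K)ˣ)
    (hε : 1 < ι ((ε : 𝓞 K) : K))
    (hW : IsWeylChamber ι ι' D m W) {z : ℍ × ℍ} (hz : z ∈ W) (l : K) :
    l ∈ weylSet ι ι' ε D m W ↔ l ∈ wallElements K D m ∧ 0 < ι l ∧
      ι l * z.1.im < -ι' l * z.2.im ∧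
      -ι' l * z.2.im < ι ((ε : 𝓞 K) : K) ^ 4 * (ι l * z.1.im) := by
  have he0 : 0 < ι ((ε : 𝓞 K) : K) := by linarith
  have hpair : pairing ι ι' (((ε : 𝓞 K) : K) ^ 2 * l) z = (ι ((ε : 𝓞 K) : K) ^ 2)⁻¹ *
      (ι ((ε : 𝓞 K) : K) ^ 4 * (ι l * z.1.im) + ι' l * z.2.im) := by
    have h1 := embed_zpow_mul (ι := ι) ε 1 l
    have h2 := embed'_zpow_mul hK hι ε 1 l
    rw [mul_one, zpow_ofNat] at h1 h2
    rw [pairing, h1, h2, zpow_neg, zpow_ofNat]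
    field_simp
  have hsq : l ∈ wallElements K D m → ((ε : 𝓞 K) : K) ^ 2 * l ∈ wallElements K D m := fun hl => by
    have := unit_zpow_mul_mem hK hι ε 1 hl
    rwa [mul_one, zpow_ofNat] at this
  constructor
  · rintro ⟨h1, h2, h3, h4, h5⟩
    refine ⟨⟨h1, h3⟩, h2, ?_, ?_⟩
    · have := h4 z hz
      rw [pairing] at this
      linarith
    · have := h5 z hz
      rw [hpair, mul_pos_iff_of_pos_left (by positivity)] at this
      linarith
  · rintro ⟨h1, h2, h3, h4⟩
    refine ⟨h1.1, h2, h1.2, fun z' hz' => ?_, fun z' hz' => ?_⟩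
    · refine pairing_neg_of_neg hW h1 hz hz' ?_
      rw [pairing]
      linarith
    · refine pairing_pos_of_pos hW (hsq h1) hz hz' ?_
      rw [hpair, mul_pos_iff_of_pos_left (by positivity)]
      linarith

end WeylChamber
end HilbertGreen

/-! ### The sum over elements of norm −m/D; field coordinates -/

namespace HilbertGreen
section WeylSum

variable {K : Type*} [Field K] [NumberField K] {ι ι' : K →+* ℝ} {D m : ℕ} {W : Set (ℍ × ℍ)}

lemma wallElements_mul_neg (hK : Module.finrank ℚ K = 2) (hι : ι ≠ ι') [Fact D.Prime] (hm : 0 < m)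
    {l : K} (hl : l ∈ wallElements K D m) : ι l * ι' l < 0 := by
  have hD : (0 : ℝ) < D := by exact_mod_cast (Fact.out : D.Prime).pos
  have hm' : (0 : ℝ) < m := by exact_mod_cast hm
  rw [mul_embed_of_mem hK hι hl]
  exact neg_neg_of_pos (by positivity)

/-- Every element of positive embedding is moved into `R(W, m)` by an even power of the unit. -/
lemma exists_zpow_mem_weylSet (hK : Module.finrank ℚ K = 2) (hι : ι ≠ ι') [Fact D.Prime]
    (hm : 0 < m) (ε : (𝓞 K)ˣ) (hε : 1 < ι ((ε : 𝓞 K) : K)) (hW : IsWeylChamber ι ι' D m W)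
    {z : ℍ × ℍ} (hz : z ∈ W) {l : K} (hl : l ∈ wallElements K D m) (hpos : 0 < ι l) :
    ∃ k : ℤ, ((ε : 𝓞 K) : K) ^ (2 * k) * l ∈ weylSet ι ι' ε D m W := by
  have he0 : 0 < ι ((ε : 𝓞 K) : K) := by linarith
  have hneg : ι' l < 0 := by
    have := wallElements_mul_neg hK hι hm hl
    exact (mul_neg_iff.1 this).elim (fun h => h.2) fun h => absurd h.1 hpos.not_gt
  have hα : 0 < ι l * z.1.im := mul_pos hpos z.1.im_pos
  have hβ : 0 < -ι' l * z.2.im := mul_pos (by linarith) z.2.im_pos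
  set e := ι ((ε : 𝓞 K) : K) with he
  -- Multiplication by ε^(2k) divides β/α by ε^(4k), so the required power locates β/α between
  -- consecutive powers of ε⁴.
  obtain ⟨n, hn1, hn2⟩ := exists_mem_Ioc_zpow (div_pos hβ hα) (one_lt_pow₀ hε (by norm_num : 4 ≠ 0))
  refine ⟨n, ?_⟩
  have hmem := unit_zpow_mul_mem hK hι ε n hl
  have hee : (e ^ 4) ^ n = e ^ (2 * n) * e ^ (2 * n) := by
    rw [← zpow_natCast, ← zpow_mul, ← zpow_add₀ he0.ne']; congr 1; push_cast; ring
  have hen : 0 < e ^ (2 * n) := zpow_pos he0 _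
  have h1 : ι (((ε : 𝓞 K) : K) ^ (2 * n) * l) = e ^ (2 * n) * ι l := embed_zpow_mul ε n l
  have h2 : ι' (((ε : 𝓞 K) : K) ^ (2 * n) * l) = (e ^ (2 * n))⁻¹ * ι' l := by
    rw [embed'_zpow_mul hK hι ε n l, zpow_neg]
  rw [mem_weylSet_iff hK hι ε hε hW hz]
  refine ⟨hmem, by rw [h1]; positivity, ?_, ?_⟩
  · rw [h1, h2]
    rw [lt_div_iff₀ hα, hee] at hn1
    rw [← mul_neg, mul_assoc, mul_assoc, lt_inv_mul_iff₀ hen, ← mul_assoc]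
    exact hn1
  · refine lt_of_le_of_ne ?_ ?_
    · rw [h1, h2]
      rw [div_le_iff₀ hα, zpow_add_one₀ (by positivity), hee] at hn2
      rw [← mul_neg, mul_assoc, inv_mul_le_iff₀ hen]
      calc _ ≤ _ := hn2
        _ = _ := by ring
    -- The locating interval is closed on the right; equality would put z on the wall of the next
    -- element ε²·ε^(2n)λ.
    · intro heq
      have hmem2 := unit_zpow_mul_mem hK hι ε 1 hmem
      refine pairing_ne_zero hW hz hmem2 ?_
      rw [pairing, embed_zpow_mul, embed'_zpow_mul hK hι, ← he, mul_one, zpow_neg, zpow_ofNat]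
      field_simp
      linear_combination -heq

/-- The ratio β/α of an element of R(W, m) lies in (1, ε⁴), too short to contain both a ratio and
its quotient by ε^(4k) with k ≥ 1. Applied in both directions this gives uniqueness of the exponent.
-/
lemma zpow_eq_of_mem_weylSet (hK : Module.finrank ℚ K = 2) (hι : ι ≠ ι')
    (ε : (𝓞 K)ˣ) (hε : 1 < ι ((ε : 𝓞 K) : K)) (hW : IsWeylChamber ι ι' D m W)
    {z : ℍ × ℍ} (hz : z ∈ W) {l : K} {k : ℤ} (hl : l ∈ weylSet ι ι' ε D m W)
    (hlk : ((ε : 𝓞 K) : K) ^ (2 * k) * l ∈ weylSet ι ι' ε D m W) : k ≤ 0 := by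
  by_contra hk
  rw [mem_weylSet_iff hK hι ε hε hW hz] at hl hlk
  have he0 : 0 < ι ((ε : 𝓞 K) : K) := by linarith
  obtain ⟨-, hl0, -, h1⟩ := hl
  obtain ⟨-, -, h2, -⟩ := hlk
  rw [embed_zpow_mul, embed'_zpow_mul hK hι, zpow_neg] at h2
  set e := ι ((ε : 𝓞 K) : K) with he
  have hen : 0 < e ^ (2 * k) := zpow_pos he0 _
  rw [← mul_neg, mul_assoc, mul_assoc, lt_inv_mul_iff₀ hen, ← mul_assoc] at h2
  have h3 : e ^ 4 ≤ e ^ (2 * k) * e ^ (2 * k) := by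
    rw [← zpow_add₀ he0.ne', ← zpow_natCast]
    exact zpow_le_zpow_right₀ hε.le (by push_cast; omega)
  have := mul_le_mul_of_nonneg_right h3 (mul_pos hl0 z.1.im_pos).le
  linarith

/-- The parametrization `± ε^(2k) r` of the elements of norm `-m/D`. -/
def orbitMap (hK : Module.finrank ℚ K = 2) (hι : ι ≠ ι') (ε : (𝓞 K)ˣ) (D m : ℕ) (W : Set (ℍ × ℍ))
    (p : (Bool × weylSet ι ι' ε D m W) × ℤ) : wallElements K D m :=
  if p.1.1 then
    ⟨((ε : 𝓞 K) : K) ^ (2 * p.2) * (p.1.2 : K),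
      unit_zpow_mul_mem hK hι ε p.2 ⟨p.1.2.2.1, p.1.2.2.2.2.1⟩⟩
  else
    ⟨-(((ε : 𝓞 K) : K) ^ (2 * p.2) * (p.1.2 : K)), neg_mem_wallElements hK
      (unit_zpow_mul_mem hK hι ε p.2 ⟨p.1.2.2.1, p.1.2.2.2.2.1⟩)⟩

lemma orbitMap_true (hK : Module.finrank ℚ K = 2) (hι : ι ≠ ι') (ε : (𝓞 K)ˣ)
    (r : weylSet ι ι' ε D m W) (k : ℤ) :
    (orbitMap hK hι ε D m W ((true, r), k) : K) = ((ε : 𝓞 K) : K) ^ (2 * k) * (r : K) := rfl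

lemma orbitMap_false (hK : Module.finrank ℚ K = 2) (hι : ι ≠ ι') (ε : (𝓞 K)ˣ)
    (r : weylSet ι ι' ε D m W) (k : ℤ) :
    (orbitMap hK hι ε D m W ((false, r), k) : K) = -(((ε : 𝓞 K) : K) ^ (2 * k) * (r : K)) := rfl

lemma zpow_mul_injective (hK : Module.finrank ℚ K = 2) (hι : ι ≠ ι')
    (ε : (𝓞 K)ˣ) (hε : 1 < ι ((ε : 𝓞 K) : K)) (hW : IsWeylChamber ι ι' D m W)
    {z : ℍ × ℍ} (hz : z ∈ W) {l l' : K} {k k' : ℤ} (hl : l ∈ weylSet ι ι' ε D m W)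
    (hl' : l' ∈ weylSet ι ι' ε D m W)
    (h : ((ε : 𝓞 K) : K) ^ (2 * k) * l = ((ε : 𝓞 K) : K) ^ (2 * k') * l') : l = l' ∧ k = k' := by
  have he : ((ε : 𝓞 K) : K) ≠ 0 := by exact_mod_cast ε.ne_zero
  have h1 : ((ε : 𝓞 K) : K) ^ (2 * (k - k')) * l = l' := by
    rw [mul_sub, zpow_sub₀ he, div_mul_eq_mul_div, h, mul_div_assoc, mul_comm,
      div_mul_cancel₀ _ (zpow_ne_zero _ he)]
  have h2 : ((ε : 𝓞 K) : K) ^ (2 * (k' - k)) * l' = l := by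
    rw [mul_sub, zpow_sub₀ he, div_mul_eq_mul_div, ← h, mul_div_assoc, mul_comm,
      div_mul_cancel₀ _ (zpow_ne_zero _ he)]
  have e1 := zpow_eq_of_mem_weylSet hK hι ε hε hW hz hl (h1.symm ▸ hl')
  have e2 := zpow_eq_of_mem_weylSet hK hι ε hε hW hz hl' (h2.symm ▸ hl)
  have : k = k' := by omega
  subst this
  exact ⟨by simpa using h1, rfl⟩

/-- The sign of λ is the Boolean. After normalising it, ε² acts freely on the elements with λ > 0,
with R(W, m) as a fundamental domain. -/
lemma orbitMap_bijective (hK : Module.finrank ℚ K = 2) (hι : ι ≠ ι') [Fact D.Prime]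
    (hm : 0 < m) (ε : (𝓞 K)ˣ) (hε : 1 < ι ((ε : 𝓞 K) : K)) (hW : IsWeylChamber ι ι' D m W)
    {z : ℍ × ℍ} (hz : z ∈ W) : Function.Bijective (orbitMap hK hι ε D m W) := by
  have he0 : 0 < ι ((ε : 𝓞 K) : K) := by linarith
  have hpos : ∀ (r : weylSet ι ι' ε D m W) (k : ℤ), 0 < ι (((ε : 𝓞 K) : K) ^ (2 * k) * (r : K)) :=
    fun r k => by
      rw [embed_zpow_mul]
      exact mul_pos (zpow_pos he0 _) r.2.2.1
  constructor
  · rintro ⟨⟨σ, r⟩, k⟩ ⟨⟨σ', r'⟩, k'⟩ h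
    have h' := congrArg Subtype.val h
    have hp := hpos r k
    have hp' := hpos r' k'
    cases σ <;> cases σ' <;> simp only [orbitMap_true, orbitMap_false] at h'
    · obtain ⟨h1, h2⟩ := zpow_mul_injective hK hι ε hε hW hz r.2 r'.2 (neg_injective h')
      rw [Subtype.ext h1, h2]
    · rw [← h', map_neg] at hp'
      linarith
    · rw [h', map_neg] at hp
      linarith
    · obtain ⟨h1, h2⟩ := zpow_mul_injective hK hι ε hε hW hz r.2 r'.2 h'
      rw [Subtype.ext h1, h2]
  · have hfin : ∀ l ∈ wallElements K D m, 0 < ι l → ∃ (r : weylSet ι ι' ε D m W) (k : ℤ),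
        ((ε : 𝓞 K) : K) ^ (2 * k) * (r : K) = l := fun l hl h0 => by
      obtain ⟨k, hk⟩ := exists_zpow_mem_weylSet hK hι hm ε hε hW hz hl h0
      refine ⟨⟨_, hk⟩, -k, ?_⟩
      have he : ((ε : 𝓞 K) : K) ≠ 0 := by exact_mod_cast ε.ne_zero
      rw [mul_neg, zpow_neg, inv_mul_cancel_left₀ (zpow_ne_zero _ he)]
    rintro ⟨l, hl⟩
    have hne := wallElements_mul_neg hK hι hm hl
    rcases lt_or_gt_of_ne (left_ne_zero_of_mul hne.ne) with h0 | h0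
    · obtain ⟨r, k, hrk⟩ := hfin (-l) (neg_mem_wallElements hK hl) (by rw [map_neg]; linarith)
      exact ⟨((false, r), k), Subtype.ext (by rw [orbitMap_false, hrk, neg_neg])⟩
    · obtain ⟨r, k, hrk⟩ := hfin l hl h0
      exact ⟨((true, r), k), Subtype.ext (by rw [orbitMap_true, hrk])⟩

/-- The contribution of the Weyl chamber to the explicit formula. -/
def weylTerm (ι ι' : K →+* ℝ) (ε : (𝓞 K)ˣ) (D m : ℕ) (W : Set (ℍ × ℍ)) (y₁ y₂ : ℝ) (s : ℂ) : ℂ :=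
  4 * (Real.pi : ℂ) / (2 * s - 1) *
        (1 / (1 - ((ι ((ε : 𝓞 K) : K) : ℝ) : ℂ) ^ (2 - 4 * s))) *
      ∑ᶠ l ∈ weylSet ι ι' ε D m W,
        (((ι ((ε : 𝓞 K) : K) : ℝ) : ℂ) ^ (2 - 4 * s) *
            ((ι l * y₁ : ℝ) : ℂ) ^ (1 - s) * ((-ι' l * y₂ : ℝ) : ℂ) ^ s
          + ((-ι' l * y₂ : ℝ) : ℂ) ^ (1 - s) * ((ι l * y₁ : ℝ) : ℂ) ^ s)

/-- Only |λ| and |λ'| enter, so ±λ contribute equally, turning 2π into 4π; what remains is a finite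
sum over R(W, m) of two-sided geometric sums. -/
lemma hasSum_wallElements (hK : Module.finrank ℚ K = 2) (hι : ι ≠ ι') [Fact D.Prime]
    (hm : 0 < m) (ε : (𝓞 K)ˣ) (hε : 1 < ι ((ε : 𝓞 K) : K)) (hW : IsWeylChamber ι ι' D m W)
    (hfin : (weylSet ι ι' ε D m W).Finite)
    {z : ℍ × ℍ} (hz : z ∈ W) {s : ℂ} (hs : 1 / 2 < s.re) :
    HasSum (fun l : wallElements K D m => horoMean s (|ι' l| * z.2.im) (|ι l| * z.1.im))
      (weylTerm ι ι' ε D m W z.1.im z.2.im s) := by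
  have he0 : 0 < ι ((ε : 𝓞 K) : K) := by linarith
  have := hfin.fintype
  rw [← (Equiv.ofBijective _ (orbitMap_bijective hK hι hm ε hε hW hz)).hasSum_iff]
  have hval : ∀ p : (Bool × weylSet ι ι' ε D m W) × ℤ,
      |ι' (orbitMap hK hι ε D m W p : K)| =
        ι ((ε : 𝓞 K) : K) ^ (-(2 * p.2)) * -ι' (p.1.2 : K) ∧
      |ι (orbitMap hK hι ε D m W p : K)| =
        ι ((ε : 𝓞 K) : K) ^ (2 * p.2) * ι (p.1.2 : K) := by
    rintro ⟨⟨σ, r⟩, k⟩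
    have hr := (mem_weylSet_iff hK hι ε hε hW hz r).1 r.2
    have hr' : ι' (r : K) < 0 :=
      (mul_neg_iff.1 (wallElements_mul_neg hK hι hm hr.1)).elim (fun h => h.2)
        fun h => absurd h.1 hr.2.1.not_gt
    have h1 : |ι' (((ε : 𝓞 K) : K) ^ (2 * k) * (r : K))| =
        ι ((ε : 𝓞 K) : K) ^ (-(2 * k)) * -ι' (r : K) := by
      rw [embed'_zpow_mul hK hι, abs_mul, abs_of_pos (zpow_pos he0 _), abs_of_neg hr']
    have h2 : |ι (((ε : 𝓞 K) : K) ^ (2 * k) * (r : K))| =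
        ι ((ε : 𝓞 K) : K) ^ (2 * k) * ι (r : K) := by
      rw [embed_zpow_mul, abs_mul, abs_of_pos (zpow_pos he0 _), abs_of_pos hr.2.1]
    cases σ
    · simp only [orbitMap_false, map_neg, abs_neg]
      exact ⟨h1, h2⟩
    · simp only [orbitMap_true]
      exact ⟨h1, h2⟩
  have key := hasSum_prod_of_finite
    (F := (fun l : wallElements K D m => horoMean s (|ι' l| * z.2.im) (|ι l| * z.1.im)) ∘
      orbitMap hK hι ε D m W)
    (g := fun a : Bool × weylSet ι ι' ε D m W => 2 * Real.pi / (2 * s - 1) *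
      (1 / (1 - ((ι ((ε : 𝓞 K) : K) : ℝ) : ℂ) ^ (2 - 4 * s))) *
        (((ι ((ε : 𝓞 K) : K) : ℝ) : ℂ) ^ (2 - 4 * s) *
            ((ι (a.2 : K) * z.1.im : ℝ) : ℂ) ^ (1 - s) * ((-ι' (a.2 : K) * z.2.im : ℝ) : ℂ) ^ s
          + ((-ι' (a.2 : K) * z.2.im : ℝ) : ℂ) ^ (1 - s) * ((ι (a.2 : K) * z.1.im : ℝ) : ℂ) ^ s))
    fun a => by
      have hr := (mem_weylSet_iff hK hι ε hε hW hz (a.2 : K)).1 a.2.2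
      refine (hasSum_horoMean_units hε (mul_pos hr.2.1 z.1.im_pos) hr.2.2.1 hr.2.2.2 hs).congr_fun
        fun k => ?_
      simp only [Function.comp, (hval (a, k)).1, (hval (a, k)).2]
      rw [mul_assoc, mul_assoc]
  suffices hval' : weylTerm ι ι' ε D m W z.1.im z.2.im s = _ by
    rw [hval']
    exact key
  rw [Fintype.sum_prod_type, Fintype.sum_bool, weylTerm, finsum_mem_eq_finite_toFinset_sum _ hfin,
    ← Finset.mul_sum, ← two_mul, ← hfin.toFinset.sum_coe_sort]
  have hsum : ∀ f : K → ℂ, ∑ x : hfin.toFinset, f x = ∑ x : weylSet ι ι' ε D m W, f x := fun f =>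
    Fintype.sum_equiv (Equiv.subtypeEquivRight fun x => by simp) _ _ fun x => rfl
  rw [hsum (fun l => ((ι ((ε : 𝓞 K) : K) : ℝ) : ℂ) ^ (2 - 4 * s) *
            ((ι l * z.1.im : ℝ) : ℂ) ^ (1 - s) * ((-ι' l * z.2.im : ℝ) : ℂ) ^ s
          + ((-ι' l * z.2.im : ℝ) : ℂ) ^ (1 - s) * ((ι l * z.1.im : ℝ) : ℂ) ^ s)]
  ring

end WeylSum

section Coordinates

variable {K : Type*} [Field K] [NumberField K] {ι ι' : K →+* ℝ} {D m : ℕ} {W : Set (ℍ × ℍ)}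
  (hK : Module.finrank ℚ K = 2) (hD : NumberField.discr K = (D : ℤ))
  (hι : ι ≠ ι') (b : Module.Basis (Fin 2) ℤ (𝓞 K))

lemma norm_dualEquiv_iff [Fact D.Prime] (n : ℤ × ℤ) (a c : ℤ) :
    ((a : ℚ) * c - Algebra.norm ℚ (dualEquiv hK hD hι b n : K) = (m : ℚ) / D) ↔
      D * a * c + (fieldLattice hK hD hι b).q n = m := by
  rw [← LatticeData.q_eq_iff, ← dualEquiv_embed, ← dualEquiv_embed', ← norm_eq_mul hK hι]
  constructor
  · intro h
    have := congrArg (Rat.cast : ℚ → ℝ) h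
    push_cast at this
    exact this
  · intro h
    apply Rat.cast_injective (α := ℝ)
    push_cast
    exact h

/-- The elements of norm `-m/D` in coordinates. -/
def wallEquiv [Fact D.Prime] :
    {n : ℤ × ℤ // (fieldLattice hK hD hι b).q n = m} ≃ wallElements K D m :=
  ((dualEquiv hK hD hι b).subtypeEquiv (q := fun l : {l : K // l ∈ inverseDifferent K} =>
    Algebra.norm ℚ (l : K) = -((m : ℚ) / D)) fun n => by
      have h := norm_dualEquiv_iff (m := m) hK hD hι b n 0 0
      simp only [mul_zero, zero_add, Int.cast_zero, zero_sub] at h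
      rw [← h, neg_eq_iff_eq_neg]).trans
    (Equiv.subtypeSubtypeEquivSubtypeInter (fun l : K => l ∈ inverseDifferent K)
      fun l => Algebra.norm ℚ l = -((m : ℚ) / D))

lemma wallEquiv_coe [Fact D.Prime] (n : {n : ℤ × ℤ // (fieldLattice hK hD hι b).q n = m}) :
    (wallEquiv hK hD hι b n : K) = dualEquiv hK hD hι b n := rfl

/-- The index set of the Green function in coordinates. -/
def greenEquiv [Fact D.Prime] : (fieldLattice hK hD hι b).index m ≃ greenIndex K D m :=
  Equiv.ofBijective (fun p => ⟨(p.1.1, p.1.2.1, (dualEquiv hK hD hι b p.1.2.2 : K)),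
    (dualEquiv hK hD hι b p.1.2.2).2, (norm_dualEquiv_iff hK hD hι b _ _ _).2 p.2⟩) <| by
    constructor
    · rintro ⟨⟨a, c, n⟩, hp⟩ ⟨⟨a', c', n'⟩, hp'⟩ h
      have h' := congrArg Subtype.val h
      simp only [Prod.mk.injEq] at h'
      obtain ⟨h1, h2, h3⟩ := h'
      have h4 := (dualEquiv hK hD hι b).injective (Subtype.ext h3)
      exact Subtype.ext (Prod.ext h1 (Prod.ext h2 h4))
    · rintro ⟨⟨a, c, l⟩, hl, hp⟩
      obtain ⟨n, hn⟩ := (dualEquiv hK hD hι b).surjective ⟨l, hl⟩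
      have hn' : (dualEquiv hK hD hι b n : K) = l := congrArg Subtype.val hn
      refine ⟨⟨(a, c, n), (norm_dualEquiv_iff hK hD hι b n a c).1 ?_⟩, ?_⟩
      · rw [hn']
        exact hp
      · simp only [hn']

/-- The product λλ' is fixed and the ratio β/α is bounded on both sides at any point of W, so both
conjugates are bounded and only finitely many lattice points qualify. -/
lemma finite_weylSet [Fact D.Prime] (hK : Module.finrank ℚ K = 2)
    (hD : NumberField.discr K = (D : ℤ)) (hι : ι ≠ ι') (b : Module.Basis (Fin 2) ℤ (𝓞 K))
    (ε : (𝓞 K)ˣ) (hε : 1 < ι ((ε : 𝓞 K) : K))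
    (hW : IsWeylChamber ι ι' D m W) : (weylSet ι ι' ε D m W).Finite := by
  obtain ⟨z, hz⟩ : W.Nonempty := by
    obtain ⟨z, hz, rfl⟩ := hW
    exact ⟨z, mem_connectedComponentIn hz⟩
  set L := fieldLattice hK hD hι b with hL
  obtain ⟨C, hC, H⟩ := L.coords_sq_le
  set e := ι ((ε : 𝓞 K) : K) with he
  have he0 : 0 < e := by linarith
  have hy1 := z.1.im_pos
  have hy2 := z.2.im_pos
  set r := C * ((m : ℝ) / D * (z.2.im / z.1.im) + e ^ 4 * ((m : ℝ) / D) * (z.1.im / z.2.im)) with hr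
  have hfin := (LatticeData.finite_of_sq_le r).preimage
    (f := fun n : ℤ × ℤ => ((0 : ℤ), (0 : ℤ), n)) (fun _ _ _ _ h => by simpa using h)
  refine (hfin.image fun n => (dualEquiv hK hD hι b n : K)).subset fun l hl => ?_
  obtain ⟨n, hn⟩ := (dualEquiv hK hD hι b).surjective ⟨l, hl.1⟩
  have hn' : (dualEquiv hK hD hι b n : K) = l := congrArg Subtype.val hn
  refine ⟨n, ?_, hn'⟩
  rw [mem_weylSet_iff hK hι ε hε hW hz] at hl
  obtain ⟨h0, h1, h2, h3⟩ := hl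
  have hmul := mul_embed_of_mem hK hι h0
  have e1 : L.lam n = ι l := by rw [← hn', dualEquiv_embed]
  have e2 : L.lam' n = ι' l := by rw [← hn', dualEquiv_embed']
  have hneg : 0 < -ι' l := by
    by_contra hcon
    nlinarith [mul_pos h1 hy1]
  have b1 : ι l ^ 2 ≤ (m : ℝ) / D * (z.2.im / z.1.im) := by
    rw [← mul_div_assoc, le_div_iff₀ hy1]
    have := mul_lt_mul_of_pos_left h2 h1
    nlinarith
  have b2 : ι' l ^ 2 ≤ e ^ 4 * ((m : ℝ) / D) * (z.1.im / z.2.im) := by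
    rw [← mul_div_assoc, le_div_iff₀ hy2]
    have := mul_lt_mul_of_pos_left h3 hneg
    calc ι' l ^ 2 * z.2.im = -ι' l * (-ι' l * z.2.im) := by ring
      _ ≤ -ι' l * (e ^ 4 * (ι l * z.1.im)) := this.le
      _ = e ^ 4 * (-(ι l * ι' l)) * z.1.im := by ring
      _ = _ := by rw [hmul, neg_neg]
  have hb := H n
  rw [e1, e2] at hb
  change ((0 : ℤ) : ℝ) ^ 2 + ((0 : ℤ) : ℝ) ^ 2 + (n.1 : ℝ) ^ 2 + (n.2 : ℝ) ^ 2 ≤ r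
  have := mul_le_mul_of_nonneg_left (add_le_add b1 b2) hC.le
  push_cast
  linarith

end Coordinates
end HilbertGreen

/-! ### Convergence of the Green function and its mean -/

namespace HilbertGreen
section Mean

open MeasureTheory LatticeData

lemma translate_zero {K : Type*} [Field K] {ι ι' : K →+* ℝ} (b : Module.Basis (Fin 2) ℤ (𝓞 K))
    (z : ℍ × ℍ) : translate ι ι' b 0 z = z := by
  simp [translate]

variable {K : Type*} [Field K] [NumberField K] {ι ι' : K →+* ℝ} {D m : ℕ} {W : Set (ℍ × ℍ)}

/-- The constant term of the Green function before the functional equation of `L(s, χ_D)` is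
applied. It is regular for `Re s > 1/2`, `s ≠ 1`. -/
def greenMean (ι ι' : K →+* ℝ) (ε : (𝓞 K)ˣ) (D m : ℕ) [Fact D.Prime] (W : Set (ℍ × ℍ))
    (y₁ y₂ : ℝ) (s : ℂ) : ℂ :=
  planeConst D m y₁ y₂ s * (2 * densitySeries D m (2 * s)) + weylTerm ι ι' ε D m W y₁ y₂ s

lemma greenTerm_translate [Fact D.Prime] (hK : Module.finrank ℚ K = 2)
    (hD : NumberField.discr K = (D : ℤ)) (hι : ι ≠ ι') (b : Module.Basis (Fin 2) ℤ (𝓞 K))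
    (s : ℂ) (z : ℍ × ℍ) (t : ℝ × ℝ) (p : (fieldLattice hK hD hι b).index m) :
    greenTerm ι ι' D m s (translate ι ι' b t z) (greenEquiv hK hD hι b p) =
      (fieldLattice hK hD hι b).term m z.1.im z.2.im s p
        ((z.1.re, z.2.re) + (fieldLattice hK hD hι b).trMap t) := by
  have h1 : (((translate ι ι' b t z).1 : ℍ) : ℂ) =
      (((z.1.re, z.2.re) + (fieldLattice hK hD hι b).trMap t).1 : ℝ) + z.1.im * Complex.I := by
    rw [LatticeData.trMap_apply, translate, UpperHalfPlane.coe_vadd]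
    conv_lhs => rw [← Complex.re_add_im (z.1 : ℂ)]
    simp only [LatticeData.tr₁, fieldLattice, Prod.fst_add, UpperHalfPlane.coe_re,
      UpperHalfPlane.coe_im]
    push_cast
    ring
  have h2 : (((translate ι ι' b t z).2 : ℍ) : ℂ) =
      (((z.1.re, z.2.re) + (fieldLattice hK hD hι b).trMap t).2 : ℝ) + z.2.im * Complex.I := by
    rw [LatticeData.trMap_apply, translate, UpperHalfPlane.coe_vadd]
    conv_lhs => rw [← Complex.re_add_im (z.2 : ℂ)]
    simp only [LatticeData.tr₂, fieldLattice, Prod.snd_add, UpperHalfPlane.coe_re,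
      UpperHalfPlane.coe_im]
    push_cast
    ring
  have i1 : (translate ι ι' b t z).1.im = z.1.im := UpperHalfPlane.vadd_im _ _
  have i2 : (translate ι ι' b t z).2.im = z.2.im := UpperHalfPlane.vadd_im _ _
  rw [greenTerm, LatticeData.term, LatticeData.arg, h1, h2, i1, i2, ← dualEquiv_embed hK hD hι b,
    ← dualEquiv_embed' hK hD hι b]
  rfl

lemma greenFunction_translate [Fact D.Prime] (hK : Module.finrank ℚ K = 2)
    (hD : NumberField.discr K = (D : ℤ)) (hι : ι ≠ ι') (b : Module.Basis (Fin 2) ℤ (𝓞 K))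
    (s : ℂ) (z : ℍ × ℍ) (t : ℝ × ℝ) :
    greenFunction ι ι' D m s (translate ι ι' b t z) =
      ∑' p : (fieldLattice hK hD hι b).index m,
        (fieldLattice hK hD hι b).term m z.1.im z.2.im s p
          ((z.1.re, z.2.re) + (fieldLattice hK hD hι b).trMap t) := by
  rw [greenFunction, ← (greenEquiv hK hD hι b).tsum_eq]
  exact tsum_congr fun p => greenTerm_translate hK hD hι b s z t p

/-- Convergence of the Green function for `Re s > 1` and the value of its mean. -/
theorem green_mean [Fact D.Prime] (hK : Module.finrank ℚ K = 2)
    (hD : NumberField.discr K = (D : ℤ)) (hι : ι ≠ ι') (ε : (𝓞 K)ˣ)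
    (hε : 1 < ι ((ε : 𝓞 K) : K)) (b : Module.Basis (Fin 2) ℤ (𝓞 K)) (hm : 0 < m)
    (hW : IsWeylChamber ι ι' D m W) {z : ℍ × ℍ} (hz : z ∈ W)
    (hA : (m : ℝ) / D < z.1.im * z.2.im) {s : ℂ} (hs : 1 < s.re) :
    (Summable fun p : greenIndex K D m => greenTerm ι ι' D m s z p) ∧
    IntegrableOn (fun t : ℝ × ℝ => greenFunction ι ι' D m s (translate ι ι' b t z))
      (Set.Icc (0 : ℝ) 1 ×ˢ Set.Icc (0 : ℝ) 1) ∧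
    constantTerm ι ι' b (greenFunction ι ι' D m s) z =
      greenMean ι ι' ε D m W z.1.im z.2.im s := by
  have hfin := finite_weylSet hK hD hι b ε hε hW
  set L := fieldLattice hK hD hι b with hL
  have hwall : ∀ n, L.q n = m → L.lam n * z.1.im + L.lam' n * z.2.im ≠ 0 := fun n hn => by
    have := pairing_ne_zero hW hz (wallEquiv hK hD hι b ⟨n, hn⟩).2
    rwa [pairing, wallEquiv_coe, dualEquiv_embed, dualEquiv_embed'] at this
  have hsum : ∀ w : ℂ, 1 / 2 < w.re → HasSum (fun n : {n : ℤ × ℤ // L.q n = m} =>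
      horoMean w (|L.lam' n| * z.2.im) (|L.lam n| * z.1.im))
      (weylTerm ι ι' ε D m W z.1.im z.2.im w) := fun w hw => by
    have := hasSum_wallElements hK hι hm ε hε hW hfin hz hw
    rw [← (wallEquiv hK hD hι b).hasSum_iff] at this
    refine this.congr_fun fun n => ?_
    simp only [Function.comp, wallEquiv_coe, dualEquiv_embed, dualEquiv_embed', hL]
  obtain ⟨⟨u, hu, hle⟩, hcont, hint⟩ := L.hasSum_mean hm z.1.im_pos z.2.im_pos hA hwall hs
    (hsum (s.re : ℂ) (by rw [Complex.ofReal_re]; linarith)).summable (hsum s (by linarith))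
    (z.1.re, z.2.re)
  refine ⟨?_, ?_, ?_⟩
  · rw [← (greenEquiv hK hD hι b).summable_iff]
    refine (Summable.of_norm_bounded hu fun p =>
      hle p 0 ⟨⟨le_rfl, zero_le_one⟩, ⟨le_rfl, zero_le_one⟩⟩).congr fun p => ?_
    rw [← greenTerm_translate hK hD hι b, translate_zero]
    rfl
  · simp only [greenFunction_translate hK hD hι b]
    exact hcont.integrableOn_compact isCompact_square
  · simp only [constantTerm, greenFunction_translate hK hD hι b]
    exact hint

end Mean
end HilbertGreen

/-! ### The explicit form of the first term -/

namespace HilbertGreen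
section Explicit

open LatticeData Complex

/-- The character sum is invariant under d ↦ m/d, so the substitution exchanges the exponents −s and
s at the cost of m^(-s). -/
lemma sum_divisors_symm {D : ℕ} [Fact D.Prime] {m : ℕ} (hm : 0 < m) (s : ℂ) :
    ∑ d ∈ m.divisors, (d : ℂ) ^ (-s) * (chiD D (d : ZMod D) + chiD D ((m / d : ℕ) : ZMod D)) =
      (m : ℂ) ^ (-s) *
        ∑ d ∈ m.divisors, (d : ℂ) ^ s * (chiD D (d : ZMod D) + chiD D ((m / d : ℕ) : ZMod D)) := by
  rw [← Nat.sum_div_divisors, Finset.mul_sum]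
  refine Finset.sum_congr rfl fun d hd => ?_
  have hdvd := Nat.dvd_of_mem_divisors hd
  have hd0 : d ≠ 0 := (Nat.pos_of_mem_divisors hd).ne'
  have hmd : (m : ℂ) ^ (-s) = (d : ℂ) ^ (-s) * ((m / d : ℕ) : ℂ) ^ (-s) := by
    rw [← natCast_mul_natCast_cpow, ← Nat.cast_mul, Nat.mul_div_cancel' hdvd]
  have hdd : (d : ℂ) ^ (-s) * (d : ℂ) ^ s = 1 := by
    rw [← cpow_add _ _ (by exact_mod_cast hd0), neg_add_cancel, cpow_zero]
  rw [hmd, Nat.div_div_self hdvd hm.ne']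
  linear_combination (-((m / d : ℕ) : ℂ) ^ (-s) *
    (chiD D (d : ZMod D) + chiD D ((m / d : ℕ) : ZMod D))) * hdd

/-- The functional equation replaces 1/L(2s, χ_D) by 1/L(1 − 2s, χ_D), and the divisor symmetry
turns the finite sum into σ_m(2s − 1). At s = 3/2 + k the right side degenerates, so these points
are excluded. -/
lemma planeConst_mul_densitySeries {D : ℕ} [Fact D.Prime] (hD4 : D % 4 = 1) {m : ℕ} (hm : 0 < m)
    {y₁ y₂ : ℝ} (hy₁ : 0 < y₁) (hy₂ : 0 < y₂) {s : ℂ} (hs : 1 / 2 < s.re)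
    (hs' : ∀ k : ℕ, s ≠ 3 / 2 + k) :
    planeConst D m y₁ y₂ s * (2 * densitySeries D m (2 * s)) =
      2 * riemannZeta (2 * s - 1) * phiM D m s *
        ((Real.pi ^ 2 * y₁ * y₂ / (D : ℝ) : ℝ) : ℂ) ^ (1 - s) := by
  have hD0 : (0 : ℝ) < D := by exact_mod_cast (Fact.out : D.Prime).pos
  have hDc : (D : ℂ) ≠ 0 := by exact_mod_cast hD0.ne'
  have hmc : (m : ℂ) ≠ 0 := by exact_mod_cast hm.ne'
  have hpre := prefactor_eq hD4 hs hs'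
  have hπ : ((Real.pi ^ 2 * y₁ * y₂ / (D : ℝ) : ℝ) : ℂ) ^ (1 - s) =
      ((Real.pi ^ 2 / D : ℝ) : ℂ) ^ (1 - s) * ((y₁ * y₂ : ℝ) : ℂ) ^ (1 - s) := by
    rw [← ofReal_mul_cpow (by positivity) (by positivity)]
    congr 2
    ring
  have hDs : (((m : ℝ) / D : ℝ) : ℂ) ^ s * ((√D)⁻¹ : ℝ) = (m : ℂ) ^ s * (D : ℂ) ^ (-s - 1 / 2) := by
    have h1 : (((m : ℝ) / D : ℝ) : ℂ) ^ s = (m : ℂ) ^ s * (D : ℂ) ^ (-s) := by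
      rw [div_eq_mul_inv, ofReal_mul_cpow (by positivity) (by positivity), ofReal_inv_cpow hD0,
        ofReal_natCast, ofReal_natCast]
    have h2 : ((√D)⁻¹ : ℝ) = (D : ℂ) ^ (-(1 / 2) : ℂ) := by
      rw [Real.sqrt_eq_rpow, ← Real.rpow_neg hD0.le, ofReal_cpow hD0.le]
      push_cast
      rfl
    rw [h1, h2, mul_assoc, ← cpow_add _ _ hDc]
    rfl
  have hmm : (m : ℂ) ^ s * (m : ℂ) ^ (-(2 * s - 1)) = (m : ℂ) ^ ((1 - (2 * s - 1)) / 2) := by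
    rw [← cpow_add _ _ hmc]
    congr 1
    ring
  have hsum := sum_divisors_symm (D := D) hm (2 * s - 1)
  rw [planeConst, densitySeries, phiM, sigmaM, hπ, ← hmm, show 1 - 2 * s = -(2 * s - 1) by ring,
    hsum]
  rw [show 1 - 2 * s = -(2 * s - 1) by ring] at hpre
  set S := ∑ d ∈ m.divisors, (d : ℂ) ^ (2 * s - 1) *
    (chiD D (d : ZMod D) + chiD D ((m / d : ℕ) : ZMod D))
  linear_combination (2 * riemannZeta (2 * s - 1) * (m : ℂ) ^ s * (m : ℂ) ^ (-(2 * s - 1)) * S *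
    ((y₁ * y₂ : ℝ) : ℂ) ^ (1 - s) * Gamma (s - 1 / 2)) * hpre +
    (2 * Real.pi / (2 * s - 1) * ((y₁ * y₂ : ℝ) : ℂ) ^ (1 - s) *
      ((√Real.pi : ℝ) * Gamma (s - 1 / 2) / Gamma s) * (2 * (riemannZeta (2 * s - 1) /
        DirichletCharacter.LFunction (chiD D) (2 * s) * ((m : ℂ) ^ (-(2 * s - 1)) * S)))) * hDs

variable {K : Type*} [Field K] [NumberField K] {ι ι' : K →+* ℝ} {D m : ℕ} {W : Set (ℍ × ℍ)}

lemma greenMean_eq_explicitTerm [Fact D.Prime] (hD4 : D % 4 = 1) (hm : 0 < m) (ε : (𝓞 K)ˣ)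
    {y₁ y₂ : ℝ} (hy₁ : 0 < y₁) (hy₂ : 0 < y₂) {s : ℂ} (hs : 1 / 2 < s.re)
    (hs' : ∀ k : ℕ, s ≠ 3 / 2 + k) :
    greenMean ι ι' ε D m W y₁ y₂ s = explicitTerm ι ι' ε D m W y₁ y₂ s := by
  rw [greenMean, explicitTerm, planeConst_mul_densitySeries hD4 hm hy₁ hy₂ hs hs', weylTerm]

end Explicit
end HilbertGreen

/-! ### Holomorphy of parametric integrals; the punctured half plane -/

namespace HilbertGreen
section ParametricIntegral

open MeasureTheory Complex Metric

/-- The integral over a compact set of a jointly continuous function that is holomorphic in the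
parameter is holomorphic in the parameter. -/
lemma differentiableOn_integral_of_continuousOn {α : Type*} [TopologicalSpace α]
    [MeasurableSpace α] [OpensMeasurableSpace α] [TopologicalSpace.MetrizableSpace α]
    {μ : Measure α} [IsFiniteMeasureOnCompacts μ] {U : Set ℂ} (hU : IsOpen U)
    {S : Set α} (hS : IsCompact S) (hSm : MeasurableSet S) {F : ℂ → α → ℂ}
    (hc : ContinuousOn (fun q : ℂ × α => F q.1 q.2) (U ×ˢ S))
    (hd : ∀ t ∈ S, DifferentiableOn ℂ (fun s => F s t) U) :
    DifferentiableOn ℂ (fun s => ∫ t in S, F s t ∂μ) U := by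
  intro s₀ hs₀
  obtain ⟨r, hr, hball⟩ : ∃ r > 0, closedBall s₀ (2 * r) ⊆ U := by
    obtain ⟨r, hr, h⟩ := nhds_basis_closedBall.mem_iff.1 (hU.mem_nhds hs₀)
    exact ⟨r / 2, by positivity, by rwa [mul_div_cancel₀ _ two_ne_zero]⟩
  obtain ⟨M, hM⟩ := ((isCompact_closedBall s₀ (2 * r)).prod hS).exists_bound_of_continuousOn
    (hc.mono (Set.prod_mono hball subset_rfl))
  have hcs : ∀ s ∈ U, ContinuousOn (F s) S := fun s hs =>
    hc.comp (by fun_prop : ContinuousOn (fun t => (s, t)) S) fun t ht => ⟨hs, ht⟩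
  have hmeas : ∀ s ∈ U, AEStronglyMeasurable (F s) (μ.restrict S) := fun s hs =>
    (hcs s hs).aestronglyMeasurable_of_isCompact hS hSm
  have hsub : ball s₀ r ⊆ U := (ball_subset_closedBall.trans
    (closedBall_subset_closedBall (by linarith))).trans hball
  have hderiv : ∀ t ∈ S, ∀ s ∈ ball s₀ r, HasDerivAt (fun s => F s t) (deriv (fun s => F s t) s) s :=
    fun t ht s hs => ((hd t ht).differentiableAt (hU.mem_nhds (hsub hs))).hasDerivAt
  -- The derivative is measurable in t as a pointwise limit of difference quotients along a sequence
  -- of steps tending to 0 inside the disc.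
  have hF' : AEStronglyMeasurable (fun t => deriv (fun s => F s t) s₀) (μ.restrict S) := by
    set h : ℕ → ℂ := fun n => ((r / 2 * (1 / ((n : ℝ) + 1)) : ℝ) : ℂ) with hh
    have hh0 : ∀ n, h n ≠ 0 := fun n => by
      simp only [hh]
      exact ofReal_ne_zero.2 (by positivity)
    have hlim : Filter.Tendsto h Filter.atTop (𝓝 0) := by
      have := (tendsto_one_div_add_atTop_nhds_zero_nat (𝕜 := ℝ)).const_mul (r / 2)
      rw [mul_zero] at this
      exact (continuous_ofReal.tendsto' 0 0 ofReal_zero).comp this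
    have hmem : ∀ n, s₀ + h n ∈ U := fun n => hsub <| by
      rw [mem_ball, dist_self_add_left, hh, norm_real, Real.norm_of_nonneg (by positivity)]
      have : 1 / ((n : ℝ) + 1) ≤ 1 := by
        rw [div_le_one (by positivity)]
        linarith [n.cast_nonneg (α := ℝ)]
      nlinarith
    refine aestronglyMeasurable_of_tendsto_ae Filter.atTop
      (f := fun n t => (h n)⁻¹ • (F (s₀ + h n) t - F s₀ t))
      (fun n => ((hmeas _ (hmem n)).sub (hmeas _ hs₀)).const_smul (h n)⁻¹) ?_
    refine (ae_restrict_iff' hSm).2 (ae_of_all _ fun t ht => ?_)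
    have := hasDerivAt_iff_tendsto_slope_zero.1 (hderiv t ht s₀ (mem_ball_self hr))
    exact this.comp (tendsto_nhdsWithin_iff.2 ⟨hlim, Filter.Eventually.of_forall hh0⟩)
  have := hasDerivAt_integral_of_dominated_loc_of_deriv_le (μ := μ.restrict S) (F := F)
    (F' := fun s t => deriv (fun s => F s t) s) (bound := fun _ => M / r) (ball_mem_nhds s₀ hr)
    (Filter.eventually_of_mem (hU.mem_nhds hs₀) hmeas)
    ((hcs s₀ hs₀).integrableOn_compact hS) hF'
    ((ae_restrict_iff' hSm).2 (ae_of_all _ fun t ht s hs => ?_))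
    (integrableOn_const hS.measure_ne_top)
    ((ae_restrict_iff' hSm).2 (ae_of_all _ fun t ht s hs => hderiv t ht s hs))
  · exact this.2.differentiableAt.differentiableWithinAt
  · have hcl : closedBall s r ⊆ closedBall s₀ (2 * r) :=
      closedBall_subset_closedBall' (by rw [mem_ball] at hs; linarith)
    -- Cauchy's estimate on discs of radius r, contained in the disc of radius 2r where F is bounded
    -- by M.
    refine norm_deriv_le_of_forall_mem_sphere_norm_le hr ?_ fun w hw =>
      hM (w, t) ⟨hcl (sphere_subset_closedBall hw), ht⟩
    refine DifferentiableOn.diffContOnCl ?_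
    rw [closure_ball s hr.ne']
    exact (hd t ht).mono (hcl.trans hball)

end ParametricIntegral

section Domain

open Complex

lemma isOpen_punctured_halfPlane {c : ℝ} : IsOpen {s : ℂ | c < s.re ∧ s ≠ 1} :=
  (isOpen_lt continuous_const continuous_re).inter isOpen_compl_singleton

/-- The domain is a union of four convex pieces, the parts above and below the real axis and those
to the right and left of Re s = 1, joined through common points. -/
lemma isPreconnected_punctured_halfPlane {c : ℝ} (hc : c < 1) :
    IsPreconnected {s : ℂ | c < s.re ∧ s ≠ 1} := by
  have h1 : Convex ℝ {s : ℂ | c < s.re ∧ 0 < s.im} :=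
    (convex_halfSpace_re_gt c).inter (convex_halfSpace_im_gt 0)
  have h2 : Convex ℝ {s : ℂ | c < s.re ∧ s.im < 0} :=
    (convex_halfSpace_re_gt c).inter (convex_halfSpace_im_lt 0)
  have h3 : Convex ℝ {s : ℂ | 1 < s.re} := convex_halfSpace_re_gt 1
  have h4 : Convex ℝ {s : ℂ | c < s.re ∧ s.re < 1} :=
    (convex_halfSpace_re_gt c).inter (convex_halfSpace_re_lt 1)
  have h5 := (h1.isPreconnected.union ⟨2, 1⟩ (by constructor <;> (simp; try linarith))
    (by simp) h3.isPreconnected).union ⟨2, -1⟩ (by right; simp)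
    (by constructor <;> (simp; try linarith)) h2.isPreconnected
  have h6 := h5.union ⟨(c + 1) / 2, 1⟩ (by left; left; refine ⟨?_, ?_⟩ <;> (simp; try linarith))
    (by constructor <;> (simp; try linarith)) h4.isPreconnected
  convert h6 using 1
  ext s
  simp only [Set.mem_ofPred_eq, Set.mem_union]
  constructor
  · rintro ⟨h, hs⟩
    rcases lt_trichotomy s.im 0 with him | him | him
    · exact Or.inl (Or.inr ⟨h, him⟩)
    · rcases lt_trichotomy s.re 1 with hre | hre | hre
      · exact Or.inr ⟨h, hre⟩
      · exact absurd (Complex.ext hre him) hs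
      · exact Or.inl (Or.inl (Or.inr hre))
    · exact Or.inl (Or.inl (Or.inl ⟨h, him⟩))
  · rintro (((h | h) | h) | h)
    · exact ⟨h.1, fun e => by rw [e] at h; simp at h⟩
    · exact ⟨by linarith, fun e => by rw [e] at h; simp at h⟩
    · exact ⟨h.1, fun e => by rw [e] at h; simp at h⟩
    · exact ⟨h.1, fun e => by rw [e] at h; simp at h⟩

/-- The excluded points are zeros of the entire function 1/Γ(3/2 − s). It is not identically zero,
having value 1 at s = 1/2, so its zeros are isolated. -/
lemma eventually_ne_three_halves_add (s₀ : ℂ) : ∀ᶠ s : ℂ in 𝓝[≠] s₀, ∀ k : ℕ, s ≠ 3 / 2 + k := by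
  have hdiff : Differentiable ℂ fun s : ℂ => (Gamma (3 / 2 - s))⁻¹ :=
    differentiable_one_div_Gamma.comp (differentiable_id.const_sub _)
  have han : AnalyticOnNhd ℂ (fun s : ℂ => (Gamma (3 / 2 - s))⁻¹) Set.univ :=
    analyticOnNhd_univ_iff_differentiable.2 hdiff
  rcases (han s₀ trivial).eventually_eq_zero_or_eventually_ne_zero with h | h
  · have := han.eqOn_zero_of_preconnected_of_eventuallyEq_zero isPreconnected_univ trivial h
      (x := 1 / 2) trivial
    norm_num [Complex.Gamma_one] at this
  · filter_upwards [h] with s hs k hk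
    refine hs ?_
    rw [hk, sub_add_cancel_left, Gamma_neg_nat_eq_zero, inv_zero]

end Domain
end HilbertGreen

/-! ### Meromorphy and analytic continuation -/

namespace HilbertGreen
section Continuation

open LatticeData Complex

lemma meromorphic_of_differentiable {f : ℂ → ℂ} (hf : Differentiable ℂ f) : Meromorphic f :=
  fun x => (hf.analyticAt x).meromorphicAt

lemma meromorphic_comp_of_differentiable {f g : ℂ → ℂ} (hf : Meromorphic f)
    (hg : Differentiable ℂ g) : Meromorphic fun s => f (g s) :=
  fun x => (hf (g x)).comp_analyticAt (hg.analyticAt x)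

/-- Away from 1 the function is analytic. At 1 it agrees, near the point and hence away from 0, with
an entire function plus two elementary fractions, times 1/Γ_ℝ. -/
lemma meromorphic_riemannZeta : Meromorphic riemannZeta := by
  intro x
  by_cases hx : x = 1
  · have h1 : MeromorphicAt (fun s => (completedRiemannZeta₀ s - 1 / s - 1 / (1 - s)) *
        (Gammaℝ s)⁻¹) x := by
      refine MeromorphicAt.fun_mul (MeromorphicAt.fun_sub (MeromorphicAt.fun_sub ?_ ?_) ?_) ?_
      · exact meromorphic_of_differentiable differentiable_completedZeta₀ x
      · exact (MeromorphicAt.const 1 x).fun_div (MeromorphicAt.id x)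
      · exact (MeromorphicAt.const 1 x).fun_div
          (meromorphic_of_differentiable (differentiable_id.const_sub 1) x)
      · exact meromorphic_of_differentiable differentiable_Gammaℝ_inv x
    refine h1.congr ?_
    have hx0 : x ≠ 0 := by rw [hx]; exact one_ne_zero
    filter_upwards [mem_nhdsWithin_of_mem_nhds (isOpen_compl_singleton.mem_nhds hx0)] with s hs
    rw [riemannZeta_def_of_ne_zero hs, completedRiemannZeta_eq, ← div_eq_mul_inv]
  · exact (analyticOn_riemannZeta x hx).meromorphicAt

lemma differentiable_const_cpow {x : ℂ} (hx : x ≠ 0) {f : ℂ → ℂ} (hf : Differentiable ℂ f) :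
    Differentiable ℂ fun s => x ^ f s := fun s => (hf s).const_cpow (Or.inl hx)

lemma differentiableAt_planeConst {D m : ℕ} [Fact D.Prime] (hm : 0 < m) {y₁ y₂ : ℝ} (hy₁ : 0 < y₁)
    (hy₂ : 0 < y₂) {s : ℂ} (hs : 1 / 2 < s.re) :
    DifferentiableAt ℂ (planeConst D m y₁ y₂) s := by
  have hD0 : (0 : ℝ) < D := by exact_mod_cast (Fact.out : D.Prime).pos
  have hm0 : (0 : ℝ) < m := by exact_mod_cast hm
  have h1 : 2 * s - 1 ≠ 0 := fun h => by
    have := congrArg re h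
    simp at this
    linarith
  have hΓ : ∀ w : ℂ, 0 < w.re → ∀ n : ℕ, w ≠ -n := fun w hw n h => by
    rw [h, neg_re, natCast_re] at hw
    linarith [n.cast_nonneg (α := ℝ)]
  have g1 : DifferentiableAt ℂ (fun s : ℂ => (((m : ℝ) / D : ℝ) : ℂ) ^ s) s :=
    differentiable_const_cpow (ofReal_ne_zero.2 (by positivity)) differentiable_id s
  have g2 : DifferentiableAt ℂ (fun s : ℂ => ((y₁ * y₂ : ℝ) : ℂ) ^ (1 - s)) s :=
    differentiable_const_cpow (ofReal_ne_zero.2 (by positivity)) (differentiable_id.const_sub 1) s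
  have g3 : DifferentiableAt ℂ (fun s : ℂ => Gamma (s - 1 / 2)) s :=
    (differentiableAt_Gamma _ (hΓ _ (by simp; linarith))).comp s (differentiableAt_id.sub_const _)
  have g4 : DifferentiableAt ℂ Gamma s := differentiableAt_Gamma _ (hΓ _ (by linarith))
  have g5 : Gamma s ≠ 0 := Gamma_ne_zero (hΓ _ (by linarith))
  unfold planeConst
  fun_prop (disch := assumption)

/-- The only singularity is the pole of ζ(2s − 1) at s = 1; L(2s, χ_D) does not vanish since Re 2s ≥
1 and χ_D is nontrivial. -/
lemma differentiableAt_densitySeries {D m : ℕ} [Fact D.Prime] (hD4 : D % 4 = 1) {s : ℂ}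
    (hs : 1 / 2 < s.re) (hs1 : s ≠ 1) :
    DifferentiableAt ℂ (fun s => densitySeries D m (2 * s)) s := by
  have g1 : DifferentiableAt ℂ (fun s : ℂ => riemannZeta (2 * s - 1)) s := by
    refine (differentiableAt_riemannZeta fun h => hs1 ?_).comp s (by fun_prop)
    linear_combination h / 2
  have g2 : DifferentiableAt ℂ (fun s : ℂ => DirichletCharacter.LFunction (chiD D) (2 * s)) s :=
    (DirichletCharacter.differentiable_LFunction (chiD_ne_one hD4) (2 * s)).comp s (by fun_prop)
  have g3 : DirichletCharacter.LFunction (chiD D) (2 * s) ≠ 0 :=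
    DirichletCharacter.LFunction_ne_zero_of_one_le_re _ (Or.inl (chiD_ne_one hD4))
      (by simp; linarith)
  have g4 : ∀ d ∈ m.divisors, DifferentiableAt ℂ (fun s : ℂ => (d : ℂ) ^ (1 - 2 * s) *
      (chiD D (d : ZMod D) + chiD D ((m / d : ℕ) : ZMod D))) s := fun d hd =>
    (differentiable_const_cpow (by exact_mod_cast (Nat.pos_of_mem_divisors hd).ne')
      (by fun_prop) s).mul_const _
  exact (g1.div g2 g3).mul (DifferentiableAt.fun_sum g4)

variable {K : Type*} [Field K] [NumberField K] {ι ι' : K →+* ℝ} {D m : ℕ} {W : Set (ℍ × ℍ)}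

/-- The finite sum of the Weyl chamber is entire in `s`. -/
lemma differentiable_weylSum (hK : Module.finrank ℚ K = 2) (hι : ι ≠ ι') [Fact D.Prime]
    (ε : (𝓞 K)ˣ) (hε : 1 < ι ((ε : 𝓞 K) : K)) (hW : IsWeylChamber ι ι' D m W)
    (hfin : (weylSet ι ι' ε D m W).Finite) {z : ℍ × ℍ} (hz : z ∈ W) :
    Differentiable ℂ fun s : ℂ => ∑ᶠ l ∈ weylSet ι ι' ε D m W,
        (((ι ((ε : 𝓞 K) : K) : ℝ) : ℂ) ^ (2 - 4 * s) *
            ((ι l * z.1.im : ℝ) : ℂ) ^ (1 - s) * ((-ι' l * z.2.im : ℝ) : ℂ) ^ s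
          + ((-ι' l * z.2.im : ℝ) : ℂ) ^ (1 - s) * ((ι l * z.1.im : ℝ) : ℂ) ^ s) := by
  simp only [finsum_mem_eq_finite_toFinset_sum _ hfin]
  refine Differentiable.fun_sum fun l hl => ?_
  obtain ⟨-, h1, h2, -⟩ := (mem_weylSet_iff hK hι ε hε hW hz l).1 (hfin.mem_toFinset.1 hl)
  have ha : ((ι l * z.1.im : ℝ) : ℂ) ≠ 0 := ofReal_ne_zero.2 (mul_pos h1 z.1.im_pos).ne'
  have hb : ((-ι' l * z.2.im : ℝ) : ℂ) ≠ 0 :=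
    ofReal_ne_zero.2 ((mul_pos h1 z.1.im_pos).trans h2).ne'
  have he : ((ι ((ε : 𝓞 K) : K) : ℝ) : ℂ) ≠ 0 := ofReal_ne_zero.2 (by linarith)
  exact (((differentiable_const_cpow he (by fun_prop)).mul
    (differentiable_const_cpow ha (by fun_prop))).mul
    (differentiable_const_cpow hb differentiable_id)).add
    ((differentiable_const_cpow hb (by fun_prop)).mul (differentiable_const_cpow ha differentiable_id))

/-- For Re s > 1/2 one has |ε^(2−4s)| < 1, so the geometric denominators do not vanish either, and
the expression is holomorphic also at 3/2, 5/2, …. -/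
lemma differentiableAt_greenMean (hK : Module.finrank ℚ K = 2) (hι : ι ≠ ι') [Fact D.Prime]
    (hD4 : D % 4 = 1) (hm : 0 < m)
    (ε : (𝓞 K)ˣ) (hε : 1 < ι ((ε : 𝓞 K) : K)) (hW : IsWeylChamber ι ι' D m W)
    (hfin : (weylSet ι ι' ε D m W).Finite) {z : ℍ × ℍ} (hz : z ∈ W) {s : ℂ} (hs : 1 / 2 < s.re)
    (hs1 : s ≠ 1) : DifferentiableAt ℂ (greenMean ι ι' ε D m W z.1.im z.2.im) s := by
  have h1 : 2 * s - 1 ≠ 0 := fun h => by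
    have := congrArg re h
    simp at this
    linarith
  have he : ((ι ((ε : 𝓞 K) : K) : ℝ) : ℂ) ≠ 0 := ofReal_ne_zero.2 (by linarith)
  have h2 : 1 - ((ι ((ε : 𝓞 K) : K) : ℝ) : ℂ) ^ (2 - 4 * s) ≠ 0 := fun h => by
    have := norm_unit_ratio_lt_one hε hs
    rw [← sub_eq_zero.1 h, CStarRing.norm_one] at this
    exact lt_irrefl _ this
  have g1 : DifferentiableAt ℂ (fun s : ℂ => ((ι ((ε : 𝓞 K) : K) : ℝ) : ℂ) ^ (2 - 4 * s)) s :=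
    differentiable_const_cpow he (by fun_prop) s
  have g2 : DifferentiableAt ℂ (fun s : ℂ => 4 * (Real.pi : ℂ) / (2 * s - 1) *
      (1 / (1 - ((ι ((ε : 𝓞 K) : K) : ℝ) : ℂ) ^ (2 - 4 * s)))) s := by
    fun_prop (disch := assumption)
  exact ((differentiableAt_planeConst hm z.1.im_pos z.2.im_pos hs).mul
    ((differentiableAt_densitySeries hD4 hs hs1).const_mul 2)).add
    (g2.mul (differentiable_weylSum hK hι ε hε hW hfin hz s))

lemma differentiable_sigmaM {D m : ℕ} [Fact D.Prime] (hm : 0 < m) :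
    Differentiable ℂ (sigmaM D m) := by
  refine (differentiable_const_cpow (by exact_mod_cast hm.ne') (by fun_prop)).mul
    (Differentiable.fun_sum fun d hd => ?_)
  exact (differentiable_const_cpow (by exact_mod_cast (Nat.pos_of_mem_divisors hd).ne')
    differentiable_id).mul_const _

lemma meromorphic_phiM {D m : ℕ} [Fact D.Prime] (hD4 : D % 4 = 1) (hm : 0 < m) : Meromorphic (phiM D m) := by
  have g1 : Meromorphic fun s : ℂ => Gamma (s - 1 / 2) :=
    meromorphic_comp_of_differentiable Meromorphic.Gamma (by fun_prop)
  have g2 : Meromorphic fun s : ℂ => Gamma (3 / 2 - s) :=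
    meromorphic_comp_of_differentiable Meromorphic.Gamma (by fun_prop)
  have g3 : Meromorphic fun s : ℂ => DirichletCharacter.LFunction (chiD D) (1 - 2 * s) :=
    meromorphic_of_differentiable ((DirichletCharacter.differentiable_LFunction
      (chiD_ne_one hD4)).comp (by fun_prop))
  have g4 : Meromorphic fun s : ℂ => sigmaM D m (2 * s - 1) :=
    meromorphic_of_differentiable ((differentiable_sigmaM hm).comp (by fun_prop))
  exact ((g1.fun_div g2).fun_neg.fun_mul ((Meromorphic.const 1).fun_div g3)).fun_mul g4

lemma meromorphic_explicitTerm (hK : Module.finrank ℚ K = 2) (hι : ι ≠ ι') [Fact D.Prime]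
    (hD4 : D % 4 = 1) (hm : 0 < m)
    (ε : (𝓞 K)ˣ) (hε : 1 < ι ((ε : 𝓞 K) : K)) (hW : IsWeylChamber ι ι' D m W)
    (hfin : (weylSet ι ι' ε D m W).Finite) {z : ℍ × ℍ} (hz : z ∈ W) :
    Meromorphic (explicitTerm ι ι' ε D m W z.1.im z.2.im) := by
  have hD0 : (0 : ℝ) < D := by exact_mod_cast (Fact.out : D.Prime).pos
  have hy₁ := z.1.im_pos
  have hy₂ := z.2.im_pos
  have he : ((ι ((ε : 𝓞 K) : K) : ℝ) : ℂ) ≠ 0 := ofReal_ne_zero.2 (by linarith)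
  have g1 : Meromorphic fun s : ℂ => riemannZeta (2 * s - 1) :=
    meromorphic_comp_of_differentiable meromorphic_riemannZeta (by fun_prop)
  have g2 : Meromorphic fun s : ℂ =>
      ((Real.pi ^ 2 * z.1.im * z.2.im / (D : ℝ) : ℝ) : ℂ) ^ (1 - s) :=
    meromorphic_of_differentiable (differentiable_const_cpow (ofReal_ne_zero.2 (by positivity))
      (by fun_prop))
  have g3 : Meromorphic fun s : ℂ => 4 * (Real.pi : ℂ) / (2 * s - 1) :=
    (Meromorphic.const _).fun_div (meromorphic_of_differentiable (by fun_prop))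
  have g4 : Meromorphic fun s : ℂ =>
      1 / (1 - ((ι ((ε : 𝓞 K) : K) : ℝ) : ℂ) ^ (2 - 4 * s)) :=
    (Meromorphic.const 1).fun_div (meromorphic_of_differentiable
      ((differentiable_const_cpow he (by fun_prop)).const_sub 1))
  exact ((((Meromorphic.const 2).fun_mul g1).fun_mul (meromorphic_phiM hD4 hm)).fun_mul g2).fun_add
    ((g3.fun_mul g4).fun_mul
      (meromorphic_of_differentiable (differentiable_weylSum hK hι ε hε hW hfin hz)))

open MeasureTheory in
/-- The constant term of a continuation of the Green function. -/
lemma constantTerm_continuation (hK : Module.finrank ℚ K = 2) [Fact D.Prime]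
    (hD : NumberField.discr K = (D : ℤ)) (hι : ι ≠ ι') (hD4 : D % 4 = 1) (ε : (𝓞 K)ˣ)
    (hε : 1 < ι ((ε : 𝓞 K) : K)) (b : Module.Basis (Fin 2) ℤ (𝓞 K)) (hm : 0 < m)
    (hW : IsWeylChamber ι ι' D m W) {z : ℍ × ℍ} (hz : z ∈ W)
    (hA : (m : ℝ) / D < z.1.im * z.2.im) {Ψ : ℂ → ℍ × ℍ → ℂ}
    (hc : ContinuousOn (fun q : ℂ × (ℍ × ℍ) => Ψ q.1 q.2)
      ({s : ℂ | 3 / 4 < s.re ∧ s ≠ 1} ×ˢ {w : ℍ × ℍ | w.1.im = z.1.im ∧ w.2.im = z.2.im}))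
    (hd : ∀ w : ℍ × ℍ, w.1.im = z.1.im → w.2.im = z.2.im →
      DifferentiableOn ℂ (fun s => Ψ s w) {s : ℂ | 3 / 4 < s.re ∧ s ≠ 1} ∧
      ∀ s : ℂ, 1 < s.re → Ψ s w = greenFunction ι ι' D m s w) {s : ℂ} (hs : 3 / 4 < s.re)
    (hs1 : s ≠ 1) :
    constantTerm ι ι' b (Ψ s) z = greenMean ι ι' ε D m W z.1.im z.2.im s := by
  have hfin := finite_weylSet hK hD hι b ε hε hW
  have him : ∀ t, (translate ι ι' b t z).1.im = z.1.im ∧ (translate ι ι' b t z).2.im = z.2.im :=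
    fun t => ⟨UpperHalfPlane.vadd_im _ _, UpperHalfPlane.vadd_im _ _⟩
  have hcont : Continuous fun t : ℝ × ℝ => translate ι ι' b t z := by
    refine Continuous.prodMk ?_ ?_ <;>
    · rw [UpperHalfPlane.isEmbedding_coe.continuous_iff]
      simp only [Function.comp_def, UpperHalfPlane.coe_vadd]
      fun_prop
  have hU : IsOpen {s : ℂ | 3 / 4 < s.re ∧ s ≠ 1} := isOpen_punctured_halfPlane
  have h1 : DifferentiableOn ℂ (fun s => constantTerm ι ι' b (Ψ s) z)
      {s : ℂ | 3 / 4 < s.re ∧ s ≠ 1} := by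
    refine differentiableOn_integral_of_continuousOn hU isCompact_square measurableSet_square
      (F := fun s t => Ψ s (translate ι ι' b t z)) ?_ fun t _ => (hd _ (him t).1 (him t).2).1
    exact hc.comp (f := fun q : ℂ × (ℝ × ℝ) => (q.1, translate ι ι' b q.2 z)) (by fun_prop)
      fun q hq => ⟨hq.1, him _⟩
  have h2 : DifferentiableOn ℂ (greenMean ι ι' ε D m W z.1.im z.2.im)
      {s : ℂ | 3 / 4 < s.re ∧ s ≠ 1} := fun s hs =>
    (differentiableAt_greenMean hK hι hD4 hm ε hε hW hfin hz (by linarith [hs.1])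
      hs.2).differentiableWithinAt
  -- Identity theorem on the connected domain: the two holomorphic functions agree near s = 2, where
  -- the series represents Ψ.
  refine (h1.analyticOnNhd hU).eqOn_of_preconnected_of_eventuallyEq (h2.analyticOnNhd hU)
    (isPreconnected_punctured_halfPlane (by norm_num)) (z₀ := 2) (by norm_num) ?_ ⟨hs, hs1⟩
  filter_upwards [(isOpen_lt continuous_const Complex.continuous_re).mem_nhds
    (show (1 : ℝ) < (2 : ℂ).re by norm_num)] with w hw
  rw [← (green_mean hK hD hι ε hε b hm hW hz hA hw).2.2]
  exact setIntegral_congr_fun measurableSet_square fun t _ => (hd _ (him t).1 (him t).2).2 w hw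

end Continuation
end HilbertGreen

end

/-! ### Assembly of the theorem -/

theorem mainTheorem8
    {K : Type*} [Field K] [NumberField K] (hK : Module.finrank ℚ K = 2)
    (D : ℕ) [Fact D.Prime] (hD : NumberField.discr K = (D : ℤ))
    (ι ι' : K →+* ℝ) (hι : ι ≠ ι')
    (ε : (𝓞 K)ˣ) (hε : HilbertGreen.IsFundamentalUnit ι ε)
    (b : Module.Basis (Fin 2) ℤ (𝓞 K))
    (m : ℕ) (hm : 0 < m)
    (W : Set (ℍ × ℍ)) (hW : HilbertGreen.IsWeylChamber ι ι' D m W) :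
    -- the Weyl chamber sum is finite
    (HilbertGreen.weylSet ι ι' ε D m W).Finite ∧
    ∀ z ∈ W, (m : ℝ) / (D : ℝ) < z.1.im * z.2.im →
      -- for `Re s > 1`: convergence, and the value of the constant term
      (∀ s : ℂ, 1 < s.re →
        (Summable fun p : HilbertGreen.greenIndex K D m =>
          HilbertGreen.greenTerm ι ι' D m s z p) ∧
        MeasureTheory.IntegrableOn
          (fun t : ℝ × ℝ => HilbertGreen.greenFunction ι ι' D m s
            (HilbertGreen.translate ι ι' b t z))
          (Set.Icc (0 : ℝ) 1 ×ˢ Set.Icc (0 : ℝ) 1) ∧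
        ((∀ k : ℕ, s ≠ 3 / 2 + k) →
          HilbertGreen.constantTerm ι ι' b (HilbertGreen.greenFunction ι ι' D m s) z =
            HilbertGreen.explicitTerm ι ι' ε D m W z.1.im z.2.im s) ∧
        -- at `s = 3/2 + k` both `1 / Γ(3/2 - s)` and `L(1 - 2s, χ_D)` vanish, and the explicit
        -- expression is to be read as its limit
        Filter.Tendsto (HilbertGreen.explicitTerm ι ι' ε D m W z.1.im z.2.im) (𝓝[≠] s)
          (𝓝 (HilbertGreen.constantTerm ι ι' b (HilbertGreen.greenFunction ι ι' D m s) z))) ∧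
      -- the explicit expression is the meromorphic continuation of the constant term
      Meromorphic (HilbertGreen.explicitTerm ι ι' ε D m W z.1.im z.2.im) ∧
      -- it is the constant term of the continuation `Ψ` of the Green function to `Re s > 3/4`
      (∀ Ψ : ℂ → ℍ × ℍ → ℂ,
        ContinuousOn (fun q : ℂ × (ℍ × ℍ) => Ψ q.1 q.2)
          ({s : ℂ | 3 / 4 < s.re ∧ s ≠ 1} ×ˢ
            {w : ℍ × ℍ | w.1.im = z.1.im ∧ w.2.im = z.2.im}) →
        (∀ w : ℍ × ℍ, w.1.im = z.1.im → w.2.im = z.2.im →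
          DifferentiableOn ℂ (fun s => Ψ s w) {s : ℂ | 3 / 4 < s.re ∧ s ≠ 1} ∧
          ∀ s : ℂ, 1 < s.re → Ψ s w = HilbertGreen.greenFunction ι ι' D m s w) →
        ∀ s : ℂ, 3 / 4 < s.re → s ≠ 1 → (∀ k : ℕ, s ≠ 3 / 2 + k) →
          HilbertGreen.constantTerm ι ι' b (Ψ s) z =
            HilbertGreen.explicitTerm ι ι' ε D m W z.1.im z.2.im s) := by
  have hfin := HilbertGreen.finite_weylSet hK hD hι b ε hε.1 hW
  have hD4 : D % 4 = 1 := (HilbertGreen.fieldLattice hK hD hι b).mod_four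
  refine ⟨hfin, fun z hz hA => ⟨fun s hs => ?_,
    HilbertGreen.meromorphic_explicitTerm hK hι hD4 hm ε hε.1 hW hfin hz,
    fun Ψ hc hd s hs hs1 hsk => ?_⟩⟩
  · obtain ⟨h1, h2, h3⟩ := HilbertGreen.green_mean hK hD hι ε hε.1 b hm hW hz hA hs
    refine ⟨h1, h2, fun hsk => ?_, ?_⟩
    · rw [h3, HilbertGreen.greenMean_eq_explicitTerm hD4 hm ε z.1.im_pos z.2.im_pos
        (by linarith) hsk]
    · rw [h3]
      have hs1 : s ≠ 1 := fun h => by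
        rw [h, Complex.one_re] at hs
        exact lt_irrefl _ hs
      -- `greenMean` is continuous at s and coincides with the explicit expression in a punctured
      -- neighbourhood, since the exceptional points are isolated; hence the limit exists and has
      -- the asserted value at every s.
      refine ((HilbertGreen.differentiableAt_greenMean hK hι hD4 hm ε hε.1 hW hfin hz
        (by linarith) hs1).continuousAt.tendsto.mono_left nhdsWithin_le_nhds).congr' ?_
      filter_upwards [HilbertGreen.eventually_ne_three_halves_add s, mem_nhdsWithin_of_mem_nhds
        ((isOpen_lt continuous_const Complex.continuous_re).mem_nhds hs)] with w hw hw1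
      exact HilbertGreen.greenMean_eq_explicitTerm hD4 hm ε z.1.im_pos z.2.im_pos
        (by linarith [show (1 : ℝ) < w.re from hw1]) hw
  · rw [HilbertGreen.constantTerm_continuation hK hD hι hD4 ε hε.1 b hm hW hz hA hc hd hs hs1,
      HilbertGreen.greenMean_eq_explicitTerm hD4 hm ε z.1.im_pos z.2.im_pos (by linarith) hsk]
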